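/- Let $G$ be a finite group, $K\trianglelefteq G$ and $H\le G$ with $G=HK$, and set $L=H\cap K$. Let $\mathbb{E}$ be an algebraically closed field, $\mathbb{F}\subseteq\mathbb{E}$ a field, and let $\theta$ and $\varphi$ be the characters of simple projective modules over $\mathbb{E}K$ and $\mathbb{E}L$, respectively. Assume 1. $n=(\theta_L,\varphi)>0$, where $(\theta_L,\varphi)$ denotes the multiplicity of $\varphi$ in $\theta_L$; 2. $\mathbb{F}(\varphi)=\mathbb{F}(\theta)$; 3. for every $h\in H$ there is $\gamma\in\operatorname{Gal}(\mathbb{F}(\varphi)/\mathbb{F})$ with $\theta^{h\gamma}=\theta$ and $\varphi^{h\gamma}=\varphi$, where $\chi^h(x)=\chi(hxh^{-1})$; 4. $n$ and $|H/L|$ are coprime. Notation. Let $e_\theta\in\mathbb{E}K$ and $e_\varphi\in\mathbb{E}L$ be the central primitive idempotents belonging to $\theta$ and $\varphi$, let $\Gamma=\operatorname{Gal}(\mathbb{F}(\varphi)/\mathbb{F})$, and put $e_{(\theta,\mathbb{F})}=\sum_{\gamma\in\Gamma}e_\theta^\gamma$, $e_{(\varphi,\mathbb{F})}=\sum_{\gamma\in\Gamma}e_\varphi^\gamma$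 and $i=\sum_{\gamma\in\Gamma}e_\varphi^\gamma e_\theta^\gamma$. Then $i$ is an $H$-stable idempotent of $\mathbb{F}K$. Let $S$ be the centralizer of $L$ in $i\mathbb{F}Ki$; it is a simple ring with unit $i$ and centre the field $Z=\mathbf{Z}(i\mathbb{F}Ki)$. The group $H$ acts by conjugation, $s^h=h^{-1}sh$, and $L$ acts trivially on $S$; let $Z_0=Z^H$. For a subring $S_0\subseteq S$ with $\mathbf{Z}(S_0)=Z_0$ and $S=S_0Z$ let $\varepsilon\colon H\to\operatorname{Aut}S$ be defined by $(s_0z)^{\varepsilon(h)}=s_0z^h$ for $s_0\in S_0$, $z\in Z$. A magic crossed representation with respect to $S_0$ is a map $\sigma\colon H/L\to S^*$ such that $$\sigma(x)^{\varepsilon(y)}\sigma(y)=\sigma(xy)\quad\text{and}\quad s^x=\sigma(x)^{-1}s^{\varepsilon(x)}\sigma(x)\qquad(x,y\in H/L,\ s\in S).$$ Its reduced norm is the map $x\mapsto\operatorname{nr}_{S/Z}(\sigma(x))\in Z^*$, and $B^1(H/L,Z^*)$ is the group of all maps $x\mapsto a^{-1}a^x$ with $a\in Z^*$. Then subrings $S_0$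 as above exist, and for every such $S_0$ there is a magic crossed representation $\sigma$ with respect to $S_0$ whose reduced norm lies in $B^1(H/L,Z^*)$. Suppose moreover that $\mathbb{E}=\mathbb{C}$. For $X\in\{G,H\}$ and a central idempotent $e$ of $\mathbb{C}X$ let $\operatorname{Irr}(X\mid e)$ be the set of irreducible complex characters $\chi$ of $X$ with $\chi(e)\ne 0$, and let $\mathbb{C}[\operatorname{Irr}(X\mid e)]$ be its linear span. Then every such $\sigma$ (with respect to any $S_0$, and with reduced norm in $B^1(H/L,Z^*)$) yields a linear isometry $\iota(\sigma)$ from $\mathbb{C}[\operatorname{Irr}(G\mid e_{(\theta,\mathbb{F})})]$ onto $\mathbb{C}[\operatorname{Irr}(H\mid e_{(\varphi,\mathbb{F})})]$ by $$\chi^{\iota(\sigma)}(h)=\chi\bigl(s_0\,h\,\sigma(Lh)^{-1}\bigr)\qquad(h\in H),$$ where $s_0$ is any element of $S_0$ with reduced trace $\operatorname{tr}_{S_0/Z_0}(s_0)=1$ (such elements exist, and the choice does not matter). An element $\chi$ of $\mathbb{C}[\operatorname{Irr}(G\mid e_{(\theta,\mathbb{F})})]$ lies in $\operatorname{Irr}(G\mid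 e_{(\theta,\mathbb{F})})$ if and only if $\chi^{\iota(\sigma)}$ lies in $\operatorname{Irr}(H\mid e_{(\varphi,\mathbb{F})})$. The isometry $\iota(\sigma)$ is canonical: it is the same for all choices of $S_0$ and $\sigma$. -/

import Mathlib

/-! ### Central primitive idempotents of characters, and Galois conjugation -/

section Characters

variable {N : Type*} [Group N] {E : Type*} [Field E]

/-- The value `χ(a)` of a function `χ` on a group at an element `a` of the group algebra
(linear extension of `χ`). -/
noncomputable def charEval (χ : N → E) (a : MonoidAlgebra E N) : E :=
  a.coeff.sum fun g c => c * χ g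

/-- A primitive idempotent of the centre of a ring. -/
def IsCentralPrimitiveIdempotent {A : Type*} [Ring A] (e : A) : Prop :=
  e ∈ Subring.center A ∧ e * e = e ∧ e ≠ 0 ∧
    ∀ f ∈ Subring.center A, f * f = f → f * e = f → f = 0 ∨ f = e

/-- `e` is a central primitive idempotent of the group algebra `E N` such that `χ` does not
vanish on `E N e`. -/
def IsIdempotentOfChar (χ : N → E) (e : MonoidAlgebra E N) : Prop :=
  IsCentralPrimitiveIdempotent e ∧ ∃ a : MonoidAlgebra E N, charEval χ (a * e) ≠ 0

open Classical in
/-- The central primitive idempotent `e_χ` of `E N` belonging to the character `χ`: for the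
character of a simple module (`N` finite, `E` algebraically closed) it is the unique central
primitive idempotent `e` such that `χ` does not vanish on `E N e`. -/
noncomputable def charIdem (χ : N → E) : MonoidAlgebra E N :=
  if h : ∃ e, IsIdempotentOfChar χ e then h.choose else 0

variable (F : Type*) [Field F] [Algebra F E]

/-- The field of values `F(χ)`. -/
noncomputable def charField (χ : N → E) : IntermediateField F E :=
  IntermediateField.adjoin F (Set.range χ)

variable {F}

open Classical in
/-- `γ ∈ Gal(M/F)` applied to an element `x` of `E`; only used for `x ∈ M`. -/
noncomputable def galApply {M : IntermediateField F E} (γ : M ≃ₐ[F] M) (x : E) : E :=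
  if h : x ∈ M then (γ ⟨x, h⟩ : M) else 0

theorem galApply_zero {M : IntermediateField F E} (γ : M ≃ₐ[F] M) : galApply γ 0 = 0 := by
  have h : (⟨0, M.zero_mem⟩ : M) = 0 := rfl
  simp [galApply, h]

/-- The Galois conjugate `a ^ γ` of an element `a` of the group algebra with coefficients in `M`:
`γ` acts on the coefficients and fixes the group elements. -/
noncomputable def galConj {M : IntermediateField F E} (γ : M ≃ₐ[F] M) (a : MonoidAlgebra E N) :
    MonoidAlgebra E N :=
  .ofCoeff (a.coeff.mapRange (galApply γ) (galApply_zero γ))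

variable (F)

/-- The idempotent `e_(χ,F)`, the sum of the `e_χ ^ γ` over `γ ∈ Gal(F(χ)/F)`
(a finite group, since `F(χ)` is a finite extension of `F`). -/
noncomputable def charIdemOver (χ : N → E) : MonoidAlgebra E N :=
  ∑ᶠ γ : charField F χ ≃ₐ[F] charField F χ, galConj γ (charIdem χ)

end Characters

/-! ### Centres, reduced norms and reduced traces of subalgebras with their own unit -/

section CentralSimple

variable {A : Type*} [Ring A]

/-- The centre `Z(R)` of a subring `R` (the unit of `R` may differ from the one of `A`). -/
def centerOf (R : NonUnitalSubring A) : NonUnitalSubring A :=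
  R ⊓ NonUnitalSubring.centralizer (R : Set A)

variable (E : Type*) [Field E]

/-- A ring homomorphism from `R` to `m × m`-matrices over `E` that splits `R`. When `R` is a
simple ring with centre the field `Z`, it turns `E` into an extension field of `Z` and induces an
isomorphism from `E ⊗_Z R` onto the full matrix ring. (The span condition with `0 < m` makes
`ψ` preserve the unit of `R` and map the centre of `R` to scalar matrices.) -/
def IsSplitting (R : NonUnitalSubring A) {m : ℕ} (ψ : R →ₙ+* Matrix (Fin m) (Fin m) E) : Prop :=
  0 < m ∧ Submodule.span E (Set.range ψ) = ⊤

/-- `z ∈ Z(R)` is the reduced norm of `s ∈ R`, computed through a splitting over `E`. -/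
def IsReducedNorm (R : NonUnitalSubring A) (s z : A) : Prop :=
  ∃ (hs : s ∈ R) (hz : z ∈ R), z ∈ centerOf R ∧
    ∃ (m : ℕ) (ψ : R →ₙ+* Matrix (Fin m) (Fin m) E), IsSplitting E R ψ ∧
      ψ ⟨z, hz⟩ = (ψ ⟨s, hs⟩).det • (1 : Matrix (Fin m) (Fin m) E)

/-- `z ∈ Z(R)` is the reduced trace of `s ∈ R`, computed through a splitting over `E`. -/
def IsReducedTrace (R : NonUnitalSubring A) (s z : A) : Prop :=
  ∃ (hs : s ∈ R) (hz : z ∈ R), z ∈ centerOf R ∧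
    ∃ (m : ℕ) (ψ : R →ₙ+* Matrix (Fin m) (Fin m) E), IsSplitting E R ψ ∧
      ψ ⟨z, hz⟩ = (ψ ⟨s, hs⟩).trace • (1 : Matrix (Fin m) (Fin m) E)

end CentralSimple

/-! ### The configuration

`K` is normal in `G`, `H` is a subgroup with `G = H K`, and `L = H ∩ K`. All algebras are
realised inside the group algebra `E G` over the large field `E`. -/

section Configuration

variable {G : Type*} [Group G] {E : Type*} [Field E] (F : Type*) [Field F] [Algebra F E]
  (K H : Subgroup G)

/-- The multiplicity `(θ_L, φ)`, where `ρ` affords `θ` and `τ` affords `φ` (a simple projective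
module): the dimension of the space of `L`-homomorphisms. -/
noncomputable def charMult {K H : Subgroup G} {V U : Type*} [AddCommGroup V] [Module E V]
    [AddCommGroup U] [Module E U]
    (ρ : Representation E K V) (τ : Representation E ↥(H ⊓ K) U) : ℕ :=
  Module.finrank E (Representation.IntertwiningMap τ
    (ρ.comp (Subgroup.inclusion (inf_le_right : H ⊓ K ≤ K)) : Representation E ↥(H ⊓ K) V))

/-- The basic configuration: `G = H K`; `ρ` and `τ` are simple projective modules over `E K`
and `E L` with characters `θ` and `φ`; `n = (θ_L, φ) > 0`; `F(φ) = F(θ)`; and for every `h ∈ H`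
there is `γ ∈ Gal(F(φ)/F)` with `θ^(hγ) = θ` and `φ^(hγ) = φ`,
where `χ^h (x) = χ (h x h⁻¹)`. -/
structure SemiInvariantConfig {V U : Type*} [AddCommGroup V] [Module E V]
    [AddCommGroup U] [Module E U]
    (ρ : Representation E K V) (τ : Representation E ↥(H ⊓ K) U) : Prop where
  prod_eq : ∀ g : G, ∃ h ∈ H, ∃ k ∈ K, g = h * k
  simple_theta : ρ.IsIrreducible
  simple_phi : τ.IsIrreducible
  proj_theta : Module.Projective (MonoidAlgebra E K) ρ.asModule
  proj_phi : Module.Projective (MonoidAlgebra E ↥(H ⊓ K)) τ.asModule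
  mult_pos : 0 < charMult ρ τ
  field_eq : charField F τ.character = charField F ρ.character
  semi_invariant : ∀ h ∈ H, ∃ γ : charField F τ.character ≃ₐ[F] charField F τ.character,
    (∀ k k' : K, (k' : G) = h * k * h⁻¹ → galApply γ (ρ.character k') = ρ.character k) ∧
    (∀ l l' : ↥(H ⊓ K), (l' : G) = h * l * h⁻¹ → galApply γ (τ.character l') = τ.character l)

/-- The subring `F K` of `E G`. -/
noncomputable def subAlg (E : Type*) [Field E] [Algebra F E] : Subring (MonoidAlgebra E G) :=
  ((MonoidAlgebra.mapRingHom G (algebraMap F E)).comp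
    (MonoidAlgebra.mapDomainRingHom F K.subtype)).range

/-- `a ^ h = h⁻¹ a h` for `a ∈ E G`. -/
noncomputable def conjBy (h : G) (a : MonoidAlgebra E G) : MonoidAlgebra E G :=
  MonoidAlgebra.of E G h⁻¹ * a * MonoidAlgebra.of E G h

variable {K H} (θ : K → E) (φ : ↥(H ⊓ K) → E)

/-- The idempotent `i`, the sum of `e_φ ^ γ * e_θ ^ γ` over `γ ∈ Gal(F(φ)/F)`. -/
noncomputable def idemI : MonoidAlgebra E G :=
  ∑ᶠ γ : charField F φ ≃ₐ[F] charField F φ,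
    MonoidAlgebra.mapDomain (H ⊓ K).subtype (galConj γ (charIdem φ)) *
      MonoidAlgebra.mapDomain K.subtype (galConj γ (charIdem θ))

/-- The ring `i F K i`, with unit `i` (note that `i` is an idempotent of `F K`). -/
noncomputable def cornerRing : NonUnitalSubring (MonoidAlgebra E G) where
  carrier := {a | a ∈ subAlg F K E ∧ idemI F θ φ * a = a ∧ a * idemI F θ φ = a}
  zero_mem' := ⟨zero_mem _, mul_zero _, zero_mul _⟩
  add_mem' := by
    rintro a b ⟨ha, ha', ha''⟩ ⟨hb, hb', hb''⟩
    exact ⟨add_mem ha hb, by rw [mul_add, ha', hb'], by rw [add_mul, ha'', hb'']⟩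
  neg_mem' := by
    rintro a ⟨ha, ha', ha''⟩
    exact ⟨neg_mem ha, by rw [mul_neg, ha'], by rw [neg_mul, ha'']⟩
  mul_mem' := by
    rintro a b ⟨ha, ha', ha''⟩ ⟨hb, hb', hb''⟩
    exact ⟨mul_mem ha hb, by rw [← mul_assoc, ha'], by rw [mul_assoc, hb'']⟩

/-- `S = (i F K i)^L`, the centralizer of `L` in `i F K i`. -/
noncomputable def ringS : NonUnitalSubring (MonoidAlgebra E G) :=
  cornerRing F θ φ ⊓ NonUnitalSubring.centralizer (MonoidAlgebra.of E G '' (H ⊓ K : Subgroup G))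

/-- `Z = Z(i F K i)`, which is also the centre of `S`. -/
noncomputable def ringZ : NonUnitalSubring (MonoidAlgebra E G) :=
  centerOf (cornerRing F θ φ)

/-- `S₀` is a subalgebra of `S` with `Z(S₀) = Z₀ := Z^H` and `S = S₀ Z`. -/
structure IsForm (S₀ : NonUnitalSubring (MonoidAlgebra E G)) : Prop where
  le : S₀ ≤ ringS F θ φ
  center_eq : (centerOf S₀ : Set (MonoidAlgebra E G)) =
    {z | z ∈ ringZ F θ φ ∧ ∀ h ∈ H, conjBy h z = z}
  span_eq : (AddSubgroup.closure {x | ∃ s ∈ S₀, ∃ z ∈ ringZ F θ φ, x = s * z} :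
    Set (MonoidAlgebra E G)) = ringS F θ φ

/-- A magic crossed representation `σ : H/L → S` with respect to `S₀`. The map `eps` is the
(unique) action of `H` on `S` with `(s₀ z)^(eps h) = s₀ z^h` for `s₀ ∈ S₀` and `z ∈ Z`, and `inv x`
is the inverse of `σ x` in `S`, whose unit is `i`. -/
structure MagicCrossedRep (S₀ : NonUnitalSubring (MonoidAlgebra E G)) where
  eps : H → (ringS F θ φ ≃+* ringS F θ φ)
  eps_form : ∀ (h : H) (s : ringS F θ φ), (s : MonoidAlgebra E G) ∈ S₀ → eps h s = s
  eps_center : ∀ (h : H) (s : ringS F θ φ), (s : MonoidAlgebra E G) ∈ ringZ F θ φ →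
    (eps h s : MonoidAlgebra E G) = conjBy (h : G) (s : MonoidAlgebra E G)
  toFun : H ⧸ (H ⊓ K).subgroupOf H → ringS F θ φ
  inv : H ⧸ (H ⊓ K).subgroupOf H → ringS F θ φ
  mul_inv : ∀ x, (toFun x * inv x : MonoidAlgebra E G) = idemI F θ φ
  inv_mul : ∀ x, (inv x * toFun x : MonoidAlgebra E G) = idemI F θ φ
  /-- `σ(x)^(eps y) σ(y) = σ(xy)`. -/
  crossed_mul : ∀ x y : H, eps y (toFun x) * toFun y = toFun ((x * y : H) : H ⧸ _)
  /-- `s^x = s^(eps(x) σ(x))`. -/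
  magic : ∀ (x : H) (s : ringS F θ φ), conjBy (x : G) (s : MonoidAlgebra E G) =
    (inv x * eps x s * toFun x : ringS F θ φ)

variable {F θ φ}

/-- The reduced norm `x ↦ nr_(S/Z)(σ x)` lies in `B¹(H/L, Z*)`, i.e. it is of the form
`x ↦ a⁻¹ a^x` for some `a ∈ Z*`. -/
def MagicCrossedRep.NormIsCoboundary {S₀ : NonUnitalSubring (MonoidAlgebra E G)}
    (σ : MagicCrossedRep F θ φ S₀) : Prop :=
  ∃ a ∈ ringZ F θ φ, ∃ b ∈ ringZ F θ φ, a * b = idemI F θ φ ∧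
    ∀ h : H, IsReducedNorm E (ringS F θ φ) (σ.toFun h) (b * conjBy (h : G) a)

/-- The function `h ↦ χ(s₀ h σ(Lh)⁻¹)` on `H`. -/
noncomputable def MagicCrossedRep.corr {S₀ : NonUnitalSubring (MonoidAlgebra E G)}
    (σ : MagicCrossedRep F θ φ S₀) (s₀ : MonoidAlgebra E G) (χ : G → E) : H → E :=
  fun h => charEval χ (s₀ * MonoidAlgebra.of E G (h : G) * (σ.inv h : MonoidAlgebra E G))

end Configuration

/-! ### Complex characters -/

section Complex

/-- `χ` is an irreducible complex character. -/
def IsIrrChar {N : Type*} [Group N] (χ : N → ℂ) : Prop :=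
  ∃ (d : ℕ) (ρ : Representation ℂ N (Fin d → ℂ)), ρ.IsIrreducible ∧ ρ.character = χ

/-- `Irr(N | e)`, the irreducible characters `χ` with `χ(e) ≠ 0`. -/
def irrOver {N : Type*} [Group N] (e : MonoidAlgebra ℂ N) : Set (N → ℂ) :=
  {χ | IsIrrChar χ ∧ charEval χ e ≠ 0}

/-- `ℂ[Irr(N | e)]`, the space of class functions spanned by `Irr(N | e)`. -/
def irrSpan {N : Type*} [Group N] (e : MonoidAlgebra ℂ N) : Submodule ℂ (N → ℂ) :=
  Submodule.span ℂ (irrOver e)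

/-- The inner product of complex functions on a finite group. -/
noncomputable def charInner {N : Type*} [Group N] (χ ψ : N → ℂ) : ℂ :=
  (Nat.card N : ℂ)⁻¹ * ∑ᶠ g : N, χ g * (starRingEnd ℂ) (ψ g)

variable {G : Type*} [Group G] (F : Type*) [Field F] [Algebra F ℂ] {K H : Subgroup G}

/-- The idempotent `e_(θ,F)` as an element of `ℂ G`. -/
noncomputable def idemTheta (θ : K → ℂ) : MonoidAlgebra ℂ G :=
  MonoidAlgebra.mapDomain K.subtype (charIdemOver F θ)

/-- The idempotent `e_(φ,F)` as an element of `ℂ H`. -/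
noncomputable def idemPhi (φ : ↥(H ⊓ K) → ℂ) : MonoidAlgebra ℂ H :=
  MonoidAlgebra.mapDomain (Subgroup.inclusion (inf_le_left : H ⊓ K ≤ H)) (charIdemOver F φ)

variable {F} {θ : K → ℂ} {φ : ↥(H ⊓ K) → ℂ}

/-- `f` is the correspondence `ι(σ)` induced by the magic crossed representation `σ`: elements
`s₀ ∈ S₀` of reduced trace `tr_(S₀/Z₀)(s₀) = 1` exist, and for each of them
`f χ (h) = χ(s₀ h σ(Lh)⁻¹)`. -/
def MagicCrossedRep.Induces {S₀ : NonUnitalSubring (MonoidAlgebra ℂ G)}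
    (σ : MagicCrossedRep F θ φ S₀)
    (f : irrSpan (idemTheta F θ) → irrSpan (idemPhi F φ)) : Prop :=
  (∃ s₀, IsReducedTrace ℂ S₀ s₀ (idemI F θ φ)) ∧
  ∀ s₀, IsReducedTrace ℂ S₀ s₀ (idemI F θ φ) →
    ∀ χ : irrSpan (idemTheta F θ), (f χ : H → ℂ) = σ.corr s₀ (χ : G → ℂ)

end Complex

/-!
Write `L = H ∩ K`, `i` for the idempotent `∑ e_φ^γ e_θ^γ`, `S` for the centraliser of `L` in
`i F K i`, `Z` for its centre, and `n` for the multiplicity of `φ` in `θ`.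

**The ring `S`.** Because `θ` and `φ` are projective, `E K e_θ` and `E L e_φ` are full matrix
algebras, and the corner `e_φ e_θ E K e_φ e_θ` is a tensor product of the matrix algebra `E L e_φ` with its centraliser, a
matrix algebra of degree `n`, which acts on the multiplicity space of `φ` in `θ`. The Galois
conjugates of `e_θ` are orthogonal, so an element of `i F K i` is determined by its product with
`e_φ e_θ`, and this identifies `S` with a central simple algebra of degree `n` over
`Z ≅ F(φ) = F(θ)` whose elements are matrices over `E` (`CornerModel`,
`SemiInvariantConfig.exists_cornerModel`). The group `H / L` acts on `S`, and acts on `Z` through a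
group `Γ` of Galois automorphisms. Reduced norms and traces are determinants and traces of these
matrices.

**Forms and crossed representations.** By Galois descent, a form `S₀` of `S` over `Z₀ = Z^Γ` is the
fixed ring of a semilinear action of `Γ` on `S`. Every element of `Γ` extends to an automorphism of
`S`, and the obstruction to choosing these extensions multiplicatively vanishes because `n` is prime
to `|Γ|` (`exists_semilinear_action`). This is seen without Brauer groups: a tensor power of `S`
with exponent `|Γ| t = q n + 1`, on whose factors `Γ` acts by free permutations, carries an action
for trivial reasons. The alternating tensors show that it is Brauer equivalent to `S`, rationality being
guaranteed by mixed discriminants; since the fixed ring of the action has degree prime to `|Γ|`, it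
contains an idempotent which cuts `S` out of the tensor power, and `S` inherits the action.
Next, the Skolem–Noether theorem provides units `σ(x)` with `s^x = σ(x)⁻¹ s^{ε(x)} σ(x)`. They form
a crossed representation up to a `2`-cocycle with values in `Z*`, which is killed by `|H / L|` and,
as reduced norms show, by `n`; coprimality also allows the reduced norm of `σ` to be made a
coboundary (`exists_trivialization_of_cocycle`, `exists_crossedRepresentation`). Two such `σ`,
possibly for different forms, are conjugate by a unit of `S`: this is Hilbert's Theorem 90
(`exists_unit_conj_crossedRepresentation`).

**The correspondence.** Put `κ(h) = h σ(Lh)⁻¹`. The magic property says that `κ` is multiplicative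
and commutes with `S₀`, and `i E G i` is spanned by `S₀ κ(H)`. Hence, for an irreducible module of
`G` over `e_(θ,F)`, the image of `i` is a module of `i E G i` that restricts to `n` copies of one
irreducible representation of `H` via `κ` (`CornerModel.exists_isIrreducible_character_eq`). So
`χ ↦ n⁻¹ (χ ∘ κ)` maps irreducible characters to irreducible characters. It is injective, because a
trace function vanishing on `κ(H)` vanishes on `i E G i` and thus on the ideal generated by `i`,
which contains `e_(θ,F)`; it is surjective, because `κ` is faithful on the ideal of `E H` generated
by `e_(φ,F)`. A bijection of irreducible characters extends to an isometry. An element `s₀` of `S₀`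
with reduced trace `1` differs from `n⁻¹` by a sum of commutators, which gives
`n χ(s₀ κ(h)) = χ(κ(h))`, and conjugacy of `σ` and `σ'` by a unit of `S` makes the map independent
of all choices.
-/

open Submodule (span subset_span span_le)
open Finset (sum_congr sum_mul mul_sum)
open FixedPoints (subfield)

/-! ### Central simple algebras -/

section Span

variable {R A V W : Type*} [CommSemiring R] [Semiring A] [Algebra R A] [AddCommMonoid V]
  [Module R V] [AddCommMonoid W] [Module R W]

theorem map_mem_of_mem_span (f : V →ₗ[R] W) {T : Set V} {N : Submodule R W}
    (h : ∀ t ∈ T, f t ∈ N) {x : V} (hx : x ∈ span R T) : f x ∈ N :=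
  (span_le (p := N.comap f)).2 h hx

theorem map_eq_zero_of_mem_span (f : V →ₗ[R] W) {T : Set V} (h : ∀ t ∈ T, f t = 0) {x : V}
    (hx : x ∈ span R T) : f x = 0 :=
  map_mem_of_mem_span f (N := ⊥) h hx

theorem mul_mem_of_mem_span {T : Set A} {N : Submodule R A} {a : A} (h : ∀ t ∈ T, a * t ∈ N)
    {x : A} (hx : x ∈ span R T) : a * x ∈ N :=
  map_mem_of_mem_span (LinearMap.mulLeft R a) h hx

theorem mul_mem_of_mem_span_left {T : Set A} {N : Submodule R A} {a : A}
    (h : ∀ t ∈ T, t * a ∈ N) {x : A} (hx : x ∈ span R T) : x * a ∈ N :=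
  map_mem_of_mem_span (LinearMap.mulRight R a) h hx

theorem mul_comm_of_mem_span {T : Set A} {a : A} (h : ∀ t ∈ T, t * a = a * t) {x : A}
    (hx : x ∈ span R T) : x * a = a * x :=
  LinearMap.eqOn_span (f := LinearMap.mulRight R a) (g := LinearMap.mulLeft R a) h hx

end Span

section CentralSimpleAlgebras

open scoped TensorProduct
open Module

/-- Two-sided multiplication identifies `S ⊗ Sᵒᵖ` with the algebra of all linear endomorphisms of
a central simple algebra `S`: surjectivity is the density theorem for the simple `S ⊗ Sᵒᵖ`-module
`S`, injectivity follows by counting dimensions. -/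
theorem mulLeftRight_bijective_of_isSimpleRing (Z S : Type*) [Field Z] [Ring S] [Algebra Z S]
    [IsSimpleRing S] [Algebra.IsCentral Z S] [FiniteDimensional Z S] :
    Function.Bijective (AlgHom.mulLeftRight Z S) := by
  have hsurj : Function.Surjective (AlgHom.mulLeftRight Z S) := by
    let _ : Module (S ⊗[Z] Sᵐᵒᵖ) S := Module.compHom S (AlgHom.mulLeftRight Z S).toRingHom
    have hsmul : ∀ (t : S ⊗[Z] Sᵐᵒᵖ) (x : S), t • x = AlgHom.mulLeftRight Z S t x :=
      fun _ _ => rfl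
    have : IsSimpleModule (S ⊗[Z] Sᵐᵒᵖ) S := by
      rw [isSimpleModule_iff_toSpanSingleton_surjective]
      refine ⟨inferInstance, fun x hx y => ?_⟩
      let I : Ideal S :=
        { carrier := {z | ∃ t : S ⊗[Z] Sᵐᵒᵖ, t • x = z}
          add_mem' := by
            rintro _ _ ⟨t, rfl⟩ ⟨u, rfl⟩
            exact ⟨t + u, add_smul _ _ _⟩
          zero_mem' := ⟨0, by rw [hsmul, map_zero]; rfl⟩
          smul_mem' := by
            rintro c _ ⟨t, rfl⟩
            refine ⟨(c ⊗ₜ 1) * t, ?_⟩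
            rw [mul_smul, hsmul (c ⊗ₜ 1)]
            simp }
      have hI : I.IsTwoSided := by
        refine ⟨?_⟩
        rintro _ b ⟨t, rfl⟩
        refine ⟨(1 ⊗ₜ MulOpposite.op b) * t, ?_⟩
        rw [mul_smul, hsmul (1 ⊗ₜ _)]
        simp
      rcases (isSimpleRing_iff_isTwoSided_imp.1 (inferInstance : IsSimpleRing S)).2 I hI with h | h
      · exfalso
        apply hx
        have : x ∈ I := ⟨1, one_smul _ _⟩
        rw [h] at this
        simpa using this
      · have : y ∈ I := by rw [h]; trivial
        exact this
    intro f
    classical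
    let b := Module.finBasis Z S
    -- every endomorphism of the bimodule `S` is multiplication by a central element
    have hend : ∀ g : Module.End (S ⊗[Z] Sᵐᵒᵖ) S, ∃ z : Z, ∀ x, g x = z • x := by
      intro g
      have h1 : ∀ a x c : S, g (a * x * c) = a * g x * c := by
        intro a x c
        have := g.map_smul (a ⊗ₜ MulOpposite.op c) x
        simpa [hsmul] using this
      have h2 : g 1 ∈ Subalgebra.center Z S := by
        rw [Subalgebra.mem_center_iff]
        intro a
        have e1 := h1 a 1 1
        have e2 := h1 1 1 a
        simp only [mul_one, one_mul] at e1 e2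
        rw [← e1, e2]
      rw [Algebra.IsCentral.center_eq_bot, Algebra.mem_bot] at h2
      obtain ⟨z, hz⟩ := h2
      refine ⟨z, fun x => ?_⟩
      have e1 := h1 x 1 1
      simp only [mul_one] at e1
      rw [e1, ← hz, Algebra.smul_def, Algebra.commutes]
    let f' : Module.End (Module.End (S ⊗[Z] Sᵐᵒᵖ) S) S :=
      { toFun := f
        map_add' := f.map_add
        map_smul' := by
          intro g x
          obtain ⟨z, hz⟩ := hend g
          change f (g x) = g (f x)
          rw [hz, hz, f.map_smul] }
    obtain ⟨r, hr⟩ := jacobson_density f' (Finset.univ.image b)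
    refine ⟨r, b.ext fun i => ?_⟩
    exact (hr (b i) (Finset.mem_image_of_mem _ (Finset.mem_univ _))).symm
  have hfr : finrank Z (S ⊗[Z] Sᵐᵒᵖ) = finrank Z (Module.End Z S) := by
    rw [finrank_tensorProduct, Module.finrank_linearMap,
      (MulOpposite.opLinearEquiv Z : S ≃ₗ[Z] Sᵐᵒᵖ).finrank_eq]
  exact ⟨(LinearMap.injective_iff_surjective_of_finrank_eq_finrank
    (f := (AlgHom.mulLeftRight Z S).toLinearMap) hfr).2 hsurj, hsurj⟩

/-- **Skolem–Noether** for automorphisms of a central simple algebra. -/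
theorem exists_unit_conj_of_algEquiv {Z S : Type*} [Field Z] [Ring S] [Algebra Z S]
    [IsSimpleRing S] [Algebra.IsCentral Z S] [FiniteDimensional Z S] (f : S ≃ₐ[Z] S) :
    ∃ u : Sˣ, ∀ s, f s * u = u * s := by
  let Θ := AlgEquiv.ofBijective _ (mulLeftRight_bijective_of_isSimpleRing Z S)
  -- `f ⊗ 1` becomes an automorphism of `End S`, hence conjugation by some `g`; take `u = g 1`
  let F : Module.End Z S ≃ₐ[Z] Module.End Z S :=
    (Θ.symm.trans (Algebra.TensorProduct.congr f AlgEquiv.refl)).trans Θ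
  obtain ⟨g, hg⟩ := LinearEquiv.conjAlgEquiv_surjective Z S S F
  have key : ∀ a x c : S, g (a * x * c) = f a * g x * c := by
    intro a x c
    have h1 : F (Θ (a ⊗ₜ MulOpposite.op c)) = Θ (f a ⊗ₜ MulOpposite.op c) := by
      simp [F]
    have h2 := LinearMap.congr_fun h1 (g x)
    rw [← hg] at h2
    simpa [Θ, LinearEquiv.conjAlgEquiv_apply] using h2
  have h1 : ∀ c, g c = g 1 * c := fun c => by simpa using key 1 1 c
  have h2 : ∀ a, g a = f a * g 1 := fun a => by simpa using key a 1 1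
  obtain ⟨c, hc⟩ := g.surjective 1
  obtain ⟨a, ha⟩ := f.surjective c
  have hr : g 1 * c = 1 := by rw [← h1, hc]
  have hl : f c * g 1 = 1 := by rw [← h2, hc]
  have hcc : f c = c := left_inv_eq_right_inv hl hr
  refine ⟨⟨g 1, c, hr, hcc ▸ hl⟩, fun s => ?_⟩
  change f s * g 1 = g 1 * s
  rw [← h1, ← h2]

/-- Elements of a central simple algebra that are linearly independent over the centre have images
that are linearly independent over any extension field `E` that acts centrally on the target. -/
theorem LinearIndependent.map_of_isSimpleRing {Z S E A ι : Type*} [Field Z] [Ring S] [Algebra Z S]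
    [IsSimpleRing S] [Algebra.IsCentral Z S] [FiniteDimensional Z S] [Field E] [Algebra Z E]
    [Ring A] [Nontrivial A] [Algebra E A] [Algebra Z A] [IsScalarTower Z E A] (ψ : S →ₐ[Z] A)
    {s : ι → S} (hs : LinearIndependent Z s) : LinearIndependent E (fun i => ψ (s i)) := by
  classical
  -- for each `j` there is an element of `S ⊗ Sᵒᵖ` that maps `s i` to `δ i j`
  rw [linearIndependent_iff']
  intro t c hc j hj
  obtain ⟨φ, hφ⟩ : ∃ φ : S →ₗ[Z] Z, ∀ i, φ (s i) = if i = j then 1 else 0 := by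
    let b := Basis.extend hs.linearIndepOn_id
    have hmem : ∀ i, s i ∈ hs.linearIndepOn_id.extend (Set.subset_univ (Set.range s)) := fun i =>
      hs.linearIndepOn_id.subset_extend _ ⟨i, rfl⟩
    refine ⟨b.coord ⟨s j, hmem j⟩, fun i => ?_⟩
    have hb : b ⟨s i, hmem i⟩ = s i := Basis.extend_apply_self _ _
    rw [← hb, Basis.coord_apply, Basis.repr_self, Finsupp.single_apply]
    simp [Subtype.ext_iff, hs.injective.eq_iff]
  obtain ⟨w, hw⟩ := (mulLeftRight_bijective_of_isSimpleRing Z S).2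
    ((LinearMap.toSpanSingleton Z S 1).comp φ)
  have gen : ∀ w : S ⊗[Z] Sᵐᵒᵖ, ∃ Φ : A →ₗ[E] A,
      ∀ x, Φ (ψ x) = ψ (AlgHom.mulLeftRight Z S w x) := by
    intro w
    induction w using TensorProduct.induction_on with
    | zero => exact ⟨0, fun x => by simp⟩
    | tmul a b =>
      refine ⟨(LinearMap.mulLeft E (ψ a)).comp (LinearMap.mulRight E (ψ b.unop)), fun x => ?_⟩
      simp [mul_assoc]
    | add x y hx hy =>
      obtain ⟨Φ, h1⟩ := hx
      obtain ⟨Φ', h2⟩ := hy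
      exact ⟨Φ + Φ', fun x => by simp [h1, h2]⟩
  obtain ⟨Φ, hΦ⟩ := gen w
  have h3 := congrArg Φ hc
  rw [map_sum, map_zero] at h3
  simp only [LinearMap.map_smul, hΦ, hw] at h3
  simp only [LinearMap.comp_apply, hφ, LinearMap.toSpanSingleton_apply, ite_smul, one_smul,
    zero_smul, apply_ite ψ, map_one, map_zero, smul_ite, smul_zero] at h3
  rw [Finset.sum_ite_eq' t j, if_pos hj] at h3
  rcases smul_eq_zero.1 h3 with h | h
  · exact h
  · exact absurd h one_ne_zero

/-- The `E`-algebra homomorphism `E ⊗ S → A` extending `ψ : S → A`. -/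
noncomputable def scalarExtension {Z S A : Type*} (E : Type*) [Field Z] [Ring S] [Algebra Z S]
    [Field E] [Algebra Z E] [Ring A] [Algebra E A] [Algebra Z A] [IsScalarTower Z E A]
    (ψ : S →ₐ[Z] A) : E ⊗[Z] S →ₐ[E] A :=
  Algebra.TensorProduct.lift (Algebra.ofId E A) ψ
    (fun e s => show Commute (Algebra.ofId E A e) (ψ s) from Algebra.commutes e (ψ s))

theorem scalarExtension_tmul {Z S A E : Type*} [Field Z] [Ring S] [Algebra Z S]
    [Field E] [Algebra Z E] [Ring A] [Algebra E A] [Algebra Z A] [IsScalarTower Z E A]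
    (ψ : S →ₐ[Z] A) (c : E) (s : S) : scalarExtension E ψ (c ⊗ₜ s) = c • ψ s := by
  rw [scalarExtension, Algebra.TensorProduct.lift_tmul, Algebra.ofId_apply, Algebra.smul_def]

/-- The extension of scalars of a central simple algebra is isomorphic to any algebra that it
generates. -/
theorem scalarExtension_bijective {Z S E A : Type*} [Field Z] [Ring S] [Algebra Z S]
    [IsSimpleRing S] [Algebra.IsCentral Z S] [FiniteDimensional Z S] [Field E] [Algebra Z E]
    [Ring A] [Nontrivial A] [Algebra E A] [Algebra Z A] [IsScalarTower Z E A] (ψ : S →ₐ[Z] A)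
    (hψ : span E (Set.range ψ) = ⊤) : Function.Bijective (scalarExtension E ψ) := by
  let b := Module.finBasis Z S
  have hind := b.linearIndependent.map_of_isSimpleRing (E := E) ψ
  constructor
  · rw [injective_iff_map_eq_zero]
    intro x hx
    have hx' := (Algebra.TensorProduct.basis E b).sum_repr x
    rw [← hx', map_sum] at hx
    simp only [map_smul, Algebra.TensorProduct.basis_apply, scalarExtension_tmul, one_smul] at hx
    have := (Fintype.linearIndependent_iff.1 hind) _ hx
    rw [← hx']
    exact Finset.sum_eq_zero fun i _ => by rw [this i, zero_smul]
  · have : LinearMap.range (scalarExtension E ψ).toLinearMap = ⊤ := by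
      rw [eq_top_iff, ← hψ, span_le]
      rintro _ ⟨s, rfl⟩
      exact ⟨1 ⊗ₜ s, by
        rw [AlgHom.toLinearMap_apply, scalarExtension_tmul, one_smul]⟩
    exact LinearMap.range_eq_top.1 this

theorem finrank_eq_of_span_eq_top {Z S E A : Type*} [Field Z] [Ring S] [Algebra Z S]
    [IsSimpleRing S] [Algebra.IsCentral Z S] [FiniteDimensional Z S] [Field E] [Algebra Z E]
    [Ring A] [Nontrivial A] [Algebra E A] [Algebra Z A] [IsScalarTower Z E A] (ψ : S →ₐ[Z] A)
    (hψ : span E (Set.range ψ) = ⊤) : finrank Z S = finrank E A := by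
  rw [← (LinearEquiv.ofBijective (scalarExtension E ψ).toLinearMap
    (scalarExtension_bijective ψ hψ)).finrank_eq, finrank_baseChange]

/-- A ring whose scalar extension is simple of no smaller dimension is itself simple. -/
theorem isSimpleRing_of_span_eq_top {Z S E A : Type*} [Field Z] [Ring S] [Algebra Z S]
    [FiniteDimensional Z S] [Field E] [Algebra Z E]
    [Ring A] [IsSimpleRing A] [Algebra E A] [Algebra Z A] [IsScalarTower Z E A] (ψ : S →ₐ[Z] A)
    (hinj : Function.Injective ψ)
    (hψ : span E (Set.range ψ) = ⊤) (hle : finrank Z S ≤ finrank E A) :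
    IsSimpleRing S := by
  have hnt : Nontrivial S := by
    by_contra hcon
    rw [not_nontrivial_iff_subsingleton] at hcon
    have := hψ
    have h1 : (1 : A) = 0 := by rw [← map_one ψ, Subsingleton.elim (1 : S) 0, map_zero]
    exact one_ne_zero h1
  rw [isSimpleRing_iff_isTwoSided_imp]
  refine ⟨hnt, fun I hI => ?_⟩
  by_cases hbot : I = ⊥
  · exact Or.inl hbot
  right
  obtain ⟨x, hxI, hx0⟩ := Submodule.exists_mem_ne_zero_of_ne_bot hbot
  let W : Submodule E A := span E (ψ '' I)
  have hmulL : ∀ a : A, ∀ w ∈ W, a * w ∈ W := by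
    intro a w hw
    have ha : a ∈ span E (Set.range ψ) := by rw [hψ]; trivial
    refine mul_mem_of_mem_span ?_ hw
    rintro _ ⟨y, hyI, rfl⟩
    refine mul_mem_of_mem_span_left ?_ ha
    rintro _ ⟨u, rfl⟩
    rw [← map_mul]
    exact subset_span ⟨_, I.mul_mem_left u hyI, rfl⟩
  have hmulR : ∀ a : A, ∀ w ∈ W, w * a ∈ W := by
    intro a w hw
    have ha : a ∈ span E (Set.range ψ) := by rw [hψ]; trivial
    refine mul_mem_of_mem_span_left ?_ hw
    rintro _ ⟨y, hyI, rfl⟩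
    refine mul_mem_of_mem_span ?_ ha
    rintro _ ⟨u, rfl⟩
    rw [← map_mul]
    exact subset_span ⟨_, I.mul_mem_right u hyI, rfl⟩
  let J : Ideal A :=
    { carrier := W
      add_mem' := fun h h' => W.add_mem h h'
      zero_mem' := W.zero_mem
      smul_mem' := fun a w hw => hmulL a w hw }
  have hJ : J.IsTwoSided := ⟨fun b ha => hmulR b _ ha⟩
  have hxJ : ψ x ∈ J := subset_span ⟨x, hxI, rfl⟩
  have hW : W = ⊤ := by
    rcases (isSimpleRing_iff_isTwoSided_imp.1 (inferInstance : IsSimpleRing A)).2 J hJ with h | h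
    · exfalso
      rw [h] at hxJ
      exact hx0 (hinj (by simpa using hxJ))
    · rw [eq_top_iff]
      intro y _
      have : y ∈ J := by rw [h]; trivial
      exact this
  -- `I` contains a basis of `A` over `E`, so its dimension is at least that of `S`
  let I' : Submodule Z S := I.restrictScalars Z
  have h1 : finrank E A ≤ finrank Z I' := by
    let b := Module.finBasis Z I'
    have hspan : span E (Set.range fun i => ψ (b i)) = ⊤ := by
      rw [eq_top_iff, ← hW, span_le]
      rintro _ ⟨y, hy, rfl⟩
      have := b.sum_repr ⟨y, hy⟩
      have h2 : ψ y = ∑ i, algebraMap Z E (b.repr ⟨y, hy⟩ i) • ψ (b i) := by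
        have h3 := congrArg (fun t : I' => ψ (t : S)) this
        simp only [Submodule.coe_sum, Submodule.coe_smul, map_sum, map_smul] at h3
        rw [← h3]
        simp
      rw [SetLike.mem_coe, h2]
      exact Submodule.sum_mem _ fun i _ => Submodule.smul_mem _ _ (subset_span ⟨i, rfl⟩)
    have h4 := finrank_range_le_card (R := E) (fun i => ψ (b i))
    rw [Set.finrank, hspan, finrank_top, Fintype.card_fin] at h4
    exact h4
  have h2 : I' = ⊤ := Submodule.eq_top_of_finrank_eq
    (le_antisymm (Submodule.finrank_le _) (hle.trans h1))
  rw [eq_top_iff]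
  intro y _
  have : y ∈ I' := by rw [h2]; trivial
  exact this

end CentralSimpleAlgebras

/-! ### Reduced norms -/

section ReducedNorm

open scoped TensorProduct
open Module

/-- Every algebra homomorphism between full matrix algebras of the same size, over possibly
different commutative rings, preserves determinants. (It is conjugation by some matrix `g`, at
least locally at a given maximal ideal of the target ring.) -/
theorem det_algHom_matrix {E R ι : Type*} [Field E] [CommRing R] [Algebra E R] [Fintype ι]
    [DecidableEq ι] (φ : Matrix ι ι E →ₐ[E] Matrix ι ι R) (X : Matrix ι ι E) :
    (φ X).det = algebraMap E R X.det := by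
  classical
  rcases isEmpty_or_nonempty ι with hι | ⟨⟨i₀⟩⟩
  · simp [Matrix.det_isEmpty]
  by_contra hne
  set r := (φ X).det - algebraMap E R X.det with hr
  have hr0 : r ≠ 0 := sub_ne_zero.2 hne
  let I : Ideal R := Ideal.span {x | x * r = 0}
  have hI : I ≠ ⊤ := by
    rw [Ideal.ne_top_iff_one]
    intro h1
    apply hr0
    have : ∀ x ∈ I, x * r = 0 := by
      intro x hx
      induction hx using Submodule.span_induction with
      | mem x hx => exact hx
      | zero => simp
      | add x y _ _ hx hy => rw [add_mul, hx, hy, add_zero]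
      | smul c x _ hx => rw [smul_eq_mul, mul_assoc, hx, mul_zero]
    simpa using this 1 h1
  obtain ⟨m, hm, hIm⟩ := Ideal.exists_le_maximal I hI
  let e : ι → ι → Matrix ι ι R := fun i j => φ (Matrix.single i j 1)
  have hee : ∀ i j k l, e i j * e k l = if j = k then e i l else 0 := by
    intro i j k l
    simp only [e, ← map_mul]
    split_ifs with h
    · subst h
      rw [Matrix.single_mul_single_same, mul_one]
    · rw [Matrix.single_mul_single_of_ne _ _ _ _ h, map_zero]
  obtain ⟨a, b, hab⟩ : ∃ a b, e i₀ i₀ a b ∉ m := by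
    by_contra! hcon
    have h1 : (1 : Matrix ι ι R) = ∑ i, e i i₀ * (e i₀ i₀ * e i₀ i) := by
      simp only [hee, if_true]
      rw [← map_one φ, ← map_sum]
      congr 1
      ext x y
      rw [Matrix.sum_apply, Matrix.one_apply]
      simp only [Matrix.single_apply]
      by_cases hxy : x = y
      · subst hxy
        simp
      · rw [if_neg hxy, Finset.sum_eq_zero]
        rintro i -
        rw [if_neg]
        rintro ⟨rfl, h⟩
        exact hxy h
    have h2 := congrFun (congrFun h1 i₀) i₀
    rw [Matrix.one_apply_eq, Matrix.sum_apply] at h2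
    apply hm.ne_top
    rw [Ideal.eq_top_iff_one, h2]
    refine Ideal.sum_mem _ fun i _ => ?_
    rw [Matrix.mul_apply]
    refine Ideal.sum_mem _ fun j _ => Ideal.mul_mem_left _ _ ?_
    rw [Matrix.mul_apply]
    exact Ideal.sum_mem _ fun k _ => Ideal.mul_mem_right _ _ (hcon _ _)
  let w : ι → R := fun x => e i₀ i₀ x b
  let g : Matrix ι ι R := Matrix.of fun k i => (e i i₀).mulVec w k
  have hg : ∀ Y : Matrix ι ι E, φ Y * g = g * Y.map (algebraMap E R) := by
    intro Y
    ext k i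
    have h1 : (φ Y * g) k i = ((φ Y).mulVec ((e i i₀).mulVec w)) k := rfl
    have h2 : φ Y * e i i₀ = ∑ l, Y l i • e l i₀ := by
      simp only [e, ← map_mul, ← map_smul, ← map_sum]
      congr 1
      ext x y
      rw [Matrix.mul_apply, Matrix.sum_apply]
      simp only [Matrix.single_apply, Matrix.smul_apply]
      by_cases hy : i₀ = y
      · subst hy
        simp
      · simp [hy]
    rw [h1, Matrix.mulVec_mulVec, h2, Matrix.sum_mulVec, Finset.sum_apply, Matrix.mul_apply]
    refine sum_congr rfl fun l _ => ?_
    rw [Matrix.smul_mulVec, Pi.smul_apply, Matrix.map_apply, Algebra.smul_def, mul_comm]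
    rfl
  have hdet : g.det ∈ m := by
    apply hIm
    apply Ideal.subset_span
    have h1 := congrArg Matrix.det (hg X)
    have h2 : (X.map (algebraMap E R)).det = algebraMap E R X.det := by
      rw [← RingHom.mapMatrix_apply, ← RingHom.map_det]
    rw [Matrix.det_mul, Matrix.det_mul, h2] at h1
    change g.det * r = 0
    rw [hr, mul_sub, ← h1]
    ring
  let _ : Field (R ⧸ m) := Ideal.Quotient.field m
  let q := Ideal.Quotient.mk m
  have hdet0 : (g.map q).det = 0 := by
    rw [← RingHom.mapMatrix_apply, ← RingHom.map_det]
    exact Ideal.Quotient.eq_zero_iff_mem.2 hdet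
  obtain ⟨u, hu0, hu⟩ := Matrix.exists_mulVec_eq_zero_iff.2 hdet0
  obtain ⟨l, hl⟩ := Function.ne_iff.1 hu0
  have h1 := congrArg (fun M : Matrix ι ι R => (M.map q).mulVec u) (hg (Matrix.single i₀ l 1))
  simp only [Matrix.map_mul] at h1
  rw [← Matrix.mulVec_mulVec, hu, Matrix.mulVec_zero, ← Matrix.mulVec_mulVec] at h1
  have h2 : (((Matrix.single i₀ l (1 : E)).map (algebraMap E R)).map q).mulVec u
      = Pi.single i₀ (u l) := by
    ext x
    simp only [Matrix.mulVec, dotProduct, Matrix.map_apply, Matrix.single_apply, Pi.single_apply]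
    by_cases hx : x = i₀
    · subst hx
      rw [if_pos rfl, Finset.sum_eq_single l]
      · simp
      · intro y _ hy
        simp [Ne.symm hy]
      · simp
    · rw [if_neg hx]
      exact Finset.sum_eq_zero fun y _ => by simp [Ne.symm hx]
  rw [h2] at h1
  have h3 := congrFun h1 a
  rw [Matrix.mulVec_single] at h3
  simp only [Pi.zero_apply, Pi.smul_apply, Matrix.col_apply, Matrix.map_apply] at h3
  have h4 : g a i₀ = e i₀ i₀ a b := by
    have : (e i₀ i₀ * e i₀ i₀) a b = e i₀ i₀ a b := by rw [hee, if_pos rfl]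
    rw [← this]
    rfl
  apply hab
  rw [← Ideal.Quotient.eq_zero_iff_mem, ← h4]
  have h5 : q (g a i₀) * u l = 0 := by
    have := h3.symm
    simpa [mul_comm] using this
  exact (mul_eq_zero.1 h5).resolve_right hl

theorem trace_algHom_matrix {E ι : Type*} [Field E] [Fintype ι] [DecidableEq ι] [Nonempty ι]
    (φ : Matrix ι ι E →ₐ[E] Matrix ι ι E) (X : Matrix ι ι E) :
    (φ X).trace = X.trace := by
  have hb : Function.Bijective φ := by
    have hi : Function.Injective φ := RingHom.injective φ.toRingHom
    exact ⟨hi, (LinearMap.injective_iff_surjective (f := φ.toLinearMap)).1 hi⟩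
  let F := AlgEquiv.ofBijective φ hb
  obtain ⟨g, hg⟩ := LinearEquiv.conjAlgEquiv_surjective E (ι → E) (ι → E)
    ((Matrix.toLinAlgEquiv'.symm.trans F).trans Matrix.toLinAlgEquiv')
  have h1 := AlgEquiv.congr_fun hg (Matrix.toLinAlgEquiv' X)
  have h2 : Matrix.toLinAlgEquiv' (φ X) = g.conj (Matrix.toLinAlgEquiv' X) := by
    simpa [F, LinearEquiv.conjAlgEquiv_apply, LinearEquiv.conj_apply, LinearMap.comp_assoc]
      using h1.symm
  have h3 : ∀ Y : Matrix ι ι E, LinearMap.trace E _ (Matrix.toLinAlgEquiv' Y) = Y.trace :=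
    Matrix.trace_toLin'_eq
  rw [← h3, h2, LinearMap.trace_conj', h3]

variable {Z S : Type*} [Field Z] [Ring S] [Algebra Z S]
    [IsSimpleRing S] [Algebra.IsCentral Z S] [FiniteDimensional Z S]

theorem finrank_eq_sq_of_span_eq_top {E : Type*} [Field E] [Algebra Z E] {n : ℕ} [NeZero n]
    (ψ : S →ₐ[Z] Matrix (Fin n) (Fin n) E) (hψ : span E (Set.range ψ) = ⊤) :
    finrank Z S = n ^ 2 := by
  rw [finrank_eq_of_span_eq_top ψ hψ, Module.finrank_matrix]
  simp [sq]

/-- Two splittings of a central simple algebra give the same determinants, compared over the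
tensor product of the two splitting fields. -/
theorem det_tmul_eq_tmul_det {E E' : Type*} [Field E] [Algebra Z E] [Field E'] [Algebra Z E']
    {n : ℕ} [NeZero n]
    (ψ : S →ₐ[Z] Matrix (Fin n) (Fin n) E) (hψ : span E (Set.range ψ) = ⊤)
    (ψ' : S →ₐ[Z] Matrix (Fin n) (Fin n) E') (s : S) :
    ((ψ s).det ⊗ₜ[Z] (1 : E') : E ⊗[Z] E') = 1 ⊗ₜ (ψ' s).det := by
  let ψ₂ : S →ₐ[Z] Matrix (Fin n) (Fin n) (E ⊗[Z] E') :=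
    (Algebra.TensorProduct.includeRight : E' →ₐ[Z] E ⊗[Z] E').mapMatrix.comp ψ'
  let Θ := AlgEquiv.ofBijective _ (scalarExtension_bijective ψ hψ)
  let φ : Matrix (Fin n) (Fin n) E →ₐ[E] Matrix (Fin n) (Fin n) (E ⊗[Z] E') :=
    (scalarExtension E ψ₂).comp (Θ.symm : _ →ₐ[E] _)
  have h1 : φ (ψ s) = ψ₂ s := by
    have h2 : Θ (1 ⊗ₜ s) = ψ s := by
      change scalarExtension E ψ (1 ⊗ₜ s) = _
      rw [scalarExtension_tmul, one_smul]
    have h3 : Θ.symm (ψ s) = 1 ⊗ₜ s := by rw [← h2, AlgEquiv.symm_apply_apply]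
    change scalarExtension E ψ₂ (Θ.symm (ψ s)) = _
    rw [h3, scalarExtension_tmul, one_smul]
  have h2 := det_algHom_matrix φ (ψ s)
  rw [h1] at h2
  have h3 : (ψ₂ s).det = 1 ⊗ₜ (ψ' s).det := by
    change ((Algebra.TensorProduct.includeRight : E' →ₐ[Z] E ⊗[Z] E').toRingHom.mapMatrix
      (ψ' s)).det = _
    rw [← RingHom.map_det]
    rfl
  rw [← h3, h2]
  rfl

/-- The reduced norm is rational: determinants of elements of `S` under a splitting lie in the
centre. -/
theorem exists_algebraMap_eq_det {E : Type*} [Field E] [Algebra Z E] {n : ℕ} [NeZero n]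
    (ψ : S →ₐ[Z] Matrix (Fin n) (Fin n) E) (hψ : span E (Set.range ψ) = ⊤) (s : S) :
    ∃ z : Z, algebraMap Z E z = (ψ s).det := by
  obtain ⟨f, hf⟩ := LinearMap.exists_leftInverse_of_injective (Algebra.linearMap Z E)
    (LinearMap.ker_eq_bot.2 (algebraMap Z E).injective)
  have hf1 : f 1 = 1 := by simpa using LinearMap.congr_fun hf 1
  have h := det_tmul_eq_tmul_det ψ hψ ψ s
  have h1 := congrArg (fun t => TensorProduct.rid Z E (f.lTensor E t)) h
  simp only [LinearMap.lTensor_tmul, TensorProduct.rid_tmul, hf1, one_smul] at h1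
  exact ⟨_, (by rw [h1, Algebra.smul_def, mul_one])⟩

/-- The reduced norm can be computed through any splitting, into matrices over any field. -/
theorem det_eq_of_algebraMap_eq_det {E E' : Type*} [Field E] [Algebra Z E] [Field E']
    {n m : ℕ} [NeZero n] [NeZero m]
    (ψ : S →ₐ[Z] Matrix (Fin n) (Fin n) E) (hψ : span E (Set.range ψ) = ⊤)
    (ζ : Z →+* E') (ψ' : S →+* Matrix (Fin m) (Fin m) E')
    (hζ : ∀ z, ψ' (algebraMap Z S z) = ζ z • (1 : Matrix (Fin m) (Fin m) E'))
    (hψ' : span E' (Set.range ψ') = ⊤)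
    {s : S} {z : Z} (hz : algebraMap Z E z = (ψ s).det) : (ψ' s).det = ζ z := by
  let _ : Algebra Z E' := ζ.toAlgebra
  let ψ'' : S →ₐ[Z] Matrix (Fin m) (Fin m) E' :=
    { ψ' with
      commutes' := fun z => by
        change ψ' (algebraMap Z S z) = _
        rw [hζ, Algebra.algebraMap_eq_smul_one (A := Matrix (Fin m) (Fin m) E') z]
        ext i j
        simp [Algebra.smul_def, RingHom.algebraMap_toAlgebra] }
  have h1 := finrank_eq_sq_of_span_eq_top ψ hψ
  have h2 := finrank_eq_sq_of_span_eq_top ψ'' hψ'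
  have hnm : n = m := by
    rw [h1] at h2
    exact Nat.pow_left_injective two_ne_zero h2
  subst hnm
  have h3 := det_tmul_eq_tmul_det ψ hψ ψ'' s
  rw [← hz, Algebra.algebraMap_eq_smul_one, TensorProduct.smul_tmul,
    ← Algebra.algebraMap_eq_smul_one] at h3
  exact (Algebra.TensorProduct.includeRight_injective (R := Z) (A := E) (B := E')
    (algebraMap Z E).injective h3).symm

end ReducedNorm

/-! ### Modules over simple algebras -/

section SimpleModules

open Module

/-- Over a simple Artinian ring every finitely generated module is a power of a given simple
left ideal. -/
theorem exists_linearEquiv_fun_of_isSimpleRing {B V : Type*} [Ring B] [IsSimpleRing B]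
    [IsArtinianRing B] (I : Ideal B) [IsSimpleModule B I] [AddCommGroup V] [Module B V]
    [Module.Finite B V] : ∃ n : ℕ, Nonempty (V ≃ₗ[B] (Fin n → I)) := by
  have h : IsIsotypicOfType B V I := by
    intro m _
    obtain ⟨J, ⟨e⟩⟩ := IsSemisimpleRing.exists_linearEquiv_ideal_of_isSimpleModule B m
    have := IsSimpleModule.congr e.symm
    obtain ⟨e'⟩ := IsSimpleRing.isIsotypic B B I J
    exact ⟨e.trans e'⟩
  exact h.linearEquiv_fun

variable {k B : Type*} [Field k] [Ring B] [Algebra k B] [FiniteDimensional k B] [IsSimpleRing B]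

theorem nonempty_linearEquiv_of_finrank_eq {V W : Type*} [AddCommGroup V] [AddCommGroup W]
    [Module k V] [Module k W] [Module B V] [Module B W] [IsScalarTower k B V]
    [IsScalarTower k B W] [FiniteDimensional k V] [FiniteDimensional k W]
    (h : finrank k V = finrank k W) : Nonempty (V ≃ₗ[B] W) := by
  have : IsArtinianRing B := IsArtinianRing.of_finite k B
  have : Module.Finite B V := Module.Finite.of_restrictScalars_finite k B V
  have : Module.Finite B W := Module.Finite.of_restrictScalars_finite k B W
  obtain ⟨I, hI⟩ := IsAtomic.exists_atom (Ideal B)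
  have := isSimpleModule_iff_isAtom.2 hI
  obtain ⟨a, ⟨e⟩⟩ := exists_linearEquiv_fun_of_isSimpleRing (V := V) I
  obtain ⟨b, ⟨f⟩⟩ := exists_linearEquiv_fun_of_isSimpleRing (V := W) I
  have h1 := (e.restrictScalars k).finrank_eq
  have h2 := (f.restrictScalars k).finrank_eq
  rw [finrank_pi_fintype, Finset.sum_const, Finset.card_univ, Fintype.card_fin,
    smul_eq_mul] at h1 h2
  have hpos : 0 < finrank k I := by
    have := IsSimpleModule.nontrivial B I
    exact finrank_pos
  have hab : a = b := Nat.eq_of_mul_eq_mul_right hpos (by rw [← h1, ← h2, h])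
  subst hab
  exact ⟨e.trans f.symm⟩

/-- A simple algebra `B` of dimension `N ^ 2` with a module of dimension `m * (N * n)` has a left
ideal of dimension `N * n` generated by an idempotent, provided `n ∣ N` and `m` is prime to `N`. -/
theorem exists_idempotent_finrank_eq {V : Type*} [AddCommGroup V]
    [Module k V] [Module B V] [IsScalarTower k B V] [FiniteDimensional k V]
    {N n m : ℕ} (hN : 0 < N) (hnN : n ∣ N) (hm : Nat.Coprime m N) (hB : finrank k B = N ^ 2)
    (hV : finrank k V = m * (N * n)) :
    ∃ e : B, e * e = e ∧ finrank k (LinearMap.range (LinearMap.mulRight k e)) = N * n := by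
  have : IsArtinianRing B := IsArtinianRing.of_finite k B
  have : Module.Finite B V := Module.Finite.of_restrictScalars_finite k B V
  obtain ⟨I, hI⟩ := IsAtomic.exists_atom (Ideal B)
  have := isSimpleModule_iff_isAtom.2 hI
  obtain ⟨a, ⟨f⟩⟩ := exists_linearEquiv_fun_of_isSimpleRing (V := B) I
  obtain ⟨b, ⟨g⟩⟩ := exists_linearEquiv_fun_of_isSimpleRing (V := V) I
  have h1 := (f.restrictScalars k).finrank_eq
  have h2 := (g.restrictScalars k).finrank_eq
  rw [finrank_pi_fintype, Finset.sum_const, Finset.card_univ, Fintype.card_fin,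
    smul_eq_mul] at h1 h2
  rw [hB] at h1
  rw [hV] at h2
  have hpos : 0 < finrank k I := by
    have := IsSimpleModule.nontrivial B I
    exact finrank_pos
  obtain ⟨n', rfl⟩ := hnN
  have hdvd : finrank k I ∣ n * n' * n := by
    have h3 : finrank k I ∣ Nat.gcd ((n * n' * n) * n') ((n * n' * n) * m) := by
      refine Nat.dvd_gcd ⟨a, ?_⟩ ⟨b, ?_⟩
      · rw [mul_comm _ a, ← h1]; ring
      · rw [mul_comm _ b, ← h2]; ring
    rw [Nat.gcd_mul_left, Nat.Coprime.gcd_eq_one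
      (Nat.Coprime.coprime_dvd_left (Dvd.intro_left n rfl) hm.symm), mul_one] at h3
    exact h3
  obtain ⟨c, hc⟩ := hdvd
  have hca : c ≤ a := by
    refine le_of_mul_le_mul_right (a := finrank k I) ?_ hpos
    rw [mul_comm c, ← hc, ← h1, sq]
    exact Nat.mul_le_mul_left _ (Nat.le_mul_of_pos_right _ (Nat.pos_of_ne_zero (by
      rintro rfl; simp at hN)))
  let p : (Fin a → I) →ₗ[B] (Fin c → I) := LinearMap.funLeft B I (Fin.castLE hca)
  let q : (Fin c → I) →ₗ[B] (Fin a → I) :=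
    LinearMap.pi fun i => if h : i.val < c then LinearMap.proj ⟨i, h⟩ else 0
  have hpq : ∀ x, p (q x) = x := by
    intro x
    ext i
    simp [p, q, LinearMap.funLeft_apply]
  let p' : B →ₗ[B] (Fin c → I) := p.comp f.toLinearMap
  let q' : (Fin c → I) →ₗ[B] B := f.symm.toLinearMap.comp q
  have hpq' : ∀ x, p' (q' x) = x := by
    intro x
    simp [p', q', hpq]
  have hmul : ∀ x, x * q' (p' 1) = q' (p' x) := by
    intro x
    rw [← smul_eq_mul, ← map_smul, ← map_smul, smul_eq_mul, mul_one]
  refine ⟨q' (p' 1), ?_, ?_⟩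
  · rw [hmul, hpq']
  · have hr : LinearMap.range (LinearMap.mulRight k (q' (p' 1)))
        = LinearMap.range (q'.restrictScalars k) := by
      ext y
      constructor
      · rintro ⟨x, rfl⟩
        exact ⟨p' x, (hmul x).symm⟩
      · rintro ⟨x, rfl⟩
        refine ⟨q' x, ?_⟩
        change q' x * _ = q' x
        rw [hmul, hpq']
    rw [hr, LinearMap.finrank_range_of_inj (f := q'.restrictScalars k)
      (Function.LeftInverse.injective (g := p') hpq'), finrank_pi_fintype, Finset.sum_const,
      Finset.card_univ, Fintype.card_fin, smul_eq_mul, hc, mul_comm]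

end SimpleModules

/-! ### Galois descent -/

section GaloisDescent

open Module

variable {Γ Z V : Type*} [Group Γ] [Field Z] [MulSemiringAction Γ Z] [FaithfulSMul Γ Z]
  [AddCommGroup V] [Module Z V]

/-- Independence of the automorphisms of a field. -/
theorem eq_zero_of_forall_sum_smul_mul_eq_zero [Fintype Γ] (c : Γ → Z)
    (h : ∀ z : Z, ∑ g, (g • z) * c g = 0) (g : Γ) : c g = 0 := by
  have hli := (linearIndependent_monoidHom Z Z).comp
    (fun g : Γ => (MulSemiringAction.toRingHom Γ Z g : Z →* Z)) (fun g g' hgg => by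
      apply FaithfulSMul.eq_of_smul_eq_smul (α := Z)
      intro z
      exact DFunLike.congr_fun hgg z)
  refine Fintype.linearIndependent_iff.1 hli c ?_ g
  ext z
  rw [Finset.sum_apply, Pi.zero_apply, ← h z]
  exact sum_congr rfl fun g _ => mul_comm _ _

variable [Finite Γ] (act : Γ → V →+ V)

/-- The fixed points of a family of additive maps that are semilinear for the action of `Γ`, as
a vector space over the fixed field. -/
def fixedSubmodule (hsmul : ∀ g (z : Z) v, act g (z • v) = (g • z) • act g v) :
    Submodule (subfield Γ Z) V where
  carrier := {v | ∀ g, act g v = v}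
  add_mem' := by
    intro a b ha hb g
    rw [map_add, ha g, hb g]
  zero_mem' := fun g => map_zero _
  smul_mem' := by
    intro c v hv g
    change act g ((c : Z) • v) = (c : Z) • v
    rw [hsmul, hv g, c.2 g]

/-- Galois descent: a vector space with a semilinear group action is spanned by the fixed vectors. A
functional that vanishes on all traces `∑ g, act g (z • v)` is zero by the independence of the
automorphisms. -/
theorem span_fixed_eq_top
    (hmul : ∀ g h v, act (g * h) v = act g (act h v)) (hone : ∀ v, act 1 v = v)
    (hsmul : ∀ g (z : Z) v, act g (z • v) = (g • z) • act g v) :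
    span Z {v | ∀ g, act g v = v} = ⊤ := by
  have := Fintype.ofFinite Γ
  by_contra hcon
  obtain ⟨f, hf0, hf⟩ := Submodule.exists_le_ker_of_lt_top _ (lt_top_iff_ne_top.2 hcon)
  apply hf0
  ext v
  have h1 : ∀ z : Z, ∑ g : Γ, (g • z) * f (act g v) = 0 := by
    intro z
    have h2 : ∑ g : Γ, act g (z • v) ∈ LinearMap.ker f := by
      apply hf
      apply subset_span
      intro h
      rw [map_sum]
      exact Fintype.sum_equiv (Equiv.mulLeft h) _ _ fun g => by
        rw [Equiv.coe_mulLeft, hmul]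
    rw [LinearMap.mem_ker, map_sum] at h2
    rw [← h2]
    exact sum_congr rfl fun g _ => by rw [hsmul, map_smul, smul_eq_mul]
  have h3 := eq_zero_of_forall_sum_smul_mul_eq_zero _ h1 1
  rw [hone] at h3
  simpa using h3

set_option maxHeartbeats 1000000 in
/-- **Galois descent**: a vector space with a semilinear action of a finite group of
automorphisms of the field has a basis consisting of fixed vectors. -/
theorem exists_basis_fixed
    (hmul : ∀ g h v, act (g * h) v = act g (act h v)) (hone : ∀ v, act 1 v = v)
    (hsmul : ∀ g (z : Z) v, act g (z • v) = (g • z) • act g v) :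
   
    ∃ (s : Set (fixedSubmodule act hsmul)) (b : Basis s Z V)
      (b₀ : Basis s (subfield Γ Z) (fixedSubmodule act hsmul)),
      ∀ i, (b₀ i : V) = b i := by
  have := Fintype.ofFinite Γ
  let b₀ := Basis.ofVectorSpace (subfield Γ Z) (fixedSubmodule act hsmul)
  have hfix : ∀ i g, act g (b₀ i : V) = b₀ i := fun i g => (b₀ i).2 g
  have hli : LinearIndependent Z fun i => (b₀ i : V) := by
    rw [linearIndependent_iff']
    intro s c hc i hi
    have h1 : ∀ z : Z, ∑ g : Γ, (g • z) * (g • c i) = 0 := by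
      intro z
      have hmem : ∀ j, ∑ g : Γ, g • (z * c j) ∈ subfield Γ Z := by
        intro j h
        rw [Finset.smul_sum]
        exact Fintype.sum_equiv (Equiv.mulLeft h) _ _ fun g => by
          rw [Equiv.coe_mulLeft, mul_smul]
      have h2 : ∑ j ∈ s, (⟨_, hmem j⟩ : subfield Γ Z) • b₀ j = 0 := by
        apply Subtype.ext
        rw [Submodule.coe_sum, Submodule.coe_zero]
        calc ∑ j ∈ s, (((⟨_, hmem j⟩ : subfield Γ Z) • b₀ j :
              fixedSubmodule act hsmul) : V)
            = ∑ j ∈ s, (∑ g : Γ, g • (z * c j)) • (b₀ j : V) := rfl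
          _ = ∑ g : Γ, act g (z • ∑ j ∈ s, c j • (b₀ j : V)) := by
            simp only [Finset.sum_smul, Finset.smul_sum, map_sum, smul_smul, hsmul, hfix]
            rw [Finset.sum_comm]
          _ = 0 := by rw [hc]; simp
      have h3 := (linearIndependent_iff'.1 b₀.linearIndependent) s _ h2 i hi
      have h4 := congrArg Subtype.val h3
      simpa [smul_mul'] using h4
    have h2 := eq_zero_of_forall_sum_smul_mul_eq_zero _ h1 1
    simpa using h2
  have hsp : ⊤ ≤ span Z (Set.range fun i => (b₀ i : V)) := by
    rw [← span_fixed_eq_top act hmul hone hsmul, span_le]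
    intro v hv
    have h1 : _ = v := congrArg Subtype.val (b₀.linearCombination_repr ⟨v, hv⟩)
    rw [Finsupp.linearCombination_apply, Finsupp.sum, Submodule.coe_sum] at h1
    rw [SetLike.mem_coe, ← h1]
    exact Submodule.sum_mem _ fun i _ => Submodule.smul_mem _ _ (subset_span ⟨i, rfl⟩)
  exact ⟨_, Basis.mk hli hsp, b₀, fun i => by rw [Basis.mk_apply]⟩

theorem finrank_fixedSubmodule
    (hmul : ∀ g h v, act (g * h) v = act g (act h v)) (hone : ∀ v, act 1 v = v)
    (hsmul : ∀ g (z : Z) v, act g (z • v) = (g • z) • act g v) :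
   
    finrank (subfield Γ Z) (fixedSubmodule act hsmul) = finrank Z V := by
  obtain ⟨ι, b, b₀, -⟩ := exists_basis_fixed act hmul hone hsmul
  rw [finrank_eq_nat_card_basis b, finrank_eq_nat_card_basis b₀]

end GaloisDescent

/-! ### Descent of a central simple algebra from one of its tensor powers -/

section DescentFromTensorPower

open scoped TensorProduct
open Module

variable {Z S E : Type*} [Field Z] [Ring S] [Algebra Z S]
    [IsSimpleRing S] [Algebra.IsCentral Z S] [FiniteDimensional Z S] [Field E] [Algebra Z E]

/-- A linear relation over `E` between images of elements of `S` can be specialised along any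
functional `E → Z`. -/
theorem sum_functional_smul_eq_zero {A κ : Type*} [Ring A] [Nontrivial A] [Algebra E A]
    [Algebra Z A] [IsScalarTower Z E A] (ψ : S →ₐ[Z] A) (t : Finset κ) (c : κ → E) (s : κ → S)
    (h : ∑ i ∈ t, c i • ψ (s i) = 0) (f : E →ₗ[Z] Z) : ∑ i ∈ t, f (c i) • s i = 0 := by
  have hinj : Function.Injective (scalarExtension E ψ) := by
    let b := Module.finBasis Z S
    have hind := b.linearIndependent.map_of_isSimpleRing (E := E) ψ
    rw [injective_iff_map_eq_zero]
    intro x hx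
    have hx' := (Algebra.TensorProduct.basis E b).sum_repr x
    rw [← hx', map_sum] at hx
    simp only [map_smul, Algebra.TensorProduct.basis_apply, scalarExtension_tmul, one_smul] at hx
    have := (Fintype.linearIndependent_iff.1 hind) _ hx
    rw [← hx']
    exact Finset.sum_eq_zero fun i _ => by rw [this i, zero_smul]
  have h1 : ∑ i ∈ t, (c i ⊗ₜ[Z] s i) = 0 := by
    apply hinj
    rw [map_sum, map_zero, ← h]
    exact sum_congr rfl fun i _ => scalarExtension_tmul _ _ _
  have h2 := congrArg (fun x => TensorProduct.lid Z S (f.rTensor S x)) h1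
  simpa using h2

variable {n : ℕ} {ψ : S →ₐ[Z] Matrix (Fin n) (Fin n) E}
  {T : Type*} [Ring T] [Algebra Z T]
  {Idx : Type*} [Fintype Idx] [DecidableEq Idx]
  {Ψ : T →ₐ[Z] Matrix Idx Idx E} {P : Matrix Idx (Fin n) E} {Q : Matrix (Fin n) Idx E}

theorem span_range_mul_eq_top (hΨ : span E (Set.range Ψ) = ⊤)
    {P' : Matrix (Fin n) Idx E} (hP : P' * P = 1) :
    span E (Set.range fun t => Ψ t * P) = ⊤ := by
  rw [eq_top_iff]
  intro Y _
  have h1 : Y * P' ∈ span E (Set.range Ψ) := by rw [hΨ]; trivial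
  have h3 : Y * P' * P ∈ span E (Set.range fun t => Ψ t * P) := by
    refine map_mem_of_mem_span (mulRightLinearMap _ E P) ?_ h1
    rintro _ ⟨t, rfl⟩
    exact subset_span ⟨t, rfl⟩
  rwa [Matrix.mul_assoc, hP, Matrix.mul_one] at h3

variable [NeZero n] [FiniteDimensional Z T]

/-- If `Q * T * P` spans a matrix algebra and consists of the images of elements of `S`, then the
kernel of right multiplication by `P` on `T` is detected by the values `Q * x * P`, which are
rational. Hence `T * P` is a form of the space of all matrices of the shape of `P`. -/
theorem finrank_quotient_ker_mul (hΨ : span E (Set.range Ψ) = ⊤)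
    {P' : Matrix (Fin n) Idx E} {Q' : Matrix Idx (Fin n) E} (hP : P' * P = 1) (hQ : Q * Q' = 1)
    (hθ : ∀ x, ∃ s, Q * Ψ x * P = ψ s)
    (J : Submodule T T) (hJ : ∀ t, t ∈ J ↔ Ψ t * P = 0) :
    finrank Z (T ⧸ J) = Fintype.card Idx * n := by
  let b := Module.finBasis Z (T ⧸ J)
  choose t ht using fun i => Submodule.mkQ_surjective J (b i)
  have hspan : span E (Set.range fun i => Ψ (t i) * P) = ⊤ := by
    rw [eq_top_iff, ← span_range_mul_eq_top hΨ hP, span_le]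
    rintro _ ⟨x, rfl⟩
    have h1 := b.sum_repr (J.mkQ x)
    have h2 : x - ∑ i, b.repr (J.mkQ x) i • t i ∈ J := by
      rw [← Submodule.Quotient.mk_eq_zero J]
      change J.mkQ _ = 0
      rw [map_sub, sub_eq_zero, map_sum]
      conv_lhs => rw [← h1]
      refine sum_congr rfl fun i _ => ?_
      rw [← ht]
      rfl
    rw [hJ, map_sub, Matrix.sub_mul, sub_eq_zero] at h2
    change Ψ x * P ∈ _
    rw [h2, map_sum, Matrix.sum_mul]
    refine Submodule.sum_mem _ fun i _ => ?_
    rw [map_smul, Matrix.smul_mul, ← algebraMap_smul E]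
    exact Submodule.smul_mem _ _ (subset_span ⟨i, rfl⟩)
  have hli : LinearIndependent E fun i => Ψ (t i) * P := by
    rw [Fintype.linearIndependent_iff]
    intro c hc i
    have hf : ∀ f : E →ₗ[Z] Z, f (c i) = 0 := by
      intro f
      have h1 : ∑ i, f (c i) • b i = 0 := by
        have h2 : ∑ i, f (c i) • t i ∈ J := by
          rw [hJ]
          have h3 : ∀ X : Matrix Idx Idx E, Q * X * (Ψ (∑ i, f (c i) • t i) * P) = 0 := by
            intro X
            have hX : X ∈ span E (Set.range Ψ) := by rw [hΨ]; trivial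
            refine map_eq_zero_of_mem_span (mulRightLinearMap _ E
              (Ψ (∑ i, f (c i) • t i) * P) ∘ₗ mulLeftLinearMap _ E Q) ?_ hX
            · rintro _ ⟨x, rfl⟩
              choose s hs using fun i => hθ (x * t i)
              have h4 : ∑ i, c i • ψ (s i) = 0 := by
                have h5 := congrArg (fun Y => Q * Ψ x * Y) hc
                simp only [Matrix.mul_sum, Matrix.mul_zero, Matrix.mul_smul] at h5
                rw [← h5]
                refine sum_congr rfl fun i _ => ?_
                rw [← hs, map_mul]
                simp only [Matrix.mul_assoc]
              have h6 := sum_functional_smul_eq_zero ψ _ _ _ h4 f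
              have h7 := congrArg ψ h6
              rw [map_sum, map_zero] at h7
              change Q * Ψ x * (Ψ (∑ i, f (c i) • t i) * P) = 0
              rw [← h7, map_sum, Matrix.sum_mul, Matrix.mul_sum]
              refine sum_congr rfl fun i _ => ?_
              rw [map_smul, map_smul, ← hs, map_mul, Matrix.smul_mul, Matrix.mul_smul]
              simp only [Matrix.mul_assoc]
          by_contra hne
          obtain ⟨a, ha⟩ : ∃ a, (Ψ (∑ i, f (c i) • t i) * P) a ≠ 0 := by
            by_contra! hcon
            exact hne (funext hcon)
          have h5 := h3 (Q' * Matrix.single (0 : Fin n) a (1 : E))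
          rw [← Matrix.mul_assoc Q Q', hQ, Matrix.one_mul] at h5
          apply ha
          ext k
          have h6 := congrFun (congrFun h5 0) k
          rw [Matrix.single_mul_apply_same, one_mul] at h6
          exact h6
        have h8 := (Submodule.Quotient.mk_eq_zero J).2 h2
        change J.mkQ _ = 0 at h8
        rw [map_sum] at h8
        rw [← h8]
        refine sum_congr rfl fun i _ => ?_
        rw [← ht]
        rfl
      exact (Fintype.linearIndependent_iff.1 b.linearIndependent) _ h1 i
    by_contra hne
    obtain ⟨f, hf1⟩ := Module.Projective.exists_dual_ne_zero Z hne
    exact hf1 (hf f)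
  have h1 := finrank_eq_card_basis (Basis.mk hli hspan.ge)
  rw [Module.finrank_matrix, finrank_self, mul_one, Fintype.card_fin, Fintype.card_fin] at h1
  exact h1.symm

omit [NeZero n] in
theorem injective_of_span_eq_top_of_finrank_eq (hΨ : span E (Set.range Ψ) = ⊤)
    (hT : finrank Z T = Fintype.card Idx ^ 2) : Function.Injective Ψ := by
  let b := Module.finBasis Z T
  have hspan : span E (Set.range fun i => Ψ (b i)) = ⊤ := by
    rw [eq_top_iff, ← hΨ, span_le]
    rintro _ ⟨x, rfl⟩
    rw [← b.sum_repr x, map_sum]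
    refine Submodule.sum_mem _ fun i _ => ?_
    rw [map_smul, ← algebraMap_smul E]
    exact Submodule.smul_mem _ _ (subset_span ⟨i, rfl⟩)
  have hli := linearIndependent_of_top_le_span_of_card_eq_finrank hspan.ge (by
    rw [Module.finrank_matrix, finrank_self, Fintype.card_fin, hT, mul_one, sq])
  rw [injective_iff_map_eq_zero]
  intro x hx
  rw [← b.sum_repr x, map_sum] at hx
  simp only [map_smul, ← algebraMap_smul E (_ : Z) (Ψ _)] at hx
  have h := Fintype.linearIndependent_iff.1 hli _ hx
  rw [← b.sum_repr x]
  refine Finset.sum_eq_zero fun i _ => ?_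
  rw [(map_eq_zero _).1 (h i), zero_smul]

/-- Suppose that a finite group `Γ` of automorphisms of the field `Z` acts semilinearly on a
central simple algebra `T` over `Z` of degree prime to `|Γ|`, and that `T` is in the Brauer class
of `S`, as witnessed by the matrices `P` and `Q`. Then `Γ` acts semilinearly on `S`: the fixed ring
of `T` contains an idempotent `e` such that `e T e` is isomorphic to `S`. -/
theorem exists_semilinear_action_of_brauerEquivalent {Γ : Type*} [Group Γ] [Finite Γ]
    [MulSemiringAction Γ Z] [FaithfulSMul Γ Z] [Nonempty Idx]
    (hΨ : span E (Set.range Ψ) = ⊤)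
    (hT : finrank Z T = Fintype.card Idx ^ 2)
    (act : Γ → T →+* T) (hmul : ∀ g h v, act (g * h) v = act g (act h v)) (hone : ∀ v, act 1 v = v)
    (hact : ∀ g (z : Z), act g (algebraMap Z T z) = algebraMap Z T (g • z))
    {P' : Matrix (Fin n) Idx E} {Q' : Matrix Idx (Fin n) E} (hP : P' * P = 1) (hQ : Q * Q' = 1)
    (hθ : ∀ x, ∃ s, Q * Ψ x * P = ψ s)
    (j : S → T) (hj : ∀ s, Ψ (j s) * P = P * ψ s) (hj' : ∀ s, Q * Ψ (j s) = ψ s * Q)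
    (hn : n ∣ Fintype.card Idx) (hco : Nat.Coprime (Nat.card Γ) (Fintype.card Idx)) :
    ∃ eps : Γ → S ≃+* S, (∀ g h s, eps (g * h) s = eps g (eps h s)) ∧ (∀ s, eps 1 s = s) ∧
      ∀ g z, eps g (algebraMap Z S z) = algebraMap Z S (g • z) := by
  have := Fintype.ofFinite Γ
  have hsmul : ∀ g (z : Z) v, act g (z • v) = (g • z) • act g v := fun g z v => by
    rw [Algebra.smul_def, map_mul, hact, ← Algebra.smul_def]
  have hΨinj := injective_of_span_eq_top_of_finrank_eq hΨ hT
  have hEdim : finrank E (Matrix Idx Idx E) = Fintype.card Idx ^ 2 := by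
    rw [Module.finrank_matrix, finrank_self, mul_one, sq]
  have hTs : IsSimpleRing T := isSimpleRing_of_span_eq_top Ψ hΨinj hΨ (by rw [hEdim, hT])
  -- the fixed ring `B`
  let B : Subalgebra (subfield Γ Z) T :=
    { carrier := {t | ∀ g, act g t = t}
      mul_mem' := fun ha hb g => by rw [map_mul, ha g, hb g]
      add_mem' := fun ha hb g => by rw [map_add, ha g, hb g]
      algebraMap_mem' := fun c g => by
        change act g (algebraMap Z T c) = algebraMap Z T c
        rw [hact, c.2 g] }
  have : FiniteDimensional (subfield Γ Z) T := Module.Finite.trans Z T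
  have hBdim : finrank (subfield Γ Z) B = Fintype.card Idx ^ 2 := by
    rw [← hT, ← finrank_fixedSubmodule (fun g => (act g : T →+ T)) hmul hone hsmul]
    rfl
  have hBs : IsSimpleRing B := by
    refine isSimpleRing_of_span_eq_top (E := E)
      ((Ψ.restrictScalars (subfield Γ Z)).comp B.val)
      (hΨinj.comp Subtype.val_injective) ?_ (by rw [hBdim, hEdim])
    rw [eq_top_iff, ← hΨ, span_le]
    rintro _ ⟨x, rfl⟩
    have hx : x ∈ span Z {v | ∀ g, act g v = v} := by
      have := span_fixed_eq_top (Z := Z) (fun g => (act g : T →+ T)) hmul hone hsmul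
      change span Z {v | ∀ g, act g v = v} = ⊤ at this
      rw [this]
      trivial
    refine map_mem_of_mem_span Ψ.toLinearMap (N := (span E _).restrictScalars Z) ?_ hx
    exact fun x hx => subset_span ⟨⟨x, hx⟩, rfl⟩
  let J : Submodule T T :=
    { carrier := {t | Ψ t * P = 0}
      add_mem' := fun {a b} ha hb => by
        change Ψ (a + b) * P = 0
        rw [map_add, Matrix.add_mul, ha, hb, add_zero]
      zero_mem' := by
        change Ψ 0 * P = 0
        rw [map_zero, Matrix.zero_mul]
      smul_mem' := fun c a ha => by
        change Ψ (c * a) * P = 0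
        rw [map_mul, Matrix.mul_assoc, ha, Matrix.mul_zero] }
  have hJ : ∀ t, t ∈ J ↔ Ψ t * P = 0 := fun t => Iff.rfl
  have hIdim := finrank_quotient_ker_mul hΨ hP hQ hθ J hJ
  have hIdim₀ : finrank (subfield Γ Z) (T ⧸ J)
      = Nat.card Γ * (Fintype.card Idx * n) := by
    rw [← finrank_mul_finrank (subfield Γ Z) Z (T ⧸ J), hIdim,
      FixedPoints.finrank_eq_card, Nat.card_eq_fintype_card]
  have : FiniteDimensional (subfield Γ Z) (T ⧸ J) := Module.Finite.trans Z (T ⧸ J)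
  obtain ⟨⟨e, heB⟩, hee, hedim⟩ := exists_idempotent_finrank_eq (B := B)
    Fintype.card_pos hn hco hBdim hIdim₀
  replace hee : e * e = e := congrArg Subtype.val hee
  replace heB : ∀ g, act g e = e := heB
  -- the left ideal `T e`
  let TE : Submodule T T := LinearMap.range (LinearMap.toSpanSingleton T T e)
  have hTE : ∀ x, x ∈ TE ↔ x * e = x := by
    intro x
    constructor
    · rintro ⟨a, rfl⟩
      change a * e * e = a * e
      rw [mul_assoc, hee]
    · intro h
      exact ⟨x, h⟩
  have hTEdim : finrank Z TE = Fintype.card Idx * n := by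
    let act' : Γ → TE →+ TE := fun g =>
      { toFun := fun x => ⟨act g x, (hTE _).2 (by
          have := (hTE _).1 x.2
          conv_rhs => rw [← this]
          rw [map_mul, heB])⟩
        map_zero' := Subtype.ext (map_zero (act g))
        map_add' := fun x y => Subtype.ext (map_add (act g) _ _) }
    have h1 := finrank_fixedSubmodule act' (fun g h v => Subtype.ext (hmul g h v))
      (fun v => Subtype.ext (hone v)) (fun g z v => Subtype.ext (hsmul g z v))
    rw [← h1, ← hedim]
    let f : LinearMap.range (LinearMap.mulRight (subfield Γ Z) (⟨e, heB⟩ : B))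
        →ₗ[subfield Γ Z] TE :=
      { toFun := fun x => ⟨x.1.1, by
          obtain ⟨a, ha⟩ := x.2
          rw [hTE, ← ha]
          change a.1 * e * e = a.1 * e
          rw [mul_assoc, hee]⟩
        map_add' := fun x y => rfl
        map_smul' := fun c x => rfl }
    have hf : Function.Injective f := fun x y h =>
      Subtype.ext (Subtype.ext (congrArg (fun t : TE => (t : T)) h))
    have : LinearMap.range f = fixedSubmodule act' (fun g z v => Subtype.ext (hsmul g z v)) := by
      ext x
      constructor
      · rintro ⟨y, rfl⟩ g
        exact Subtype.ext (y.1.2 g)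
      · intro h
        exact ⟨⟨⟨x.1, fun g => congrArg Subtype.val (h g)⟩, ⟨⟨x.1, fun g =>
          congrArg Subtype.val (h g)⟩, Subtype.ext ((hTE _).1 x.2)⟩⟩, rfl⟩
    rw [← LinearMap.finrank_range_of_inj hf, this]
  obtain ⟨g⟩ := nonempty_linearEquiv_of_finrank_eq (k := Z) (B := T) (hTEdim.trans hIdim.symm)
  let e' : TE := ⟨e, (hTE e).2 hee⟩
  obtain ⟨t₀, ht₀⟩ := Submodule.mkQ_surjective J (g e')
  have hgx : ∀ x : T, g (x • e') = J.mkQ (x * t₀) := by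
    intro x
    rw [map_smul, ← ht₀, ← map_smul, smul_eq_mul]
  have hmk : ∀ a b, J.mkQ a = J.mkQ b ↔ Ψ a * P = Ψ b * P := by
    intro a b
    rw [← sub_eq_zero, ← map_sub, ← LinearMap.mem_ker, Submodule.ker_mkQ, hJ, map_sub,
      Matrix.sub_mul, sub_eq_zero]
  obtain ⟨y, hy⟩ : ∃ y, y = Ψ t₀ * P := ⟨_, rfl⟩
  have hey : Ψ e * y = y := by
    have h1 : e • e' = e' := Subtype.ext hee
    have h2 := hgx e
    rw [h1, ← ht₀, hmk, map_mul, Matrix.mul_assoc, ← hy] at h2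
    exact h2.symm
  obtain ⟨x', hx'⟩ : ∃ x', Ψ x' * y = P := by
    obtain ⟨a, ha⟩ := g.surjective (J.mkQ 1)
    have h1 : (a : T) • e' = a := Subtype.ext ((hTE _).1 a.2)
    have h2 := hgx a
    rw [h1, ha, hmk, map_one, Matrix.one_mul, map_mul, Matrix.mul_assoc, ← hy] at h2
    exact ⟨_, h2.symm⟩
  have hinj : ∀ x, Ψ x * y = 0 → x * e = 0 := by
    intro x hx
    have h2 := hgx x
    have h3 : J.mkQ (x * t₀) = J.mkQ 0 := by
      rw [hmk, map_mul, Matrix.mul_assoc, ← hy, hx, map_zero, Matrix.zero_mul]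
    rw [h3, map_zero, EmbeddingLike.map_eq_zero_iff] at h2
    exact congrArg Subtype.val h2
  have hinjE : ∀ X : Matrix Idx Idx E, X * Ψ e * y = 0 → X * Ψ e = 0 := by
    intro X hX
    let b := Module.finBasis Z TE
    have hsp : ∀ x : T, Ψ (x * e) ∈ span E (Set.range fun i => Ψ (b i : T)) := by
      intro x
      have h1 := congrArg (Subtype.val : TE → T) (b.sum_repr ⟨x * e, ⟨x, rfl⟩⟩)
      change _ = x * e at h1
      rw [← h1, Submodule.coe_sum, map_sum]
      refine Submodule.sum_mem _ fun i _ => ?_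
      change Ψ (_ • (b i : T)) ∈ _
      rw [map_smul, ← algebraMap_smul E]
      exact Submodule.smul_mem _ _ (subset_span ⟨i, rfl⟩)
    have hspy : span E (Set.range fun i => Ψ (b i : T) * y) = ⊤ := by
      rw [eq_top_iff, ← span_range_mul_eq_top hΨ hP, span_le]
      rintro _ ⟨t, rfl⟩
      have h1 : Ψ t * P = Ψ ((t * x') * e) * y := by
        rw [← hx', map_mul, map_mul, Matrix.mul_assoc, Matrix.mul_assoc, hey]
      change Ψ t * P ∈ _
      rw [h1]
      have h2 := hsp (t * x')
      generalize Ψ (t * x' * e) = W at h2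
      refine map_mem_of_mem_span (mulRightLinearMap _ E y) ?_ h2
      rintro _ ⟨i, rfl⟩
      exact subset_span ⟨i, rfl⟩
    have hli := linearIndependent_of_top_le_span_of_card_eq_finrank hspy.ge (by
      rw [Module.finrank_matrix, finrank_self, Fintype.card_fin, Fintype.card_fin, hTEdim,
        mul_one])
    have hXm : X * Ψ e ∈ span E (Set.range fun i => Ψ (b i : T)) := by
      have h1 : X ∈ span E (Set.range Ψ) := by rw [hΨ]; trivial
      clear hX
      refine mul_mem_of_mem_span_left ?_ h1
      rintro _ ⟨t, rfl⟩
      rw [← map_mul]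
      exact hsp t
    obtain ⟨c, hc⟩ := (Submodule.mem_span_range_iff_exists_fun E).1 hXm
    rw [← hc, Matrix.sum_mul] at hX
    simp only [Matrix.smul_mul] at hX
    have h0 := Fintype.linearIndependent_iff.1 hli c hX
    rw [← hc]
    exact Finset.sum_eq_zero fun i _ => by rw [h0 i, zero_smul]
  -- the values of `Q * x * P` form a two-sided ideal of `S`
  obtain ⟨z', hz'⟩ : ∃ z', Q * Ψ z' * P = 1 := by
    let I : Ideal S :=
      { carrier := {s | ∃ x, Q * Ψ x * P = ψ s}
        add_mem' := by
          rintro a b ⟨x, hx⟩ ⟨y, hy⟩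
          exact ⟨x + y, by rw [map_add, map_add, Matrix.mul_add, Matrix.add_mul, hx, hy]⟩
        zero_mem' := ⟨0, by rw [map_zero, map_zero, Matrix.mul_zero, Matrix.zero_mul]⟩
        smul_mem' := by
          rintro c a ⟨x, hx⟩
          exact ⟨j c * x, by
            rw [map_mul, smul_eq_mul, map_mul, ← hx, ← Matrix.mul_assoc, hj']
            simp only [Matrix.mul_assoc]⟩ }
    have hI : I.IsTwoSided := by
      refine ⟨?_⟩
      rintro a c ⟨x, hx⟩
      exact ⟨x * j c, by
        rw [map_mul, map_mul, ← hx, Matrix.mul_assoc, Matrix.mul_assoc, hj]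
        simp only [Matrix.mul_assoc]⟩
    rcases (isSimpleRing_iff_isTwoSided_imp.1 (inferInstance : IsSimpleRing S)).2 I hI with h | h
    · exfalso
      have h1 : ∀ X : Matrix Idx Idx E, Q * X * P = 0 := by
        intro X
        have h1 : X ∈ span E (Set.range Ψ) := by rw [hΨ]; trivial
        refine map_eq_zero_of_mem_span (mulRightLinearMap _ E P ∘ₗ mulLeftLinearMap _ E Q) ?_ h1
        rintro _ ⟨t, rfl⟩
        obtain ⟨s, hs⟩ := hθ t
        have h2 : s ∈ I := ⟨t, hs⟩
        rw [h, Submodule.mem_bot] at h2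
        exact hs.trans (by rw [h2, map_zero])
      have h2 := h1 (Q' * P')
      rw [← Matrix.mul_assoc, hQ, Matrix.one_mul, hP] at h2
      exact one_ne_zero h2
    · have h1 : (1 : S) ∈ I := by rw [h]; trivial
      obtain ⟨x, hx⟩ := h1
      exact ⟨x, by rw [hx, map_one]⟩
  obtain ⟨w, hw⟩ : ∃ w, w = Q * Ψ (z' * x') := ⟨_, rfl⟩
  have hwy : w * y = 1 := by
    rw [hw, map_mul, Matrix.mul_assoc, Matrix.mul_assoc, hx', ← Matrix.mul_assoc, hz']
  have hywe : y * w * Ψ e = Ψ e := by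
    have h1 := hinjE (y * w - 1) (by
      rw [Matrix.mul_assoc, hey, Matrix.sub_mul, Matrix.mul_assoc, hwy, Matrix.mul_one,
        Matrix.one_mul, sub_self])
    rwa [Matrix.sub_mul, Matrix.one_mul, sub_eq_zero] at h1
  -- the isomorphism `ξ` from `S` onto `e T e`
  obtain ⟨ξ, hξy, hξe, heξ⟩ : ∃ ξ : S → T, (∀ s, Ψ (ξ s) * y = y * ψ s) ∧
      (∀ s, ξ s * e = ξ s) ∧ ∀ s, e * ξ s = ξ s := by
    refine ⟨fun s => e * (t₀ * j s * x') * e, fun s => ?_, fun s => ?_, fun s => ?_⟩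
    · simp only [map_mul, Matrix.mul_assoc, hey, hx', hj]
      rw [← Matrix.mul_assoc (Ψ t₀), ← hy, ← Matrix.mul_assoc, hey]
    · simp only [mul_assoc, hee]
    · simp only [← mul_assoc, hee]
  have huniq : ∀ x x' : T, x * e = x → x' * e = x' → Ψ x * y = Ψ x' * y → x = x' := by
    intro x x' h1 h2 h3
    have h4 := hinj (x - x') (by rw [map_sub, Matrix.sub_mul, h3, sub_self])
    rwa [sub_mul, h1, h2, sub_eq_zero] at h4
  have hξadd : ∀ s s', ξ (s + s') = ξ s + ξ s' := fun s s' =>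
    huniq _ _ (hξe _) (by rw [add_mul, hξe, hξe]) (by
      rw [map_add, Matrix.add_mul, hξy, hξy, hξy, map_add, Matrix.mul_add])
  have hξmul : ∀ s s', ξ (s * s') = ξ s * ξ s' := fun s s' =>
    huniq _ _ (hξe _) (by rw [mul_assoc, hξe]) (by
      rw [map_mul, Matrix.mul_assoc, hξy, hξy, ← Matrix.mul_assoc, hξy, map_mul,
        Matrix.mul_assoc])
  have hξalg : ∀ z, ξ (algebraMap Z S z) = z • e := fun z =>
    huniq _ _ (hξe _) (by rw [smul_mul_assoc, hee]) (by
      rw [hξy, AlgHom.commutes, map_smul, Matrix.smul_mul, hey, Algebra.algebraMap_eq_smul_one,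
        Matrix.mul_smul, Matrix.mul_one])
  have hξinj : Function.Injective ξ := by
    intro s s' h
    have h1 := congrArg (fun x => w * (Ψ x * y)) h
    simp only [hξy, ← Matrix.mul_assoc, hwy, Matrix.one_mul] at h1
    exact ψ.toRingHom.injective h1
  have hξsurj : ∀ x, e * x = x → x * e = x → ∃ s, ξ s = x := by
    intro x hx1 hx2
    obtain ⟨s, hs⟩ := hθ (z' * x' * x * t₀)
    refine ⟨s, huniq _ _ (hξe _) hx2 ?_⟩
    have h1 : w * (Ψ x * y) = ψ s := by
      rw [← hs, hw, hy]
      simp only [map_mul, Matrix.mul_assoc]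
    rw [hξy, ← h1, ← hx1, map_mul, Matrix.mul_assoc, ← Matrix.mul_assoc y w,
      ← Matrix.mul_assoc (y * w), hywe]
  have hex : ∀ g s, ∃ s', ξ s' = act g (ξ s) := by
    intro g s
    apply hξsurj
    · conv_rhs => rw [← heξ]
      rw [map_mul, heB]
    · conv_rhs => rw [← hξe]
      rw [map_mul, heB]
  choose eps heps using hex
  have hemul : ∀ g h s, eps (g * h) s = eps g (eps h s) := by
    intro g h s
    apply hξinj
    rw [heps, heps, heps, hmul]
  have heone : ∀ s, eps 1 s = s := by
    intro s
    apply hξinj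
    rw [heps, hone]
  refine ⟨fun g =>
    { toFun := eps g
      invFun := eps g⁻¹
      left_inv := fun s => by rw [← hemul, inv_mul_cancel, heone]
      right_inv := fun s => by rw [← hemul, mul_inv_cancel, heone]
      map_mul' := fun s s' => hξinj (by rw [hξmul, heps, heps, heps, hξmul, map_mul])
      map_add' := fun s s' => hξinj (by rw [hξadd, heps, heps, heps, hξadd, map_add]) },
    hemul, heone, fun g z => hξinj ?_⟩
  change ξ (eps g _) = _
  rw [heps, hξalg, hξalg, hsmul, heB]

end DescentFromTensorPower

/-! ### Tensor powers and mixed discriminants -/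

section MixedDiscriminant

open Module Equiv

variable {E : Type*} [Field E] {n : ℕ}

/-- The (unnormalised) mixed discriminant of `n` matrices of size `n`, the value of the complete
polarisation of `det`. -/
def mixedDiscriminant (X : Fin n → Matrix (Fin n) (Fin n) E) : E :=
  ∑ σ : Perm (Fin n), ∑ τ : Perm (Fin n),
    ((Perm.sign σ : ℤ) : E) * ((Perm.sign τ : ℤ) : E) * ∏ j, X j (σ j) (τ j)

/-- Inclusion–exclusion over the sets that contain the image of a map. -/
theorem sum_neg_one_pow_card_of_forall_mem (f : Fin n → Fin n) :
    ∑ A : Finset (Fin n), (if ∀ i, f i ∈ A then (-1 : E) ^ A.card else 0)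
      = if Function.Surjective f then (-1) ^ n else 0 := by
  classical
  split_ifs with hf
  · rw [Finset.sum_eq_single Finset.univ]
    · simp
    · intro A _ hA
      rw [if_neg]
      intro h
      apply hA
      ext x
      obtain ⟨y, rfl⟩ := hf x
      simp [h y]
    · simp
  · obtain ⟨j, hj⟩ : ∃ j, ∀ i, f i ≠ j := by
      by_contra! hcon
      exact hf hcon
    refine Finset.sum_involution (fun A _ => if j ∈ A then A.erase j else insert j A) ?_ ?_ ?_ ?_
    · intro A _
      by_cases hA : j ∈ A
      · have h1 : (∀ i, f i ∈ A.erase j) ↔ ∀ i, f i ∈ A := by simp [hj]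
        rw [if_pos hA]
        simp only [h1]
        split_ifs
        · rw [← Finset.card_erase_add_one hA, pow_succ]
          ring
        · ring
      · have h1 : (∀ i, f i ∈ insert j A) ↔ ∀ i, f i ∈ A := by simp [hj]
        rw [if_neg hA]
        simp only [h1]
        split_ifs
        · rw [Finset.card_insert_of_notMem hA, pow_succ]
          ring
        · ring
    · intro A _ _ h
      by_cases hA : j ∈ A
      · rw [if_pos hA] at h
        rw [← h] at hA
        simp at hA
      · rw [if_neg hA] at h
        rw [← h] at hA
        simp at hA
    · intro A _
      exact Finset.mem_univ _
    · intro A _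
      by_cases hA : j ∈ A
      · simp [hA]
      · simp [hA]

/-- The polarisation formula for determinants. -/
theorem sum_neg_one_pow_card_mul_det (X : Fin n → Matrix (Fin n) (Fin n) E) :
    ∑ A : Finset (Fin n), (-1 : E) ^ A.card * (∑ j ∈ A, X j).det
      = (-1) ^ n * mixedDiscriminant X := by
  classical
  have h1 : ∀ A : Finset (Fin n), (-1 : E) ^ A.card * (∑ j ∈ A, X j).det
      = ∑ τ : Perm (Fin n), ∑ f : Fin n → Fin n,
        (if ∀ i, f i ∈ A then (-1 : E) ^ A.card else 0) *
          (((Perm.sign τ : ℤ) : E) * ∏ i, X (f i) (τ i) i) := by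
    intro A
    rw [Matrix.det_apply', mul_sum]
    refine sum_congr rfl fun τ _ => ?_
    simp only [Matrix.sum_apply, Finset.prod_univ_sum]
    rw [mul_sum, mul_sum, ← Finset.sum_filter_add_sum_filter_not Finset.univ
      (fun f : Fin n → Fin n => ∀ i, f i ∈ A), Finset.sum_eq_zero (s := Finset.univ.filter
      (fun f : Fin n → Fin n => ¬ ∀ i, f i ∈ A)), add_zero]
    · refine sum_congr ?_ fun f hf => ?_
      · ext f
        simp [Fintype.mem_piFinset]
      · rw [if_pos]
        intro i
        exact (Finset.mem_filter.1 hf).2 i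
    · intro f hf
      rw [if_neg (Finset.mem_filter.1 hf).2, zero_mul]
  simp only [h1]
  rw [Finset.sum_comm]
  refine (sum_congr rfl fun τ _ => Finset.sum_comm).trans ?_
  simp only [← sum_mul, sum_neg_one_pow_card_of_forall_mem]
  -- only permutations contribute
  have h2 : ∀ F : (Fin n → Fin n) → E,
      ∑ f : Fin n → Fin n, (if Function.Surjective f then (-1 : E) ^ n else 0) * F f
        = ∑ π : Perm (Fin n), (-1) ^ n * F π := by
    intro F
    rw [← Finset.sum_filter_add_sum_filter_not Finset.univ
      (fun f : Fin n → Fin n => Function.Surjective f), Finset.sum_eq_zero (s := Finset.univ.filter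
      (fun f : Fin n → Fin n => ¬ Function.Surjective f)), add_zero]
    · symm
      refine Finset.sum_bij (fun π _ => (π : Fin n → Fin n)) ?_ ?_ ?_ ?_
      · intro π _
        simp [π.surjective]
      · intro π _ π' _ h
        exact DFunLike.coe_injective h
      · intro f hf
        have := (Finset.mem_filter.1 hf).2
        exact ⟨Equiv.ofBijective f ⟨Finite.injective_iff_surjective.2 this, this⟩,
          Finset.mem_univ _, rfl⟩
      · intro π _
        rw [if_pos π.surjective]
    · intro f hf
      rw [if_neg (Finset.mem_filter.1 hf).2, zero_mul]
  simp only [h2]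
  have h3 : ∀ π τ : Perm (Fin n), (-1 : E) ^ n * (((Perm.sign τ : ℤ) : E) *
      ∏ i, X (π i) (τ i) i) = (-1 : E) ^ n * ((((Perm.sign (τ * π⁻¹) : ℤ) : E) *
        ((Perm.sign π⁻¹ : ℤ) : E)) * ∏ j, X j ((τ * π⁻¹) j) (π⁻¹ j)) := by
    intro π τ
    have h4 : ∏ i, X (π i) (τ i) i = ∏ j, X j ((τ * π⁻¹) j) (π⁻¹ j) :=
      Fintype.prod_equiv π _ _ fun i => by simp
    have h5 : Perm.sign (τ * π⁻¹) * Perm.sign π⁻¹ = Perm.sign τ := by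
      rw [Perm.sign_mul, mul_assoc, Int.units_mul_self, mul_one]
    rw [h4, ← Int.cast_mul, ← Units.val_mul, h5]
  simp only [h3]
  rw [mixedDiscriminant, mul_sum]
  simp only [mul_sum]
  rw [Finset.sum_comm]
  calc _ = ∑ π : Perm (Fin n), ∑ σ : Perm (Fin n), (-1 : E) ^ n * ((((Perm.sign σ : ℤ) : E) *
        ((Perm.sign π⁻¹ : ℤ) : E)) * ∏ j, X j (σ j) (π⁻¹ j)) :=
      sum_congr rfl fun π _ => Fintype.sum_equiv (Equiv.mulRight π⁻¹) _ _ fun τ => rfl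
    _ = ∑ π : Perm (Fin n), ∑ σ : Perm (Fin n), (-1 : E) ^ n * ((((Perm.sign σ : ℤ) : E) *
        ((Perm.sign π : ℤ) : E)) * ∏ j, X j (σ j) (π j)) :=
      Fintype.sum_equiv (Equiv.inv _) _ _ fun π => rfl
    _ = _ := Finset.sum_comm

/-- Mixed discriminants of elements of a central simple algebra are rational, because determinants
are. -/
theorem exists_algebraMap_eq_mixedDiscriminant {Z S : Type*} [Field Z] [Ring S] [Algebra Z S]
    [IsSimpleRing S] [Algebra.IsCentral Z S] [FiniteDimensional Z S] [Algebra Z E] [NeZero n]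
    (ψ : S →ₐ[Z] Matrix (Fin n) (Fin n) E) (hψ : span E (Set.range ψ) = ⊤)
    (s : Fin n → S) : ∃ z : Z, algebraMap Z E z = mixedDiscriminant fun j => ψ (s j) := by
  choose z hz using fun A : Finset (Fin n) => exists_algebraMap_eq_det ψ hψ (∑ j ∈ A, s j)
  refine ⟨(-1) ^ n * ∑ A : Finset (Fin n), (-1) ^ A.card * z A, ?_⟩
  have h := sum_neg_one_pow_card_mul_det fun j => ψ (s j)
  have h1 : ((-1 : E) ^ n) * (-1) ^ n = 1 := by rw [← mul_pow]; simp
  have h2 : algebraMap Z E (∑ A : Finset (Fin n), (-1) ^ A.card * z A)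
      = ∑ A : Finset (Fin n), (-1 : E) ^ A.card * (∑ j ∈ A, ψ (s j)).det := by
    rw [map_sum]
    exact sum_congr rfl fun A _ => by
      rw [map_mul, map_pow, map_neg, map_one, hz, map_sum]
  rw [map_mul, map_pow, map_neg, map_one, h2, h, ← mul_assoc, h1, one_mul]

end MixedDiscriminant

section TensorPower

open Module Equiv
open scoped TensorProduct

variable {E : Type*} [Field E] {n : ℕ}

/-- The Kronecker product of a family of square matrices, as a multilinear map. -/
def kroneckerPi (E : Type*) [Field E] (n : ℕ) (ι : Type*) [Fintype ι] :
    MultilinearMap E (fun _ : ι => Matrix (Fin n) (Fin n) E)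
      (Matrix (ι → Fin n) (ι → Fin n) E) where
  toFun X := Matrix.of fun a b => ∏ i, X i (a i) (b i)
  map_update_add' := by
    intro _ X i x y
    ext a b
    exact ((MultilinearMap.mkPiAlgebra E ι E).compLinearMap
      (fun i => Matrix.entryLinearMap E E (a i) (b i))).map_update_add X i x y
  map_update_smul' := by
    intro _ X i c x
    ext a b
    exact ((MultilinearMap.mkPiAlgebra E ι E).compLinearMap
      (fun i => Matrix.entryLinearMap E E (a i) (b i))).map_update_smul X i c x

theorem kroneckerPi_apply {ι : Type*} [Fintype ι] (X : ι → Matrix (Fin n) (Fin n) E)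
    (a b : ι → Fin n) : kroneckerPi E n ι X a b = ∏ i, X i (a i) (b i) := rfl

theorem kroneckerPi_one {ι : Type*} [Fintype ι] [DecidableEq ι] : kroneckerPi E n ι 1 = 1 := by
  ext a b
  rw [kroneckerPi_apply, Matrix.one_apply]
  split_ifs with h
  · subst h
    simp
  · obtain ⟨i, hi⟩ := Function.ne_iff.1 h
    exact Finset.prod_eq_zero (Finset.mem_univ i) (Matrix.one_apply_ne hi)

theorem kroneckerPi_mul {ι : Type*} [Fintype ι] [DecidableEq ι]
    (X Y : ι → Matrix (Fin n) (Fin n) E) :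
    kroneckerPi E n ι (X * Y) = kroneckerPi E n ι X * kroneckerPi E n ι Y := by
  ext a b
  rw [kroneckerPi_apply, Matrix.mul_apply]
  simp only [Pi.mul_apply, Matrix.mul_apply, Finset.prod_univ_sum, kroneckerPi_apply,
    Fintype.piFinset_univ, Finset.prod_mul_distrib]

theorem kroneckerPi_transpose {ι : Type*} [Fintype ι] (X : ι → Matrix (Fin n) (Fin n) E) :
    (kroneckerPi E n ι X).transpose = kroneckerPi E n ι fun i => (X i).transpose := rfl

variable {Z S : Type*} [Field Z] [Ring S] [Algebra Z S] [Algebra Z E]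

/-- The tensor power of a matrix representation. -/
noncomputable def tensorPowerHom (ψ : S →ₐ[Z] Matrix (Fin n) (Fin n) E) (ι : Type*) [Fintype ι]
    [DecidableEq ι] : (⨂[Z] _ : ι, S) →ₐ[Z] Matrix (ι → Fin n) (ι → Fin n) E :=
  PiTensorProduct.liftAlgHom
    (((kroneckerPi E n ι).restrictScalars Z).compLinearMap fun _ => ψ.toLinearMap)
    (by
      change kroneckerPi E n ι (fun i => ψ 1) = 1
      rw [map_one]
      exact kroneckerPi_one)
    (fun x y => by
      change kroneckerPi E n ι (fun i => ψ (x i * y i))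
        = kroneckerPi E n ι (fun i => ψ (x i)) * kroneckerPi E n ι (fun i => ψ (y i))
      rw [← kroneckerPi_mul]
      congr 1
      funext i
      exact map_mul ψ _ _)

theorem tensorPowerHom_tprod (ψ : S →ₐ[Z] Matrix (Fin n) (Fin n) E) {ι : Type*} [Fintype ι]
    [DecidableEq ι] (s : ι → S) :
    tensorPowerHom ψ ι (PiTensorProduct.tprod Z s) = kroneckerPi E n ι fun i => ψ (s i) :=
  PiTensorProduct.lift.tprod _

theorem span_tensorPowerHom_eq_top [FiniteDimensional Z S] (ψ : S →ₐ[Z] Matrix (Fin n) (Fin n) E)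
    (hψ : span E (Set.range ψ) = ⊤) (ι : Type*) [Fintype ι] [DecidableEq ι] :
    span E (Set.range (tensorPowerHom ψ ι)) = ⊤ := by
  have h1 : ∀ X : ι → Matrix (Fin n) (Fin n) E,
      kroneckerPi E n ι X ∈ span E (Set.range (tensorPowerHom ψ ι)) := by
    intro X
    let b := Module.finBasis Z S
    have hb : ∀ M : Matrix (Fin n) (Fin n) E, ∃ c : Fin (finrank Z S) → E,
        ∑ j, c j • ψ (b j) = M := by
      intro M
      rw [← Submodule.mem_span_range_iff_exists_fun]
      have hM : M ∈ span E (Set.range ψ) := by rw [hψ]; trivial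
      refine Submodule.span_le.2 ?_ hM
      rintro _ ⟨x, rfl⟩
      rw [← b.sum_repr x, map_sum]
      refine Submodule.sum_mem _ fun i _ => ?_
      rw [map_smul, ← algebraMap_smul E]
      exact Submodule.smul_mem _ _ (subset_span ⟨i, rfl⟩)
    choose c hc using fun i => hb (X i)
    have hX : X = fun i => ∑ j, c i j • ψ (b j) := funext fun i => (hc i).symm
    rw [hX, MultilinearMap.map_sum]
    refine Submodule.sum_mem _ fun f _ => ?_
    rw [MultilinearMap.map_smul_univ (kroneckerPi E n ι) (fun i => c i (f i))
      (fun i => ψ (b (f i))), ← tensorPowerHom_tprod]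
    exact Submodule.smul_mem _ _ (subset_span ⟨_, rfl⟩)
  rw [eq_top_iff]
  intro M _
  rw [Matrix.matrix_eq_sum_single M]
  refine Submodule.sum_mem _ fun a _ => Submodule.sum_mem _ fun a' _ => ?_
  have h2 : Matrix.single a a' (M a a')
      = M a a' • kroneckerPi E n ι fun i => Matrix.single (a i) (a' i) 1 := by
    ext x y
    rw [Matrix.smul_apply, kroneckerPi_apply]
    simp only [Matrix.single_apply]
    split_ifs with h
    · obtain ⟨rfl, rfl⟩ := h
      simp
    · rw [not_and_or] at h
      have : ∃ i, ¬ (a i = x i ∧ a' i = y i) := by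
        by_contra! hcon
        rcases h with h | h
        · exact h (funext fun i => (hcon i).1)
        · exact h (funext fun i => (hcon i).2)
      obtain ⟨i, hi⟩ := this
      rw [Finset.prod_eq_zero (Finset.mem_univ i) (if_neg hi), smul_zero]
  rw [h2]
  exact Submodule.smul_mem _ _ (h1 _)

theorem finrank_tensorPower [FiniteDimensional Z S] (ι : Type*) [Fintype ι] :
    finrank Z (⨂[Z] _ : ι, S) = finrank Z S ^ Fintype.card ι := by
  classical
  rw [finrank_eq_card_basis (Basis.piTensorProduct fun _ : ι => Module.finBasis Z S)]
  simp

/-- The matrix that realises the embedding of `Eⁿ` into a tensor power `Eⁿ ⊗ (Eⁿ)^{⊗ n q}` given by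
the `q`-th power of the alternating tensor. -/
def alternatorMatrix (E : Type*) [Field E] (n q : ℕ) :
    Matrix (Option (Fin q × Fin n) → Fin n) (Fin n) E :=
  Matrix.of fun a c => ∑ σ : Fin q → Perm (Fin n), (∏ k, ((Perm.sign (σ k) : ℤ) : E)) *
    if a = (fun x => Option.elim x c fun kj => σ kj.1 kj.2) then 1 else 0

theorem sum_alternatorMatrix_mul (q : ℕ) (c : Fin n)
    (F : (Option (Fin q × Fin n) → Fin n) → E) :
    ∑ a, alternatorMatrix E n q a c * F a
      = ∑ σ : Fin q → Perm (Fin n), (∏ k, ((Perm.sign (σ k) : ℤ) : E)) *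
        F (fun x => Option.elim x c fun kj => σ kj.1 kj.2) := by
  simp only [alternatorMatrix, Matrix.of_apply, sum_mul]
  rw [Finset.sum_comm]
  simp

theorem exists_mul_alternatorMatrix_eq_one (E : Type*) [Field E] (n q : ℕ) :
    ∃ P' : Matrix (Fin n) (Option (Fin q × Fin n) → Fin n) E, P' * alternatorMatrix E n q = 1 := by
  refine ⟨Matrix.of fun c a => if a = (fun x => Option.elim x c fun kj => kj.2) then 1 else 0, ?_⟩
  ext c c'
  rw [Matrix.mul_apply]
  simp only [Matrix.of_apply, mul_comm _ (alternatorMatrix E n q _ _)]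
  rw [sum_alternatorMatrix_mul, Finset.sum_eq_single 1]
  · rw [Matrix.one_apply]
    by_cases h : c = c'
    · subst h
      simp
    · rw [if_neg h, if_neg, mul_zero]
      intro h'
      exact h (congrFun h' none).symm
  · intro σ _ hσ
    rw [if_neg, mul_zero]
    intro h
    apply hσ
    ext k j
    have := congrFun h (some (k, j))
    simp only [Option.elim_some] at this
    rw [this]
    rfl
  · simp

/-- The embedding given by the alternating tensors intertwines `X` with its action on the tensor factor
`none`. -/
theorem kroneckerPi_mul_alternatorMatrix (q : ℕ) (X : Matrix (Fin n) (Fin n) E) :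
    kroneckerPi E n (Option (Fin q × Fin n)) (fun x => Option.elim x X fun _ => 1)
      * alternatorMatrix E n q = alternatorMatrix E n q * X := by
  ext a c
  rw [Matrix.mul_apply, Matrix.mul_apply]
  simp only [mul_comm _ (alternatorMatrix E n q _ c)]
  rw [sum_alternatorMatrix_mul]
  simp only [alternatorMatrix, Matrix.of_apply, sum_mul]
  rw [Finset.sum_comm]
  refine sum_congr rfl fun σ _ => ?_
  rw [kroneckerPi_apply, Fintype.prod_option]
  change _ * (X (a none) c * ∏ kj : Fin q × Fin n,
    (1 : Matrix (Fin n) (Fin n) E) (a (some kj)) (σ kj.1 kj.2)) = _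
  rw [Finset.sum_eq_single (a none)]
  · by_cases h : ∀ kj : Fin q × Fin n, a (some kj) = σ kj.1 kj.2
    · rw [if_pos (funext fun x => by
        rcases x with _ | x
        · rfl
        · exact h x)]
      have h1 : ∏ kj : Fin q × Fin n,
          (1 : Matrix (Fin n) (Fin n) E) (a (some kj)) (σ kj.1 kj.2) = 1 :=
        Finset.prod_eq_one fun kj _ => by rw [h kj, Matrix.one_apply_eq]
      rw [h1]
      ring
    · push Not at h
      obtain ⟨kj, hkj⟩ := h
      have h1 : ∏ kj : Fin q × Fin n,
          (1 : Matrix (Fin n) (Fin n) E) (a (some kj)) (σ kj.1 kj.2) = 0 :=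
        Finset.prod_eq_zero (Finset.mem_univ kj) (Matrix.one_apply_ne hkj)
      rw [if_neg fun h' => hkj (congrFun h' (some kj)), h1]
      ring
  · intro c' _ hc'
    rw [if_neg fun h => hc' (congrFun h none).symm]
    ring
  · simp

/-- Compressing a Kronecker product by the alternating tensors leaves the first factor, multiplied by
mixed discriminants of the others. -/
theorem alternatorMatrix_transpose_mul_kroneckerPi_mul (q : ℕ)
    (X : Option (Fin q × Fin n) → Matrix (Fin n) (Fin n) E) :
    (alternatorMatrix E n q).transpose * kroneckerPi E n _ X * alternatorMatrix E n q
      = (∏ k, mixedDiscriminant fun j => X (some (k, j))) • X none := by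
  ext c c'
  rw [Matrix.mul_apply]
  simp only [mul_comm _ (alternatorMatrix E n q _ c')]
  rw [sum_alternatorMatrix_mul]
  simp only [Matrix.mul_apply, Matrix.transpose_apply, sum_alternatorMatrix_mul,
    kroneckerPi_apply, Fintype.prod_option]
  change ∑ τ : Fin q → Perm (Fin n), (∏ k, ((Perm.sign (τ k) : ℤ) : E)) *
    ∑ σ : Fin q → Perm (Fin n), (∏ k, ((Perm.sign (σ k) : ℤ) : E)) * (X none c c' *
      ∏ kj : Fin q × Fin n, X (some kj) (σ kj.1 kj.2) (τ kj.1 kj.2)) = _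
  rw [Matrix.smul_apply, smul_eq_mul]
  simp only [mixedDiscriminant, Finset.prod_univ_sum, Fintype.piFinset_univ, sum_mul,
    Finset.prod_mul_distrib, Fintype.prod_prod_type, mul_sum]
  rw [Finset.sum_comm]
  refine sum_congr rfl fun σ _ => sum_congr rfl fun τ _ => ?_
  ring

end TensorPower

section SemilinearAction

open Module Equiv
open scoped TensorProduct

theorem comp_update_comp {ι S : Type*} [DecidableEq ι] {e : ι → ι} (he : Function.Injective e)
    (β : ι → S → S) (f : ι → S) (i : ι) (x : S) :
    (fun k => β k (Function.update f (e i) x (e k)))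
      = Function.update (fun k => β k (f (e k))) i (β i x) := by
  funext k
  by_cases hk : k = i
  · subst hk
    simp
  · rw [Function.update_of_ne hk, Function.update_of_ne (he.ne hk)]

variable {Z S Γ : Type*} [Field Z] [Ring S] [Algebra Z S] [Group Γ] [MulSemiringAction Γ Z]

/-- The semilinear map on a tensor power given by a permutation of the tensor factors followed by
ring automorphisms of the factors that all induce the same automorphism `g` of the field `Z`. -/
noncomputable def tensorPowerTwist {ι : Type*} (g : Γ) {e : ι → ι} (he : Function.Bijective e)
    {β : ι → S ≃+* S} (hβ : ∀ i z, β i (algebraMap Z S z) = algebraMap Z S (g • z)) :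
    (⨂[Z] _ : ι, S) →+ ⨂[Z] _ : ι, S :=
  PiTensorProduct.liftAddHom
    (fun rf => (g • rf.1) • PiTensorProduct.tprod Z fun i => β i (rf.2 (e i)))
    (fun r f i hi => by
      obtain ⟨i', rfl⟩ := he.2 i
      change (g • r) • (PiTensorProduct.tprod Z fun i => β i (f (e i))) = 0
      rw [(PiTensorProduct.tprod Z).map_coord_zero i' (by rw [hi, map_zero]), smul_zero])
    (fun f => by rw [smul_zero, zero_smul])
    (fun r f i x y => by
      obtain ⟨i', rfl⟩ := he.2 i
      have h := comp_update_comp he.1 (fun i => β i) f i'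
      change (g • r) • (PiTensorProduct.tprod Z fun i => β i (Function.update f (e i') x (e i)))
        + (g • r) • (PiTensorProduct.tprod Z fun i => β i (Function.update f (e i') y (e i)))
        = (g • r) • PiTensorProduct.tprod Z fun i => β i (Function.update f (e i') (x + y) (e i))
      rw [h, h, h, map_add, MultilinearMap.map_update_add, smul_add])
    (fun r r' f => by rw [smul_add, add_smul])
    (fun r f i r' => by
      obtain ⟨i', rfl⟩ := he.2 i
      have h := comp_update_comp he.1 (fun i => β i) f i'
      change (g • r) • (PiTensorProduct.tprod Z
        fun i => β i (Function.update f (e i') (r' • f (e i')) (e i)))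
        = (g • (r' * r)) • PiTensorProduct.tprod Z fun i => β i (f (e i))
      have h1 : β i' (r' • f (e i')) = (g • r') • β i' (f (e i')) := by
        rw [Algebra.smul_def, map_mul, hβ, ← Algebra.smul_def]
      rw [h, h1, MultilinearMap.map_update_smul, smul_smul, smul_mul', mul_comm]
      congr 2
      exact Function.update_eq_self _ _)

theorem tensorPowerTwist_smul_tprod {ι : Type*} (g : Γ) {e : ι → ι} (he : Function.Bijective e)
    {β : ι → S ≃+* S} (hβ : ∀ i z, β i (algebraMap Z S z) = algebraMap Z S (g • z)) (r : Z)
    (s : ι → S) : tensorPowerTwist g he hβ (r • PiTensorProduct.tprod Z s)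
      = (g • r) • PiTensorProduct.tprod Z fun i => β i (s (e i)) := by
  rw [← PiTensorProduct.tprodCoeff_eq_smul_tprod]
  rfl

variable [IsSimpleRing S] [Algebra.IsCentral Z S] [FiniteDimensional Z S] {E : Type*} [Field E]
  [Algebra Z E]

/-- If every element of a finite group `Γ` of automorphisms of `Z` extends to an automorphism of
the central simple algebra `S`, and the degree of `S` is prime to `|Γ|`, then these extensions can
be chosen to form an action of `Γ`: the obstruction is killed both by `|Γ|` and by the degree. In
the proof, a tensor power of `S` in which `Γ` permutes the factors carries such an action for
trivial reasons, and it is Brauer equivalent to `S` when its exponent is `1` modulo the degree. -/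
theorem exists_semilinear_action [Finite Γ] [FaithfulSMul Γ Z] {n : ℕ} [NeZero n]
    (ψ : S →ₐ[Z] Matrix (Fin n) (Fin n) E) (hψ : span E (Set.range ψ) = ⊤)
    (α : Γ → S ≃+* S) (hα : ∀ g z, α g (algebraMap Z S z) = algebraMap Z S (g • z))
    (hco : Nat.Coprime n (Nat.card Γ)) :
    ∃ eps : Γ → S ≃+* S, (∀ g h s, eps (g * h) s = eps g (eps h s)) ∧ (∀ s, eps 1 s = s) ∧
      ∀ g z, eps g (algebraMap Z S z) = algebraMap Z S (g • z) := by
  classical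
  have := Fintype.ofFinite Γ
  have hn0 : n ≠ 0 := NeZero.ne n
  have hΓ : 0 < Nat.card Γ := Nat.card_pos
  obtain ⟨t, q, htq⟩ : ∃ t q : ℕ, Nat.card Γ * t = q * n + 1 := by
    rcases Nat.lt_or_ge 1 n with h1 | h1
    · obtain ⟨t, ht⟩ := Nat.exists_mul_mod_eq_one_of_coprime hco.symm h1
      exact ⟨t, Nat.card Γ * t / n, by
        conv_lhs => rw [← Nat.div_add_mod (Nat.card Γ * t) n, ht.2]
        rw [mul_comm n]⟩
    · have : n = 1 := by omega
      subst this
      exact ⟨1, Nat.card Γ - 1, by omega⟩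
  -- `Γ` acts on the indices of the tensor factors, with an equivariant map `p` to `Γ`
  obtain ⟨ix⟩ : Nonempty (Option (Fin q × Fin n) ≃ Γ × Fin t) := by
    rw [← Fintype.card_eq]
    simp only [Fintype.card_option, Fintype.card_prod, Fintype.card_fin]
    rw [← Nat.card_eq_fintype_card, htq]
  let p : Option (Fin q × Fin n) → Γ := fun x => (ix x).1
  let m : Γ → Option (Fin q × Fin n) → Option (Fin q × Fin n) :=
    fun g x => ix.symm (g * (ix x).1, (ix x).2)
  have hpm : ∀ g x, p (m g x) = g * p x := fun g x => by simp [p, m]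
  have hmm : ∀ g h x, m (g * h) x = m g (m h x) := fun g h x => by simp [m, mul_assoc]
  have hm1 : ∀ x, m 1 x = x := fun x => by simp [m]
  have hmb : ∀ g, Function.Bijective (m g⁻¹) := fun g =>
    Function.bijective_iff_has_inverse.2 ⟨m g, fun x => by rw [← hmm, mul_inv_cancel, hm1],
      fun x => by rw [← hmm, inv_mul_cancel, hm1]⟩
  let β : Γ → Option (Fin q × Fin n) → S ≃+* S :=
    fun g x => (α (p (m g⁻¹ x))).symm.trans (α (p x))
  have hβ : ∀ g x z, β g x (algebraMap Z S z) = algebraMap Z S (g • z) := by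
    intro g x z
    have h1 : (α (p (m g⁻¹ x))).symm (algebraMap Z S z)
        = algebraMap Z S ((p (m g⁻¹ x))⁻¹ • z) := by
      rw [RingEquiv.symm_apply_eq, hα, smul_inv_smul]
    change α (p x) ((α (p (m g⁻¹ x))).symm _) = _
    rw [h1, hα, smul_smul, hpm]
    congr 2
    group
  let act₀ : Γ → (⨂[Z] _ : Option (Fin q × Fin n), S) →+ ⨂[Z] _ : Option (Fin q × Fin n), S :=
    fun g => tensorPowerTwist g (hmb g) (hβ g)
  have hact₀ : ∀ g r s, act₀ g (r • PiTensorProduct.tprod Z s)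
      = (g • r) • PiTensorProduct.tprod Z fun i => β g i (s (m g⁻¹ i)) := fun g r s =>
    tensorPowerTwist_smul_tprod g (hmb g) (hβ g) r s
  have hone₀ : ∀ g, act₀ g 1 = 1 := by
    intro g
    have h1 := hact₀ g 1 1
    simp only [smul_one, one_smul, Pi.one_apply, map_one] at h1
    exact h1
  let act : Γ → (⨂[Z] _ : Option (Fin q × Fin n), S) →+* ⨂[Z] _ : Option (Fin q × Fin n), S :=
    fun g =>
    { act₀ g with
      map_one' := hone₀ g
      map_mul' := by
        intro x y
        change act₀ g (x * y) = act₀ g x * act₀ g y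
        induction x using PiTensorProduct.induction_on with
        | add x x' hx hx' => rw [add_mul, map_add, map_add, add_mul, hx, hx']
        | smul_tprod r s =>
          induction y using PiTensorProduct.induction_on with
          | add y y' hy hy' => rw [mul_add, map_add, map_add, mul_add, hy, hy']
          | smul_tprod r' s' =>
            rw [smul_mul_smul_comm, PiTensorProduct.tprod_mul_tprod, hact₀, hact₀, hact₀,
              smul_mul_smul_comm, PiTensorProduct.tprod_mul_tprod, smul_mul']
            congr 2
            funext i
            exact map_mul _ _ _ }
  have hact : ∀ g (r : Z) (s : _ → S), act g (r • PiTensorProduct.tprod Z s)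
      = (g • r) • PiTensorProduct.tprod Z fun i => β g i (s (m g⁻¹ i)) := hact₀
  have hT : finrank Z (⨂[Z] _ : Option (Fin q × Fin n), S)
      = Fintype.card (Option (Fin q × Fin n) → Fin n) ^ 2 := by
    rw [finrank_tensorPower, finrank_eq_sq_of_span_eq_top ψ hψ, Fintype.card_fun,
      Fintype.card_fin, ← pow_mul, ← pow_mul, mul_comm]
  have : FiniteDimensional Z (⨂[Z] _ : Option (Fin q × Fin n), S) := inferInstance
  obtain ⟨P', hP'⟩ := exists_mul_alternatorMatrix_eq_one E n q
  have helim : ∀ s : S, (fun x : Option (Fin q × Fin n) => ψ (Option.elim x s fun _ => 1))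
      = fun x => Option.elim x (ψ s) fun _ => 1 := by
    intro s
    funext x
    rcases x with _ | x
    · rfl
    · exact map_one ψ
  refine exists_semilinear_action_of_brauerEquivalent (ψ := ψ)
    (Ψ := tensorPowerHom ψ (Option (Fin q × Fin n))) (P := alternatorMatrix E n q)
    (Q := (alternatorMatrix E n q).transpose) (P' := P') (Q' := P'.transpose)
    (span_tensorPowerHom_eq_top ψ hψ _) hT act ?_ ?_ ?_ hP' ?_ ?_
    (fun s => PiTensorProduct.tprod Z fun x => Option.elim x s fun _ => 1) ?_ ?_ ?_ ?_
  · intro g h v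
    induction v using PiTensorProduct.induction_on with
    | add x x' hx hx' => rw [map_add, map_add, map_add, hx, hx']
    | smul_tprod r s =>
      rw [hact, hact, hact, mul_smul]
      congr 2
      funext x
      simp only [β, RingEquiv.coe_trans, Function.comp_apply, RingEquiv.symm_apply_apply, ← hmm,
        mul_inv_rev]
      rw [← hmm h⁻¹ g⁻¹ x, mul_inv_rev]
  · intro v
    induction v using PiTensorProduct.induction_on with
    | add x x' hx hx' => rw [map_add, hx, hx']
    | smul_tprod r s =>
      rw [hact, one_smul]
      congr 2
      funext x
      simp only [β, RingEquiv.coe_trans, Function.comp_apply, RingEquiv.apply_symm_apply, inv_one,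
        hm1]
      rw [inv_one, hm1]
  · intro g z
    rw [Algebra.algebraMap_eq_smul_one, Algebra.algebraMap_eq_smul_one]
    have h1 := hact g z 1
    simp only [Pi.one_apply, map_one] at h1
    exact h1
  · rw [← Matrix.transpose_mul, hP', Matrix.transpose_one]
  · intro x
    induction x using PiTensorProduct.induction_on with
    | add x x' hx hx' =>
      obtain ⟨s, hs⟩ := hx
      obtain ⟨s', hs'⟩ := hx'
      exact ⟨s + s', by rw [map_add, map_add, Matrix.mul_add, Matrix.add_mul, hs, hs']⟩
    | smul_tprod r s =>
      choose z hz using fun k => exists_algebraMap_eq_mixedDiscriminant ψ hψ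
        fun j => s (some (k, j))
      refine ⟨(r * ∏ k, z k) • s none, ?_⟩
      rw [map_smul, tensorPowerHom_tprod, Matrix.mul_smul, Matrix.smul_mul,
        alternatorMatrix_transpose_mul_kroneckerPi_mul, map_smul, mul_smul]
      congr 1
      rw [← algebraMap_smul E (∏ k, z k), map_prod]
      simp only [hz]
  · intro s
    rw [tensorPowerHom_tprod, helim, kroneckerPi_mul_alternatorMatrix]
  · intro s
    have h1 := kroneckerPi_mul_alternatorMatrix q (ψ s).transpose
    have h2 := congrArg Matrix.transpose h1
    rw [Matrix.transpose_mul, Matrix.transpose_mul, Matrix.transpose_transpose,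
      kroneckerPi_transpose] at h2
    rw [tensorPowerHom_tprod, helim, ← h2]
    congr 2
    funext x
    rcases x with _ | x
    · rfl
    · exact Matrix.transpose_one.symm
  · rw [Fintype.card_fun, Fintype.card_fin]
    exact dvd_pow_self _ Fintype.card_ne_zero
  · rw [Fintype.card_fun, Fintype.card_fin]
    exact hco.symm.pow_right _

end SemilinearAction

/-! ### Forms of a central simple algebra over a fixed field -/

section Forms

open Module
open scoped TensorProduct

/-- A finite-dimensional algebra whose centre is the base field is simple as soon as it is
semiprime. -/
theorem isSimpleRing_of_semiprime {k B : Type*} [Field k] [Ring B] [Algebra k B]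
    [FiniteDimensional k B] [Nontrivial B] (hcenter : Subalgebra.center k B ≤ ⊥)
    (hprime : ∀ y : B, (∀ x, y * x * y = 0) → y = 0) : IsSimpleRing B := by
  have : IsArtinianRing B := IsArtinianRing.of_finite k B
  have hss : IsSemisimpleRing B := by
    rw [IsArtinianRing.isSemisimpleRing_iff_jacobson]
    have hnil : IsNilpotent (Ring.jacobson B) := IsSemiprimaryRing.isNilpotent
    obtain ⟨m, hm⟩ := hnil
    -- every element of the last nonzero power of the radical generates an ideal of square zero
    have h1 : ∀ m, Ring.jacobson B ^ (m + 1) = ⊥ → Ring.jacobson B = ⊥ := by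
      intro m
      induction m with
      | zero => exact fun h => by rwa [zero_add, Submodule.pow_one] at h
      | succ m ih =>
        intro h
        apply ih
        rw [eq_bot_iff]
        intro y hy
        apply hprime
        intro x
        have h5 : (y * x) * y ∈ Ring.jacobson B ^ (m + 1 + 1) := by
          rw [Submodule.pow_succ' _ m.succ_ne_zero]
          refine Submodule.mul_mem_mul (Ideal.mul_mem_right _ _ ?_) hy
          rw [Submodule.pow_succ] at hy
          exact Submodule.mul_le.2 (fun a _ b hb => Ideal.mul_mem_left _ a hb) hy
        rw [h] at h5
        exact h5
    refine h1 m ?_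
    rw [Submodule.pow_succ, hm]
    exact Submodule.bot_mul _
  rw [isSimpleRing_iff_isTwoSided_imp]
  refine ⟨inferInstance, fun I hI => ?_⟩
  obtain ⟨e, he, rfl⟩ := IsSemisimpleRing.ideal_eq_span_idempotent I
  have hmem : ∀ y, y ∈ Ideal.span {e} → y * e = y := by
    intro y hy
    obtain ⟨a, rfl⟩ := Ideal.mem_span_singleton'.1 hy
    rw [mul_assoc, he.eq]
  have heI : e ∈ Ideal.span {e} := Ideal.mem_span_singleton_self e
  have h1 : ∀ x, e * x * e = e * x := fun x => hmem _ (Ideal.mul_mem_right x _ heI)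
  have h2 : ∀ x, x * e - e * x * e = 0 := by
    intro x
    apply hprime
    intro z
    have h3 : e * z * (x * e - e * x * e) = 0 := by
      have h5 : e * z * e * x * e = e * z * x * e := by rw [h1 z]
      rw [mul_sub]
      simp only [← mul_assoc]
      rw [h5, sub_self]
    have h4 : (x * e - e * x * e) * z * (x * e - e * x * e)
        = (x - e * x) * (e * z * (x * e - e * x * e)) := by
      simp only [sub_mul, mul_sub, mul_assoc]
    rw [h4, h3, mul_zero]
  have h3 : e ∈ Subalgebra.center k B := by
    rw [Subalgebra.mem_center_iff]
    intro x
    rw [← h1 x, ← sub_eq_zero, h2]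
  obtain ⟨c, hc⟩ := Algebra.mem_bot.1 (hcenter h3)
  have h4 : c * c = c := (algebraMap k B).injective (by rw [map_mul, hc, he.eq])
  rcases IsIdempotentElem.iff_eq_zero_or_one.1 h4 with h | h
  · left
    rw [← hc, h, map_zero]
    simp
  · right
    rw [← hc, h, map_one]
    exact Ideal.span_singleton_one

theorem eq_zero_of_forall_mul_mul_eq_zero {R : Type*} [Ring R] [IsSimpleRing R] {y : R}
    (h : ∀ x, y * x * y = 0) : y = 0 := by
  let I : Ideal R :=
    { carrier := {x | ∀ r, y * r * x = 0}
      add_mem' := fun ha hb r => by rw [mul_add, ha, hb, add_zero]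
      zero_mem' := fun r => mul_zero _
      smul_mem' := fun c x hx r => by rw [smul_eq_mul, ← mul_assoc, mul_assoc y, hx] }
  have hI : I.IsTwoSided := ⟨fun {a} b ha r => by rw [← mul_assoc, ha, zero_mul]⟩
  rcases (isSimpleRing_iff_isTwoSided_imp.1 (inferInstance : IsSimpleRing R)).2 I hI with h0 | h0
  · have h1 : y ∈ I := h
    rw [h0] at h1
    exact h1
  · have h1 : (1 : R) ∈ I := by rw [h0]; trivial
    have := h1 1
    rwa [mul_one, mul_one] at this

variable {Γ Z S : Type*} [Group Γ] [Finite Γ] [Field Z] [MulSemiringAction Γ Z] [Ring S]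
  [Algebra Z S] [IsSimpleRing S] [FiniteDimensional Z S]

/-- A form of a simple ring is simple: it is semiprime, since `y B y = 0` implies `y S y = 0`, and its
centre is a field. -/
theorem isSimpleRing_form (B : Subalgebra (subfield Γ Z) S)
    (hcenter : ∀ b ∈ B, (∀ b' ∈ B, b' * b = b * b') →
      ∃ c : subfield Γ Z, algebraMap _ S c = b)
    (hspan : span Z (B : Set S) = ⊤) : IsSimpleRing B := by
  have : Fintype Γ := Fintype.ofFinite Γ
  have : FiniteDimensional (subfield Γ Z) S := Module.Finite.trans Z S
  refine isSimpleRing_of_semiprime (k := subfield Γ Z) ?_ ?_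
  · intro b hb
    rw [Subalgebra.mem_center_iff] at hb
    obtain ⟨c, hc⟩ := hcenter b b.2 fun b' hb' => congrArg Subtype.val (hb ⟨b', hb'⟩)
    exact Algebra.mem_bot.2 ⟨c, Subtype.ext hc⟩
  · intro y hy
    apply Subtype.ext
    apply eq_zero_of_forall_mul_mul_eq_zero
    intro x
    have hx : x ∈ span Z (B : Set S) := by rw [hspan]; trivial
    exact map_eq_zero_of_mem_span (LinearMap.mulLeftRight Z ((y : S), (y : S)))
      (fun x hx => congrArg Subtype.val (hy ⟨x, hx⟩)) hx

/-- A form of `S` over the fixed field of `Γ` gives rise to a semilinear action of `Γ` on `S`. -/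
theorem exists_semilinear_action_of_form (B : Subalgebra (subfield Γ Z) S)
    (hcenter : ∀ b ∈ B, (∀ b' ∈ B, b' * b = b * b') →
      ∃ c : subfield Γ Z, algebraMap _ S c = b)
    (hspan : span Z (B : Set S) = ⊤) :
    ∃ eps : Γ → S ≃+* S, (∀ g h s, eps (g * h) s = eps g (eps h s)) ∧ (∀ s, eps 1 s = s) ∧
      (∀ g z, eps g (algebraMap Z S z) = algebraMap Z S (g • z)) ∧ ∀ g, ∀ b ∈ B, eps g b = b := by
  have : Fintype Γ := Fintype.ofFinite Γ
  have : FiniteDimensional (subfield Γ Z) S := Module.Finite.trans Z S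
  have hs := isSimpleRing_form B hcenter hspan
  have hc : Algebra.IsCentral (subfield Γ Z) B := by
    refine ⟨fun b hb => ?_⟩
    rw [Subalgebra.mem_center_iff] at hb
    obtain ⟨c, hc⟩ := hcenter b b.2 fun b' hb' => congrArg Subtype.val (hb ⟨b', hb'⟩)
    exact Algebra.mem_bot.2 ⟨c, Subtype.ext hc⟩
  have hbij := scalarExtension_bijective (E := Z) B.val (by
    rw [← hspan]
    congr 1
    ext x
    simp)
  let Θ := AlgEquiv.ofBijective _ hbij
  have hΘ : ∀ c (b : B), Θ (c ⊗ₜ b) = c • (b : S) := fun c b => scalarExtension_tmul _ _ _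
  let eps : Γ → S ≃+* S := fun g =>
    (Θ.symm.toRingEquiv.trans (Algebra.TensorProduct.congr
      (MulSemiringAction.toAlgEquiv (subfield Γ Z) Z g)
      (AlgEquiv.refl : B ≃ₐ[subfield Γ Z] B)).toRingEquiv).trans Θ.toRingEquiv
  have heps : ∀ g (c : Z) (b : S), b ∈ B → eps g (c • b) = (g • c) • b := by
    intro g c b hb
    have h1 : Θ.symm (c • b) = c ⊗ₜ ⟨b, hb⟩ := by
      rw [AlgEquiv.symm_apply_eq, hΘ]
    change Θ (Algebra.TensorProduct.congr _ _ (Θ.symm (c • b))) = _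
    rw [h1, Algebra.TensorProduct.congr_apply, Algebra.TensorProduct.map_tmul]
    exact hΘ _ _
  have hind : ∀ f f' : S → S, (∀ x y, f (x + y) = f x + f y) → (∀ x y, f' (x + y) = f' x + f' y) →
      (∀ c : Z, ∀ b ∈ B, f (c • b) = f' (c • b)) → ∀ s, f s = f' s := by
    intro f f' hf hf' h s
    have hs : s ∈ span Z (B : Set S) := by rw [hspan]; trivial
    have hs' : ∃ t : Z ⊗[subfield Γ Z] B, Θ t = s := Θ.surjective s
    obtain ⟨t, rfl⟩ := hs'
    induction t using TensorProduct.induction_on with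
    | zero =>
      have h1 := h 0 0 B.zero_mem
      rw [smul_zero] at h1
      rw [map_zero, h1]
    | tmul c b => rw [hΘ]; exact h c b b.2
    | add x y hx hy =>
      rw [map_add, hf, hf', hx (by rw [hspan]; trivial), hy (by rw [hspan]; trivial)]
  refine ⟨eps, fun g h => ?_, ?_, ?_, ?_⟩
  · refine hind _ _ (map_add _) (fun x y => by rw [map_add, map_add]) fun c b hb => ?_
    rw [heps _ _ _ hb, heps _ _ _ hb, heps _ _ _ hb, mul_smul]
  · refine hind _ _ (map_add _) (fun x y => rfl) fun c b hb => ?_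
    rw [heps _ _ _ hb, one_smul]
  · intro g z
    rw [Algebra.algebraMap_eq_smul_one, heps _ _ _ B.one_mem, Algebra.algebraMap_eq_smul_one]
  · intro g b hb
    have h1 := heps g 1 b hb
    rwa [one_smul, smul_one, one_smul] at h1

end Forms

/-! ### Crossed representations -/

section Cocycles

/-- If a `2`-cocycle `f` of a finite group `Q` in an abelian group is killed by `n` in the sense
that `f ^ n` is the coboundary of `N`, where `n` is prime to `|Q|`, then `f` is the coboundary of
some `μ`, which can be chosen such that the `1`-cocycle `N / μ ^ n` is a coboundary. -/
theorem exists_trivialization_of_cocycle {Q A : Type*} [Group Q] [Finite Q] [CommGroup A]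
    (act : Q → A →* A) {n : ℕ} (hn : Nat.Coprime n (Nat.card Q)) (f : Q → Q → A) (N : Q → A)
    (hf : ∀ x y z, act z (f x y) * f (x * y) z = f y z * f x (y * z))
    (hN : ∀ x y, act y (N x) * N y = f x y ^ n * N (x * y)) :
    ∃ μ : Q → A, (∀ x y, act y (μ x) * μ y = f x y * μ (x * y)) ∧
      ∃ a : A, ∀ x, (μ x ^ n)⁻¹ * N x = a⁻¹ * act x a := by
  have := Fintype.ofFinite Q
  obtain ⟨a, b, hab⟩ : ∃ a b : ℤ, a * n + b * Nat.card Q = 1 := by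
    refine ⟨Nat.gcdA n (Nat.card Q), Nat.gcdB n (Nat.card Q), ?_⟩
    have := Nat.gcd_eq_gcd_ab n (Nat.card Q)
    rw [hn.gcd_eq_one] at this
    push_cast at this
    rw [this]
    ring
  have hpow : ∀ x : A, (x ^ n) ^ a * (x ^ Nat.card Q) ^ b = x := by
    intro x
    rw [← zpow_natCast, ← zpow_natCast, ← zpow_mul, ← zpow_mul, ← zpow_add, mul_comm (n : ℤ),
      mul_comm (Nat.card Q : ℤ), hab, zpow_one]
  let F : Q → A := fun y => ∏ x, f x y
  have hF : ∀ y z, act z (F y) * F z = f y z ^ Nat.card Q * F (y * z) := by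
    intro y z
    have h1 : ∏ x, f (x * y) z = F z := Fintype.prod_equiv (Equiv.mulRight y) _ _ fun x => rfl
    calc act z (F y) * F z = ∏ x, act z (f x y) * f (x * y) z := by
          rw [Finset.prod_mul_distrib, h1, map_prod]
      _ = ∏ x, f y z * f x (y * z) := Finset.prod_congr rfl fun x _ => hf x y z
      _ = _ := by
        rw [Finset.prod_mul_distrib, Finset.prod_const, Finset.card_univ,
          ← Nat.card_eq_fintype_card]
  let μ₀ : Q → A := fun x => N x ^ a * F x ^ b
  have hμ₀ : ∀ x y, act y (μ₀ x) * μ₀ y = f x y * μ₀ (x * y) := by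
    intro x y
    calc act y (μ₀ x) * μ₀ y = (act y (N x) * N y) ^ a * (act y (F x) * F y) ^ b := by
          simp only [μ₀, map_mul, map_zpow, mul_zpow]
          exact mul_mul_mul_comm _ _ _ _
      _ = ((f x y ^ n) ^ a * (f x y ^ Nat.card Q) ^ b) * μ₀ (x * y) := by
        rw [hN, hF, mul_zpow, mul_zpow]
        exact mul_mul_mul_comm _ _ _ _
      _ = _ := by rw [hpow]
  let ν : Q → A := fun x => (μ₀ x ^ n)⁻¹ * N x
  have hν : ∀ x y, act y (ν x) * ν y = ν (x * y) := by
    intro x y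
    calc act y (ν x) * ν y = ((act y (μ₀ x) * μ₀ y) ^ n)⁻¹ * (act y (N x) * N y) := by
          simp only [ν, map_mul, map_inv, map_pow, mul_pow, mul_inv]
          exact mul_mul_mul_comm _ _ _ _
      _ = ν (x * y) := by
        rw [hμ₀, hN, mul_pow, mul_inv]
        simp only [ν]
        rw [mul_mul_mul_comm, inv_mul_cancel, one_mul]
  let P : A := ∏ x, ν x
  have hP : ∀ y, act y P * ν y ^ Nat.card Q = P := by
    intro y
    calc act y P * ν y ^ Nat.card Q = ∏ x, act y (ν x) * ν y := by
          rw [Finset.prod_mul_distrib, Finset.prod_const, Finset.card_univ,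
            ← Nat.card_eq_fintype_card, map_prod]
      _ = ∏ x, ν (x * y) := Finset.prod_congr rfl fun x _ => hν x y
      _ = P := Fintype.prod_equiv (Equiv.mulRight y) _ _ fun x => rfl
  refine ⟨fun x => μ₀ x * ν x ^ a, fun x y => ?_, P ^ (-b), fun x => ?_⟩
  · calc act y (μ₀ x * ν x ^ a) * (μ₀ y * ν y ^ a)
        = (act y (μ₀ x) * μ₀ y) * (act y (ν x) * ν y) ^ a := by
          rw [map_mul, map_zpow, mul_zpow (act y (ν x))]
          exact mul_mul_mul_comm _ _ _ _
      _ = _ := by rw [hμ₀, hν, mul_assoc]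
  · have h1 : ν x ^ Nat.card Q = P * (act x P)⁻¹ := by
      rw [eq_mul_inv_iff_mul_eq, mul_comm, hP]
    have h2 : ((μ₀ x * ν x ^ a) ^ n)⁻¹ * N x = ((ν x ^ n) ^ a)⁻¹ * ν x := by
      have h3 : (ν x ^ a) ^ n = (ν x ^ n) ^ a := by
        rw [← zpow_natCast, ← zpow_natCast, ← zpow_mul, ← zpow_mul, mul_comm]
      rw [mul_pow, mul_inv, h3]
      simp only [ν]
      rw [mul_comm (_ ^ n)⁻¹, mul_assoc]
    have h4 : ((ν x ^ n) ^ a)⁻¹ * ν x = (ν x ^ Nat.card Q) ^ b := by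
      rw [inv_mul_eq_iff_eq_mul, hpow]
    rw [h2, h4, h1, mul_zpow, map_zpow, zpow_neg, zpow_neg, inv_inv, inv_zpow]

end Cocycles

section CrossedRepresentations

open Module

variable {Z S E : Type*} [Field Z] [Ring S] [Algebra Z S] [IsSimpleRing S] [Algebra.IsCentral Z S]
  [FiniteDimensional Z S] [Field E] [Algebra Z E] {n : ℕ} [NeZero n]

/-- The reduced norm of a central simple algebra, computed through the splitting `ψ`. -/
noncomputable def reducedNorm (ψ : S →ₐ[Z] Matrix (Fin n) (Fin n) E)
    (hψ : span E (Set.range ψ) = ⊤) : S →* Z where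
  toFun s := (exists_algebraMap_eq_det ψ hψ s).choose
  map_one' := (algebraMap Z E).injective (by
    rw [(exists_algebraMap_eq_det ψ hψ 1).choose_spec, map_one, map_one, Matrix.det_one])
  map_mul' s t := (algebraMap Z E).injective (by
    rw [(exists_algebraMap_eq_det ψ hψ _).choose_spec, map_mul, map_mul, Matrix.det_mul,
      (exists_algebraMap_eq_det ψ hψ s).choose_spec, (exists_algebraMap_eq_det ψ hψ t).choose_spec])

variable (ψ : S →ₐ[Z] Matrix (Fin n) (Fin n) E) (hψ : span E (Set.range ψ) = ⊤)

theorem algebraMap_reducedNorm (s : S) : algebraMap Z E (reducedNorm ψ hψ s) = (ψ s).det :=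
  (exists_algebraMap_eq_det ψ hψ s).choose_spec

theorem reducedNorm_algebraMap (z : Z) : reducedNorm ψ hψ (algebraMap Z S z) = z ^ n := by
  apply (algebraMap Z E).injective
  rw [algebraMap_reducedNorm, AlgHom.commutes, map_pow, Algebra.algebraMap_eq_smul_one,
    ← algebraMap_smul E, Matrix.det_smul, Matrix.det_one, Fintype.card_fin, mul_one]

theorem reducedNorm_ringEquiv (f : S ≃+* S) (g : Z →+* Z)
    (hf : ∀ z, f (algebraMap Z S z) = algebraMap Z S (g z)) (s : S) :
    reducedNorm ψ hψ (f s) = g (reducedNorm ψ hψ s) := by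
  apply (algebraMap Z E).injective
  rw [algebraMap_reducedNorm]
  refine det_eq_of_algebraMap_eq_det ψ hψ ((algebraMap Z E).comp g)
    (ψ.toRingHom.comp (f : S →+* S)) ?_ ?_ (algebraMap_reducedNorm ψ hψ s)
  · intro z
    change ψ (f (algebraMap Z S z)) = algebraMap Z E (g z) • _
    rw [hf, AlgHom.commutes, Algebra.algebraMap_eq_smul_one, algebraMap_smul]
  · rw [← hψ]
    congr 1
    exact f.surjective.range_comp ψ

omit [IsSimpleRing S] [FiniteDimensional Z S] in
theorem exists_units_algebraMap_eq [Nontrivial S] (u : Sˣ) (hu : ∀ s : S, s * u = u * s) :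
    ∃ z : Zˣ, algebraMap Z S z = u := by
  have h1 : (u : S) ∈ Subalgebra.center Z S := Subalgebra.mem_center_iff.2 hu
  rw [Algebra.IsCentral.center_eq_bot, Algebra.mem_bot] at h1
  obtain ⟨z, hz⟩ := h1
  refine ⟨Units.mk0 z ?_, hz⟩
  rintro rfl
  rw [map_zero] at hz
  exact u.ne_zero hz.symm

variable {Γ Q : Type*} [Group Γ] [MulSemiringAction Γ Z] [Group Q] [Finite Q]

/-- Existence of crossed representations: let `Q` act on `S` by `α`, such that `x` and `(π x)⁻¹`
have the same effect on the centre, and let `Γ` act semilinearly by `eps`. The automorphisms `α x`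
and `eps (π x)⁻¹` differ by an inner automorphism, and the resulting `2`-cocycle of `Q` is killed
by `|Q|` and, because of the reduced norm, by the degree of `S`. -/
theorem exists_crossedRepresentation (eps : Γ → S ≃+* S)
    (hmul : ∀ g h s, eps (g * h) s = eps g (eps h s))
    (hZ : ∀ g z, eps g (algebraMap Z S z) = algebraMap Z S (g • z))
    (π : Q →* Γ) (α : Q → S ≃+* S) (hα : ∀ x y s, α (x * y) s = α y (α x s))
    (hαZ : ∀ x z, α x (algebraMap Z S z) = algebraMap Z S ((π x)⁻¹ • z))
    (hn : Nat.Coprime n (Nat.card Q)) :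
    ∃ σ : Q → Sˣ, (∀ x y, eps (π y)⁻¹ (σ x) * σ y = (σ (x * y) : S)) ∧
      (∀ x s, α x s = ↑(σ x)⁻¹ * eps (π x)⁻¹ s * (σ x : S)) ∧
      ∃ a : Zˣ, ∀ x, reducedNorm ψ hψ (σ x) = ↑a⁻¹ * ((π x)⁻¹ • (a : Z)) := by
  have hex : ∀ x, ∃ u : Sˣ, ∀ s, α x s = ↑u⁻¹ * eps (π x)⁻¹ s * u := by
    intro x
    let f : S ≃ₐ[Z] S := AlgEquiv.ofRingEquiv (f := (eps (π x)⁻¹).symm.trans (α x)) (by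
      intro z
      change α x ((eps (π x)⁻¹).symm _) = _
      have h1 : (eps (π x)⁻¹).symm (algebraMap Z S z) = algebraMap Z S ((π x) • z) := by
        rw [RingEquiv.symm_apply_eq, hZ, inv_smul_smul]
      rw [h1, hαZ, inv_smul_smul])
    obtain ⟨u, hu⟩ := exists_unit_conj_of_algEquiv f
    refine ⟨u⁻¹, fun s => ?_⟩
    have h1 := hu (eps (π x)⁻¹ s)
    have h2 : f (eps (π x)⁻¹ s) = α x s := by
      change α x ((eps (π x)⁻¹).symm _) = _
      rw [RingEquiv.symm_apply_apply]
    rw [h2] at h1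
    rw [inv_inv, ← h1, mul_assoc, Units.mul_inv, mul_one]
  choose u hu using hex
  have hucomm : ∀ x s, eps (π x)⁻¹ s * u x = u x * α x s := by
    intro x s
    rw [hu, mul_assoc, ← mul_assoc (u x : S), Units.mul_inv, one_mul]
  have hexf : ∀ x y, ∃ z : Zˣ, eps (π y)⁻¹ (u x) * u y = algebraMap Z S z * u (x * y) := by
    intro x y
    obtain ⟨w, hw⟩ : ∃ w : Sˣ, (w : S) = eps (π y)⁻¹ (u x) * u y :=
      ⟨Units.map (eps (π y)⁻¹ : S →* S) (u x) * u y, rfl⟩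
    have hwc : ∀ s, eps (π (x * y))⁻¹ s * w = w * α (x * y) s := by
      intro s
      rw [hw, map_mul, mul_inv_rev, hmul, ← mul_assoc, ← map_mul, hucomm x s, map_mul, mul_assoc,
        hucomm, hα, mul_assoc]
    obtain ⟨z, hz⟩ := exists_units_algebraMap_eq (Z := Z) (w * (u (x * y))⁻¹) (by
      intro s
      obtain ⟨t, rfl⟩ := (eps (π (x * y))⁻¹).surjective s
      have h1 : α (x * y) t * ↑(u (x * y))⁻¹ = ↑(u (x * y))⁻¹ * eps (π (x * y))⁻¹ t := by
        rw [hu, mul_assoc, Units.mul_inv, mul_one]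
      rw [Units.val_mul, ← mul_assoc, hwc, mul_assoc, h1, mul_assoc])
    refine ⟨z, ?_⟩
    rw [hz, ← hw, Units.val_mul, mul_assoc, Units.inv_mul, mul_one]
  choose f hf using hexf
  let act : Q → Zˣ →* Zˣ := fun y => Units.map (MulSemiringAction.toRingHom Γ Z (π y)⁻¹ : Z →* Z)
  have hact : ∀ y (a : Zˣ), ((act y a : Zˣ) : Z) = (π y)⁻¹ • (a : Z) := fun y a => rfl
  have hinj : Function.Injective (algebraMap Z S) := (algebraMap Z S).injective
  have hcoc : ∀ x y z, act z (f x y) * f (x * y) z = f y z * f x (y * z) := by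
    intro x y z
    -- compare the two ways of expanding a product of three factors
    apply Units.ext
    apply hinj
    have h1 : eps (π z)⁻¹ (eps (π y)⁻¹ (u x) * u y) * u z
        = algebraMap Z S (act z (f x y) * f (x * y) z : Zˣ) * u (x * y * z) := by
      rw [hf, map_mul, hZ, mul_assoc, hf, ← mul_assoc, ← map_mul]
      rfl
    have h2 : eps (π z)⁻¹ (eps (π y)⁻¹ (u x) * u y) * u z
        = algebraMap Z S (f y z * f x (y * z) : Zˣ) * u (x * y * z) := by
      rw [map_mul, ← hmul, ← mul_inv_rev, ← map_mul, mul_assoc, hf, ← mul_assoc,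
        ← Algebra.commutes (R := Z), mul_assoc, hf, ← mul_assoc, ← map_mul, mul_assoc x]
      rfl
    exact (Units.isUnit (u (x * y * z))).mul_right_cancel (h1.symm.trans h2)
  have hnorm : ∀ x y, act y (Units.map (reducedNorm ψ hψ) (u x)) *
      Units.map (reducedNorm ψ hψ) (u y)
        = f x y ^ n * Units.map (reducedNorm ψ hψ) (u (x * y)) := by
    intro x y
    apply Units.ext
    have h1 := congrArg (reducedNorm ψ hψ) (hf x y)
    rw [map_mul, map_mul, reducedNorm_algebraMap,
      reducedNorm_ringEquiv ψ hψ _ (MulSemiringAction.toRingHom Γ Z (π y)⁻¹) (hZ _)] at h1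
    exact h1
  obtain ⟨μ, hμ, a, ha⟩ := exists_trivialization_of_cocycle act hn f
    (fun x => Units.map (reducedNorm ψ hψ) (u x)) hcoc hnorm
  refine ⟨fun x => Units.map (algebraMap Z S : Z →* S) (μ x)⁻¹ * u x, fun x y => ?_,
    fun x s => ?_, a, fun x => ?_⟩
  · have h1 : (μ x : Z) ≠ 0 := (μ x).ne_zero
    have h2 : (act y (μ x)⁻¹) * (μ y)⁻¹ * f x y = (μ (x * y))⁻¹ := by
      rw [map_inv, ← mul_inv, hμ, mul_inv, mul_right_comm, inv_mul_cancel, one_mul]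
    have h3 := congrArg (fun t : Zˣ => algebraMap Z S t) h2
    simp only [Units.val_mul, map_mul] at h3
    have e1 : ∀ (z : Zˣ) (v : Sˣ), ((Units.map (algebraMap Z S : Z →* S) z * v : Sˣ) : S)
        = algebraMap Z S z * v := fun z v => rfl
    rw [e1, e1, e1, map_mul, hZ, ← hact, ← h3]
    simp only [mul_assoc]
    rw [← hf x y, ← mul_assoc (eps (π y)⁻¹ _), ← Algebra.commutes (R := Z) _ (eps (π y)⁻¹ _),
      mul_assoc]
  · have e1 : ((Units.map (algebraMap Z S : Z →* S) (μ x)⁻¹ * u x : Sˣ) : S)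
        = algebraMap Z S ↑(μ x)⁻¹ * u x := rfl
    have e2 : (((Units.map (algebraMap Z S : Z →* S) (μ x)⁻¹ * u x)⁻¹ : Sˣ) : S)
        = ↑(u x)⁻¹ * algebraMap Z S ↑(μ x) := by
      rw [mul_inv_rev, ← map_inv, inv_inv]
      rfl
    rw [e1, e2, hu, mul_assoc _ (algebraMap Z S _), Algebra.commutes (R := Z) _ (eps _ s)]
    simp only [mul_assoc]
    rw [← mul_assoc (algebraMap Z S (μ x)) (algebraMap Z S _), ← map_mul, Units.mul_inv, map_one,
      one_mul]
  · have h1 := congrArg (Units.val : Zˣ → Z) (ha x)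
    have h2 : reducedNorm ψ hψ (Units.map (algebraMap Z S : Z →* S) (μ x)⁻¹ * u x : Sˣ)
        = ((μ x ^ n)⁻¹ * Units.map (reducedNorm ψ hψ) (u x) : Zˣ) := by
      have e1 : ((Units.map (algebraMap Z S : Z →* S) (μ x)⁻¹ * u x : Sˣ) : S)
        = algebraMap Z S ↑(μ x)⁻¹ * u x := rfl
      rw [e1, map_mul, reducedNorm_algebraMap, ← inv_pow, Units.val_mul, Units.val_pow_eq_pow_val]
      rfl
    rw [h2, h1]
    rfl

omit [Finite Q] in
/-- Uniqueness of crossed representations: two crossed representations, with respect to two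
semilinear actions of `Γ`, whose reduced norms are coboundaries are conjugate. Their quotient is a
`1`-cocycle for the first action, and the proof is an instance of Hilbert's Theorem 90: the fixed
points of the twisted action form a free module of rank `1` over the fixed ring. -/
theorem exists_unit_conj_crossedRepresentation [Finite Γ] [FaithfulSMul Γ Z]
    (eps eps' : Γ → S ≃+* S)
    (hmul : ∀ g h s, eps (g * h) s = eps g (eps h s)) (hone : ∀ s, eps 1 s = s)
    (hone' : ∀ s, eps' 1 s = s)
    (hZ : ∀ g z, eps g (algebraMap Z S z) = algebraMap Z S (g • z))
    (π : Q →* Γ) (hπ : Function.Surjective π) (α : Q → S ≃+* S)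
    (hn : Nat.Coprime n (Nat.card Q)) (σ σ' : Q → Sˣ)
    (hσ : ∀ x y, eps (π y)⁻¹ (σ x) * σ y = (σ (x * y) : S))
    (hσ' : ∀ x y, eps' (π y)⁻¹ (σ' x) * σ' y = (σ' (x * y) : S))
    (hα : ∀ x s, α x s = ↑(σ x)⁻¹ * eps (π x)⁻¹ s * (σ x : S))
    (hα' : ∀ x s, α x s = ↑(σ' x)⁻¹ * eps' (π x)⁻¹ s * (σ' x : S))
    (hnr : ∃ a : Zˣ, ∀ x, reducedNorm ψ hψ (σ x) = ↑a⁻¹ * ((π x)⁻¹ • (a : Z)))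
    (hnr' : ∃ a : Zˣ, ∀ x, reducedNorm ψ hψ (σ' x) = ↑a⁻¹ * ((π x)⁻¹ • (a : Z))) :
    ∃ v : Sˣ, ∀ x, eps (π x)⁻¹ v * (σ x * ↑(σ' x)⁻¹) = (v : S) := by
  have := Fintype.ofFinite Γ
  obtain ⟨w, hw⟩ : ∃ w : Q → Sˣ, ∀ x, w x = σ x * (σ' x)⁻¹ := ⟨_, fun _ => rfl⟩
  have hwv : ∀ x, (w x : S) = σ x * ↑(σ' x)⁻¹ := fun x => by rw [hw, Units.val_mul]
  -- `w` is a cocycle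
  have hcoc : ∀ x y, eps (π y)⁻¹ (w x) * w y = (w (x * y) : S) := by
    intro x y
    have h1 : ∀ s, eps (π y)⁻¹ s * w y = w y * eps' (π y)⁻¹ s := by
      intro s
      have h2 := (hα y s).symm.trans (hα' y s)
      have h3 := congrArg (fun t => (σ y : S) * t * ↑(σ' y)⁻¹) h2
      simp only [← mul_assoc, Units.mul_inv, one_mul] at h3
      rw [hwv, ← mul_assoc, h3, mul_assoc _ (σ' y : S), Units.mul_inv, mul_one]
    have h4 : eps' (π y)⁻¹ ↑(σ' x)⁻¹ = (σ' y : S) * ↑(σ' (x * y))⁻¹ := by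
      have h5 : eps' (π y)⁻¹ ↑(σ' x)⁻¹ * ((σ' (x * y) : Sˣ) : S) = σ' y := by
        rw [← hσ', ← mul_assoc, ← map_mul, Units.inv_mul, map_one, one_mul]
      rw [← h5, mul_assoc, Units.mul_inv, mul_one]
    rw [hwv x, map_mul, mul_assoc, h1, h4, hwv y, ← mul_assoc, ← mul_assoc, ← mul_assoc,
      mul_assoc _ (↑(σ' y)⁻¹ : S), Units.inv_mul, mul_one, hσ, hwv]
  -- `w` is trivial on the kernel of `π`
  have hker : ∀ x, π x = 1 → w x = 1 := by
    intro x hx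
    have hcomm : ∀ s : S, s * w x = w x * s := by
      intro s
      have h2 := (hα x s).symm.trans (hα' x s)
      rw [hx, inv_one, hone, hone'] at h2
      have h3 := congrArg (fun t => (σ x : S) * t * ↑(σ' x)⁻¹) h2
      simp only [← mul_assoc, Units.mul_inv, one_mul] at h3
      rw [hwv, ← mul_assoc, h3, mul_assoc _ (σ' x : S), Units.mul_inv, mul_one]
    obtain ⟨z, hz⟩ := exists_units_algebraMap_eq (Z := Z) (w x) hcomm
    have hzn : z ^ n = 1 := by
      obtain ⟨a, ha⟩ := hnr
      obtain ⟨b, hb⟩ := hnr'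
      have h1 : reducedNorm ψ hψ (σ x) = 1 := by
        rw [ha, hx, inv_one, one_smul, Units.inv_mul]
      have h2 : reducedNorm ψ hψ (σ' x) = 1 := by
        rw [hb, hx, inv_one, one_smul, Units.inv_mul]
      have h3 : (σ x : S) = algebraMap Z S z * σ' x := by
        rw [hz, hwv, mul_assoc, Units.inv_mul, mul_one]
      rw [h3, map_mul, h2, mul_one, reducedNorm_algebraMap] at h1
      exact Units.ext h1
    have hpow : ∀ k : ℕ, w (x ^ k) = w x ^ k := by
      intro k
      induction k with
      | zero =>
        have h1 := hcoc 1 1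
        rw [map_one, inv_one, hone, mul_one] at h1
        rw [pow_zero, pow_zero]
        exact (mul_eq_left (a := w 1)).1 (Units.ext h1)
      | succ k ih =>
        have h1 := hcoc (x ^ k) x
        rw [hx, inv_one, hone, ← pow_succ] at h1
        rw [pow_succ (w x), ← ih]
        exact Units.ext h1.symm
    have hzq : z ^ Nat.card Q = 1 := by
      have h1 := hpow (Nat.card Q)
      have h2 := hpow 0
      rw [pow_card_eq_one', ← pow_zero x, h2, pow_zero] at h1
      apply Units.ext
      apply (algebraMap Z S).injective
      rw [Units.val_pow_eq_pow_val, map_pow, hz, Units.val_one, map_one,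
        ← Units.val_pow_eq_pow_val, ← h1, Units.val_one]
    have hz1 : z = 1 := by
      have h1 := orderOf_dvd_of_pow_eq_one hzn
      have h2 := orderOf_dvd_of_pow_eq_one hzq
      exact orderOf_eq_one_iff.1 (Nat.eq_one_of_dvd_coprimes hn h1 h2)
    apply Units.ext
    rw [← hz, hz1, Units.val_one, map_one, Units.val_one]
  have hwπ : ∀ x y, π x = π y → w x = w y := by
    intro x y hxy
    have h1 := hcoc x (x⁻¹ * y)
    rw [map_mul, map_inv, hxy, inv_mul_cancel, inv_one, hone, mul_inv_cancel_left,
      hker (x⁻¹ * y) (by rw [map_mul, map_inv, hxy, inv_mul_cancel]), Units.val_one, mul_one] at h1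
    exact Units.ext h1
  choose r hr using hπ
  -- the twisted action
  let act : Γ → S →+ S := fun g =>
    { toFun := fun s => eps g s * w (r g⁻¹)
      map_zero' := by rw [map_zero, zero_mul]
      map_add' := fun s t => by rw [map_add, add_mul] }
  have hact : ∀ g s, act g s = eps g s * w (r g⁻¹) := fun _ _ => rfl
  have hactmul : ∀ g h v, act (g * h) v = act g (act h v) := by
    intro g h v
    have h1 : w (r (g * h)⁻¹) = w (r h⁻¹ * r g⁻¹) := hwπ _ _ (by
      rw [map_mul, hr, hr, hr, mul_inv_rev])
    rw [hact, hact, hact, map_mul, hmul, mul_assoc]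
    congr 1
    rw [h1, ← hcoc, hr, inv_inv]
  have hactone : ∀ v, act 1 v = v := by
    intro v
    rw [hact, hone, hker _ (by rw [hr, inv_one]), Units.val_one, mul_one]
  have hsm : ∀ g (z : Z) v, eps g (z • v) = (g • z) • eps g v := by
    intro g z v
    rw [Algebra.smul_def, map_mul, hZ, ← Algebra.smul_def]
  have hactsmul : ∀ g (z : Z) v, act g (z • v) = (g • z) • act g v := by
    intro g z v
    rw [hact, hact, hsm, smul_mul_assoc]
  have hV := finrank_fixedSubmodule (Z := Z) act hactmul hactone hactsmul
  have hspV := span_fixed_eq_top (Z := Z) act hactmul hactone hactsmul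
  -- the fixed ring of `eps`
  let B : Subalgebra (subfield Γ Z) S :=
    { carrier := {t | ∀ g, eps g t = t}
      mul_mem' := fun ha hb g => by rw [map_mul, ha g, hb g]
      add_mem' := fun ha hb g => by rw [map_add, ha g, hb g]
      algebraMap_mem' := fun c g => by
        change eps g (algebraMap Z S c) = algebraMap Z S c
        rw [hZ, c.2 g] }
  have : FiniteDimensional (subfield Γ Z) S := Module.Finite.trans Z S
  let actB : Γ → S →+ S := fun g => (eps g : S →+* S)
  have hBfix : finrank (subfield Γ Z) (fixedSubmodule actB hsm) = finrank Z S :=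
    finrank_fixedSubmodule actB hmul hone hsm
  have hBspan := span_fixed_eq_top (Z := Z) actB hmul hone hsm
  have hBs : IsSimpleRing B := by
    refine isSimpleRing_of_semiprime (k := subfield Γ Z) ?_ ?_
    · intro b hb
      rw [Subalgebra.mem_center_iff] at hb
      have h1 : (b : S) ∈ Subalgebra.center Z S := by
        rw [Subalgebra.mem_center_iff]
        intro x
        have hx : x ∈ span Z {v | ∀ g, actB g v = v} := by
          rw [hBspan]; trivial
        exact mul_comm_of_mem_span (fun x hx => congrArg Subtype.val (hb ⟨x, hx⟩)) hx
      rw [Algebra.IsCentral.center_eq_bot, Algebra.mem_bot] at h1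
      obtain ⟨z, hz⟩ := h1
      refine Algebra.mem_bot.2 ⟨⟨z, fun g => ?_⟩, Subtype.ext hz⟩
      apply (algebraMap Z S).injective
      rw [← hZ, hz]
      exact b.2 g
    · intro y hy
      apply Subtype.ext
      apply eq_zero_of_forall_mul_mul_eq_zero
      intro x
      have hx : x ∈ span Z {v | ∀ g, actB g v = v} := by
        rw [hBspan]; trivial
      exact map_eq_zero_of_mem_span (LinearMap.mulLeftRight Z ((y : S), (y : S)))
        (fun x hx => congrArg Subtype.val (hy ⟨x, hx⟩)) hx
  let V : Submodule B S :=
    { carrier := {v | ∀ g, act g v = v}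
      add_mem' := fun ha hb g => by rw [map_add, ha g, hb g]
      zero_mem' := fun g => map_zero _
      smul_mem' := fun b v hv g => by
        change act g ((b : S) * v) = (b : S) * v
        rw [hact, map_mul, b.2 g, mul_assoc, ← hact, hv g] }
  have hfr : finrank (subfield Γ Z) B = finrank (subfield Γ Z) V :=
    hBfix.trans hV.symm
  let _ : Module (subfield Γ Z) V := V.module'
  have : IsScalarTower (subfield Γ Z) B V := ⟨fun x y z => by
    apply Subtype.ext
    exact smul_mul_assoc x (y : S) (z : S)⟩
  let incl : V →ₗ[subfield Γ Z] S :=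
    { toFun := Subtype.val
      map_add' := fun _ _ => rfl
      map_smul' := fun _ _ => rfl }
  have : FiniteDimensional (subfield Γ Z) V :=
    FiniteDimensional.of_injective incl Subtype.val_injective
  obtain ⟨e⟩ := nonempty_linearEquiv_of_finrank_eq (k := subfield Γ Z) (B := B) (V := B)
    (W := V) hfr
  have he : ∀ b : B, ((e b : V) : S) = b * (e 1 : V) := by
    intro b
    have h1 := e.map_smul b 1
    rw [smul_eq_mul, mul_one] at h1
    rw [h1]
    rfl
  obtain ⟨t, ht⟩ : ∃ t : S, t * (e 1 : V) = 1 := by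
    have h1 : (1 : S) ∈ span Z {v | ∀ g, act g v = v} := by rw [hspV]; trivial
    refine map_mem_of_mem_span LinearMap.id
      (N := LinearMap.range (LinearMap.mulRight Z ((e 1 : V) : S)))
      (fun x hx => ?_) h1
    obtain ⟨b, hb⟩ := e.surjective ⟨x, hx⟩
    exact ⟨b, by rw [LinearMap.mulRight_apply, ← he, hb]; rfl⟩
  have : IsArtinianRing S := IsArtinianRing.of_finite Z S
  refine ⟨⟨(e 1 : V), t, mul_eq_one_comm.1 ht, ht⟩, fun x => ?_⟩
  have h1 := (e 1).2 (π x)⁻¹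
  rw [hact] at h1
  rw [← hwv, hwπ x (r (π x)⁻¹⁻¹) (by rw [hr, inv_inv])]
  exact h1

end CrossedRepresentations

open scoped MonoidAlgebra
open MonoidAlgebra (of mapDomain mapRingHom induction_linear mapDomainRingHom single
  coeff_mapRingHom mapDomain_zero mapDomain_add coeff_smul_apply mapDomain_single of_apply
  mapRingHom_comp_mapDomainRingHom single_mul_single mapDomain_smul mapDomain_injective
  coeff_mul_apply_left smul_single mapDomainRingHom_comp)

/-! ### Simple projective modules -/

section SimpleProjectiveModules

open Module

variable {N E V : Type*} [Group N] [Finite N] [Field E] [AddCommGroup V] [Module E V]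
  (ρ : Representation E N V)

theorem Representation.finiteDimensional_of_isIrreducible [ρ.IsIrreducible] :
    FiniteDimensional E V := by
  have h1 : Module.Finite E[N] ρ.asModule := inferInstance
  have h3 : Module.Finite E E[N] :=
    Module.Finite.equiv (MonoidAlgebra.coeffLinearEquiv E).symm
  have h2 : Module.Finite E ρ.asModule := Module.Finite.trans E[N] ρ.asModule
  exact Module.Finite.equiv ρ.asModuleEquiv

omit [Finite N] in
theorem Representation.nontrivial_of_isIrreducible [ρ.IsIrreducible] : Nontrivial V :=
  IsSimpleModule.nontrivial E[N] ρ.asModule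

/-- Burnside's theorem: over an algebraically closed field, the group algebra maps onto the
endomorphism ring of a simple module. -/
theorem Representation.asAlgebraHom_surjective [IsAlgClosed E] [ρ.IsIrreducible] :
    Function.Surjective ρ.asAlgebraHom := by
  have hfin := ρ.finiteDimensional_of_isIrreducible
  have hfin' : FiniteDimensional E ρ.asModule := hfin
  intro A
  have hsc := (IsSimpleModule.algebraMap_end_bijective_of_isAlgClosed (A := E[N])
    (V := ρ.asModule) E).2
  let A' : End (End E[N] ρ.asModule) ρ.asModule :=
    { toFun := fun v => A v
      map_add' := fun v w => map_add A v w
      map_smul' := fun f v => by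
        obtain ⟨c, rfl⟩ := hsc f
        exact map_smul A c v }
  have hfin'' : Module.Finite (End E[N] ρ.asModule) ρ.asModule :=
    Module.Finite.of_restrictScalars_finite E _ _
  obtain ⟨r, hr⟩ := Module.Finite.toModuleEnd_moduleEnd_surjective (R := E[N])
    (M := ρ.asModule) A'
  refine ⟨r, LinearMap.ext fun v => ?_⟩
  exact LinearMap.congr_fun hr v

omit [Finite N] in
/-- Higman's criterion: a projective module has a rank one endomorphism `v ↦ f v • v₀` of
relative trace `1`. -/
theorem Representation.exists_sum_smul_eq_of_projective [Fintype N] [ρ.IsIrreducible]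
    [hp : Module.Projective E[N] ρ.asModule] :
    ∃ (f : V →ₗ[E] E) (v₀ : V), ∀ v, ∑ g, f (ρ g⁻¹ v) • ρ g v₀ = v := by
  have := IsSimpleModule.nontrivial E[N] ρ.asModule
  obtain ⟨v₀, hv₀⟩ := exists_ne (0 : ρ.asModule)
  obtain ⟨s, hs⟩ := Module.projective_lifting_property
    (LinearMap.toSpanSingleton E[N] ρ.asModule v₀) LinearMap.id
    (IsSimpleModule.toSpanSingleton_surjective _ hv₀)
  refine ⟨{ toFun := fun v => (s v).coeff 1
            map_add' := fun v w => congrArg (fun x => x.coeff 1) (map_add s v w)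
            map_smul' := fun c v => congrArg (fun x => x.coeff 1)
              ((s.restrictScalars E).map_smul c v) }, v₀, fun v => ?_⟩
  have h1 : ∀ g (w : ρ.asModule), (s (ρ g⁻¹ w)).coeff 1 = (s w).coeff g := by
    intro g w
    have h2 := s.map_smul (single g⁻¹ (1 : E)) w
    rw [Representation.single_smul, one_smul, smul_eq_mul] at h2
    have h3 := congrArg (fun x => x.coeff 1) h2
    simp only [MonoidAlgebra.coeff_single_mul_apply] at h3
    rw [inv_inv, one_mul, mul_one] at h3
    exact h3
  have h4 : s v • v₀ = v := LinearMap.congr_fun hs v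
  have h5 : ρ.asAlgebraHom (s v) v₀ = v := h4
  have h6 : ρ.asAlgebraHom (s v) = ∑ g, (s v).coeff g • ρ g := by
    rw [Representation.asAlgebraHom_def, MonoidAlgebra.lift_apply, Finsupp.sum_fintype _ _
      (fun _ => by simp)]
  refine Eq.trans ?_ ((LinearMap.sum_apply _ _ _).symm.trans
    ((LinearMap.congr_fun h6 v₀).symm.trans h5))
  exact sum_congr rfl fun g _ => congrArg (· • ρ g v₀) (h1 g v)

/-- The element `∑ g, tr(A ρ(g)⁻¹) g` of the group algebra; up to a scalar, the map
`A ↦ traceElement ρ A` is inverse to the action of the group algebra on a simple projective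
module. -/
noncomputable def Representation.traceElement : End E V →ₗ[E] E[N] where
  toFun A := .ofCoeff (Finsupp.equivFunOnFinite.symm fun g => LinearMap.trace E V (A * ρ g⁻¹))
  map_add' A B := by
    ext g
    simp [add_mul]
  map_smul' c A := by
    ext g
    simp

theorem Representation.coeff_traceElement (A : End E V) (g : N) :
    (ρ.traceElement A).coeff g = LinearMap.trace E V (A * ρ g⁻¹) := rfl

theorem Representation.mul_traceElement (x : E[N]) (A : End E V) :
    x * ρ.traceElement A = ρ.traceElement (ρ.asAlgebraHom x * A) := by
  induction x using induction_linear with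
  | zero => simp
  | add x y hx hy => rw [add_mul, hx, hy, map_add, add_mul, map_add]
  | single h c =>
    ext g
    rw [MonoidAlgebra.coeff_single_mul_apply, coeff_traceElement, coeff_traceElement,
      Representation.asAlgebraHom_single, smul_mul_assoc, smul_mul_assoc, map_smul, smul_eq_mul,
      mul_inv_rev, inv_inv, map_mul ρ, mul_assoc, LinearMap.trace_mul_comm E (ρ h), mul_assoc]

theorem Representation.traceElement_mul (x : E[N]) (A : End E V) :
    ρ.traceElement A * x = ρ.traceElement (A * ρ.asAlgebraHom x) := by
  induction x using induction_linear with
  | zero => simp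
  | add x y hx hy => rw [mul_add, hx, hy, map_add, mul_add, map_add]
  | single h c =>
    ext g
    rw [MonoidAlgebra.coeff_mul_single_apply, coeff_traceElement, coeff_traceElement,
      Representation.asAlgebraHom_single, mul_smul_comm, smul_mul_assoc, map_smul, smul_eq_mul,
      mul_inv_rev, inv_inv, map_mul ρ, ← mul_assoc, mul_comm]

theorem Representation.asAlgebraHom_traceElement [Fintype N] (A : End E V) :
    ρ.asAlgebraHom (ρ.traceElement A) = ∑ g, LinearMap.trace E V (A * ρ g⁻¹) • ρ g := by
  rw [Representation.asAlgebraHom_def, MonoidAlgebra.lift_apply, Finsupp.sum_fintype _ _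
    (fun _ => by simp)]
  rfl

variable [IsAlgClosed E] [ρ.IsIrreducible]

theorem Representation.exists_eq_smul_one_of_forall_commute (B : End E V)
    (hB : ∀ A : End E V, A * B = B * A) : ∃ c : E, B = c • 1 := by
  have h1 : B ∈ Subalgebra.center E (End E V) := Subalgebra.mem_center_iff.2 hB
  rw [Algebra.IsCentral.center_eq_bot, Algebra.mem_bot] at h1
  obtain ⟨c, hc⟩ := h1
  exact ⟨c, by rw [← hc, Algebra.algebraMap_eq_smul_one]⟩

/-- For a simple projective module, `A ↦ c • traceElement ρ A` is a section of the action of the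
group algebra, for a suitable scalar `c ≠ 0`. -/
theorem Representation.exists_asAlgebraHom_traceElement
    [hp : Module.Projective E[N] ρ.asModule] :
    ∃ c : E, c ≠ 0 ∧ ∀ A, ρ.asAlgebraHom (ρ.traceElement A) = c • A := by
  have := Fintype.ofFinite N
  have hfin := ρ.finiteDimensional_of_isIrreducible
  have hnt := ρ.nontrivial_of_isIrreducible
  obtain ⟨c, hc⟩ := exists_eq_smul_one_of_forall_commute
    (ρ.asAlgebraHom (ρ.traceElement 1)) (fun A => by
      obtain ⟨x, rfl⟩ := ρ.asAlgebraHom_surjective A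
      rw [← map_mul, ← map_mul, mul_traceElement, traceElement_mul, mul_one, one_mul])
  have hcA : ∀ A, ρ.asAlgebraHom (ρ.traceElement A) = c • A := by
    intro A
    obtain ⟨x, rfl⟩ := ρ.asAlgebraHom_surjective A
    rw [← mul_one (ρ.asAlgebraHom x), ← mul_traceElement, map_mul, hc, mul_smul_comm]
  refine ⟨c, ?_, hcA⟩
  rintro rfl
  obtain ⟨f, v₀, hf⟩ := ρ.exists_sum_smul_eq_of_projective
  obtain ⟨v, hv⟩ := exists_ne (0 : V)
  apply hv
  have h1 := LinearMap.congr_fun (hcA (f.smulRight v)) v₀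
  rw [asAlgebraHom_traceElement, LinearMap.sum_apply, zero_smul, LinearMap.zero_apply] at h1
  rw [← hf v, ← h1]
  refine sum_congr rfl fun g _ => ?_
  rw [LinearMap.smul_apply, LinearMap.trace_mul_comm]
  congr 1
  have h2 : ρ g⁻¹ * f.smulRight v = f.smulRight (ρ g⁻¹ v) := by
    ext w
    simp
  rw [h2, LinearMap.trace_smulRight]

end SimpleProjectiveModules

section CharacterIdempotents

open Module

variable {N E V : Type*} [Group N] [Finite N] [Field E] [AddCommGroup V] [Module E V]
  (ρ : Representation E N V)

omit [Finite N] in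
theorem Representation.charEval_character (x : E[N]) :
    charEval ρ.character x = LinearMap.trace E V (ρ.asAlgebraHom x) := by
  rw [Representation.asAlgebraHom_def, MonoidAlgebra.lift_apply, map_finsuppSum]
  simp only [map_smul, smul_eq_mul]
  rfl

variable [IsAlgClosed E] [ρ.IsIrreducible]

theorem Representation.asAlgebraHom_eq_one_of_central {e : E[N]}
    (hc : ∀ x, x * e = e * x) (he : e * e = e) (h0 : ρ.asAlgebraHom e ≠ 0) :
    ρ.asAlgebraHom e = 1 := by
  have := ρ.finiteDimensional_of_isIrreducible
  have := ρ.nontrivial_of_isIrreducible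
  obtain ⟨c, hc⟩ := exists_eq_smul_one_of_forall_commute
    (ρ.asAlgebraHom e) (fun A => by
      obtain ⟨x, rfl⟩ := ρ.asAlgebraHom_surjective A
      rw [← map_mul, ← map_mul, hc])
  have h1 : ρ.asAlgebraHom e * ρ.asAlgebraHom e = ρ.asAlgebraHom e := by rw [← map_mul, he]
  rw [hc, smul_mul_assoc, one_mul] at h1
  have h2 : c * c = c := by
    rw [smul_smul] at h1
    exact smul_left_injective E one_ne_zero h1
  have h3 : c ≠ 0 := by
    rintro rfl
    exact h0 (by rw [hc, zero_smul])
  rw [hc, mul_right_cancel₀ h3 (h2.trans (one_mul c).symm), one_smul]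

variable [hp : Module.Projective E[N] ρ.asModule]

theorem Representation.charIdem_character_eq :
    ∃ c : E, c ≠ 0 ∧ charIdem ρ.character = c⁻¹ • ρ.traceElement 1 ∧
      IsCentralPrimitiveIdempotent (charIdem ρ.character) ∧
      (∀ A, ρ.asAlgebraHom (ρ.traceElement A) = c • A) ∧
      ∀ e', IsCentralPrimitiveIdempotent e' → ρ.asAlgebraHom e' ≠ 0 →
        e' = charIdem ρ.character := by
  have := ρ.finiteDimensional_of_isIrreducible
  have := ρ.nontrivial_of_isIrreducible
  obtain ⟨c, hc0, hc⟩ := ρ.exists_asAlgebraHom_traceElement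
  obtain ⟨e, he⟩ : ∃ e, e = c⁻¹ • ρ.traceElement 1 := ⟨_, rfl⟩
  have he1 : ρ.asAlgebraHom e = 1 := by rw [he, map_smul, hc, inv_smul_smul₀ hc0]
  have hxe : ∀ x, x * e = c⁻¹ • ρ.traceElement (ρ.asAlgebraHom x) := fun x => by
    rw [he, mul_smul_comm, mul_traceElement, mul_one]
  have hex : ∀ x, e * x = c⁻¹ • ρ.traceElement (ρ.asAlgebraHom x) := fun x => by
    rw [he, smul_mul_assoc, traceElement_mul, one_mul]
  have hcen : e ∈ Subring.center E[N] :=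
    Subring.mem_center_iff.2 fun x => (hxe x).trans (hex x).symm
  have hprim : IsCentralPrimitiveIdempotent e := by
    refine ⟨hcen, by rw [hxe, he1, ← he], ?_, ?_⟩
    · rintro h
      rw [h, map_zero] at he1
      exact zero_ne_one he1
    · intro f hf hff hfe
      by_cases h0 : ρ.asAlgebraHom f = 0
      · left
        rw [← hfe, hxe, h0, map_zero, smul_zero]
      · right
        rw [← hfe, hxe, ρ.asAlgebraHom_eq_one_of_central (Subring.mem_center_iff.1 hf) hff h0, he]
  have huniq : ∀ e', IsCentralPrimitiveIdempotent e' → ρ.asAlgebraHom e' ≠ 0 → e' = e := by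
    rintro e' ⟨h1, h2, h3, h4⟩ h0
    have h5 := ρ.asAlgebraHom_eq_one_of_central (Subring.mem_center_iff.1 h1) h2 h0
    have h6 : e' * e = e := by rw [hxe, h5, he]
    have h7 : e * e' = e := by rw [hex, h5, he]
    rcases h4 e hcen hprim.2.1 h7 with h8 | h8
    · exact absurd h8 hprim.2.2.1
    · exact h8.symm
  have hchar : charIdem ρ.character = e := by
    have hex : ∃ e, IsIdempotentOfChar ρ.character e := by
      refine ⟨e, hprim, ?_⟩
      obtain ⟨v, hv⟩ := exists_ne (0 : V)
      obtain ⟨f, hf⟩ := Module.Projective.exists_dual_ne_zero E hv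
      obtain ⟨x, hx⟩ := ρ.asAlgebraHom_surjective (f.smulRight v)
      refine ⟨x, ?_⟩
      rw [charEval_character, map_mul, he1, mul_one, hx, LinearMap.trace_smulRight]
      exact hf
    rw [charIdem, dif_pos hex]
    obtain ⟨h1, a, h2⟩ := hex.choose_spec
    refine huniq _ h1 fun h0 => h2 ?_
    rw [charEval_character, map_mul, h0, mul_zero, map_zero]
  rw [hchar]
  exact ⟨c, hc0, he, hprim, hc, huniq⟩

theorem Representation.isCentralPrimitiveIdempotent_charIdem :
    IsCentralPrimitiveIdempotent (charIdem ρ.character) := by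
  obtain ⟨c, hc0, he, hprim, hc, huniq⟩ := ρ.charIdem_character_eq
  exact hprim

theorem Representation.mul_charIdem_comm (x : E[N]) :
    x * charIdem ρ.character = charIdem ρ.character * x :=
  Subring.mem_center_iff.1 ρ.isCentralPrimitiveIdempotent_charIdem.1 x

theorem Representation.asAlgebraHom_charIdem : ρ.asAlgebraHom (charIdem ρ.character) = 1 := by
  obtain ⟨c, hc0, he, hprim, hc, huniq⟩ := ρ.charIdem_character_eq
  rw [he, map_smul, hc, inv_smul_smul₀ hc0]

theorem Representation.mul_charIdem_eq_zero {x : E[N]} (hx : ρ.asAlgebraHom x = 0) :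
    x * charIdem ρ.character = 0 := by
  obtain ⟨c, hc0, he, hprim, hc, huniq⟩ := ρ.charIdem_character_eq
  rw [he, mul_smul_comm, mul_traceElement, hx, zero_mul, map_zero, smul_zero]

variable (F : Type*) [Field F] [Algebra F E]

/-- The coefficients of the idempotent of a simple projective module are the values of its
character, up to a factor in the field of values. -/
theorem Representation.exists_coeff_charIdem :
    ∃ c ∈ charField F ρ.character, c ≠ 0 ∧
      ∀ g, (charIdem ρ.character).coeff g = c * ρ.character g⁻¹ := by
  have := Fintype.ofFinite N
  obtain ⟨c, hc0, he, hprim, hc, huniq⟩ := ρ.charIdem_character_eq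
  have hval : ∀ g, ρ.character g ∈ charField F ρ.character := fun g =>
    IntermediateField.subset_adjoin F _ ⟨g, rfl⟩
  have hco : ∀ g, (charIdem ρ.character).coeff g = c⁻¹ * ρ.character g⁻¹ := fun g => by
    rw [he, coeff_smul_apply, coeff_traceElement, one_mul]
    rfl
  refine ⟨c⁻¹, ?_, inv_ne_zero hc0, hco⟩
  obtain ⟨g, hg⟩ : ∃ g, (charIdem ρ.character).coeff g ≠ 0 := by
    by_contra hcon
    push Not at hcon
    exact hprim.2.2.1 (MonoidAlgebra.ext (Finsupp.ext hcon))
  have hg' : ρ.character g⁻¹ ≠ 0 := fun h => hg (by rw [hco, h, mul_zero])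
  -- comparing coefficients in `e * e = e` expresses the factor in terms of character values
  have h1 := congrArg (fun x => x.coeff g) hprim.2.1
  simp only [coeff_mul_apply_left] at h1
  rw [Finsupp.sum_fintype _ _ (fun _ => zero_mul _)] at h1
  simp only [hco] at h1
  have h2 : c⁻¹ * ∑ x, ρ.character x⁻¹ * ρ.character (x⁻¹ * g)⁻¹ = ρ.character g⁻¹ := by
    apply mul_left_cancel₀ (inv_ne_zero hc0)
    rw [← h1, mul_sum, mul_sum]
    exact sum_congr rfl fun x _ => by ring
  have h3 : c⁻¹ = ρ.character g⁻¹ / ∑ x, ρ.character x⁻¹ * ρ.character (x⁻¹ * g)⁻¹ := by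
    rw [← h2, mul_div_assoc, div_self, mul_one]
    intro h0
    rw [h0, mul_zero] at h2
    exact hg' h2.symm
  rw [h3]
  exact div_mem (hval _) (sum_mem fun x _ => mul_mem (hval _) (hval _))

end CharacterIdempotents

/-! ### Fields of values and Galois conjugation of idempotents -/

section FieldOfValues

open Module

variable {N E V : Type*} [Group N] [Finite N] [Field E] [IsAlgClosed E] [AddCommGroup V]
  [Module E V] [FiniteDimensional E V] (ρ : Representation E N V)
  (F : Type*) [Field F] [Algebra F E]

omit [IsAlgClosed E] in
theorem exists_forall_pow_eq_one_of_pow_eq_one (m : ℕ) (hm : m ≠ 0) :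
    ∃ m' : ℕ, (m' : E) ≠ 0 ∧ ∀ x : E, x ^ m = 1 → x ^ m' = 1 := by
  obtain ⟨p, hp⟩ := CharP.exists E
  rcases CharP.char_is_prime_or_zero E p with h | rfl
  · have : Fact p.Prime := ⟨h⟩
    obtain ⟨a, m', hm', rfl⟩ := Nat.exists_eq_pow_mul_and_not_dvd hm p h.ne_one
    refine ⟨m', fun h0 => hm' ((CharP.cast_eq_zero_iff E p m').1 h0), fun x hx => ?_⟩
    exact (ExpChar.pow_prime_pow_mul_eq_one_iff p a m' x).1 hx
  · have := CharP.charP_to_charZero E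
    exact ⟨m, Nat.cast_ne_zero.2 hm, fun x hx => hx⟩

/-- The field of values of a character lies in a cyclotomic extension. -/
theorem Representation.exists_isCyclotomicExtension_charField :
    ∃ (m : ℕ) (C : IntermediateField F E), NeZero m ∧ IsCyclotomicExtension {m} F C ∧
      charField F ρ.character ≤ C := by
  obtain ⟨m, hm0, hm⟩ := exists_forall_pow_eq_one_of_pow_eq_one (E := E) (Nat.card N)
    Nat.card_pos.ne'
  have : NeZero (m : E) := ⟨hm0⟩
  have : NeZero m := ⟨by rintro rfl; exact hm0 Nat.cast_zero⟩
  obtain ⟨ζ, hζ⟩ := HasEnoughRootsOfUnity.exists_primitiveRoot E m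
  refine ⟨m, IntermediateField.adjoin F {x | ∃ n ∈ ({m} : Set ℕ), n ≠ 0 ∧ x ^ n = 1}, this,
    IntermediateField.isCyclotomicExtension_adjoin_of_exists_isPrimitiveRoot {m} F E ?_, ?_⟩
  · rintro n rfl -
    exact ⟨ζ, hζ⟩
  rw [charField, IntermediateField.adjoin_le_iff]
  rintro _ ⟨g, rfl⟩
  change LinearMap.trace E V (ρ g) ∈ _
  rw [Module.End.trace_eq_sum_roots_charpoly_of_splits (IsAlgClosed.splits _)]
  refine multiset_sum_mem _ fun x hx => ?_
  have h1 : Module.End.HasEigenvalue (ρ g) x := by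
    rw [Module.End.hasEigenvalue_iff_isRoot_charpoly]
    exact (Polynomial.mem_roots'.1 hx).2
  obtain ⟨v, hv⟩ := h1.exists_hasEigenvector
  have h2 : x ^ Nat.card N = 1 := by
    have h3 := hv.pow_apply (Nat.card N)
    rw [← map_pow, pow_card_eq_one', map_one] at h3
    have h4 : (x ^ Nat.card N) • v = (1 : E) • v := by rw [← h3, one_smul]; rfl
    exact smul_left_injective E hv.2 h4
  exact IntermediateField.subset_adjoin F _ ⟨m, rfl, NeZero.ne m, hm x h2⟩

theorem Representation.isAbelianGalois_charField : IsAbelianGalois F (charField F ρ.character) := by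
  obtain ⟨m, C, hm, hC, hle⟩ := ρ.exists_isCyclotomicExtension_charField F
  have := IsCyclotomicExtension.isAbelianGalois {m} F C
  exact IsAbelianGalois.of_algHom (IntermediateField.inclusion hle)

theorem Representation.finiteDimensional_charField :
    FiniteDimensional F (charField F ρ.character) := by
  obtain ⟨m, C, hm, hC, hle⟩ := ρ.exists_isCyclotomicExtension_charField F
  have := IsCyclotomicExtension.finiteDimensional {m} F C
  exact FiniteDimensional.of_injective (IntermediateField.inclusion hle).toLinearMap
    (IntermediateField.inclusion hle).injective

variable {F}

omit [Finite N] [AddCommGroup V] [Module E V] [FiniteDimensional E V] in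
/-- Automorphisms of a subfield extend to an algebraically closed field, here through a transcendence
basis. -/
theorem exists_ringEquiv_extending {M : IntermediateField F E} (γ : M ≃ₐ[F] M) :
    ∃ γ' : E ≃+* E, ∀ l : M, γ' l = γ l := by
  obtain ⟨ι, x, hx⟩ := exists_isTranscendenceBasis' M E
  have := IsAlgClosed.isAlgClosure_of_transcendence_basis x hx
  let ae := hx.1.aevalEquiv
  let e : Algebra.adjoin M (Set.range x) ≃+* Algebra.adjoin M (Set.range x) :=
    (ae.symm.toRingEquiv.trans (MvPolynomial.mapEquiv ι (γ : M ≃+* M))).trans ae.toRingEquiv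
  refine ⟨IsAlgClosure.equivOfEquiv E E e, fun l => ?_⟩
  have h1 := IsAlgClosure.equivOfEquiv_algebraMap E E e (algebraMap M _ l)
  have h2 : e (algebraMap M _ l) = algebraMap M _ (γ l) := by
    change ae (MvPolynomial.map _ (ae.symm (algebraMap M _ l))) = _
    rw [AlgEquiv.commutes, MvPolynomial.algebraMap_eq, MvPolynomial.map_C,
      ← MvPolynomial.algebraMap_eq,
      AlgEquiv.commutes]
    rfl
  rw [h2] at h1
  exact h1

end FieldOfValues

section GaloisConjugation

variable {N N' E : Type*} [Group N] [Group N'] [Field E] {F : Type*} [Field F] [Algebra F E]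

variable (N) in
/-- The subring `M N` of the group algebra `E N`. -/
noncomputable def coeffSubring (M : IntermediateField F E) : Subring E[N] :=
  (mapRingHom N (algebraMap M E)).range

variable {M : IntermediateField F E}

theorem mem_coeffSubring {x : E[N]} : x ∈ coeffSubring N M ↔ ∀ g, x.coeff g ∈ M := by
  constructor
  · rintro ⟨y, rfl⟩ g
    rw [coeff_mapRingHom]
    exact (y.coeff g).2
  · intro h
    refine ⟨.ofCoeff (Finsupp.onFinset x.coeff.support (fun g => ⟨x.coeff g, h g⟩) ?_), ?_⟩
    · intro g hg
      rw [Finsupp.mem_support_iff]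
      exact fun h0 => hg (Subtype.ext h0)
    · ext g
      rw [coeff_mapRingHom]
      rfl

theorem galApply_coe (γ : M ≃ₐ[F] M) (l : M) : galApply γ (l : E) = γ l := by
  rw [galApply, dif_pos l.2]

omit [Group N] in
theorem coeff_galConj (γ : M ≃ₐ[F] M) (x : E[N]) (g : N) :
    (galConj γ x).coeff g = galApply γ (x.coeff g) := rfl

theorem galConj_mapRingHom (γ : M ≃ₐ[F] M) (y : M[N]) :
    galConj γ (mapRingHom N (algebraMap M E) y) =
      mapRingHom N (algebraMap M E)
        (mapRingHom N (γ : M →+* M) y) := by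
  ext g
  rw [coeff_galConj, coeff_mapRingHom, coeff_mapRingHom,
    coeff_mapRingHom]
  exact galApply_coe γ _

theorem galConj_eq_mapRingHom {γ : M ≃ₐ[F] M} {γ' : E →+* E} (h : ∀ l : M, γ' l = γ l)
    {x : E[N]} (hx : x ∈ coeffSubring N M) :
    galConj γ x = mapRingHom N γ' x := by
  ext g
  rw [coeff_galConj, coeff_mapRingHom]
  obtain ⟨l, hl⟩ : ∃ l : M, (l : E) = x.coeff g := ⟨⟨_, mem_coeffSubring.1 hx g⟩, rfl⟩
  rw [← hl, galApply_coe, h]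

variable (γ δ : M ≃ₐ[F] M) {x y : E[N]}

theorem galConj_mem (hx : x ∈ coeffSubring N M) : galConj γ x ∈ coeffSubring N M := by
  obtain ⟨x, rfl⟩ := hx
  rw [galConj_mapRingHom]
  exact ⟨_, rfl⟩

theorem galConj_zero : galConj γ (0 : E[N]) = 0 := by
  ext g
  exact galApply_zero γ

theorem galConj_add (hx : x ∈ coeffSubring N M) (hy : y ∈ coeffSubring N M) :
    galConj γ (x + y) = galConj γ x + galConj γ y := by
  obtain ⟨x, rfl⟩ := hx
  obtain ⟨y, rfl⟩ := hy
  rw [← map_add, galConj_mapRingHom, galConj_mapRingHom, galConj_mapRingHom, map_add, map_add]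

theorem galConj_mul (hx : x ∈ coeffSubring N M) (hy : y ∈ coeffSubring N M) :
    galConj γ (x * y) = galConj γ x * galConj γ y := by
  obtain ⟨x, rfl⟩ := hx
  obtain ⟨y, rfl⟩ := hy
  rw [← map_mul, galConj_mapRingHom, galConj_mapRingHom, galConj_mapRingHom, map_mul, map_mul]

theorem galConj_sum {ι : Type*} (s : Finset ι) (f : ι → E[N])
    (hf : ∀ i ∈ s, f i ∈ coeffSubring N M) :
    galConj γ (∑ i ∈ s, f i) = ∑ i ∈ s, galConj γ (f i) := by
  classical
  induction s using Finset.induction_on with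
  | empty => exact galConj_zero γ
  | insert i s hi ih =>
    rw [Finset.sum_insert hi, Finset.sum_insert hi,
      galConj_add γ (hf i (Finset.mem_insert_self _ _))
      (sum_mem fun j hj => hf j (Finset.mem_insert_of_mem hj)),
      ih fun j hj => hf j (Finset.mem_insert_of_mem hj)]

theorem galConj_galConj (hx : x ∈ coeffSubring N M) :
    galConj γ (galConj δ x) = galConj (γ * δ) x := by
  obtain ⟨x, rfl⟩ := hx
  rw [galConj_mapRingHom, galConj_mapRingHom, galConj_mapRingHom]
  congr 1
  ext g
  simp

theorem galConj_one_apply (hx : x ∈ coeffSubring N M) :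
    galConj (1 : M ≃ₐ[F] M) x = x := by
  obtain ⟨x, rfl⟩ := hx
  rw [galConj_mapRingHom]
  congr 1
  ext g
  simp

theorem smul_mem_coeffSubring {l : E} (hl : l ∈ M) (hx : x ∈ coeffSubring N M) :
    l • x ∈ coeffSubring N M := by
  rw [mem_coeffSubring] at hx ⊢
  intro g
  rw [coeff_smul_apply]
  exact mul_mem hl (hx g)

theorem galConj_smul (l : M) (hx : x ∈ coeffSubring N M) :
    galConj γ ((l : E) • x) = (γ l : E) • galConj γ x := by
  ext g
  obtain ⟨m, hm⟩ : ∃ m : M, (m : E) = x.coeff g := ⟨⟨_, mem_coeffSubring.1 hx g⟩, rfl⟩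
  rw [coeff_galConj, coeff_smul_apply, coeff_smul_apply, coeff_galConj,
    smul_eq_mul, smul_eq_mul, ← hm, ← IntermediateField.coe_mul, galApply_coe, galApply_coe,
    map_mul,
    IntermediateField.coe_mul]

theorem of_mem_coeffSubring (g : N) : of E N g ∈ coeffSubring N M :=
  ⟨of M N g, by simp⟩

theorem galConj_of (g : N) : galConj γ (of E N g) = of E N g := by
  have h : of E N g = mapRingHom N (algebraMap M E)
    (of M N g) := by simp
  rw [h, galConj_mapRingHom]
  simp

theorem mapDomain_mem_coeffSubring (f : N →* N') (hx : x ∈ coeffSubring N M) :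
    mapDomain f x ∈ coeffSubring N' M := by
  obtain ⟨x, rfl⟩ := hx
  exact ⟨mapDomainRingHom M f x, RingHom.congr_fun
    (mapRingHom_comp_mapDomainRingHom (algebraMap M E) f) x⟩

theorem galConj_mapDomain (f : N →* N') (hx : x ∈ coeffSubring N M) :
    galConj γ (mapDomain f x) = mapDomain f (galConj γ x) := by
  obtain ⟨x, rfl⟩ := hx
  have h1 := RingHom.congr_fun
    (mapRingHom_comp_mapDomainRingHom (algebraMap M E) f)
  have h2 := RingHom.congr_fun
    (mapRingHom_comp_mapDomainRingHom (γ : M →+* M) f)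
  have h3 := h1 x
  change _ = mapDomain f _ at h3
  rw [← h3, galConj_mapRingHom]
  change galConj γ (mapRingHom N' (algebraMap M E) _) = _
  rw [galConj_mapRingHom, ← RingHom.comp_apply (mapRingHom N' (γ : M →+* M)), h2]
  exact h1 _

theorem galConj_of_mem_range (y : F[N]) :
    galConj γ (mapRingHom N (algebraMap F E) y) =
      mapRingHom N (algebraMap F E) y := by
  ext g
  rw [coeff_galConj, coeff_mapRingHom]
  have h : algebraMap F E (y.coeff g) = (algebraMap F M (y.coeff g) : M) := rfl
  rw [h, galApply_coe, AlgEquiv.commutes]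

theorem mapRingHom_mem_coeffSubring (y : F[N]) :
    mapRingHom N (algebraMap F E) y ∈ coeffSubring N M := by
  rw [mem_coeffSubring]
  intro g
  rw [coeff_mapRingHom]
  exact M.algebraMap_mem _

theorem exists_mapRingHom_eq_of_galConj_eq [IsGalois F M] (hx : x ∈ coeffSubring N M)
    (h : ∀ γ : M ≃ₐ[F] M, galConj γ x = x) :
    ∃ y, mapRingHom N (algebraMap F E) y = x := by
  have h1 : ∀ g, ∃ a : F, algebraMap F E a = x.coeff g := by
    intro g
    obtain ⟨m, hm⟩ : ∃ m : M, (m : E) = x.coeff g := ⟨⟨_, mem_coeffSubring.1 hx g⟩, rfl⟩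
    obtain ⟨a, ha⟩ := (InfiniteGalois.mem_range_algebraMap_iff_fixed (k := F) m).2 (fun γ => by
      have h2 := congrArg (fun x => x.coeff g) (h γ)
      simp only [coeff_galConj] at h2
      rw [← hm, galApply_coe] at h2
      exact Subtype.ext h2)
    exact ⟨a, by rw [← hm, ← ha]; rfl⟩
  choose a ha using h1
  refine ⟨.ofCoeff (Finsupp.onFinset x.coeff.support a fun g hg => ?_), ?_⟩
  · rw [Finsupp.mem_support_iff, ← ha]
    exact fun h0 => hg ((algebraMap F E).injective (h0.trans (map_zero _).symm))
  · ext g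
    rw [coeff_mapRingHom]
    exact ha g

end GaloisConjugation

section GaloisConjugateIdempotents

open Module

variable {N E V : Type*} [Group N] [Finite N] [Field E] [IsAlgClosed E] [AddCommGroup V]
  [Module E V] (ρ : Representation E N V) [ρ.IsIrreducible]
  [hp : Module.Projective E[N] ρ.asModule]
  {F : Type*} [Field F] [Algebra F E] {M : IntermediateField F E}

theorem Representation.charIdem_mem_coeffSubring (hM : charField F ρ.character = M) :
    charIdem ρ.character ∈ coeffSubring N M := by
  subst hM
  obtain ⟨c, hc, hc0, h⟩ := ρ.exists_coeff_charIdem F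
  rw [mem_coeffSubring]
  intro g
  rw [h]
  exact mul_mem hc (IntermediateField.subset_adjoin F _ ⟨_, rfl⟩)

theorem Representation.mul_galConj_charIdem_comm (hM : charField F ρ.character = M)
    (γ : M ≃ₐ[F] M) (x : E[N]) :
    x * galConj γ (charIdem ρ.character) = galConj γ (charIdem ρ.character) * x := by
  obtain ⟨γ', hγ'⟩ := exists_ringEquiv_extending γ
  rw [galConj_eq_mapRingHom (γ' := γ') hγ' (ρ.charIdem_mem_coeffSubring hM)]
  have h1 : x = mapRingHom N (γ' : E →+* E)
      (mapRingHom N (γ'.symm : E →+* E) x) := by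
    ext g
    simp
  rw [h1, ← map_mul, ρ.mul_charIdem_comm, map_mul]

omit hp in
/-- The trace of a representation is invariant under a field automorphism `γ'` if the algebra
map `x ↦ ρ(γ'(x))` factors through `ρ`: it then induces an automorphism of a matrix algebra,
semilinear for `γ'`. -/
theorem Representation.ringEquiv_character_eq (γ' : E ≃+* E)
    (h : ∀ x, ρ.asAlgebraHom x = 0 →
      ρ.asAlgebraHom (mapRingHom N (γ' : E →+* E) x) = 0) (g : N) :
    γ' (ρ.character g) = ρ.character g := by
  have := ρ.finiteDimensional_of_isIrreducible
  have := ρ.nontrivial_of_isIrreducible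
  let b := finBasis E V
  have : NeZero (finrank E V) := ⟨finrank_pos.ne'⟩
  let θ := LinearMap.toMatrixAlgEquiv b
  let f : E[N] →+* Matrix (Fin (finrank E V)) (Fin (finrank E V)) E :=
    (γ'.symm : E →+* E).mapMatrix.comp (((θ : End E V →+* _).comp
      (ρ.asAlgebraHom : E[N] →+* End E V)).comp
        (mapRingHom N (γ' : E →+* E)))
  let ρ' : E[N] →+* End E V := ρ.asAlgebraHom
  have hs := Function.rightInverse_surjInv ρ.asAlgebraHom_surjective
  have hker : RingHom.ker ρ' ≤ RingHom.ker f := by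
    intro x hx
    rw [RingHom.mem_ker] at hx ⊢
    change (γ'.symm : E →+* E).mapMatrix (θ (ρ.asAlgebraHom _)) = 0
    rw [h x hx, map_zero, map_zero]
  let φ₀ : End E V →+* Matrix (Fin (finrank E V)) (Fin (finrank E V)) E :=
    ρ'.liftOfRightInverse _ hs ⟨f, hker⟩
  have hφ₀ : ∀ x, φ₀ (ρ.asAlgebraHom x) = f x :=
    fun x => ρ'.liftOfRightInverse_comp_apply _ hs ⟨f, hker⟩ x
  let φ : Matrix (Fin (finrank E V)) (Fin (finrank E V)) E →ₐ[E]
      Matrix (Fin (finrank E V)) (Fin (finrank E V)) E :=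
    { φ₀.comp (θ.symm : _ →+* End E V) with
      commutes' := fun c => by
        change φ₀ (θ.symm (algebraMap E _ c)) = _
        rw [AlgEquiv.commutes, ← AlgHom.commutes ρ.asAlgebraHom, hφ₀]
        change (γ'.symm : E →+* E).mapMatrix (θ (ρ.asAlgebraHom
          (mapRingHom N (γ' : E →+* E) (algebraMap E _ c)))) = _
        have h1 : mapRingHom N (γ' : E →+* E) (algebraMap E _ c) =
            algebraMap E E[N] (γ' c) := by
          rw [MonoidAlgebra.coe_algebraMap, Function.comp_apply, Function.comp_apply,
            MonoidAlgebra.mapRingHom_single]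
          rfl
        rw [h1, AlgHom.commutes, AlgEquiv.commutes]
        ext i j
        by_cases hij : i = j <;> simp [Matrix.algebraMap_matrix_apply, hij] }
  have h1 := trace_algHom_matrix φ (θ (ρ g))
  have h2 : φ (θ (ρ g)) = (γ'.symm : E →+* E).mapMatrix (θ (ρ g)) := by
    change φ₀ (θ.symm (θ (ρ g))) = _
    rw [AlgEquiv.symm_apply_apply, ← Representation.asAlgebraHom_of, hφ₀]
    change (γ'.symm : E →+* E).mapMatrix (θ (ρ.asAlgebraHom
          (mapRingHom N (γ' : E →+* E) (of E N g)))) = _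
    congr 3
    simp
  have h3 : (θ (ρ g)).trace = ρ.character g := (LinearMap.trace_eq_matrix_trace E b (ρ g)).symm
  rw [h2, h3] at h1
  have h4 : ((γ'.symm : E →+* E).mapMatrix (θ (ρ g))).trace = γ'.symm (θ (ρ g)).trace :=
    (AddMonoidHom.map_trace (γ'.symm : E →+* E) (θ (ρ g))).symm
  rw [h4, h3] at h1
  rw [← h1, RingEquiv.apply_symm_apply, h1]

theorem Representation.galConj_charIdem_mul_charIdem (hM : charField F ρ.character = M)
    {γ : M ≃ₐ[F] M} (hγ : γ ≠ 1) :
    galConj γ (charIdem ρ.character) * charIdem ρ.character = 0 := by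
  have he := ρ.charIdem_mem_coeffSubring hM
  obtain ⟨γ', hγ'⟩ := exists_ringEquiv_extending γ
  have h0 := galConj_eq_mapRingHom (γ' := γ') hγ' he
  by_cases h1 : ρ.asAlgebraHom (galConj γ (charIdem ρ.character)) = 0
  · exact ρ.mul_charIdem_eq_zero h1
  exfalso
  have h2 := ρ.asAlgebraHom_eq_one_of_central (ρ.mul_galConj_charIdem_comm hM γ)
    (by rw [← galConj_mul γ he he, ρ.isCentralPrimitiveIdempotent_charIdem.2.1]) h1
  rw [h0] at h2
  have h3 := ρ.ringEquiv_character_eq γ' (fun x hx => by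
    have h4 := ρ.mul_charIdem_eq_zero hx
    have h5 := congrArg (fun y => ρ.asAlgebraHom (mapRingHom N (γ' : E →+* E) y)) h4
    simp only [map_mul, map_zero] at h5
    rwa [h2, mul_one] at h5)
  apply hγ
  have hF : ∀ a : F, γ' (algebraMap F E a) = algebraMap F E a := fun a => by
    have h4 := hγ' (algebraMap F M a)
    rw [AlgEquiv.commutes] at h4
    exact h4
  let K' : IntermediateField F E :=
    Subfield.toIntermediateField (RingHom.eqLocusField (γ' : E →+* E) (RingHom.id E)) hF
  have hle : M ≤ K' := by
    rw [← hM, charField, IntermediateField.adjoin_le_iff]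
    rintro _ ⟨g, rfl⟩
    exact h3 g
  refine AlgEquiv.ext fun l => Subtype.ext ?_
  rw [← hγ' l]
  exact hle l.2

/-- If an automorphism of the group acts on the character as a Galois automorphism, then it acts
on the idempotent in the same way. -/
theorem Representation.galConj_mapDomain_charIdem (hM : charField F ρ.character = M)
    (γ : M ≃ₐ[F] M) (f : N ≃* N)
    (hf : ∀ k, galApply γ (ρ.character (f k)) = ρ.character k) :
    galConj γ (mapDomain f.symm (charIdem ρ.character)) = charIdem ρ.character := by
  have he := ρ.charIdem_mem_coeffSubring hM
  have he' : mapDomain f.symm (charIdem ρ.character) ∈ coeffSubring N M :=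
    mapDomain_mem_coeffSubring (f.symm : N →* N) he
  obtain ⟨c, hc, hc0, h⟩ := ρ.exists_coeff_charIdem F
  rw [hM] at hc
  have h0 := ρ.isCentralPrimitiveIdempotent_charIdem
  obtain ⟨l, hl⟩ : ∃ l : E, galConj γ (mapDomain f.symm (charIdem ρ.character)) =
      l • charIdem ρ.character := by
    refine ⟨γ ⟨c, hc⟩ / c, ?_⟩
    ext g
    have h1 : (mapDomain f.symm (charIdem ρ.character)).coeff g =
        (charIdem ρ.character).coeff (f g) := by
      have h2 := Finsupp.mapDomain_equiv_apply (f := f.symm.toEquiv) (charIdem ρ.character).coeff g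
      exact h2
    have hm : ρ.character (f g)⁻¹ ∈ M := by
      rw [← hM]
      exact IntermediateField.subset_adjoin F _ ⟨_, rfl⟩
    have h3 := hf g⁻¹
    rw [map_inv] at h3
    have h4 : c * ρ.character (f g)⁻¹ = ((⟨c, hc⟩ * ⟨_, hm⟩ : M) : E) := rfl
    have h5 : galApply γ (ρ.character (f g)⁻¹) = γ ⟨_, hm⟩ := galApply_coe γ ⟨_, hm⟩
    rw [coeff_galConj, h1, h, h4, galApply_coe, map_mul, IntermediateField.coe_mul, ← h5, h3,
      coeff_smul_apply, h, smul_eq_mul, ← mul_assoc, div_mul_cancel₀ _ hc0]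
  have h6 : mapDomain f.symm (charIdem ρ.character) *
      mapDomain f.symm (charIdem ρ.character) =
      mapDomain f.symm (charIdem ρ.character) := by
    have h7 := congrArg (mapDomainRingHom E (f.symm : N →* N)) h0.2.1
    rw [map_mul] at h7
    exact h7
  have h8 := congrArg (galConj γ) h6
  rw [galConj_mul γ he' he', hl, smul_mul_assoc, mul_smul_comm, h0.2.1] at h8
  rw [hl]
  by_cases hl0 : l = 0
  · exfalso
    rw [hl0, zero_smul] at hl
    have h9 := congrArg (galConj γ⁻¹) hl
    rw [galConj_galConj _ _ he', inv_mul_cancel, galConj_one_apply he', galConj_zero] at h9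
    exact h0.2.2.1 (mapDomain_injective f.symm.injective
      (h9.trans (mapDomain_zero _).symm))
  · have h9 := smul_right_injective _ hl0 h8
    exact h9

end GaloisConjugateIdempotents

/-! ### The corner of a group algebra attached to a pair of characters -/

section CornerSplittings

open Module

/-- The data describing a corner `f e A e f` of an algebra: the central idempotent `e` belongs to
the simple module `V` (via the action `toEnd`), the `unit a b` form a system of matrix units with
sum `f`, and the range of the idempotent `unit o o` on `V` is coordinatised by `incl` and `proj`.
The centraliser of the matrix units in the corner is then a matrix algebra of degree `n`. -/
structure CornerSplitting (E A V : Type*) [Field E] [Ring A] [Algebra E A] [AddCommGroup V]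
    [Module E V] (d n : ℕ) where
  toEnd : A →ₐ[E] End E V
  surjective : Function.Surjective toEnd
  e : A
  mul_e : ∀ x, x * e = e * x
  toEnd_e : toEnd e = 1
  mul_e_eq_zero : ∀ x, toEnd x = 0 → x * e = 0
  unit : Fin d → Fin d → A
  unit_mul : ∀ a b b' c, unit a b * unit b' c = if b = b' then unit a c else 0
  o : Fin d
  incl : (Fin n → E) →ₗ[E] V
  proj : V →ₗ[E] (Fin n → E)
  incl_proj : incl ∘ₗ proj = toEnd (unit o o)
  proj_incl : proj ∘ₗ incl = LinearMap.id

namespace CornerSplitting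

variable {E A V : Type*} [Field E] [Ring A] [Algebra E A] [AddCommGroup V]
    [Module E V] {d n : ℕ} (c : CornerSplitting E A V d n)

/-- The idempotent `f`. -/
def f : A := ∑ a, c.unit a a

theorem e_mul_e : c.e * c.e = c.e := by
  have h := c.mul_e_eq_zero (1 - c.e) (by rw [map_sub, map_one, c.toEnd_e, sub_self])
  rw [sub_mul, one_mul, sub_eq_zero] at h
  exact h.symm

theorem unit_mul_f (a b : Fin d) : c.unit a b * c.f = c.unit a b := by
  rw [f, mul_sum]
  simp [c.unit_mul]

theorem f_mul_unit (a b : Fin d) : c.f * c.unit a b = c.unit a b := by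
  rw [f, sum_mul]
  simp [c.unit_mul]

theorem f_mul_f : c.f * c.f = c.f := by
  have h : c.f * c.f = ∑ a, c.unit a a * c.f := sum_mul _ _ _
  simp only [h, unit_mul_f]
  rfl

theorem f_mul_comm {x : A} (hx : ∀ a b, c.unit a b * x = x * c.unit a b) : c.f * x = x * c.f := by
  rw [f, sum_mul, mul_sum]
  exact sum_congr rfl fun a _ => hx a a

/-- The representation of the centraliser of the matrix units on the range of `unit o o`. -/
noncomputable def rep : A →ₗ[E] Matrix (Fin n) (Fin n) E where
  toFun x := LinearMap.toMatrix' (c.proj ∘ₗ c.toEnd x ∘ₗ c.incl)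
  map_add' x y := by
    rw [map_add, LinearMap.add_comp, LinearMap.comp_add, map_add]
  map_smul' l x := by
    rw [map_smul, LinearMap.smul_comp, LinearMap.comp_smul, map_smul, RingHom.id_apply]

theorem rep_apply (x : A) : c.rep x = LinearMap.toMatrix' (c.proj ∘ₗ c.toEnd x ∘ₗ c.incl) := rfl

theorem rep_mul (x : A) {y : A} (hy : c.unit c.o c.o * y = y * c.unit c.o c.o) :
    c.rep (x * y) = c.rep x * c.rep y := by
  rw [rep_apply, rep_apply, rep_apply, ← LinearMap.toMatrix'_comp]
  congr 1
  have h1 : c.proj ∘ₗ c.toEnd x ∘ₗ (c.incl ∘ₗ c.proj) ∘ₗ c.toEnd y ∘ₗ c.incl =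
      c.proj ∘ₗ c.toEnd x ∘ₗ c.toEnd y ∘ₗ (c.incl ∘ₗ c.proj) ∘ₗ c.incl := by
    have h2 : (c.incl ∘ₗ c.proj) ∘ₗ c.toEnd y = c.toEnd y ∘ₗ (c.incl ∘ₗ c.proj) := by
      have h3 := congrArg c.toEnd hy
      rw [map_mul, map_mul, ← c.incl_proj] at h3
      exact h3
    rw [← LinearMap.comp_assoc (c.incl) (c.toEnd y), h2, LinearMap.comp_assoc]
  have h4 : (c.incl ∘ₗ c.proj) ∘ₗ c.incl = c.incl := by
    rw [LinearMap.comp_assoc, c.proj_incl, LinearMap.comp_id]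
  rw [h4] at h1
  rw [map_mul]
  exact h1.symm

theorem rep_e : c.rep c.e = 1 := by
  have h : c.proj ∘ₗ c.toEnd c.e ∘ₗ c.incl = LinearMap.id := by
    rw [c.toEnd_e]
    exact c.proj_incl
  rw [rep_apply, h, LinearMap.toMatrix'_id]

theorem rep_mul_e (x : A) : c.rep (x * c.e) = c.rep x := by
  rw [c.rep_mul _ (c.mul_e _), rep_e, mul_one]

theorem rep_unit : c.rep (c.unit c.o c.o) = 1 := by
  have h : c.proj ∘ₗ c.toEnd (c.unit c.o c.o) ∘ₗ c.incl = LinearMap.id := by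
    rw [← c.incl_proj]
    rw [LinearMap.comp_assoc, c.proj_incl, LinearMap.comp_id, c.proj_incl]
  rw [rep_apply, h, LinearMap.toMatrix'_id]

theorem rep_mul_f (x : A) : c.rep (x * c.f) = c.rep x := by
  have h1 := c.rep_mul (x * c.f) (y := c.unit c.o c.o) rfl
  rw [mul_assoc, f_mul_unit, c.rep_mul x (y := c.unit c.o c.o) rfl, rep_unit, mul_one,
    mul_one] at h1
  exact h1.symm

theorem eq_zero_of_rep_eq_zero {x : A} (hx : ∀ a b, c.unit a b * x = x * c.unit a b)
    (he : x * c.e = x) (hf : x * c.f = x) (h : c.rep x = 0) : x = 0 := by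
  have h1 : c.proj ∘ₗ c.toEnd x ∘ₗ c.incl = 0 := by
    rw [rep_apply] at h
    exact LinearMap.toMatrix'.injective (h.trans (map_zero _).symm)
  have h2 : c.toEnd (c.unit c.o c.o * x * c.unit c.o c.o) = 0 := by
    rw [map_mul, map_mul, ← c.incl_proj]
    change c.incl ∘ₗ (c.proj ∘ₗ c.toEnd x ∘ₗ c.incl) ∘ₗ c.proj = 0
    rw [h1, LinearMap.zero_comp, LinearMap.comp_zero]
  have h3 := c.mul_e_eq_zero _ h2
  rw [hx, mul_assoc x, c.unit_mul, if_pos rfl, mul_assoc, c.mul_e, ← mul_assoc, he] at h3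
  rw [← hf, f, mul_sum]
  refine Finset.sum_eq_zero fun a _ => ?_
  have h4 : c.unit a a = c.unit a c.o * (c.unit c.o c.o * c.unit c.o a) := by
    rw [c.unit_mul, if_pos rfl, c.unit_mul, if_pos rfl]
  rw [h4, ← mul_assoc, ← hx, mul_assoc, ← mul_assoc x, h3, zero_mul, mul_zero]

/-- The element `∑ k, unit k a * x * unit b k`, which commutes with the matrix units. -/
def average (a b : Fin d) (x : A) : A := ∑ k, c.unit k a * x * c.unit b k

theorem unit_mul_average (a b : Fin d) (x : A) (p q : Fin d) :
    c.unit p q * c.average a b x = c.average a b x * c.unit p q := by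
  rw [average, mul_sum, sum_mul]
  simp only [← mul_assoc, c.unit_mul]
  simp only [mul_assoc, c.unit_mul]
  simp

theorem sum_unit_mul_average (x : A) :
    ∑ a, ∑ b, c.unit a b * c.average a b x = c.f * x * c.f := by
  have h : ∀ a b, c.unit a b * c.average a b x = c.unit a a * x * c.unit b b := by
    intro a b
    rw [average, mul_sum]
    simp only [← mul_assoc, c.unit_mul]
    simp
  simp only [h]
  rw [f, sum_mul, sum_mul]
  simp only [mul_sum]

theorem average_mul_e (a b : Fin d) (x : A) :
    c.average a b x * c.e = c.average a b (x * c.e) := by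
  rw [average, average, sum_mul]
  exact sum_congr rfl fun k _ => by
    rw [mul_assoc, c.mul_e, ← mul_assoc, ← mul_assoc, mul_assoc _ x]

theorem average_mul_f (a b : Fin d) (x : A) : c.average a b x * c.f = c.average a b x := by
  rw [average, sum_mul]
  exact sum_congr rfl fun k _ => by rw [mul_assoc, unit_mul_f]

/-- Every matrix is the image of an element of the corner centralising the matrix units, a combination
of averages. -/
theorem exists_rep_eq (X : Matrix (Fin n) (Fin n) E) :
    ∃ x, (∀ a b, c.unit a b * x = x * c.unit a b) ∧ x * c.e = x ∧ x * c.f = x ∧ c.rep x = X := by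
  obtain ⟨y, hy⟩ := c.surjective (c.incl ∘ₗ X.toLin' ∘ₗ c.proj)
  refine ⟨c.average c.o c.o (y * c.e), c.unit_mul_average _ _ _, ?_, c.average_mul_f _ _ _, ?_⟩
  · rw [average_mul_e, mul_assoc, e_mul_e]
  · have h1 : c.rep (c.average c.o c.o (y * c.e)) =
        c.rep (c.unit c.o c.o * y * c.unit c.o c.o) := by
      rw [← average_mul_e, rep_mul_e, ← mul_one (c.rep (c.average c.o c.o y)), ← c.rep_unit,
        ← c.rep_mul _ rfl]
      congr 1
      rw [average, sum_mul]
      simp only [mul_assoc, c.unit_mul]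
      simp
    have h2 : c.proj ∘ₗ c.toEnd (c.unit c.o c.o * y * c.unit c.o c.o) ∘ₗ c.incl =
        (c.proj ∘ₗ c.incl) ∘ₗ (c.proj ∘ₗ c.incl) ∘ₗ X.toLin' ∘ₗ (c.proj ∘ₗ c.incl) ∘ₗ
          (c.proj ∘ₗ c.incl) := by
      rw [map_mul, map_mul, ← c.incl_proj, hy]
      rfl
    rw [h1, rep_apply, h2, c.proj_incl]
    simp

end CornerSplitting

end CornerSplittings

section CornerSplittingOfCharacters

open Module

theorem exists_coordinates_of_idempotent {E V : Type*} [Field E] [AddCommGroup V] [Module E V]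
    [FiniteDimensional E V] {Q : End E V} (hQ : Q * Q = Q) {n : ℕ}
    (hn : finrank E (LinearMap.range Q) = n) :
    ∃ (P : (Fin n → E) →ₗ[E] V) (R : V →ₗ[E] (Fin n → E)), P ∘ₗ R = Q ∧ R ∘ₗ P = LinearMap.id := by
  subst hn
  let b := (finBasis E (LinearMap.range Q)).equivFun
  refine ⟨(LinearMap.range Q).subtype ∘ₗ b.symm.toLinearMap,
    b.toLinearMap ∘ₗ Q.rangeRestrict, ?_, ?_⟩
  · ext v
    simp
  · apply LinearMap.ext
    intro x
    change b (Q.rangeRestrict (b.symm x)) = x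
    rw [← LinearEquiv.eq_symm_apply]
    apply Subtype.ext
    obtain ⟨v, hv⟩ := (b.symm x).2
    change Q (b.symm x) = b.symm x
    rw [← hv]
    exact LinearMap.congr_fun hQ v

variable {K L E V U : Type*} [Group K] [Finite K] [Group L] [Finite L] [Field E] [IsAlgClosed E]
  [AddCommGroup V] [Module E V] [AddCommGroup U] [Module E U]
  (ρ : Representation E K V) (τ : Representation E L U) (ι : L →* K)
  [τ.IsIrreducible] [hτ : Module.Projective E[L] τ.asModule]

omit [Finite K] [Finite L] [IsAlgClosed E] [τ.IsIrreducible] hτ in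
theorem Representation.intertwining_asAlgebraHom
    (T : Representation.IntertwiningMap τ (ρ.comp ι : Representation E L V))
    (y : E[L]) (u : U) :
    T (τ.asAlgebraHom y u) = ρ.asAlgebraHom (mapDomain ι y) (T u) := by
  induction y using induction_linear with
  | zero => simp
  | add x y hx hy =>
    rw [map_add, LinearMap.add_apply, map_add, hx, hy, mapDomain_add, map_add,
      LinearMap.add_apply]
  | single l c =>
    rw [mapDomain_single, asAlgebraHom_single, asAlgebraHom_single,
      LinearMap.smul_apply, LinearMap.smul_apply, map_smul]
    congr 1
    exact Representation.IntertwiningMap.isIntertwining _ _ T l u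

omit [Finite K] [Finite L] [IsAlgClosed E] [τ.IsIrreducible] hτ in
/-- Evaluation at a vector identifies the homomorphisms from a simple projective module with the
range of a primitive idempotent. -/
theorem Representation.finrank_range_eq_finrank_intertwiningMap
    (β : End E U →ₗ[E] E[L]) (hβ : ∀ A, τ.asAlgebraHom (β A) = A)
    (hmul : ∀ x A, x * β A = β (τ.asAlgebraHom x * A)) (f : U →ₗ[E] E) (u : U) (hfu : f u = 1) :
    finrank E (LinearMap.range
      (ρ.asAlgebraHom (mapDomain ι (β (f.smulRight u))))) =
      finrank E (Representation.IntertwiningMap τ (ρ.comp ι : Representation E L V)) := by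
  have hm : ∀ x y : E[L], ρ.asAlgebraHom (mapDomain ι (x * y)) =
      ρ.asAlgebraHom (mapDomain ι x) * ρ.asAlgebraHom (mapDomain ι y) :=
    fun x y => by
      rw [← map_mul]
      exact congrArg _ (map_mul (mapDomainRingHom E ι) x y)
  have hsm : ∀ v w : U, f.smulRight v * f.smulRight w = f w • f.smulRight v := by
    intro v w
    ext x
    simp [smul_comm (f x) (f w) v]
  have hlin : ∀ (A B : End E U), mapDomain ι (β (A + B)) =
      mapDomain ι (β A) + mapDomain ι (β B) := fun A B => by
    rw [map_add, mapDomain_add]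
  let W := LinearMap.range (ρ.asAlgebraHom (mapDomain ι (β (f.smulRight u))))
  have hββ : ∀ v, β (f.smulRight v) * β (f.smulRight u) = β (f.smulRight v) := fun v => by
    rw [hmul, hβ, hsm, hfu, one_smul]
  have hW : ∀ w : W, ρ.asAlgebraHom (mapDomain ι (β (f.smulRight u))) w = w := by
    rintro ⟨_, v, rfl⟩
    change (ρ.asAlgebraHom _ * ρ.asAlgebraHom _) v = _
    rw [← hm, hββ]
  let Φ : W →ₗ[E] Representation.IntertwiningMap τ (ρ.comp ι : Representation E L V) :=
    { toFun := fun w =>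
        { toFun := fun v => ρ.asAlgebraHom (mapDomain ι (β (f.smulRight v))) w
          map_add' := fun v v' => by
            have h : f.smulRight (v + v') = f.smulRight v + f.smulRight v' := by
              ext x; simp
            rw [h, hlin, map_add, LinearMap.add_apply]
          map_smul' := fun c v => by
            have h : f.smulRight (c • v) = c • f.smulRight v := by
              ext x; simp [smul_comm (f x) c v]
            rw [h, map_smul, mapDomain_smul, map_smul]
            rfl
          isIntertwining' := fun l => by
            ext v
            change ρ.asAlgebraHom (mapDomain ι (β (f.smulRight (τ l v)))) w =
              ρ (ι l) (ρ.asAlgebraHom (mapDomain ι (β (f.smulRight v))) w)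
            have h1 : f.smulRight (τ l v) = τ.asAlgebraHom (of E L l) *
                f.smulRight v := by
              ext x
              simp
            have h2 : mapDomain ι (of E L l) =
              of E K (ι l) := by simp
            rw [h1, ← hmul, hm, h2, asAlgebraHom_of]
            rfl }
      map_add' := fun w w' => by
        ext v
        exact map_add (ρ.asAlgebraHom _) (w : V) w'
      map_smul' := fun c w => by
        ext v
        exact map_smul (ρ.asAlgebraHom _) c (w : V) }
  have hΦ : ∀ w v, Φ w v = ρ.asAlgebraHom (mapDomain ι (β (f.smulRight v))) w :=
    fun _ _ => rfl
  refine (LinearEquiv.ofBijective Φ ⟨?_, ?_⟩).finrank_eq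
  · intro w w' hww
    apply Subtype.ext
    rw [← hW, ← hW w', ← hΦ, ← hΦ, hww]
  · intro T
    refine ⟨⟨T u, T u, ?_⟩, ?_⟩
    · rw [← intertwining_asAlgebraHom, hβ]
      simp [hfu]
    · ext v
      change ρ.asAlgebraHom (mapDomain ι (β (f.smulRight v))) (T u) = T v
      rw [← intertwining_asAlgebraHom, hβ]
      simp [hfu]

/-- The corner at `e_φ e_θ`: the matrix units come from the matrix algebra `E L e_φ`, and the range of
one of their diagonal idempotents on the module of `θ` is the multiplicity space of `φ`. -/
theorem Representation.exists_cornerSplitting [ρ.IsIrreducible]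
    [hρ : Module.Projective E[K] ρ.asModule] {n : ℕ}
    (hn : finrank E (Representation.IntertwiningMap τ (ρ.comp ι : Representation E L V)) = n) :
    ∃ (d : ℕ) (c : CornerSplitting E E[K] V d n), c.toEnd = ρ.asAlgebraHom ∧
      c.e = charIdem ρ.character ∧
      c.f = mapDomain ι (charIdem τ.character) ∧
      (∀ a b, ∃ y : E[L], c.unit a b = mapDomain ι y) ∧
      ∀ y : E[L], mapDomain ι (y * charIdem τ.character) ∈
        span E (Set.range fun p : Fin d × Fin d => c.unit p.1 p.2) := by
  have := ρ.finiteDimensional_of_isIrreducible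
  have := τ.finiteDimensional_of_isIrreducible
  have := τ.nontrivial_of_isIrreducible
  obtain ⟨k, hk0, he, -, hk, -⟩ := τ.charIdem_character_eq
  let b := finBasis E U
  let β : End E U →ₗ[E] E[L] := k⁻¹ • τ.traceElement
  have hβ : ∀ A, τ.asAlgebraHom (β A) = A := fun A => by
    rw [LinearMap.smul_apply, map_smul, hk, inv_smul_smul₀ hk0]
  have hβ1 : β 1 = charIdem τ.character := he.symm
  have hmul : ∀ x A, x * β A = β (τ.asAlgebraHom x * A) := fun x A => by
    rw [LinearMap.smul_apply, mul_smul_comm, mul_traceElement]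
    rfl
  have hββ : ∀ A B, β A * β B = β (A * B) := fun A B => by rw [hmul, hβ]
  let m : Fin (finrank E U) → Fin (finrank E U) → E[L] :=
    fun p q => β ((b.coord q).smulRight (b p))
  have hsm : ∀ p q q' s, (b.coord q).smulRight (b p) * (b.coord s).smulRight (b q') =
      if q = q' then (b.coord s).smulRight (b p) else 0 := by
    intro p q q' s
    ext x
    by_cases h : q = q'
    · subst h
      simp
    · simp [h]
  have hmm : ∀ p q q' s, m p q * m q' s = if q = q' then m p s else 0 := by
    intro p q q' s
    change β _ * β _ = _
    rw [hββ, hsm]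
    split_ifs
    · rfl
    · exact map_zero β
  have hsum : ∀ A : End E U, A = ∑ p, ∑ q, b.coord p (A (b q)) • (b.coord q).smulRight (b p) := by
    intro A
    refine b.ext fun q => ?_
    conv_lhs => rw [← b.sum_repr (A (b q))]
    simp [LinearMap.sum_apply, Finsupp.single_apply]
  have hmapmul : ∀ x y : E[L], mapDomain ι (x * y) =
      mapDomain ι x * mapDomain ι y :=
    fun x y => map_mul (mapDomainRingHom E ι) x y
  have hd : 0 < finrank E U := finrank_pos
  let o : Fin (finrank E U) := ⟨0, hd⟩
  have hQ : ρ.asAlgebraHom (mapDomain ι (m o o)) *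
      ρ.asAlgebraHom (mapDomain ι (m o o)) =
      ρ.asAlgebraHom (mapDomain ι (m o o)) := by
    rw [← map_mul, ← hmapmul, hmm, if_pos rfl]
  have hrank := ρ.finrank_range_eq_finrank_intertwiningMap τ ι β hβ hmul (b.coord o) (b o) (by simp)
  obtain ⟨P, R, hPR, hRP⟩ := exists_coordinates_of_idempotent hQ (hrank.trans hn)
  refine ⟨finrank E U,
    { toEnd := ρ.asAlgebraHom
      surjective := ρ.asAlgebraHom_surjective
      e := charIdem ρ.character
      mul_e := ρ.mul_charIdem_comm
      toEnd_e := ρ.asAlgebraHom_charIdem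
      mul_e_eq_zero := fun x hx => ρ.mul_charIdem_eq_zero hx
      unit := fun p q => mapDomain ι (m p q)
      unit_mul := fun p q q' s => by
        rw [← hmapmul, hmm]
        split_ifs
        · rfl
        · exact mapDomain_zero _
      o := o
      incl := P
      proj := R
      incl_proj := hPR
      proj_incl := hRP }, rfl, rfl, ?_, fun a b => ⟨_, rfl⟩, fun y => ?_⟩
  · rw [← hβ1, CornerSplitting.f, hsum 1, map_sum]
    change _ = mapDomainRingHom E ι _
    rw [map_sum]
    refine sum_congr rfl fun p _ => ?_
    rw [map_sum, Finset.sum_eq_single p]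
    · simp
      rfl
    · intro q _ hqp
      simp [hqp]
    · simp
  · rw [← hβ1, hmul, mul_one, hsum (τ.asAlgebraHom y), map_sum]
    change mapDomainRingHom E ι _ ∈ _
    rw [map_sum]
    refine Submodule.sum_mem _ fun p _ => ?_
    rw [map_sum, map_sum]
    refine Submodule.sum_mem _ fun q _ => ?_
    rw [map_smul]
    change mapDomain ι _ ∈ _
    rw [mapDomain_smul]
    exact Submodule.smul_mem _ _ (subset_span ⟨(p, q), rfl⟩)

end CornerSplittingOfCharacters

section CoefficientFunctionals

variable {K E F : Type*} [Group K] [Field E] [Field F] [Algebra F E] {M : IntermediateField F E}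

/-- An `M`-linear functional of `E`, applied to the coefficients of an element of `E K`. -/
noncomputable def mapCoeff (r : E →ₗ[M] M) (x : E[K]) : E[K] :=
  .ofCoeff (x.coeff.mapRange (fun a => (r a : E)) (by rw [map_zero]; rfl))

omit [Group K] in
theorem coeff_mapCoeff (r : E →ₗ[M] M) (x : E[K]) (g : K) :
    (mapCoeff r x).coeff g = r (x.coeff g) := rfl

theorem mapCoeff_mem (r : E →ₗ[M] M) (x : E[K]) :
    mapCoeff r x ∈ coeffSubring K M :=
  mem_coeffSubring.2 fun g => (r (x.coeff g)).2

theorem mapCoeff_mul (r : E →ₗ[M] M) (x : E[K]) {y : E[K]}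
    (hy : y ∈ coeffSubring K M) : mapCoeff r (x * y) = mapCoeff r x * y := by
  classical
  ext g
  rw [coeff_mapCoeff, MonoidAlgebra.coeff_mul_apply_right, MonoidAlgebra.coeff_mul_apply_right,
    Finsupp.sum, Finsupp.sum, map_sum, AddSubmonoidClass.coe_finsetSum]
  refine sum_congr rfl fun h _ => ?_
  obtain ⟨m, hm⟩ : ∃ m : M, (m : E) = y.coeff h := ⟨⟨_, mem_coeffSubring.1 hy h⟩, rfl⟩
  rw [← hm, coeff_mapCoeff, mul_comm, mul_comm (r _ : E)]
  have h1 : (m : E) * x.coeff (g * h⁻¹) = m • x.coeff (g * h⁻¹) := rfl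
  rw [h1, map_smul]
  rfl

theorem mapCoeff_mul_left (r : E →ₗ[M] M) {x : E[K]} (y : E[K])
    (hx : x ∈ coeffSubring K M) : mapCoeff r (x * y) = x * mapCoeff r y := by
  classical
  ext g
  rw [coeff_mapCoeff, coeff_mul_apply_left, coeff_mul_apply_left,
    Finsupp.sum, Finsupp.sum, map_sum, AddSubmonoidClass.coe_finsetSum]
  refine sum_congr rfl fun h _ => ?_
  obtain ⟨m, hm⟩ : ∃ m : M, (m : E) = x.coeff h := ⟨⟨_, mem_coeffSubring.1 hx h⟩, rfl⟩
  rw [← hm, coeff_mapCoeff]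
  have h1 : (m : E) * y.coeff (h⁻¹ * g) = m • y.coeff (h⁻¹ * g) := rfl
  rw [h1, map_smul]
  rfl

theorem mem_span_mapCoeff [Finite K] (x : E[K]) :
    x ∈ span E (Set.range fun r : E →ₗ[M] M => mapCoeff r x) := by
  classical
  have := Fintype.ofFinite K
  let B := Module.Basis.ofVectorSpace M E
  have h : x = ∑ s ∈ Finset.univ.biUnion (fun g => (B.repr (x.coeff g)).support),
      B s • mapCoeff (B.coord s) x := by
    ext g
    rw [MonoidAlgebra.coeff_sum, Finsupp.finsetSum_apply]
    have h1 := B.linearCombination_repr (x.coeff g)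
    rw [Finsupp.linearCombination_apply, Finsupp.sum_of_support_subset _
      (Finset.subset_biUnion_of_mem (fun g => (B.repr (x.coeff g)).support) (Finset.mem_univ g)) _
      (fun _ _ => by simp)] at h1
    conv_lhs => rw [← h1]
    refine sum_congr rfl fun s _ => ?_
    rw [coeff_smul_apply, coeff_mapCoeff, smul_eq_mul, mul_comm]
    rfl
  rw [h]
  exact Submodule.sum_mem _ fun s _ => Submodule.smul_mem _ _ (subset_span ⟨_, by rw [← h]⟩)

end CoefficientFunctionals

section CharacterCorners

/-- The corner of `E K` attached to a pair of characters `θ` of `K` and `φ` of `L` with the same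
field of values `M`, together with the Galois conjugates of the idempotents `e` and `f`. -/
structure CharacterCorner {K L E F : Type*} [Group K] [Group L] [Field E] [Field F] [Algebra F E]
    (ι : L →* K) (M : IntermediateField F E) (V : Type*) [AddCommGroup V] [Module E V]
    (n : ℕ) where
  d : ℕ
  c : CornerSplitting E E[K] V d n
  unit_mem : ∀ a b, ∃ y : E[L], c.unit a b = mapDomain ι y
  mul_f_mem : ∀ y : E[L], mapDomain ι y * c.f ∈
    span E (Set.range fun p : Fin d × Fin d => c.unit p.1 p.2)
  mul_f : ∀ y : E[L],
    mapDomain ι y * c.f = c.f * mapDomain ι y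
  e_mem : c.e ∈ coeffSubring K M
  f_mem : c.f ∈ coeffSubring K M
  galConj_e_mul_e : ∀ γ : M ≃ₐ[F] M, γ ≠ 1 → galConj γ c.e * c.e = 0
  mul_galConj_e : ∀ (γ : M ≃ₐ[F] M) x, x * galConj γ c.e = galConj γ c.e * x

namespace CharacterCorner

variable {K L E F : Type*} [Group K] [Group L] [Field E] [Field F] [Algebra F E]
    {ι : L →* K} {M : IntermediateField F E} {V : Type*} [AddCommGroup V] [Module E V]
    {n : ℕ} (C : CharacterCorner ι M V n)

/-- The idempotent `j = f e`. -/
noncomputable def j : E[K] := C.c.f * C.c.e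

theorem j_mem : C.j ∈ coeffSubring K M := mul_mem C.f_mem C.e_mem

theorem e_mul_f : C.c.e * C.c.f = C.j := (C.c.mul_e _).symm

theorem j_mul_j : C.j * C.j = C.j := by
  rw [j, mul_assoc, ← mul_assoc C.c.e, ← C.c.mul_e C.c.f, mul_assoc, C.c.e_mul_e, ← mul_assoc,
    C.c.f_mul_f]

theorem j_mul_e : C.j * C.c.e = C.j := by rw [j, mul_assoc, C.c.e_mul_e]

theorem j_mul_f : C.j * C.c.f = C.j := by rw [j, mul_assoc, C.e_mul_f, j, ← mul_assoc, C.c.f_mul_f]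

theorem f_mul_j : C.c.f * C.j = C.j := by rw [j, ← mul_assoc, C.c.f_mul_f]

theorem unit_commute {x : E[K]}
    (hx : ∀ l, of E K (ι l) * x = x * of E K (ι l)) (a b : Fin C.d) :
    C.c.unit a b * x = x * C.c.unit a b := by
  obtain ⟨y, hy⟩ := C.unit_mem a b
  rw [hy]
  clear hy
  induction y using induction_linear with
  | zero => rw [mapDomain_zero, zero_mul, mul_zero]
  | add y z hy hz => rw [mapDomain_add, add_mul, mul_add, hy, hz]
  | single l t =>
    have h : mapDomain ι (single l t) =
        t • of E K (ι l) := by simp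
    rw [h, smul_mul_assoc, mul_smul_comm, hx]

theorem mapDomain_of (l : L) :
    mapDomain ι (of E L l) = of E K (ι l) := by
  simp

theorem of_mul_f (l : L) :
    of E K (ι l) * C.c.f = C.c.f * of E K (ι l) := by
  rw [← mapDomain_of, C.mul_f]

theorem of_mul_j (l : L) :
    of E K (ι l) * C.j = C.j * of E K (ι l) := by
  rw [j, ← mul_assoc, of_mul_f, mul_assoc, C.c.mul_e, mul_assoc]

theorem of_commute {x : E[K]}
    (hx : ∀ a b, C.c.unit a b * x = x * C.c.unit a b) (hf : x * C.c.f = x) (l : L) :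
    of E K (ι l) * x = x * of E K (ι l) := by
  have h2 := mul_comm_of_mem_span (a := x) (by
    rintro _ ⟨p, rfl⟩
    exact hx _ _) (C.mul_f_mem (of E L l))
  rw [mapDomain_of] at h2
  calc of E K (ι l) * x = of E K (ι l) * C.c.f * x := by
        rw [mul_assoc, C.c.f_mul_comm hx, hf]
    _ = x * of E K (ι l) := by
        rw [h2, of_mul_f, ← mul_assoc, hf]

theorem rep_mul_j (x : E[K]) : C.c.rep (x * C.j) = C.c.rep x := by
  rw [j, ← mul_assoc, C.c.rep_mul_e, C.c.rep_mul_f]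

theorem rep_j : C.c.rep C.j = 1 := by
  rw [← mul_one (C.c.rep C.j), ← C.c.rep_unit, ← C.c.rep_mul _ rfl, j, mul_assoc, ← C.c.mul_e,
    ← mul_assoc, C.c.f_mul_unit, C.c.rep_mul_e]

theorem galConj_j (γ : M ≃ₐ[F] M) : galConj γ C.j = galConj γ C.c.f * galConj γ C.c.e :=
  galConj_mul γ C.f_mem C.e_mem

theorem galConj_e_mul_galConj_e {γ δ : M ≃ₐ[F] M} (h : γ ≠ δ) :
    galConj γ C.c.e * galConj δ C.c.e = 0 := by
  have h1 := C.galConj_e_mul_e (δ⁻¹ * γ) (fun h' => h (inv_mul_eq_one.1 h').symm)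
  have h2 := congrArg (galConj δ) h1
  rw [galConj_mul δ (galConj_mem _ C.e_mem) C.e_mem, galConj_galConj _ _ C.e_mem,
    mul_inv_cancel_left, galConj_zero] at h2
  exact h2

theorem galConj_j_mul_galConj_e {γ δ : M ≃ₐ[F] M} (h : γ ≠ δ) :
    galConj γ C.j * galConj δ C.c.e = 0 := by
  rw [galConj_j, mul_assoc, C.galConj_e_mul_galConj_e h, mul_zero]

theorem galConj_j_mul_galConj_j {γ δ : M ≃ₐ[F] M} (h : γ ≠ δ) :
    galConj γ C.j * galConj δ C.j = 0 := by
  rw [C.galConj_j δ, C.mul_galConj_e δ, ← mul_assoc, galConj_j_mul_galConj_e C h, zero_mul]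

theorem galConj_j_mul_self (γ : M ≃ₐ[F] M) : galConj γ C.j * galConj γ C.j = galConj γ C.j := by
  rw [← galConj_mul γ C.j_mem C.j_mem, j_mul_j]

variable [Fintype (M ≃ₐ[F] M)]

/-- The idempotent `i`, the sum of the Galois conjugates of `j`. -/
noncomputable def i : E[K] := ∑ γ : M ≃ₐ[F] M, galConj γ C.j

theorem i_mul_galConj_j (γ : M ≃ₐ[F] M) : C.i * galConj γ C.j = galConj γ C.j := by
  rw [i, sum_mul, Finset.sum_eq_single γ, galConj_j_mul_self]
  · exact fun δ _ h => C.galConj_j_mul_galConj_j h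
  · simp

theorem galConj_j_mul_i (γ : M ≃ₐ[F] M) : galConj γ C.j * C.i = galConj γ C.j := by
  rw [i, mul_sum, Finset.sum_eq_single γ, galConj_j_mul_self]
  · exact fun δ _ h => C.galConj_j_mul_galConj_j h.symm
  · simp

theorem i_mul_i : C.i * C.i = C.i := by
  conv_lhs => rw [i, sum_mul]
  exact sum_congr rfl fun γ _ => C.galConj_j_mul_i γ

theorem i_mul_galConj_e (γ : M ≃ₐ[F] M) : C.i * galConj γ C.c.e = galConj γ C.j := by
  rw [i, sum_mul, Finset.sum_eq_single γ, galConj_j, mul_assoc, ← galConj_mul γ C.e_mem C.e_mem,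
    C.c.e_mul_e]
  · exact fun δ _ h => C.galConj_j_mul_galConj_e h
  · simp

theorem i_mul_e : C.i * C.c.e = C.j := by
  have h := C.i_mul_galConj_e 1
  rwa [galConj_one_apply C.e_mem, galConj_one_apply C.j_mem] at h

theorem i_mul_j : C.i * C.j = C.j := by
  have h := C.i_mul_galConj_j 1
  rwa [galConj_one_apply C.j_mem] at h

theorem j_mul_i : C.j * C.i = C.j := by
  have h := C.galConj_j_mul_i 1
  rwa [galConj_one_apply C.j_mem] at h

theorem mul_e_eq_mul_j {x : E[K]} (hx : x * C.i = x) : x * C.c.e = x * C.j := by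
  conv_lhs => rw [← hx, mul_assoc, i_mul_e]

theorem mul_j_comm {x : E[K]} (hx : C.i * x = x) (hx' : x * C.i = x) :
    x * C.j = C.j * x := by
  rw [← mul_e_eq_mul_j C hx', C.c.mul_e, ← i_mul_e, mul_assoc, ← C.c.mul_e, ← mul_assoc, hx]

theorem i_mem : C.i ∈ coeffSubring K M := sum_mem fun γ _ => galConj_mem γ C.j_mem

theorem galConj_i (γ : M ≃ₐ[F] M) : galConj γ C.i = C.i := by
  rw [i, galConj_sum γ _ _ fun δ _ => galConj_mem δ C.j_mem]
  simp only [galConj_galConj _ _ C.j_mem]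
  exact Fintype.sum_equiv (Equiv.mulLeft γ) _ _ fun _ => rfl

/-- Elements of the corner `i F K i`. -/
structure InCorner (x : E[K]) : Prop where
  mem : x ∈ (mapRingHom K (algebraMap F E)).range
  i_mul : C.i * x = x
  mul_i : x * C.i = x

variable {C} in
theorem InCorner.coeff_mem {x : E[K]} (hx : C.InCorner x) : x ∈ coeffSubring K M := by
  obtain ⟨y, rfl⟩ := hx.mem
  exact mapRingHom_mem_coeffSubring y

variable {C} in
theorem InCorner.galConj {x : E[K]} (hx : C.InCorner x) (γ : M ≃ₐ[F] M) :
    galConj γ x = x := by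
  obtain ⟨y, rfl⟩ := hx.mem
  exact galConj_of_mem_range γ y

/-- Elements of the centraliser of `L` in `i F K i`. -/
structure InS (x : E[K]) : Prop extends C.InCorner x where
  comm : ∀ l, of E K (ι l) * x = x * of E K (ι l)

/-- The sum of the Galois conjugates. -/
noncomputable def galSum (x : E[K]) : E[K] :=
  ∑ γ : M ≃ₐ[F] M, _root_.galConj γ x

theorem galSum_mul_j {x : E[K]} (hx : C.InCorner x) :
    galSum (M := M) (x * C.j) = x := by
  conv_rhs => rw [← hx.mul_i, i, mul_sum]
  exact sum_congr rfl fun γ _ => by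
    rw [galConj_mul γ hx.coeff_mem C.j_mem, hx.galConj]

theorem eq_of_mul_j_eq {x y : E[K]} (hx : C.InCorner x) (hy : C.InCorner y)
    (h : x * C.j = y * C.j) : x = y := by
  rw [← C.galSum_mul_j hx, h, C.galSum_mul_j hy]

theorem galSum_mul_j_self {b : E[K]} (hb : b ∈ coeffSubring K M)
    (hbj : b * C.j = b) : galSum (M := M) b * C.j = b := by
  rw [galSum, sum_mul, Finset.sum_eq_single 1, galConj_one_apply hb, hbj]
  · intro γ _ h
    rw [← hbj, galConj_mul γ hb C.j_mem, mul_assoc]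
    have h1 := C.galConj_j_mul_galConj_j h
    rw [galConj_one_apply C.j_mem] at h1
    rw [h1, mul_zero]
  · simp

theorem inCorner_galSum [IsGalois F M] {b : E[K]} (hb : b ∈ coeffSubring K M)
    (hjb : C.j * b = b) (hbj : b * C.j = b) : C.InCorner (galSum (M := M) b) := by
  refine ⟨?_, ?_, ?_⟩
  · obtain ⟨y, hy⟩ := exists_mapRingHom_eq_of_galConj_eq (M := M) (x := galSum (M := M) b)
      (sum_mem fun γ _ => galConj_mem γ hb) (fun γ => by
        rw [galSum, galConj_sum γ _ _ fun δ _ => galConj_mem δ hb]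
        simp only [galConj_galConj _ _ hb]
        exact Fintype.sum_equiv (Equiv.mulLeft γ) _ _ fun _ => rfl)
    exact ⟨y, hy⟩
  · rw [galSum, mul_sum]
    refine sum_congr rfl fun γ _ => ?_
    conv_lhs => rw [← C.galConj_i γ, ← galConj_mul γ C.i_mem hb, ← hjb, ← mul_assoc, i_mul_j, hjb]
  · rw [galSum, sum_mul]
    refine sum_congr rfl fun γ _ => ?_
    conv_lhs => rw [← C.galConj_i γ, ← galConj_mul γ hb C.i_mem, ← hbj, mul_assoc, j_mul_i, hbj]

theorem inS_galSum [IsGalois F M] {b : E[K]} (hb : b ∈ coeffSubring K M)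
    (hjb : C.j * b = b) (hbj : b * C.j = b)
    (hl : ∀ l, of E K (ι l) * b = b * of E K (ι l)) :
    C.InS (galSum (M := M) b) := by
  refine { toInCorner := C.inCorner_galSum hb hjb hbj, comm := fun l => ?_ }
  rw [galSum, mul_sum, sum_mul]
  refine sum_congr rfl fun γ _ => ?_
  have h := congrArg (_root_.galConj γ) (hl l)
  rwa [galConj_mul γ (of_mem_coeffSubring _) hb, galConj_mul γ hb (of_mem_coeffSubring _),
    galConj_of] at h

variable {C} in
theorem InCorner.mul {x y : E[K]} (hx : C.InCorner x) (hy : C.InCorner y) :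
    C.InCorner (x * y) :=
  ⟨mul_mem hx.mem hy.mem, by rw [← mul_assoc, hx.i_mul], by rw [mul_assoc, hy.mul_i]⟩

variable {C} in
theorem InCorner.add {x y : E[K]} (hx : C.InCorner x) (hy : C.InCorner y) :
    C.InCorner (x + y) :=
  ⟨add_mem hx.mem hy.mem, by rw [mul_add, hx.i_mul, hy.i_mul], by rw [add_mul, hx.mul_i, hy.mul_i]⟩

variable {C} in
theorem InS.rep_mul {y : E[K]} (hy : C.InS y) (x : E[K]) :
    C.c.rep (x * y) = C.c.rep x * C.c.rep y :=
  C.c.rep_mul x (C.unit_commute hy.comm _ _)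

omit [Fintype (M ≃ₐ[F] M)] in
theorem eq_of_rep_eq {x y : E[K]}
    (hx : ∀ l, of E K (ι l) * x = x * of E K (ι l))
    (hy : ∀ l, of E K (ι l) * y = y * of E K (ι l))
    (h : C.c.rep x = C.c.rep y) : x * C.j = y * C.j := by
  rw [← sub_eq_zero, ← sub_mul]
  refine C.c.eq_zero_of_rep_eq_zero (C.unit_commute fun l => ?_) ?_ ?_ ?_
  · rw [← mul_assoc, mul_sub, hx, hy, ← sub_mul, mul_assoc, of_mul_j, mul_assoc]
  · rw [mul_assoc, j_mul_e]
  · rw [mul_assoc, j_mul_f]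
  · rw [rep_mul_j, map_sub, h, sub_self]

theorem InS.eq_of_rep_eq {x y : E[K]} (hx : C.InS x) (hy : C.InS y)
    (h : C.c.rep x = C.c.rep y) : x = y :=
  C.eq_of_mul_j_eq hx.toInCorner hy.toInCorner (C.eq_of_rep_eq hx.comm hy.comm h)

/-- The matrices of the elements of `S` span the full matrix ring over `E`: an element of the corner
at `j` is a combination of its images under functionals `E → M` applied to the coefficients, and
the Galois sums of these images lie in `S`. -/
theorem span_rep_eq_top [Finite K] [IsGalois F M] :
    span E (C.c.rep '' {x | C.InS x}) = ⊤ := by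
  rw [eq_top_iff]
  rintro X -
  obtain ⟨b, hb, hbe, hbf, rfl⟩ := C.c.exists_rep_eq X
  have hbj : b * C.j = b := by rw [j, ← mul_assoc, hbf, hbe]
  have hjb : C.j * b = b := by
    rw [← e_mul_f, mul_assoc, C.c.f_mul_comm hb, ← mul_assoc, ← C.c.mul_e, hbe, hbf]
  have hbl := C.of_commute hb hbf
  have h1 := mem_span_mapCoeff (M := M) b
  have h2 := Submodule.mem_map_of_mem (f := C.c.rep) h1
  rw [Submodule.map_span] at h2
  refine Submodule.span_mono ?_ h2
  rintro _ ⟨_, ⟨r, rfl⟩, rfl⟩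
  have hm := mapCoeff_mem r b
  have h3 : mapCoeff r b * C.j = mapCoeff r b := by rw [← mapCoeff_mul r b C.j_mem, hbj]
  refine ⟨galSum (M := M) (mapCoeff r b), C.inS_galSum hm ?_ h3 fun l => ?_, ?_⟩
  · rw [← mapCoeff_mul_left r b C.j_mem, hjb]
  · rw [← mapCoeff_mul_left r b (of_mem_coeffSubring _), hbl,
      mapCoeff_mul r b (of_mem_coeffSubring _)]
  · rw [← rep_mul_j, C.galSum_mul_j_self hm h3]

/-- Elements of `S` that are linearly independent over the field of values remain so over `E`: a
relation can be specialised along a functional `E → M`, because the coefficients lie in `M`. -/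
theorem linearIndependent_rep {κ : Type*} [Finite κ] (a : κ → E[K])
    (ha : ∀ k, C.InS (a k)) (hli : LinearIndependent M fun k => C.c.rep (a k)) :
    LinearIndependent E fun k => C.c.rep (a k) := by
  have := Fintype.ofFinite κ
  rw [Fintype.linearIndependent_iff]
  intro x hx k
  have h1 : (∑ k, x k • a k) * C.j = 0 := by
    rw [← zero_mul C.j]
    refine C.eq_of_rep_eq (fun l => ?_) (fun l => by rw [mul_zero, zero_mul]) ?_
    · rw [mul_sum, sum_mul]
      exact sum_congr rfl fun k _ => by
        rw [mul_smul_comm, smul_mul_assoc, (ha k).comm]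
    · rw [map_sum, map_zero, ← hx]
      exact sum_congr rfl fun k _ => map_smul _ _ _
  by_contra hne
  let B := Module.Basis.ofVectorSpace M E
  obtain ⟨s, hs⟩ : ∃ s, B.coord s (x k) ≠ 0 := by
    by_contra hcon
    push Not at hcon
    exact hne (B.ext_elem_iff.2 fun s => (hcon s).trans (by simp))
  apply hs
  rw [Fintype.linearIndependent_iff] at hli
  refine hli (fun k => B.coord s (x k)) ?_ k
  have h2 : (∑ k, (B.coord s (x k) : E) • a k) * C.j = 0 := by
    ext g
    have h3 := congrArg (fun y => (B.coord s (y.coeff g) : E)) h1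
    simp only [sum_mul, smul_mul_assoc, MonoidAlgebra.coeff_sum, Finsupp.finsetSum_apply,
      map_sum, AddSubmonoidClass.coe_finsetSum, coeff_smul_apply, smul_eq_mul] at h3 ⊢
    rw [MonoidAlgebra.coeff_zero, Finsupp.zero_apply, map_zero] at h3
    refine Eq.trans ?_ h3
    refine sum_congr rfl fun k _ => ?_
    obtain ⟨m, hm⟩ : ∃ m : M, (m : E) = (a k * C.j).coeff g :=
      ⟨⟨_, mem_coeffSubring.1 (mul_mem (ha k).coeff_mem C.j_mem) g⟩, rfl⟩
    rw [← hm]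
    have h4 : x k * (m : E) = m • x k := mul_comm _ _
    rw [h4, map_smul, smul_eq_mul, mul_comm]
    rfl
  have h5 := congrArg C.c.rep h2
  rw [rep_mul_j, map_sum, map_zero] at h5
  rw [← h5]
  exact sum_congr rfl fun k _ => (map_smul C.c.rep (B.coord s (x k) : E) (a k)).symm

/-- The element of the centre of `i F K i` corresponding to `l ∈ M`. -/
noncomputable def zeta (l : M) : E[K] := galSum (M := M) ((l : E) • C.j)

theorem zeta_mul_j (l : M) : C.zeta l * C.j = (l : E) • C.j :=
  C.galSum_mul_j_self (smul_mem_coeffSubring l.2 C.j_mem) (by rw [smul_mul_assoc, j_mul_j])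

theorem rep_zeta (l : M) : C.c.rep (C.zeta l) = (l : E) • 1 := by
  rw [← rep_mul_j, zeta_mul_j, map_smul, rep_j]

theorem inS_zeta [IsGalois F M] (l : M) : C.InS (C.zeta l) :=
  C.inS_galSum (smul_mem_coeffSubring l.2 C.j_mem) (by rw [mul_smul_comm, j_mul_j])
    (by rw [smul_mul_assoc, j_mul_j]) fun l => by rw [mul_smul_comm, smul_mul_assoc, of_mul_j]

theorem zeta_commute [IsGalois F M] (l : M) {x : E[K]} (hx : C.InCorner x) :
    x * C.zeta l = C.zeta l * x := by
  have hz := (C.inS_zeta l).toInCorner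
  refine C.eq_of_mul_j_eq (hx.mul hz) (hz.mul hx) ?_
  rw [mul_assoc, zeta_mul_j, mul_assoc, C.mul_j_comm hx.i_mul hx.mul_i, ← mul_assoc, zeta_mul_j,
    mul_smul_comm, smul_mul_assoc, C.mul_j_comm hx.i_mul hx.mul_i]

theorem exists_zeta_eq [Finite K] [IsGalois F M] [NeZero n] {z : E[K]} (hz : C.InS z)
    (h : ∀ x, C.InS x → x * z = z * x) : ∃ l, C.zeta l = z := by
  have h1 : ∀ X : Matrix (Fin n) (Fin n) E, X * C.c.rep z = C.c.rep z * X := by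
    intro X
    refine mul_comm_of_mem_span ?_ (C.span_rep_eq_top.symm ▸ Submodule.mem_top (x := X))
    rintro _ ⟨x, hx, rfl⟩
    rw [← hz.rep_mul, ← InS.rep_mul hx, h x hx]
  have h2 : C.c.rep z ∈ Subalgebra.center E (Matrix (Fin n) (Fin n) E) :=
    Subalgebra.mem_center_iff.2 h1
  rw [Algebra.IsCentral.center_eq_bot, Algebra.mem_bot] at h2
  obtain ⟨t, ht⟩ := h2
  rw [Algebra.algebraMap_eq_smul_one] at ht
  have h3 : z * C.j = (t • C.j) * C.j := by
    refine C.eq_of_rep_eq hz.comm (fun l => ?_) ?_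
    · rw [mul_smul_comm, smul_mul_assoc, of_mul_j]
    · rw [map_smul, rep_j, ht]
  rw [smul_mul_assoc, j_mul_j] at h3
  have hj0 : C.j ≠ 0 := by
    intro h0
    have h4 := C.rep_j
    rw [h0, map_zero] at h4
    exact zero_ne_one h4
  obtain ⟨g, hg⟩ : ∃ g, C.j.coeff g ≠ 0 := by
    by_contra hcon
    push Not at hcon
    exact hj0 (MonoidAlgebra.ext (Finsupp.ext hcon))
  have htM : t ∈ M := by
    have h4 := mem_coeffSubring.1 (mul_mem hz.coeff_mem C.j_mem) g
    rw [h3, coeff_smul_apply, smul_eq_mul] at h4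
    have h5 := div_mem h4 (mem_coeffSubring.1 C.j_mem g)
    rwa [mul_div_cancel_right₀ _ hg] at h5
  refine ⟨⟨t, htM⟩, C.eq_of_mul_j_eq (C.inS_zeta _).toInCorner hz.toInCorner ?_⟩
  rw [zeta_mul_j, h3]

end CharacterCorner

end CharacterCorners

/-! ### The action of the normalizing subgroup on the corner -/

/-- The inclusion of `L = H ∩ K` into `K`. -/
abbrev interIncl {G : Type*} [Group G] (H K : Subgroup G) : ↥(H ⊓ K) →* K :=
  Subgroup.inclusion inf_le_right

section Inclusion

variable {G : Type*} [Group G] {E : Type*} [Field E] (K : Subgroup G)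

/-- The inclusion `E K → E G`. -/
noncomputable def inclK : E[K] →+* E[G] :=
  mapDomainRingHom E K.subtype

theorem inclK_apply (x : E[K]) :
    inclK K x = mapDomain K.subtype x := rfl

theorem inclK_injective : Function.Injective (inclK (E := E) K) :=
  mapDomain_injective K.subtype_injective

theorem inclK_of (k : K) : inclK K (of E K k) = of E G k := by
  simp [inclK]

theorem inclK_smul (t : E) (x : E[K]) : inclK K (t • x) = t • inclK K x := by
  rw [inclK_apply, mapDomain_smul]
  rfl

variable [K.Normal]

/-- Conjugation `x ↦ h⁻¹ x h` on `E K`. -/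
noncomputable def twist (h : G) : E[K] →+* E[K] :=
  mapDomainRingHom E ((MulAut.conjNormal h).symm : K ≃* K)

theorem twist_of (h : G) (k : K) : twist K h (of E K k) =
    of E K ((MulAut.conjNormal h).symm k) := by
  simp [twist]

theorem twist_single (h : G) (k : K) (t : E) : twist K h (single k t) =
    single ((MulAut.conjNormal h).symm k) t :=
  mapDomain_single

theorem twist_smul (h : G) (t : E) (x : E[K]) :
    twist K h (t • x) = t • twist K h x := by
  change mapDomain _ (t • x) = _
  rw [mapDomain_smul]
  rfl

theorem conjBy_inclK (h : G) (x : E[K]) :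
    conjBy h (inclK K x) = inclK K (twist K h x) := by
  induction x using induction_linear with
  | zero => simp [conjBy]
  | add x y hx hy =>
    rw [map_add, map_add, map_add, ← hx, ← hy, conjBy, conjBy, conjBy, mul_add, add_mul]
  | single k t =>
    have h1 : single k t = t • of E K k := by simp
    rw [h1, inclK_smul, twist_smul, inclK_smul, twist_of, inclK_of, inclK_of, conjBy, mul_smul_comm,
      smul_mul_assoc, ← map_mul, ← map_mul, MulAut.conjNormal_symm_apply]

theorem twist_mul (g h : G) (x : E[K]) : twist K (g * h) x = twist K h (twist K g x) := by
  apply inclK_injective K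
  rw [← conjBy_inclK, ← conjBy_inclK, ← conjBy_inclK, conjBy, conjBy, conjBy, mul_inv_rev, map_mul,
    map_mul]
  simp only [mul_assoc]

variable {F : Type*} [Field F] [Algebra F E] {M : IntermediateField F E} {K}

theorem twist_mem (h : G) {x : E[K]} (hx : x ∈ coeffSubring K M) :
    twist K h x ∈ coeffSubring K M :=
  mapDomain_mem_coeffSubring _ hx

theorem galConj_twist (γ : M ≃ₐ[F] M) (h : G) {x : E[K]} (hx : x ∈ coeffSubring K M) :
    galConj γ (twist K h x) = twist K h (galConj γ x) :=
  galConj_mapDomain γ _ hx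

theorem twist_mem_range (h : G) {x : E[K]}
    (hx : x ∈ (mapRingHom K (algebraMap F E)).range) :
    twist K h x ∈ (mapRingHom K (algebraMap F E)).range := by
  obtain ⟨y, rfl⟩ := hx
  exact ⟨twist K h y, RingHom.congr_fun
    (mapRingHom_comp_mapDomainRingHom (algebraMap F E) _) y⟩

omit [K.Normal] in
theorem mem_subAlg {a : E[G]} : a ∈ subAlg F K E ↔
    ∃ x ∈ (mapRingHom K (algebraMap F E)).range, inclK K x = a := by
  have h : (mapRingHom G (algebraMap F E)).comp
      (mapDomainRingHom F K.subtype) =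
      (inclK K).comp (mapRingHom K (algebraMap F E)) :=
    mapRingHom_comp_mapDomainRingHom (algebraMap F E) _
  rw [subAlg, h]
  constructor
  · rintro ⟨y, rfl⟩
    exact ⟨_, ⟨y, rfl⟩, rfl⟩
  · rintro ⟨_, ⟨y, rfl⟩, rfl⟩
    exact ⟨y, rfl⟩

end Inclusion

section ConfigurationCorner

open Module

variable {G : Type*} [Group G] {K H : Subgroup G} {E F : Type*} [Field E] [Field F] [Algebra F E]

/-- Conjugation by an element of `H` on `H ∩ K`. -/
def conjInf [K.Normal] (h : H) : ↥(H ⊓ K) ≃* ↥(H ⊓ K) where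
  toFun l := ⟨h * l * h⁻¹, H.mul_mem (H.mul_mem h.2 l.2.1) (H.inv_mem h.2),
    ‹K.Normal›.conj_mem _ l.2.2 _⟩
  invFun l := ⟨h⁻¹ * l * h, H.mul_mem (H.mul_mem (H.inv_mem h.2) l.2.1) h.2, by
    have h1 := ‹K.Normal›.conj_mem _ l.2.2 (h : G)⁻¹
    rwa [inv_inv] at h1⟩
  left_inv l := Subtype.ext (by simp [mul_assoc])
  right_inv l := Subtype.ext (by simp [mul_assoc])
  map_mul' l l' := Subtype.ext (by simp [mul_assoc])

variable {V U : Type*} [AddCommGroup V] [Module E V] [AddCommGroup U] [Module E U]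

theorem SemiInvariantConfig.exists_characterCorner [Finite G] [IsAlgClosed E]
    {ρ : Representation E K V} {τ : Representation E ↥(H ⊓ K) U}
    (cfg : SemiInvariantConfig F K H ρ τ) :
    ∃ C : CharacterCorner (interIncl H K)
        (charField F τ.character) V (charMult ρ τ),
      C.c.e = charIdem ρ.character ∧
      C.c.f = mapDomain (interIncl H K)
        (charIdem τ.character) ∧ C.c.toEnd = ρ.asAlgebraHom := by
  have := cfg.simple_theta
  have := cfg.simple_phi
  have := cfg.proj_theta
  have := cfg.proj_phi
  obtain ⟨d, c, h1, h2, h3, h4, h5⟩ := ρ.exists_cornerSplitting τ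
    (interIncl H K) (n := charMult ρ τ) rfl
  have hmm : ∀ x y, mapDomain (interIncl H K) (x * y)
      = mapDomain (interIncl H K) x *
        (mapDomain (interIncl H K) y :
          E[K]) :=
    fun x y => map_mul (mapDomainRingHom E _) x y
  refine ⟨⟨d, c, h4, fun y => ?_, fun y => ?_, ?_, ?_, fun γ hγ => ?_, fun γ x => ?_⟩, h2, h3, h1⟩
  · rw [h3, ← hmm]
    exact h5 y
  · rw [h3, ← hmm, ← hmm, τ.mul_charIdem_comm]
  · rw [h2]
    exact ρ.charIdem_mem_coeffSubring cfg.field_eq.symm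
  · rw [h3]
    exact mapDomain_mem_coeffSubring _ (τ.charIdem_mem_coeffSubring rfl)
  · rw [h2]
    exact ρ.galConj_charIdem_mul_charIdem cfg.field_eq.symm hγ
  · rw [h2]
    exact ρ.mul_galConj_charIdem_comm cfg.field_eq.symm γ x

theorem twist_mapDomain_inclusion [K.Normal] (h : H) (y : E[↥(H ⊓ K)]) :
    twist K (h : G) (mapDomain (interIncl H K) y) =
      mapDomain (interIncl H K)
        (mapDomain (conjInf h).symm y) := by
  induction y using induction_linear with
  | zero => rw [mapDomain_zero, mapDomain_zero,
      mapDomain_zero, map_zero]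
  | add x y hx hy => rw [mapDomain_add, mapDomain_add,
      mapDomain_add, map_add, hx, hy]
  | single l t =>
    rw [mapDomain_single, mapDomain_single,
      mapDomain_single, twist_single]
    congr 1
    apply Subtype.ext
    rw [MulAut.conjNormal_symm_apply]
    rfl

omit [Group G] in
theorem mapDomain_mulEquiv_mem_coeffSubring {N : Type*} [Group N] {M : IntermediateField F E}
    (f : N ≃* N) {y : E[N]} (hy : y ∈ coeffSubring N M) :
    mapDomain f y ∈ coeffSubring N M :=
  mapDomain_mem_coeffSubring (f : N →* N) hy

theorem galConj_twist_mapDomain_inclusion [K.Normal] {M : IntermediateField F E} (h : H)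
    (γ : M ≃ₐ[F] M) {y : E[↥(H ⊓ K)]} (hy : y ∈ coeffSubring ↥(H ⊓ K) M)
    (hγ : galConj γ (mapDomain (conjInf h).symm y) = y) :
    galConj γ (twist K (h : G)
        (mapDomain (interIncl H K) y)) =
      mapDomain (interIncl H K) y := by
  have h5 : mapDomain (conjInf h).symm y ∈ coeffSubring ↥(H ⊓ K) M :=
    mapDomain_mulEquiv_mem_coeffSubring (conjInf h).symm hy
  rw [twist_mapDomain_inclusion, galConj_mapDomain γ _ h5, hγ]

theorem SemiInvariantConfig.exists_galConj_twist_eq [Finite G] [IsAlgClosed E] [K.Normal]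
    {ρ : Representation E K V} {τ : Representation E ↥(H ⊓ K) U}
    (cfg : SemiInvariantConfig F K H ρ τ) (h : H) :
    ∃ γ : charField F τ.character ≃ₐ[F] charField F τ.character,
      galConj γ (twist K (h : G) (charIdem ρ.character)) = charIdem ρ.character ∧
      galConj γ (twist K (h : G)
        (mapDomain (interIncl H K)
          (charIdem τ.character))) =
        mapDomain (interIncl H K)
          (charIdem τ.character) := by
  have := cfg.simple_theta
  have := cfg.simple_phi
  have := cfg.proj_theta
  have := cfg.proj_phi
  have hθ : charField F ρ.character = charField F τ.character := cfg.field_eq.symm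
  obtain ⟨γ, h1, h2⟩ := cfg.semi_invariant h h.2
  clear cfg
  have h3 : ∀ k : K, galApply γ (ρ.character (MulAut.conjNormal (h : G) k)) = ρ.character k :=
    fun k => h1 k _ (MulAut.conjNormal_apply _ _)
  have h4 : ∀ l, galApply γ (τ.character (conjInf h l)) = τ.character l := fun l => h2 l _ rfl
  clear h1 h2
  generalize hM : charField F τ.character = M at *
  refine ⟨γ, ρ.galConj_mapDomain_charIdem hθ γ (MulAut.conjNormal (h : G)) h3, ?_⟩
  exact galConj_twist_mapDomain_inclusion h γ (τ.charIdem_mem_coeffSubring hM)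
    (τ.galConj_mapDomain_charIdem hM γ (conjInf h) h4)

end ConfigurationCorner

section ConcreteRings

variable {G : Type*} [Group G] {K H : Subgroup G} {E F : Type*} [Field E] [Field F] [Algebra F E]
  {θ : K → E} {φ : ↥(H ⊓ K) → E} {V : Type*} [AddCommGroup V] [Module E V] {n : ℕ}
  [Fintype (charField F φ ≃ₐ[F] charField F φ)]
  {C : CharacterCorner (interIncl H K) (charField F φ) V n}

theorem CharacterCorner.idemI_eq (he : C.c.e = charIdem θ)
    (hf : C.c.f = mapDomain (interIncl H K)
      (charIdem φ))
    (hφ : charIdem φ ∈ coeffSubring ↥(H ⊓ K) (charField F φ)) :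
    idemI F θ φ = inclK K C.i := by
  rw [idemI, finsum_eq_sum_of_fintype, i, map_sum]
  refine sum_congr rfl fun γ _ => ?_
  rw [galConj_j, map_mul, he, hf]
  congr 1
  have h1 : galConj γ (mapDomain (interIncl H K)
      (charIdem φ)) = mapDomain (interIncl H K)
      (galConj γ (charIdem φ)) := galConj_mapDomain γ _ hφ
  rw [h1]
  have h2 := mapDomainRingHom_comp (R := E) K.subtype
    (interIncl H K)
  exact RingHom.congr_fun h2 (galConj γ (charIdem φ))

theorem mem_cornerRing_iff (hI : idemI F θ φ = inclK K C.i) {a : E[G]} :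
    a ∈ cornerRing F θ φ ↔ ∃ x, C.InCorner x ∧ inclK K x = a := by
  change (a ∈ subAlg F K E ∧ idemI F θ φ * a = a ∧ a * idemI F θ φ = a) ↔ _
  rw [hI]
  constructor
  · rintro ⟨h1, h2, h3⟩
    obtain ⟨x, hx, rfl⟩ := mem_subAlg.1 h1
    rw [← map_mul] at h2 h3
    exact ⟨x, ⟨hx, inclK_injective K h2, inclK_injective K h3⟩, rfl⟩
  · rintro ⟨x, hx, rfl⟩
    exact ⟨mem_subAlg.2 ⟨x, hx.mem, rfl⟩, by rw [← map_mul, hx.i_mul], by rw [← map_mul, hx.mul_i]⟩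

theorem mem_ringS_iff (hI : idemI F θ φ = inclK K C.i) {a : E[G]} :
    a ∈ ringS F θ φ ↔ ∃ x, C.InS x ∧ inclK K x = a := by
  rw [ringS, NonUnitalSubring.mem_inf, mem_cornerRing_iff hI, NonUnitalSubring.mem_centralizer_iff]
  constructor
  · rintro ⟨⟨x, hx, rfl⟩, h⟩
    refine ⟨x, { toInCorner := hx, comm := fun l => ?_ }, rfl⟩
    apply inclK_injective K
    rw [map_mul, map_mul, inclK_of]
    exact h _ ⟨l, l.2, rfl⟩
  · rintro ⟨x, hx, rfl⟩
    refine ⟨⟨x, hx.toInCorner, rfl⟩, ?_⟩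
    rintro _ ⟨l, hl, rfl⟩
    have h := congrArg (inclK K) (hx.comm ⟨l, hl⟩)
    rw [map_mul, map_mul, inclK_of] at h
    exact h

theorem mem_ringZ_iff [Finite G] [IsGalois F (charField F φ)] [NeZero n]
    (hI : idemI F θ φ = inclK K C.i) {a : E[G]} :
    a ∈ ringZ F θ φ ↔ ∃ l, inclK K (C.zeta l) = a := by
  rw [ringZ, centerOf, NonUnitalSubring.mem_inf, mem_cornerRing_iff hI,
    NonUnitalSubring.mem_centralizer_iff]
  constructor
  · rintro ⟨⟨z, hz, rfl⟩, h⟩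
    have hcomm : ∀ x, C.InCorner x → x * z = z * x := by
      intro x hx
      apply inclK_injective K
      rw [map_mul, map_mul]
      exact h _ ((mem_cornerRing_iff hI).2 ⟨x, hx, rfl⟩)
    have hzS : C.InS z := by
      refine { toInCorner := hz, comm := fun l => ?_ }
      have hi : of E K (Subgroup.inclusion inf_le_right l) * C.i =
          C.i * of E K (Subgroup.inclusion inf_le_right l) := by
        rw [CharacterCorner.i, mul_sum, sum_mul]
        refine sum_congr rfl fun γ _ => ?_
        have h1 := congrArg (galConj γ) (C.of_mul_j l)
        rwa [galConj_mul γ (of_mem_coeffSubring _) C.j_mem,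
          galConj_mul γ C.j_mem (of_mem_coeffSubring _), galConj_of] at h1
      have hmem : of E K (Subgroup.inclusion inf_le_right l) ∈
          (mapRingHom K (algebraMap F E)).range :=
        ⟨of F K (Subgroup.inclusion inf_le_right l), by simp⟩
      have himem : C.i ∈ (mapRingHom K (algebraMap F E)).range := by
        obtain ⟨y, hy⟩ := exists_mapRingHom_eq_of_galConj_eq C.i_mem C.galConj_i
        exact ⟨y, hy⟩
      have h1 := hcomm (of E K (Subgroup.inclusion inf_le_right l) * C.i)
        ⟨mul_mem hmem himem, by rw [← mul_assoc, ← hi, mul_assoc, C.i_mul_i],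
          by rw [mul_assoc, C.i_mul_i]⟩
      rw [mul_assoc, hz.i_mul, hi, ← mul_assoc, hz.mul_i] at h1
      exact h1
    obtain ⟨l, hl⟩ := C.exists_zeta_eq hzS fun x hx => hcomm x hx.toInCorner
    exact ⟨l, by rw [hl]⟩
  · rintro ⟨l, rfl⟩
    refine ⟨⟨_, (C.inS_zeta l).toInCorner, rfl⟩, fun x hx => ?_⟩
    obtain ⟨x, hx', rfl⟩ := (mem_cornerRing_iff hI).1 hx
    rw [← map_mul, ← map_mul, C.zeta_commute l hx']

theorem ringZ_le_ringS [Finite G] [IsGalois F (charField F φ)] [NeZero n]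
    (hI : idemI F θ φ = inclK K C.i) :
    ringZ F θ φ ≤ ringS F θ φ := by
  intro a ha
  obtain ⟨l, rfl⟩ := (mem_ringZ_iff hI).1 ha
  exact (mem_ringS_iff hI).2 ⟨_, C.inS_zeta l, rfl⟩

end ConcreteRings

namespace CharacterCorner

variable {G : Type*} [Group G] {K H : Subgroup G} [K.Normal] {E F : Type*} [Field E] [Field F]
  [Algebra F E] {M : IntermediateField F E} {V : Type*} [AddCommGroup V] [Module E V] {n : ℕ}
  [Fintype (M ≃ₐ[F] M)]
  (C : CharacterCorner (interIncl H K) M V n)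

/-- The Galois automorphism `γ` has the same effect on `e` and `f` as conjugation by `h⁻¹`. -/
structure IsSemiInvariant (h : H) (γ : M ≃ₐ[F] M) : Prop where
  e : galConj γ (twist K (h : G) C.c.e) = C.c.e
  f : galConj γ (twist K (h : G) C.c.f) = C.c.f

variable {C} {h : H} {γ : M ≃ₐ[F] M}

omit [Fintype (M ≃ₐ[F] M)] in
theorem IsSemiInvariant.twist_j (hγ : C.IsSemiInvariant h γ) :
    twist K (h : G) C.j = galConj γ⁻¹ C.j := by
  have h1 : galConj γ (twist K (h : G) C.j) = C.j := by
    rw [j, map_mul, galConj_mul γ (twist_mem _ C.f_mem) (twist_mem _ C.e_mem), hγ.e, hγ.f]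
  conv_rhs => rw [← h1]
  rw [galConj_galConj _ _ (twist_mem _ C.j_mem), inv_mul_cancel,
    galConj_one_apply (twist_mem _ C.j_mem)]

omit [K.Normal] in
theorem galSum_galConj (δ : M ≃ₐ[F] M) {x : E[K]} (hx : x ∈ coeffSubring K M) :
    galSum (M := M) (galConj δ x) = galSum (M := M) x := by
  rw [galSum, galSum]
  simp only [galConj_galConj _ _ hx]
  exact Fintype.sum_equiv (Equiv.mulRight δ) _ _ fun _ => rfl

theorem twist_galSum (g : G) {x : E[K]} (hx : x ∈ coeffSubring K M) :
    twist K g (galSum (M := M) x) = galSum (M := M) (twist K g x) := by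
  rw [galSum, galSum, map_sum]
  exact sum_congr rfl fun γ _ => (galConj_twist γ g hx).symm

theorem IsSemiInvariant.twist_i (hγ : C.IsSemiInvariant h γ) : twist K (h : G) C.i = C.i := by
  change twist K (h : G) (galSum (M := M) C.j) = galSum (M := M) C.j
  rw [twist_galSum _ C.j_mem, hγ.twist_j, galSum_galConj _ C.j_mem]

theorem IsSemiInvariant.twist_zeta (hγ : C.IsSemiInvariant h γ) (l : M) :
    twist K (h : G) (C.zeta l) = C.zeta (γ l) := by
  rw [zeta, twist_galSum _ (smul_mem_coeffSubring l.2 C.j_mem), twist_smul, hγ.twist_j, zeta,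
    ← galSum_galConj γ (smul_mem_coeffSubring l.2 (galConj_mem _ C.j_mem)),
    galConj_smul _ _ (galConj_mem _ C.j_mem), galConj_galConj _ _ C.j_mem, mul_inv_cancel,
    galConj_one_apply C.j_mem]

theorem IsSemiInvariant.twist_inCorner (hγ : C.IsSemiInvariant h γ) {x : E[K]}
    (hx : C.InCorner x) : C.InCorner (twist K (h : G) x) :=
  ⟨twist_mem_range _ hx.mem, by conv_lhs => rw [← hγ.twist_i, ← map_mul, hx.i_mul],
    by conv_lhs => rw [← hγ.twist_i, ← map_mul, hx.mul_i]⟩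

theorem IsSemiInvariant.twist_inS (hγ : C.IsSemiInvariant h γ) {x : E[K]}
    (hx : C.InS x) : C.InS (twist K (h : G) x) := by
  refine { toInCorner := hγ.twist_inCorner hx.toInCorner, comm := fun l => ?_ }
  have h1 := congrArg (twist K (h : G)) (hx.comm (conjInf h l))
  have h2 : twist K (h : G) (of E K (Subgroup.inclusion inf_le_right (conjInf h l))) =
      of E K (interIncl H K l) := by
    rw [twist_of]
    congr 1
    rw [MulEquiv.symm_apply_eq]
    rfl
  rwa [map_mul, map_mul, h2] at h1

omit [K.Normal] in
theorem zeta_injective [NeZero n] : Function.Injective C.zeta := by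
  intro l l' hll
  have h1 := congrArg C.c.rep hll
  rw [rep_zeta, rep_zeta] at h1
  exact Subtype.ext (smul_left_injective E (one_ne_zero (α := Matrix (Fin n) (Fin n) E)) h1)

theorem IsSemiInvariant.mul [NeZero n] {h' : H} {γ' γ'' : M ≃ₐ[F] M}
    (hγ : C.IsSemiInvariant h γ) (hγ' : C.IsSemiInvariant h' γ')
    (hγ'' : C.IsSemiInvariant (h * h') γ'') : γ'' = γ' * γ := by
  refine AlgEquiv.ext fun l => zeta_injective (C := C) ?_
  rw [← hγ''.twist_zeta, Subgroup.coe_mul, twist_mul, hγ.twist_zeta, hγ'.twist_zeta]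
  rfl

theorem IsSemiInvariant.eq_one [NeZero n] [IsGalois F M] (hγ : C.IsSemiInvariant h γ)
    (hh : (h : G) ∈ K) : γ = 1 := by
  refine AlgEquiv.ext fun l => zeta_injective (C := C) ?_
  rw [← hγ.twist_zeta, AlgEquiv.one_apply]
  apply inclK_injective K
  have h1 := congrArg (inclK K) ((C.inS_zeta l).comm ⟨h, h.2, hh⟩)
  rw [map_mul, map_mul, inclK_of] at h1
  change of E G (h : G) * _ = _ * of E G (h : G) at h1
  rw [← conjBy_inclK, conjBy, mul_assoc, ← h1, ← mul_assoc, ← map_mul, inv_mul_cancel, map_one,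
    one_mul]

end CharacterCorner

/-! ### The central simple algebra attached to the configuration -/

section CornerModel

open Module

variable {G : Type*} [Group G] {K H : Subgroup G} {E F : Type*} [Field E] [Field F] [Algebra F E]

instance normal_inf_subgroupOf [K.Normal] : ((H ⊓ K).subgroupOf H).Normal := by
  rw [Subgroup.inf_subgroupOf_left]
  infer_instance

/-- A realization of `S` as a central simple algebra of matrices over `E` with centre the field of
values of `φ`, together with the right action `act` of `H / L` on `S` and the left action `gal` on
its centre; therefore `act x` induces `(gal x)⁻¹`. -/
structure CornerModel [K.Normal] (F : Type*) [Field F] [Algebra F E] (θ : K → E)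
    (φ : ↥(H ⊓ K) → E) (n : ℕ) where
  S : Subalgebra (charField F φ) (Matrix (Fin n) (Fin n) E)
  equiv : ringS F θ φ ≃+* S
  gal : H ⧸ (H ⊓ K).subgroupOf H →* (charField F φ ≃ₐ[F] charField F φ)
  act : H ⧸ (H ⊓ K).subgroupOf H → S ≃+* S
  simple : IsSimpleRing S
  central : Algebra.IsCentral (charField F φ) S
  finite : FiniteDimensional (charField F φ) S
  span_eq_top : span E (Set.range S.val) = ⊤
  ringZ_le : ringZ F θ φ ≤ ringS F θ φ
  mem_ringZ_iff : ∀ s : ringS F θ φ, (s : E[G]) ∈ ringZ F θ φ ↔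
    ∃ l, equiv s = algebraMap (charField F φ) S l
  conjBy_mem : ∀ (h : H) (s : ringS F θ φ),
    conjBy (h : G) (s : E[G]) ∈ ringS F θ φ
  equiv_conjBy : ∀ (h : H) (s : ringS F θ φ),
    equiv ⟨conjBy (h : G) (s : E[G]), conjBy_mem h s⟩ = act h (equiv s)
  act_algebraMap : ∀ x l, act x (algebraMap (charField F φ) S l) =
    algebraMap (charField F φ) S ((gal x)⁻¹ l)
  idemI_mem : idemI F θ φ ∈ ringS F θ φ
  equiv_idemI : equiv ⟨idemI F θ φ, idemI_mem⟩ = 1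

end CornerModel

namespace CharacterCorner

open Module

section

variable {K L E F : Type*} [Group K] [Group L] [Field E] [Field F] [Algebra F E]
  {ι : L →* K} {M : IntermediateField F E} {V : Type*} [AddCommGroup V] [Module E V] {n : ℕ}
  (C : CharacterCorner ι M V n) [Fintype (M ≃ₐ[F] M)]

theorem inS_i [IsGalois F M] : C.InS C.i := by
  have h := C.inS_zeta 1
  have h1 : C.zeta 1 = C.i := by
    rw [zeta, OneMemClass.coe_one, one_smul]
    rfl
  rwa [h1] at h

theorem rep_i : C.c.rep C.i = 1 := by
  have h1 : C.zeta 1 = C.i := by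
    rw [zeta, OneMemClass.coe_one, one_smul]
    rfl
  rw [← h1, rep_zeta, OneMemClass.coe_one, one_smul]

variable {C}

theorem InS.mul {x y : E[K]} (hx : C.InS x) (hy : C.InS y) : C.InS (x * y) :=
  { toInCorner := hx.toInCorner.mul hy.toInCorner
    comm := fun l => by rw [← mul_assoc, hx.comm, mul_assoc, hy.comm, mul_assoc] }

theorem InS.add {x y : E[K]} (hx : C.InS x) (hy : C.InS y) : C.InS (x + y) :=
  { toInCorner := hx.toInCorner.add hy.toInCorner
    comm := fun l => by rw [mul_add, add_mul, hx.comm, hy.comm] }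

variable (C)

/-- The matrices by which the elements of `S` act on the multiplicity space. -/
noncomputable def matrixAlgebra [IsGalois F M] : Subalgebra M (Matrix (Fin n) (Fin n) E) where
  carrier := C.c.rep '' {x | C.InS x}
  mul_mem' := by
    rintro _ _ ⟨x, hx, rfl⟩ ⟨y, hy, rfl⟩
    exact ⟨x * y, hx.mul hy, hy.rep_mul x⟩
  add_mem' := by
    rintro _ _ ⟨x, hx, rfl⟩ ⟨y, hy, rfl⟩
    exact ⟨x + y, hx.add hy, map_add _ _ _⟩
  algebraMap_mem' l := ⟨C.zeta l, C.inS_zeta l, by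
    rw [rep_zeta, Algebra.algebraMap_eq_smul_one]
    rfl⟩

variable [IsGalois F M]

theorem rep_mem_matrixAlgebra {x : E[K]} (hx : C.InS x) :
    C.c.rep x ∈ C.matrixAlgebra := ⟨x, hx, rfl⟩

theorem algebraMap_matrixAlgebra (l : M) :
    algebraMap M C.matrixAlgebra l = ⟨C.c.rep (C.zeta l), C.rep_mem_matrixAlgebra (C.inS_zeta l)⟩ :=
  Subtype.ext ((Algebra.algebraMap_eq_smul_one (A := Matrix (Fin n) (Fin n) E) l).trans
    (C.rep_zeta l).symm)

theorem span_matrixAlgebra [Finite K] :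
    span E (Set.range C.matrixAlgebra.val) = ⊤ := by
  have h : Set.range C.matrixAlgebra.val = C.c.rep '' {x | C.InS x} := by
    rw [Subalgebra.coe_val, Subtype.range_coe]
    rfl
  rw [h, C.span_rep_eq_top]

theorem rank_matrixAlgebra_le [Finite K] : Module.rank M C.matrixAlgebra ≤ (n * n : ℕ) := by
  refine rank_le fun s hs => ?_
  have h : ∀ k : s, ∃ x, C.InS x ∧ C.c.rep x = ((k : C.matrixAlgebra) : Matrix (Fin n) (Fin n) E) :=
    fun k => k.1.2
  choose a ha ha' using h
  have h1 : LinearIndependent M fun k => C.c.rep (a k) := by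
    simp only [ha']
    exact hs.map' C.matrixAlgebra.val.toLinearMap (LinearMap.ker_eq_bot.2 Subtype.val_injective)
  have h2 := (C.linearIndependent_rep a ha h1).fintype_card_le_finrank
  rwa [Module.finrank_matrix, Fintype.card_fin, Module.finrank_self, mul_one, Fintype.card_coe]
    at h2

instance finite_matrixAlgebra [Finite K] : FiniteDimensional M C.matrixAlgebra :=
  IsNoetherian.iff_fg.1 (IsNoetherian.iff_rank_lt_aleph0.2
    (C.rank_matrixAlgebra_le.trans_lt Cardinal.natCast_lt_aleph0))

theorem finrank_matrixAlgebra_le [Finite K] : finrank M C.matrixAlgebra ≤ n * n :=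
  finrank_le_of_rank_le C.rank_matrixAlgebra_le

instance isSimpleRing_matrixAlgebra [Finite K] [NeZero n] : IsSimpleRing C.matrixAlgebra :=
  isSimpleRing_of_span_eq_top (E := E) C.matrixAlgebra.val Subtype.val_injective
    C.span_matrixAlgebra (by
      rw [Module.finrank_matrix, Fintype.card_fin, Module.finrank_self, mul_one]
      exact C.finrank_matrixAlgebra_le)

instance isCentral_matrixAlgebra [Finite K] [NeZero n] : Algebra.IsCentral M C.matrixAlgebra where
  out := by
    rintro ⟨_, x, hx, rfl⟩ hz
    rw [Subalgebra.mem_center_iff] at hz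
    have hxy : ∀ y, C.InS y → y * x = x * y := by
      intro y hy
      apply (hy.mul hx).eq_of_rep_eq C (hx.mul hy)
      have h1 := congrArg Subtype.val (hz ⟨C.c.rep y, C.rep_mem_matrixAlgebra hy⟩)
      rw [hx.rep_mul, hy.rep_mul]
      exact h1
    obtain ⟨l, rfl⟩ := C.exists_zeta_eq hx hxy
    rw [Algebra.mem_bot]
    exact ⟨l, C.algebraMap_matrixAlgebra l⟩

end

end CharacterCorner

section ExistsCornerModel

variable {G : Type*} [Group G] {K H : Subgroup G} {E F : Type*} [Field E] [Field F] [Algebra F E]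
  {θ : K → E} {φ : ↥(H ⊓ K) → E} {V : Type*} [AddCommGroup V] [Module E V] {n : ℕ}
  [Fintype (charField F φ ≃ₐ[F] charField F φ)] [IsGalois F (charField F φ)]
  {C : CharacterCorner (interIncl H K) (charField F φ) V n}

namespace CharacterCorner

omit [IsGalois F (charField F φ)] in
theorem exists_preimage (hI : idemI F θ φ = inclK K C.i) (s : ringS F θ φ) :
    ∃ x, C.InS x ∧ inclK K x = s :=
  (mem_ringS_iff hI).1 s.2

theorem exists_ringEquiv_matrixAlgebra (hI : idemI F θ φ = inclK K C.i) :
    ∃ f : ringS F θ φ ≃+* C.matrixAlgebra,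
      ∀ (s : ringS F θ φ) (x), inclK K x = s → (f s : Matrix (Fin n) (Fin n) E) = C.c.rep x := by
  choose p hp hp' using exists_preimage hI
  have hpe : ∀ (s : ringS F θ φ) x, inclK K x = s → p s = x := fun s x h =>
    inclK_injective K ((hp' s).trans h.symm)
  let f : ringS F θ φ →ₙ+* C.matrixAlgebra :=
    { toFun := fun s => ⟨C.c.rep (p s), C.rep_mem_matrixAlgebra (hp s)⟩
      map_mul' := fun s t => Subtype.ext <| by
        change C.c.rep (p (s * t)) = _
        rw [hpe (s * t) (p s * p t) (by rw [map_mul, hp', hp']; rfl), (hp t).rep_mul]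
        rfl
      map_add' := fun s t => Subtype.ext <| by
        change C.c.rep (p (s + t)) = _
        rw [hpe (s + t) (p s + p t) (by rw [map_add, hp', hp']; rfl), map_add]
        rfl
      map_zero' := Subtype.ext <| by
        change C.c.rep (p 0) = _
        rw [hpe 0 0 (by rw [map_zero]; rfl), map_zero]
        rfl }
  refine ⟨RingEquiv.ofBijective f ⟨fun s t hst => ?_, ?_⟩, fun s x hx => ?_⟩
  · have h1 := (hp s).eq_of_rep_eq C (hp t) (congrArg Subtype.val hst)
    exact Subtype.ext (by rw [← hp', h1, hp'])
  · rintro ⟨_, x, hx, rfl⟩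
    refine ⟨⟨inclK K x, (mem_ringS_iff hI).2 ⟨x, hx, rfl⟩⟩, Subtype.ext ?_⟩
    change C.c.rep (p _) = _
    rw [hpe _ x rfl]
  · change C.c.rep (p _) = _
    rw [hpe _ x hx]

end CharacterCorner

variable [K.Normal]

/-- The right action of `H` on `S` by conjugation. -/
noncomputable def conjEquiv (hmem : ∀ (h : H) (s : ringS F θ φ),
    conjBy (h : G) (s : E[G]) ∈ ringS F θ φ) (h : H) :
    ringS F θ φ ≃+* ringS F θ φ where
  toFun s := ⟨conjBy (h : G) (s : E[G]), hmem h s⟩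
  invFun s := ⟨conjBy ((h⁻¹ : H) : G) (s : E[G]), hmem h⁻¹ s⟩
  left_inv s := Subtype.ext <| by
    simp only [conjBy, Subgroup.coe_inv, inv_inv, ← mul_assoc, ← map_mul, mul_inv_cancel, map_one,
      one_mul]
    rw [mul_assoc, ← map_mul, mul_inv_cancel, map_one, mul_one]
  right_inv s := Subtype.ext <| by
    simp only [conjBy, Subgroup.coe_inv, inv_inv, ← mul_assoc, ← map_mul, inv_mul_cancel, map_one,
      one_mul]
    rw [mul_assoc, ← map_mul, inv_mul_cancel, map_one, mul_one]
  map_mul' s t := Subtype.ext <| by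
    change conjBy _ (_ * _) = conjBy _ _ * conjBy _ _
    simp only [conjBy, mul_assoc]
    rw [← mul_assoc (of E G (h : G)) (of E G _), ← map_mul,
      mul_inv_cancel, map_one, one_mul]
  map_add' s t := Subtype.ext <| by
    change conjBy _ (_ + _) = conjBy _ _ + conjBy _ _
    simp only [conjBy, mul_add, add_mul]

omit [IsGalois F (charField F φ)] in
theorem conjBy_mem_ringS (hI : idemI F θ φ = inclK K C.i)
    (hγ : ∀ h : H, ∃ γ, C.IsSemiInvariant h γ) (h : H) (s : ringS F θ φ) :
    conjBy (h : G) (s : E[G]) ∈ ringS F θ φ := by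
  obtain ⟨γ, hγ⟩ := hγ h
  obtain ⟨x, hx, hx'⟩ := (mem_ringS_iff hI).1 s.2
  rw [← hx', conjBy_inclK]
  exact (mem_ringS_iff hI).2 ⟨_, hγ.twist_inS hx, rfl⟩

omit [Fintype (charField F φ ≃ₐ[F] charField F φ)] [IsGalois F (charField F φ)] [K.Normal] in
theorem conjEquiv_congr (hmem : ∀ (h : H) (s : ringS F θ φ),
    conjBy (h : G) (s : E[G]) ∈ ringS F θ φ) {h h' : H}
    (hh : (h : H ⧸ (H ⊓ K).subgroupOf H) = h') : conjEquiv hmem h = conjEquiv hmem h' := by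
  obtain ⟨l, hl, rfl⟩ : ∃ l ∈ (H ⊓ K).subgroupOf H, h' = h * l :=
    ⟨h⁻¹ * h', QuotientGroup.eq.1 hh, by group⟩
  refine RingEquiv.ext fun s => Subtype.ext ?_
  have h1 : of E G (l : G) * conjBy (h : G) (s : E[G]) =
      conjBy (h : G) (s : E[G]) * of E G (l : G) :=
    NonUnitalSubring.mem_centralizer_iff.1 (NonUnitalSubring.mem_inf.1 (hmem h s)).2 _ ⟨l, hl, rfl⟩
  change conjBy (h : G) (s : E[G]) = conjBy ((h * l : H) : G) _
  have h2 : conjBy ((h * l : H) : G) (s : E[G]) =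
      of E G (l : G)⁻¹ * conjBy (h : G) (s : E[G]) *
        of E G (l : G) := by
    simp only [conjBy, Subgroup.coe_mul, mul_inv_rev, map_mul, mul_assoc]
  rw [h2, mul_assoc, ← h1, ← mul_assoc, ← map_mul, inv_mul_cancel, map_one, one_mul]

/-- The Galois automorphism that compensates the action of `h` is unique and depends on `L h` only. -/
theorem exists_galHom [NeZero n] (hγ : ∀ h : H, ∃ γ, C.IsSemiInvariant h γ) :
    ∃ π : H ⧸ (H ⊓ K).subgroupOf H →* (charField F φ ≃ₐ[F] charField F φ),
      ∀ h : H, C.IsSemiInvariant h (π h)⁻¹ := by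
  choose γ hγ using hγ
  have hmul : ∀ h h', γ (h * h') = γ h' * γ h := fun h h' => (hγ h).mul (hγ h') (hγ _)
  have hone : γ 1 = 1 := (hγ 1).eq_one K.one_mem
  let p : H →* (charField F φ ≃ₐ[F] charField F φ) :=
    { toFun := fun h => (γ h)⁻¹
      map_one' := by rw [hone, inv_one]
      map_mul' := fun h h' => by rw [hmul, mul_inv_rev] }
  refine ⟨QuotientGroup.lift _ p fun h hh => ?_, fun h => ?_⟩
  · change (γ h)⁻¹ = 1
    rw [(hγ h).eq_one hh.2, inv_one]
  · change C.IsSemiInvariant h (γ h)⁻¹⁻¹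
    rw [inv_inv]
    exact hγ h

theorem exists_cornerModel [Finite G] [NeZero n] (hI : idemI F θ φ = inclK K C.i)
    (hγ : ∀ h : H, ∃ γ, C.IsSemiInvariant h γ) : Nonempty (CornerModel F θ φ n) := by
  obtain ⟨f, hf⟩ := CharacterCorner.exists_ringEquiv_matrixAlgebra hI
  obtain ⟨π, hπ⟩ := exists_galHom hγ
  have hmem := conjBy_mem_ringS hI hγ
  have hZ := ringZ_le_ringS hI
  have hzeta : ∀ (s : ringS F θ φ) l, inclK K (C.zeta l) = (s : E[G]) →
      f s = algebraMap (charField F φ) C.matrixAlgebra l := by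
    intro s l hs
    rw [C.algebraMap_matrixAlgebra]
    exact Subtype.ext (hf s _ hs)
  have hmemZ : ∀ s : ringS F θ φ, (s : E[G]) ∈ ringZ F θ φ ↔
      ∃ l, f s = algebraMap (charField F φ) C.matrixAlgebra l := by
    intro s
    rw [mem_ringZ_iff hI]
    refine ⟨fun ⟨l, hl⟩ => ⟨l, hzeta s l hl⟩, fun ⟨l, hl⟩ => ⟨l, ?_⟩⟩
    have h1 := hzeta ⟨inclK K (C.zeta l), (mem_ringS_iff hI).2 ⟨_, C.inS_zeta l, rfl⟩⟩ l rfl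
    rw [← hl] at h1
    exact congrArg Subtype.val (f.injective h1)
  let act : H ⧸ (H ⊓ K).subgroupOf H → C.matrixAlgebra ≃+* C.matrixAlgebra := fun x =>
    (f.symm.trans (conjEquiv hmem x.out)).trans f
  have hact : ∀ (h : H) s, act h (f s) = f (conjEquiv hmem h s) := by
    intro h s
    change f (conjEquiv hmem _ (f.symm (f s))) = _
    rw [f.symm_apply_apply, conjEquiv_congr hmem (h' := h) (QuotientGroup.out_eq' _)]
  have hIm : idemI F θ φ ∈ ringS F θ φ := (mem_ringS_iff hI).2 ⟨_, C.inS_i, hI.symm⟩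
  refine ⟨⟨C.matrixAlgebra, f, π, act, inferInstance, inferInstance, inferInstance,
    C.span_matrixAlgebra, hZ, hmemZ, hmem, fun h s => (hact h s).symm, fun x l => ?_, hIm, ?_⟩⟩
  · induction x using QuotientGroup.induction_on with
    | H h =>
      have h1 := hzeta ⟨inclK K (C.zeta l), (mem_ringS_iff hI).2 ⟨_, C.inS_zeta l, rfl⟩⟩ l rfl
      rw [← h1, hact]
      apply hzeta
      change _ = conjBy _ (inclK K _)
      rw [conjBy_inclK, (hπ h).twist_zeta]
  · exact Subtype.ext ((hf _ _ hI.symm).trans C.rep_i)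

end ExistsCornerModel

theorem SemiInvariantConfig.exists_cornerModel {G : Type*} [Group G] [Finite G] {K H : Subgroup G}
    [K.Normal] {E F : Type*} [Field E] [IsAlgClosed E] [Field F] [Algebra F E] {V U : Type*}
    [AddCommGroup V] [Module E V] [AddCommGroup U] [Module E U]
    {ρ : Representation E K V} {τ : Representation E ↥(H ⊓ K) U}
    (cfg : SemiInvariantConfig F K H ρ τ) :
    Nonempty (CornerModel F ρ.character τ.character (charMult ρ τ)) := by
  have := cfg.simple_theta
  have := cfg.simple_phi
  have := cfg.proj_theta
  have := cfg.proj_phi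
  have : NeZero (charMult ρ τ) := ⟨cfg.mult_pos.ne'⟩
  have := τ.finiteDimensional_of_isIrreducible
  have := τ.finiteDimensional_charField F
  have : IsGalois F (charField F τ.character) := by
    have := τ.isAbelianGalois_charField F
    infer_instance
  have := Fintype.ofFinite (charField F τ.character ≃ₐ[F] charField F τ.character)
  obtain ⟨C, he, hf, -⟩ := cfg.exists_characterCorner
  have hφ := τ.charIdem_mem_coeffSubring (F := F) rfl
  refine _root_.exists_cornerModel (CharacterCorner.idemI_eq he hf hφ) fun h => ?_
  obtain ⟨γ, h1, h2⟩ := cfg.exists_galConj_twist_eq h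
  exact ⟨γ, by rw [he, h1], by rw [hf, h2]⟩

/-! ### Existence of forms and of magic crossed representations -/

section Splittings

/-- A splitting preserves units. -/
theorem map_one_of_span_range_eq_top {S E : Type*} [Ring S] [Field E] {k : ℕ}
    (ψ : S →ₙ+* Matrix (Fin k) (Fin k) E) (hψ : span E (Set.range ψ) = ⊤) : ψ 1 = 1 := by
  have h1 : LinearMap.mulLeft E (ψ 1) = LinearMap.id := LinearMap.ext_on_range hψ fun s =>
    (map_mul ψ 1 s).symm.trans (by rw [one_mul]; rfl)
  exact (mul_one _).symm.trans (LinearMap.congr_fun h1 1)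

theorem exists_eq_smul_one_of_span_range_eq_top {S E : Type*} [Field E] {k : ℕ}
    (ψ : S → Matrix (Fin k) (Fin k) E) (hψ : span E (Set.range ψ) = ⊤)
    {A : Matrix (Fin k) (Fin k) E} (hA : ∀ s, ψ s * A = A * ψ s) : ∃ c : E, A = c • 1 := by
  have h1 : ∀ B, B * A = A * B := fun B => by
    refine mul_comm_of_mem_span ?_ (hψ ▸ Submodule.mem_top (x := B))
    rintro _ ⟨s, rfl⟩
    exact hA s
  obtain ⟨c, hc⟩ := Algebra.mem_bot.1 (Algebra.IsCentral.out (K := E)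
    (Subalgebra.mem_center_iff.2 h1))
  exact ⟨c, by rw [← hc, Algebra.algebraMap_eq_smul_one]⟩

/-- A splitting of an algebra over a field `Z` embeds `Z` into the large field. -/
theorem exists_ringHom_of_span_range_eq_top {Z S E : Type*} [Field Z] [Ring S] [Algebra Z S]
    [Field E] {k : ℕ} [NeZero k] (ψ : S →+* Matrix (Fin k) (Fin k) E)
    (hψ : span E (Set.range ψ) = ⊤) :
    ∃ ζ : Z →+* E, ∀ z, ψ (algebraMap Z S z) = ζ z • 1 := by
  have h1 : ∀ z : Z, ∃ c : E, ψ (algebraMap Z S z) = c • 1 := fun z =>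
    exists_eq_smul_one_of_span_range_eq_top ψ hψ fun s => by
      rw [← map_mul, ← map_mul, Algebra.commutes]
  choose ζ hζ using h1
  have hinj : Function.Injective fun c : E => c • (1 : Matrix (Fin k) (Fin k) E) :=
    smul_left_injective E one_ne_zero
  refine ⟨⟨⟨⟨ζ, hinj ?_⟩, fun x y => hinj ?_⟩, hinj ?_, fun x y => hinj ?_⟩, hζ⟩
  · change ζ 1 • (1 : Matrix (Fin k) (Fin k) E) = (1 : E) • 1
    rw [← hζ, map_one, map_one, one_smul]
  · change ζ (x * y) • (1 : Matrix (Fin k) (Fin k) E) = (ζ x * ζ y) • 1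
    rw [← hζ, map_mul, map_mul, hζ, hζ, smul_mul_smul_comm, one_mul]
  · change ζ 0 • (1 : Matrix (Fin k) (Fin k) E) = (0 : E) • 1
    rw [← hζ, map_zero, map_zero, zero_smul]
  · change ζ (x + y) • (1 : Matrix (Fin k) (Fin k) E) = (ζ x + ζ y) • 1
    rw [← hζ, map_add, map_add, hζ, hζ, add_smul]

end Splittings

namespace CornerModel

open Module

variable {G : Type*} [Group G] {K H : Subgroup G} [K.Normal] {E F : Type*} [Field E] [Field F]
  [Algebra F E] {θ : K → E} {φ : ↥(H ⊓ K) → E} {n : ℕ} (m : CornerModel F θ φ n)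

/-- The group of automorphisms of `Z` induced by `H`. -/
noncomputable abbrev galGroup : Subgroup (charField F φ ≃ₐ[F] charField F φ) := m.gal.range

theorem equiv_symm_one : (m.equiv.symm 1 : E[G]) = idemI F θ φ := by
  rw [← m.equiv_idemI, m.equiv.symm_apply_apply]

theorem equiv_symm_mul (s t : m.S) : (m.equiv.symm (s * t) : E[G]) =
    m.equiv.symm s * m.equiv.symm t := by
  rw [map_mul]
  rfl

theorem equiv_symm_zero : (m.equiv.symm 0 : E[G]) = 0 :=
  congrArg Subtype.val (RingEquiv.map_zero m.equiv.symm)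

theorem equiv_symm_add (s t : m.S) : (m.equiv.symm (s + t) : E[G]) =
    m.equiv.symm s + m.equiv.symm t :=
  congrArg Subtype.val (RingEquiv.map_add m.equiv.symm s t)

theorem act_mul (x y : H ⧸ (H ⊓ K).subgroupOf H) (s : m.S) :
    m.act (x * y) s = m.act y (m.act x s) := by
  induction x using QuotientGroup.induction_on with
  | H x =>
    induction y using QuotientGroup.induction_on with
    | H y =>
      obtain ⟨s, rfl⟩ := m.equiv.surjective s
      rw [← QuotientGroup.mk_mul, ← m.equiv_conjBy, ← m.equiv_conjBy, ← m.equiv_conjBy]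
      congr 1
      apply Subtype.ext
      simp only [conjBy, Subgroup.coe_mul, mul_inv_rev, map_mul, mul_assoc]

theorem equiv_symm_algebraMap_mem (l : charField F φ) :
    (m.equiv.symm (algebraMap (charField F φ) m.S l) : E[G]) ∈ ringZ F θ φ :=
  (m.mem_ringZ_iff _).2 ⟨l, m.equiv.apply_symm_apply _⟩

theorem algebraMap_injective : Function.Injective (algebraMap (charField F φ) m.S) := by
  have := m.simple
  exact RingHom.injective (algebraMap (charField F φ) m.S)

theorem equiv_symm_algebraMap_conjBy (h : H) (l : charField F φ) :
    conjBy (h : G) (m.equiv.symm (algebraMap (charField F φ) m.S l) : E[G]) =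
      m.equiv.symm (algebraMap (charField F φ) m.S ((m.gal h)⁻¹ l)) := by
  rw [← m.act_algebraMap]
  conv_rhs => rw [← m.equiv.apply_symm_apply (algebraMap (charField F φ) m.S l),
    ← m.equiv_conjBy, m.equiv.symm_apply_apply]

/-- The elements of `Z` fixed by `H` correspond to the fixed field of `galGroup`. -/
theorem mem_ringZ_fixed_iff (s : ringS F θ φ) :
    ((s : E[G]) ∈ ringZ F θ φ ∧
      ∀ h ∈ H, conjBy h (s : E[G]) = s) ↔
    ∃ c : subfield m.galGroup (charField F φ), m.equiv s = algebraMap _ m.S c := by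
  constructor
  · rintro ⟨hs, h⟩
    obtain ⟨l, hl⟩ := (m.mem_ringZ_iff s).1 hs
    refine ⟨⟨l, ?_⟩, hl⟩
    rintro ⟨_, x, rfl⟩
    induction x using QuotientGroup.induction_on with
    | H x =>
      have h1 := m.equiv_conjBy x s
      have h2 : (⟨conjBy (x : G) (s : E[G]), m.conjBy_mem x s⟩ : ringS F θ φ) = s :=
        Subtype.ext (h x x.2)
      rw [h2, hl, m.act_algebraMap] at h1
      have h3 := congrArg (m.gal x) (m.algebraMap_injective h1)
      exact h3.trans ((AlgEquiv.mul_apply _ _ _).symm.trans (by rw [mul_inv_cancel]; rfl))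
  · rintro ⟨c, hc⟩
    have hc' : m.equiv s = algebraMap (charField F φ) m.S c := hc
    refine ⟨(m.mem_ringZ_iff s).2 ⟨c, hc'⟩, fun h hh => ?_⟩
    have h1 := m.equiv_symm_algebraMap_conjBy ⟨h, hh⟩ c
    have h2 : (m.gal (⟨h, hh⟩ : H))⁻¹ (c : charField F φ) = c :=
      c.2 ⟨(m.gal (⟨h, hh⟩ : H))⁻¹, inv_mem ⟨_, rfl⟩⟩
    rw [h2, ← hc', m.equiv.symm_apply_apply] at h1
    exact h1

theorem mem_closure_of_span_eq_top {W : Set m.S} (hW : span (charField F φ) W = ⊤)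
    {S₀ : NonUnitalSubring E[G]}
    (hmem : ∀ t ∈ W, (m.equiv.symm t : E[G]) ∈ S₀) {a : E[G]}
    (ha : a ∈ ringS F θ φ) :
    a ∈ AddSubgroup.closure {x | ∃ s ∈ S₀, ∃ z ∈ ringZ F θ φ, x = s * z} := by
  have key : ∀ t : m.S, ∀ l : charField F φ, (m.equiv.symm (l • t) : E[G]) ∈
      AddSubgroup.closure {x | ∃ s ∈ S₀, ∃ z ∈ ringZ F θ φ, x = s * z} := by
    intro t
    have ht : t ∈ span (charField F φ) W := hW ▸ Submodule.mem_top
    induction ht using Submodule.span_induction with intro l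
    | zero =>
      rw [smul_zero, m.equiv_symm_zero]
      exact zero_mem _
    | add x y _ _ hx hy =>
      rw [smul_add, m.equiv_symm_add]
      exact add_mem (hx l) (hy l)
    | smul c x _ hx =>
      rw [smul_smul]
      exact hx _
    | mem t ht =>
      refine AddSubgroup.subset_closure ⟨_, hmem t ht, _, m.equiv_symm_algebraMap_mem l, ?_⟩
      rw [← m.equiv_symm_mul, ← Algebra.commutes, Algebra.smul_def]
  have h1 := key (m.equiv ⟨a, ha⟩) 1
  rwa [one_smul, m.equiv.symm_apply_apply] at h1

/-- The fixed ring of a semilinear action of `Γ` on `S` is a form of `S`. -/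
theorem exists_isForm [Finite m.galGroup] (eps : m.galGroup → m.S ≃+* m.S)
    (hmul : ∀ g h s, eps (g * h) s = eps g (eps h s)) (hone : ∀ s, eps 1 s = s)
    (hZ : ∀ g z, eps g (algebraMap (charField F φ) m.S z) = algebraMap _ m.S (g • z)) :
    ∃ S₀, IsForm F θ φ S₀ := by
  have := m.simple
  have := m.central
  have := m.finite
  have hspan : span (charField F φ) {v : m.S | ∀ g, eps g v = v} = ⊤ :=
    span_fixed_eq_top (Z := charField F φ) (fun g => (eps g).toAddEquiv.toAddMonoidHom) hmul hone
      fun g z v => by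
        change eps g (z • v) = (g • z) • eps g v
        rw [Algebra.smul_def, map_mul, hZ, Algebra.smul_def]
  let S₀ : NonUnitalSubring E[G] :=
    { carrier := {a | ∃ s : ringS F θ φ, (∀ g, eps g (m.equiv s) = m.equiv s) ∧
        (s : E[G]) = a}
      zero_mem' := ⟨0, fun g => by rw [map_zero, map_zero], rfl⟩
      add_mem' := by
        rintro _ _ ⟨s, hs, rfl⟩ ⟨t, ht, rfl⟩
        exact ⟨s + t, fun g => by rw [map_add, map_add, hs, ht], rfl⟩
      mul_mem' := by
        rintro _ _ ⟨s, hs, rfl⟩ ⟨t, ht, rfl⟩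
        exact ⟨s * t, fun g => by rw [map_mul, map_mul, hs, ht], rfl⟩
      neg_mem' := by
        rintro _ ⟨s, hs, rfl⟩
        exact ⟨-s, fun g => by rw [map_neg, map_neg, hs], rfl⟩ }
  have hmem : ∀ t : m.S, (∀ g, eps g t = t) → (m.equiv.symm t : E[G]) ∈ S₀ :=
    fun t ht => ⟨m.equiv.symm t, fun g => by rw [m.equiv.apply_symm_apply, ht], rfl⟩
  refine ⟨S₀, ?_, ?_, ?_⟩
  · rintro _ ⟨s, -, rfl⟩
    exact s.2
  · ext z
    constructor
    · rintro ⟨⟨s, hs, rfl⟩, hz⟩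
      have hcen : ∀ t : m.S, t * m.equiv s = m.equiv s * t := by
        intro t
        refine mul_comm_of_mem_span (fun t ht => ?_) (hspan ▸ Submodule.mem_top (x := t))
        have h1 := NonUnitalSubring.mem_centralizer_iff.1 hz _ (hmem t ht)
        have h2 : m.equiv.symm t * s = s * m.equiv.symm t := Subtype.ext h1
        have h3 := congrArg m.equiv h2
        rwa [map_mul, map_mul, m.equiv.apply_symm_apply] at h3
      obtain ⟨l, hl⟩ := Algebra.mem_bot.1 (Algebra.IsCentral.out (K := charField F φ)
        (Subalgebra.mem_center_iff.2 hcen))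
      refine (m.mem_ringZ_fixed_iff s).2 ⟨⟨l, fun g => ?_⟩, hl.symm⟩
      apply m.algebraMap_injective
      rw [← hZ, hl, hs]
    · rintro hz
      obtain ⟨hzZ, -⟩ := id hz
      obtain ⟨c, hc⟩ := (m.mem_ringZ_fixed_iff ⟨z, m.ringZ_le hzZ⟩).1 hz
      refine ⟨⟨⟨z, m.ringZ_le hzZ⟩, fun g => ?_, rfl⟩, ?_⟩
      · rw [hc]
        change eps g (algebraMap (charField F φ) m.S c) = algebraMap (charField F φ) m.S c
        rw [hZ, c.2 g]
      · rw [SetLike.mem_coe, NonUnitalSubring.mem_centralizer_iff]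
        rintro _ ⟨s, -, rfl⟩
        have h1 : s * ⟨z, m.ringZ_le hzZ⟩ = ⟨z, m.ringZ_le hzZ⟩ * s := by
          apply m.equiv.injective
          rw [map_mul, map_mul, hc]
          exact (Algebra.commutes (c : charField F φ) _).symm
        exact congrArg Subtype.val h1
  · refine Set.Subset.antisymm ?_ fun a ha => ?_
    · change _ ≤ (ringS F θ φ).toAddSubgroup
      rw [AddSubgroup.closure_le]
      rintro _ ⟨_, ⟨s, -, rfl⟩, z, hz, rfl⟩
      exact (ringS F θ φ).mul_mem s.2 (m.ringZ_le hz)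
    · exact m.mem_closure_of_span_eq_top hspan hmem ha

variable {S₀ : NonUnitalSubring E[G]}

omit [K.Normal] in
/-- Induction along `S = S₀ Z`. -/
theorem _root_.IsForm.induction (hS₀ : IsForm F θ φ S₀) {p : ringS F θ φ → Prop} (zero : p 0)
    (add : ∀ s t, p s → p t → p (s + t)) (neg : ∀ s, p s → p (-s))
    (mul : ∀ s z : ringS F θ φ, (s : E[G]) ∈ S₀ →
      (z : E[G]) ∈ ringZ F θ φ → p (s * z))
    (hZ : ringZ F θ φ ≤ ringS F θ φ) (s : ringS F θ φ) : p s := by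
  have hcl : ∀ a, a ∈ AddSubgroup.closure {x | ∃ s ∈ S₀, ∃ z ∈ ringZ F θ φ, x = s * z} ↔
      a ∈ ringS F θ φ := Set.ext_iff.1 hS₀.span_eq
  have key : ∀ a ∈ AddSubgroup.closure {x | ∃ s ∈ S₀, ∃ z ∈ ringZ F θ φ, x = s * z},
      ∀ ha : a ∈ ringS F θ φ, p ⟨a, ha⟩ := by
    intro a ha
    induction ha using AddSubgroup.closure_induction with
    | zero => exact fun _ => zero
    | add x y hx hy hx' hy' =>
      exact fun _ => add _ _ (hx' ((hcl x).1 hx)) (hy' ((hcl y).1 hy))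
    | neg x hx hx' => exact fun _ => neg _ (hx' ((hcl x).1 hx))
    | mem x hx =>
      obtain ⟨s, hs, z, hz, rfl⟩ := hx
      exact fun _ => mul ⟨s, hS₀.le hs⟩ ⟨z, hZ hz⟩ hs hz
  exact key s ((hcl s).2 s.2) s.2

/-- A form `S₀`, as a subalgebra of the algebra of matrices that realizes `S`. -/
noncomputable def formSubalgebra (hS₀ : IsForm F θ φ S₀) :
    Subalgebra (subfield m.galGroup (charField F φ)) m.S where
  carrier := {t | (m.equiv.symm t : E[G]) ∈ S₀}
  mul_mem' := fun {s t} hs ht => by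
    rw [Set.mem_ofPred_eq, m.equiv_symm_mul]
    exact S₀.mul_mem hs ht
  add_mem' := fun {s t} hs ht => by
    rw [Set.mem_ofPred_eq, m.equiv_symm_add]
    exact S₀.add_mem hs ht
  algebraMap_mem' := fun c => by
    have h1 := (m.mem_ringZ_fixed_iff (m.equiv.symm (algebraMap _ m.S c))).2
      ⟨c, m.equiv.apply_symm_apply _⟩
    have h2 := (Set.ext_iff.1 hS₀.center_eq _).2 h1
    exact h2.1

theorem mem_formSubalgebra (hS₀ : IsForm F θ φ S₀) {t : m.S} :
    t ∈ m.formSubalgebra hS₀ ↔ (m.equiv.symm t : E[G]) ∈ S₀ := Iff.rfl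

theorem equiv_mem_formSubalgebra (hS₀ : IsForm F θ φ S₀) {s : ringS F θ φ} :
    m.equiv s ∈ m.formSubalgebra hS₀ ↔ (s : E[G]) ∈ S₀ := by
  rw [mem_formSubalgebra, m.equiv.symm_apply_apply]

theorem span_formSubalgebra (hS₀ : IsForm F θ φ S₀) :
    span (charField F φ) (m.formSubalgebra hS₀ : Set m.S) = ⊤ := by
  rw [eq_top_iff]
  rintro t -
  obtain ⟨s, rfl⟩ := m.equiv.surjective t
  refine hS₀.induction (p := fun s => m.equiv s ∈ span (charField F φ)
    (m.formSubalgebra hS₀ : Set m.S)) ?_ (fun s t hs ht => ?_) (fun s hs => ?_)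
    (fun s z hs hz => ?_) m.ringZ_le s
  · rw [RingEquiv.map_zero]
    exact Submodule.zero_mem _
  · rw [RingEquiv.map_add]
    exact Submodule.add_mem _ hs ht
  · rw [RingEquiv.map_neg]
    exact Submodule.neg_mem _ hs
  · obtain ⟨l, hl⟩ := (m.mem_ringZ_iff z).1 hz
    rw [RingEquiv.map_mul, hl, ← Algebra.commutes, ← Algebra.smul_def]
    exact Submodule.smul_mem _ _ (subset_span ((m.equiv_mem_formSubalgebra hS₀).2 hs))

theorem exists_algebraMap_eq_of_commute (hS₀ : IsForm F θ φ S₀) (b : m.S)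
    (hb : b ∈ m.formSubalgebra hS₀) (hb' : ∀ b' ∈ m.formSubalgebra hS₀, b' * b = b * b') :
    ∃ c, algebraMap (subfield m.galGroup (charField F φ)) m.S c = b := by
  have h1 : (m.equiv.symm b : E[G]) ∈ (centerOf S₀ : Set E[G]) := by
    refine ⟨hb, NonUnitalSubring.mem_centralizer_iff.2 fun s hs => ?_⟩
    have h2 := hb' _ ((m.equiv_mem_formSubalgebra hS₀ (s := ⟨s, hS₀.le hs⟩)).2 hs)
    have h3 := congrArg (fun t => (m.equiv.symm t : E[G])) h2
    simp only [m.equiv_symm_mul, m.equiv.symm_apply_apply] at h3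
    exact h3
  rw [hS₀.center_eq] at h1
  obtain ⟨c, hc⟩ := (m.mem_ringZ_fixed_iff _).1 h1
  rw [m.equiv.apply_symm_apply] at hc
  exact ⟨c, hc.symm⟩

theorem exists_semilinear_action_of_isForm [Finite m.galGroup] (hS₀ : IsForm F θ φ S₀) :
    ∃ eps : m.galGroup → m.S ≃+* m.S, (∀ g h s, eps (g * h) s = eps g (eps h s)) ∧
      (∀ s, eps 1 s = s) ∧
      (∀ g z, eps g (algebraMap (charField F φ) m.S z) = algebraMap _ m.S (g • z)) ∧
      ∀ g, ∀ s : ringS F θ φ, (s : E[G]) ∈ S₀ → eps g (m.equiv s) = m.equiv s := by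
  have := m.simple
  have := m.central
  have := m.finite
  obtain ⟨eps, h1, h2, h3, h4⟩ := exists_semilinear_action_of_form (m.formSubalgebra hS₀)
    (m.exists_algebraMap_eq_of_commute hS₀) (m.span_formSubalgebra hS₀)
  exact ⟨eps, h1, h2, h3, fun g s hs => h4 g _ ((m.equiv_mem_formSubalgebra hS₀).2 hs)⟩

theorem equiv_eps (hS₀ : IsForm F θ φ S₀) (eps : m.galGroup → m.S ≃+* m.S)
    (hZ : ∀ g z, eps g (algebraMap (charField F φ) m.S z) = algebraMap _ m.S (g • z))
    (hfix : ∀ g, ∀ s : ringS F θ φ, (s : E[G]) ∈ S₀ → eps g (m.equiv s) = m.equiv s)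
    (σ : MagicCrossedRep F θ φ S₀) (h : H) (s : ringS F θ φ) :
    m.equiv (σ.eps h s) = eps (m.gal.rangeRestrict h)⁻¹ (m.equiv s) := by
  refine hS₀.induction (p := fun s => m.equiv (σ.eps h s) =
    eps (m.gal.rangeRestrict h)⁻¹ (m.equiv s)) ?_ (fun s t hs ht => ?_) (fun s hs => ?_)
    (fun s z hs hz => ?_) m.ringZ_le s
  · rw [RingEquiv.map_zero, RingEquiv.map_zero, RingEquiv.map_zero]
  · rw [RingEquiv.map_add, RingEquiv.map_add, RingEquiv.map_add, RingEquiv.map_add, hs, ht]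
  · rw [RingEquiv.map_neg, RingEquiv.map_neg, RingEquiv.map_neg, RingEquiv.map_neg, hs]
  · obtain ⟨l, hl⟩ := (m.mem_ringZ_iff z).1 hz
    rw [RingEquiv.map_mul, RingEquiv.map_mul, RingEquiv.map_mul, RingEquiv.map_mul, hfix _ s hs,
      σ.eps_form h s hs, hl, hZ]
    congr 1
    have h1 : σ.eps h z = ⟨conjBy (h : G) (z : E[G]), m.conjBy_mem h z⟩ :=
      Subtype.ext (σ.eps_center h z hz)
    rw [h1, m.equiv_conjBy, hl, m.act_algebraMap]
    rfl

attribute [instance] CornerModel.simple CornerModel.central CornerModel.finite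

/-- The reduced norm of `S`. -/
noncomputable def nr [NeZero n] : m.S →* charField F φ :=
  reducedNorm (E := E) m.S.val m.span_eq_top

theorem equiv_symm_mem_centerOf (l : charField F φ) :
    (m.equiv.symm (algebraMap (charField F φ) m.S l) : E[G]) ∈
      centerOf (ringS F θ φ) := by
  refine ⟨(m.equiv.symm _).2, NonUnitalSubring.mem_centralizer_iff.2 fun s hs => ?_⟩
  have h1 : (⟨s, hs⟩ : ringS F θ φ) * m.equiv.symm (algebraMap (charField F φ) m.S l) =
      m.equiv.symm (algebraMap (charField F φ) m.S l) * ⟨s, hs⟩ := by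
    apply m.equiv.injective
    rw [RingEquiv.map_mul, RingEquiv.map_mul, m.equiv.apply_symm_apply, Algebra.commutes]
  exact congrArg Subtype.val h1

theorem isReducedNorm [NeZero n] (s : m.S) :
    IsReducedNorm E (ringS F θ φ) (m.equiv.symm s)
      (m.equiv.symm (algebraMap (charField F φ) m.S (m.nr s))) := by
  let ψ : ringS F θ φ →ₙ+* Matrix (Fin n) (Fin n) E :=
    { toFun := fun s => (m.equiv s : Matrix (Fin n) (Fin n) E)
      map_mul' := fun s t => congrArg Subtype.val (RingEquiv.map_mul m.equiv s t)
      map_add' := fun s t => congrArg Subtype.val (RingEquiv.map_add m.equiv s t)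
      map_zero' := congrArg Subtype.val (RingEquiv.map_zero m.equiv) }
  refine ⟨(m.equiv.symm s).2, (m.equiv.symm _).2, m.equiv_symm_mem_centerOf _, n, ψ,
    ⟨Nat.pos_of_ne_zero (NeZero.ne n), ?_⟩, ?_⟩
  · rw [← m.span_eq_top]
    congr 1
    exact m.equiv.surjective.range_comp m.S.val
  · change ((m.equiv (m.equiv.symm _) : m.S) : Matrix (Fin n) (Fin n) E) =
      ((m.equiv (m.equiv.symm s) : m.S) : Matrix (Fin n) (Fin n) E).det • 1
    rw [m.equiv.apply_symm_apply, m.equiv.apply_symm_apply]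
    have h1 : algebraMap (charField F φ) E (m.nr s) = (m.S.val s).det :=
      algebraMap_reducedNorm m.S.val m.span_eq_top s
    rw [Subalgebra.coe_val] at h1
    rw [← h1]
    exact Algebra.algebraMap_eq_smul_one (A := Matrix (Fin n) (Fin n) E) (m.nr s)

theorem nr_eq_of_isReducedNorm [NeZero n] {s z : ringS F θ φ} {l : charField F φ}
    (h : IsReducedNorm E (ringS F θ φ) s z) (hz : m.equiv z = algebraMap _ m.S l) :
    m.nr (m.equiv s) = l := by
  obtain ⟨_, _, -, k, ψ, ⟨hk, hψ⟩, hs⟩ := h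
  have : NeZero k := ⟨hk.ne'⟩
  have hs : ψ z = (ψ s).det • 1 := hs
  let ψ₁ : m.S →ₙ+* Matrix (Fin k) (Fin k) E := ψ.comp (m.equiv.symm : m.S →ₙ+* ringS F θ φ)
  have hψ₁ : ∀ s, ψ₁ (m.equiv s) = ψ s := fun s =>
    congrArg ψ (m.equiv.symm_apply_apply s)
  have hspan : span E (Set.range ψ₁) = ⊤ := by
    rw [← hψ]
    congr 1
    exact m.equiv.symm.surjective.range_comp ψ
  let ψ₂ : m.S →+* Matrix (Fin k) (Fin k) E :=
    { ψ₁ with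
      map_one' := map_one_of_span_range_eq_top ψ₁ hspan }
  obtain ⟨ζ, hζ⟩ := exists_ringHom_of_span_range_eq_top (Z := charField F φ) ψ₂ hspan
  have h1 := det_eq_of_algebraMap_eq_det (E := E) m.S.val m.span_eq_top ζ ψ₂ hζ hspan
    (algebraMap_reducedNorm m.S.val m.span_eq_top (m.equiv s))
  have h2 : ψ₂ (m.equiv z) = (ψ₂ (m.equiv s)).det • 1 := by
    change ψ₁ (m.equiv z) = (ψ₁ (m.equiv s)).det • 1
    rw [hψ₁, hψ₁, hs]
  rw [hz, hζ, h1] at h2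
  exact (ζ.injective (smul_left_injective E
    (one_ne_zero (α := Matrix (Fin k) (Fin k) E)) h2)).symm

theorem exists_magicCrossedRep [Finite G] [NeZero n] [Finite m.galGroup]
    (hn : n.Coprime (Nat.card (H ⧸ (H ⊓ K).subgroupOf H))) (hS₀ : IsForm F θ φ S₀) :
    ∃ σ : MagicCrossedRep F θ φ S₀, σ.NormIsCoboundary := by
  obtain ⟨eps, hmul, -, hZ, hfix⟩ := m.exists_semilinear_action_of_isForm hS₀
  obtain ⟨σ, h1, h2, a, h3⟩ := exists_crossedRepresentation (E := E) m.S.val m.span_eq_top eps hmul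
    hZ m.gal.rangeRestrict m.act m.act_mul (fun x z => m.act_algebraMap x z) hn
  let τ : MagicCrossedRep F θ φ S₀ :=
    { eps := fun h => (m.equiv.trans (eps (m.gal.rangeRestrict h)⁻¹)).trans m.equiv.symm
      eps_form := fun h s hs => by
        change m.equiv.symm (eps _ (m.equiv s)) = s
        rw [hfix _ s hs, m.equiv.symm_apply_apply]
      eps_center := fun h s hs => by
        obtain ⟨l, hl⟩ := (m.mem_ringZ_iff s).1 hs
        change (m.equiv.symm (eps _ (m.equiv s)) : E[G]) = _
        have h4 := m.equiv_symm_algebraMap_conjBy h l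
        rw [hl, hZ]
        rw [← hl, m.equiv.symm_apply_apply] at h4
        exact h4.symm
      toFun := fun x => m.equiv.symm (σ x)
      inv := fun x => m.equiv.symm ((σ x)⁻¹ : m.Sˣ)
      mul_inv := fun x => by rw [← m.equiv_symm_mul, Units.mul_inv, m.equiv_symm_one]
      inv_mul := fun x => by rw [← m.equiv_symm_mul, Units.inv_mul, m.equiv_symm_one]
      crossed_mul := fun x y => by
        change m.equiv.symm (eps _ (m.equiv (m.equiv.symm (σ x)))) * m.equiv.symm (σ y) =
          m.equiv.symm (σ ((x : H ⧸ (H ⊓ K).subgroupOf H) * y))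
        rw [m.equiv.apply_symm_apply, ← RingEquiv.map_mul, h1]
      magic := fun x s => by
        have h4 := m.equiv_conjBy x s
        rw [h2] at h4
        have h5 := congrArg (fun t => (m.equiv.symm t : E[G])) h4
        simp only [m.equiv.symm_apply_apply, RingEquiv.map_mul] at h5
        exact h5 }
  refine ⟨τ, m.equiv.symm (algebraMap _ m.S (a : charField F φ)), m.equiv_symm_algebraMap_mem _,
    m.equiv.symm (algebraMap _ m.S ((a⁻¹ : (charField F φ)ˣ) : charField F φ)),
    m.equiv_symm_algebraMap_mem _, ?_, fun h => ?_⟩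
  · rw [← m.equiv_symm_mul, ← map_mul, Units.mul_inv, map_one, m.equiv_symm_one]
  · rw [m.equiv_symm_algebraMap_conjBy, ← m.equiv_symm_mul, ← map_mul]
    have h4 := m.isReducedNorm (σ h)
    rw [nr, h3] at h4
    exact h4

/-- The values of a magic crossed representation as units of the matrix algebra. -/
noncomputable def units (σ : MagicCrossedRep F θ φ S₀) (x : H ⧸ (H ⊓ K).subgroupOf H) : m.Sˣ where
  val := m.equiv (σ.toFun x)
  inv := m.equiv (σ.inv x)
  val_inv := by
    rw [← RingEquiv.map_mul, ← m.equiv_idemI]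
    congr 1
    exact Subtype.ext (σ.mul_inv x)
  inv_val := by
    rw [← RingEquiv.map_mul, ← m.equiv_idemI]
    congr 1
    exact Subtype.ext (σ.inv_mul x)

theorem equiv_conjBy_eq_units (σ : MagicCrossedRep F θ φ S₀) (x : H) (s : ringS F θ φ) :
    m.act x (m.equiv s) = ↑(m.units σ x)⁻¹ * m.equiv (σ.eps x s) * ↑(m.units σ x) := by
  have h1 : (⟨conjBy (x : G) (s : E[G]), m.conjBy_mem x s⟩ : ringS F θ φ) =
      σ.inv x * σ.eps x s * σ.toFun x := Subtype.ext (σ.magic x s)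
  rw [← m.equiv_conjBy, h1, RingEquiv.map_mul, RingEquiv.map_mul]
  rfl

theorem nr_units [NeZero n] {σ : MagicCrossedRep F θ φ S₀} (hσ : σ.NormIsCoboundary) :
    ∃ a : (charField F φ)ˣ, ∀ x, m.nr (m.units σ x) =
      ((a⁻¹ : (charField F φ)ˣ) : charField F φ) *
        (m.gal.rangeRestrict x)⁻¹ • (a : charField F φ) := by
  obtain ⟨a, ha, b, hb, hab, h⟩ := hσ
  obtain ⟨l, hl⟩ := (m.mem_ringZ_iff ⟨a, m.ringZ_le ha⟩).1 ha
  obtain ⟨k, hk⟩ := (m.mem_ringZ_iff ⟨b, m.ringZ_le hb⟩).1 hb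
  have h1 : l * k = 1 := by
    apply m.algebraMap_injective
    rw [map_mul, map_one, ← hl, ← hk, ← RingEquiv.map_mul, ← m.equiv_idemI]
    congr 1
    exact Subtype.ext hab
  refine ⟨⟨l, k, h1, by rw [mul_comm, h1]⟩, fun x => ?_⟩
  induction x using QuotientGroup.induction_on with
  | H x =>
    obtain ⟨c, hc, hc'⟩ : ∃ c : ringS F θ φ, (c : E[G]) = b * conjBy (x : G) a ∧
        m.equiv c = algebraMap _ m.S (k * (m.gal x)⁻¹ l) := by
      refine ⟨⟨b, m.ringZ_le hb⟩ * ⟨conjBy (x : G) a, m.conjBy_mem x ⟨a, m.ringZ_le ha⟩⟩, rfl, ?_⟩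
      rw [RingEquiv.map_mul, hk, m.equiv_conjBy x ⟨a, m.ringZ_le ha⟩, hl, m.act_algebraMap, map_mul]
    have h2 := h x
    rw [← hc] at h2
    exact m.nr_eq_of_isReducedNorm h2 hc'

/-- Two magic crossed representations, possibly with respect to different forms, are related by
conjugation with a unit of `S`. -/
theorem exists_unit_conj [Finite G] [NeZero n] [Finite m.galGroup]
    (hn : n.Coprime (Nat.card (H ⧸ (H ⊓ K).subgroupOf H))) {S₀' : NonUnitalSubring E[G]}
    (hS₀ : IsForm F θ φ S₀) (hS₀' : IsForm F θ φ S₀') {σ : MagicCrossedRep F θ φ S₀}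
    {σ' : MagicCrossedRep F θ φ S₀'} (hσ : σ.NormIsCoboundary) (hσ' : σ'.NormIsCoboundary) :
    ∃ v w : ringS F θ φ, (v * w : E[G]) = idemI F θ φ ∧
      (w * v : E[G]) = idemI F θ φ ∧
      ∀ h : H, (σ.eps h v * (σ.toFun h * σ'.inv h) : E[G]) = v := by
  obtain ⟨eps, hmul, hone, hZ, hfix⟩ := m.exists_semilinear_action_of_isForm hS₀
  obtain ⟨eps', hmul', hone', hZ', hfix'⟩ := m.exists_semilinear_action_of_isForm hS₀'
  have he := m.equiv_eps hS₀ eps hZ hfix σ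
  have he' := m.equiv_eps hS₀' eps' hZ' hfix' σ'
  have hcross : ∀ x y, eps (m.gal.rangeRestrict y)⁻¹ (m.units σ x) * (m.units σ y) =
      (m.units σ (x * y) : m.S) := by
    intro x y
    induction x using QuotientGroup.induction_on with
    | H x =>
      induction y using QuotientGroup.induction_on with
      | H y =>
        change eps _ (m.equiv (σ.toFun x)) * m.equiv (σ.toFun y) = m.equiv (σ.toFun _)
        rw [← he, ← RingEquiv.map_mul, σ.crossed_mul]
        rfl
  have hcross' : ∀ x y, eps' (m.gal.rangeRestrict y)⁻¹ (m.units σ' x) * (m.units σ' y) =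
      (m.units σ' (x * y) : m.S) := by
    intro x y
    induction x using QuotientGroup.induction_on with
    | H x =>
      induction y using QuotientGroup.induction_on with
      | H y =>
        change eps' _ (m.equiv (σ'.toFun x)) * m.equiv (σ'.toFun y) = m.equiv (σ'.toFun _)
        rw [← he', ← RingEquiv.map_mul, σ'.crossed_mul]
        rfl
  have hact : ∀ x s, m.act x s = ↑(m.units σ x)⁻¹ * eps (m.gal.rangeRestrict x)⁻¹ s *
      ↑(m.units σ x) := by
    intro x s
    induction x using QuotientGroup.induction_on with
    | H x =>
      obtain ⟨s, rfl⟩ := m.equiv.surjective s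
      rw [m.equiv_conjBy_eq_units σ, he]
  have hact' : ∀ x s, m.act x s = ↑(m.units σ' x)⁻¹ * eps' (m.gal.rangeRestrict x)⁻¹ s *
      ↑(m.units σ' x) := by
    intro x s
    induction x using QuotientGroup.induction_on with
    | H x =>
      obtain ⟨s, rfl⟩ := m.equiv.surjective s
      rw [m.equiv_conjBy_eq_units σ', he']
  obtain ⟨v, hv⟩ := exists_unit_conj_crossedRepresentation (E := E) m.S.val m.span_eq_top eps eps'
    hmul hone hone' hZ m.gal.rangeRestrict m.gal.rangeRestrict_surjective m.act hn (m.units σ)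
    (m.units σ') hcross hcross' hact hact' (m.nr_units hσ) (m.nr_units hσ')
  refine ⟨m.equiv.symm v, m.equiv.symm (v⁻¹ : m.Sˣ), ?_, ?_, fun h => ?_⟩
  · rw [← m.equiv_symm_mul, Units.mul_inv, m.equiv_symm_one]
  · rw [← m.equiv_symm_mul, Units.inv_mul, m.equiv_symm_one]
  · have h1 : σ.eps h (m.equiv.symm v) * (σ.toFun h * σ'.inv h) = m.equiv.symm v := by
      apply m.equiv.injective
      rw [RingEquiv.map_mul, RingEquiv.map_mul, he, m.equiv.apply_symm_apply]
      exact hv h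
    exact congrArg Subtype.val h1

end CornerModel

/-- Forms of `S` and magic crossed representations with trivial reduced norm exist. -/
theorem SemiInvariantConfig.exists_magicCrossedRep {G : Type*} [Group G] [Finite G]
    {K H : Subgroup G} [K.Normal] {E F : Type*} [Field E] [IsAlgClosed E] [Field F] [Algebra F E]
    {V U : Type*} [AddCommGroup V] [Module E V] [AddCommGroup U] [Module E U]
    {ρ : Representation E K V} {τ : Representation E ↥(H ⊓ K) U}
    (cfg : SemiInvariantConfig F K H ρ τ)
    (hn : Nat.Coprime (charMult ρ τ) (Nat.card (H ⧸ (H ⊓ K).subgroupOf H))) :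
    (∃ S₀, IsForm F ρ.character τ.character S₀) ∧
      ∀ S₀, IsForm F ρ.character τ.character S₀ →
        ∃ σ : MagicCrossedRep F ρ.character τ.character S₀, σ.NormIsCoboundary := by
  obtain ⟨m⟩ := cfg.exists_cornerModel
  have : NeZero (charMult ρ τ) := ⟨cfg.mult_pos.ne'⟩
  have hfin : Finite m.galGroup := Set.finite_range m.gal
  refine ⟨?_, fun S₀ hS₀ => m.exists_magicCrossedRep hn hS₀⟩
  have hlift : ∀ g : m.galGroup, ∃ x, m.gal x⁻¹ = g⁻¹ := fun g => by
    obtain ⟨x, hx⟩ := g.2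
    exact ⟨x, by rw [map_inv, hx]; rfl⟩
  choose x hx using hlift
  have hcard : (charMult ρ τ).Coprime (Nat.card m.galGroup) := by
    refine hn.coprime_dvd_right ?_
    exact Subgroup.card_range_dvd m.gal
  obtain ⟨eps, h1, h2, h3⟩ := exists_semilinear_action (E := E) m.S.val m.span_eq_top
    (fun g => m.act (x g)⁻¹) (fun g z => by
      rw [m.act_algebraMap, hx]
      congr 1) hcard
  exact m.exists_isForm eps h1 h2 h3

/-! ### Irreducible constituents of tensor factors, and commutators -/

section TensorFactor

open Module
open scoped TensorProduct

/-- Extensions of scalars of central simple algebras are simple. -/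
theorem isSimpleRing_tensorProduct (Z B E : Type*) [Field Z] [Ring B] [Algebra Z B]
    [IsSimpleRing B] [Algebra.IsCentral Z B] [FiniteDimensional Z B] [Field E] [Algebra Z E] :
    IsSimpleRing (E ⊗[Z] B) := by
  rw [isSimpleRing_iff_isTwoSided_imp]
  refine ⟨inferInstance, fun I hI => ?_⟩
  by_cases htop : I = ⊤
  · exact Or.inr htop
  left
  have : Nontrivial ((E ⊗[Z] B) ⧸ I) := Ideal.Quotient.nontrivial_iff.2 htop
  let ψ : B →ₐ[Z] (E ⊗[Z] B) ⧸ I :=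
    (Ideal.Quotient.mkₐ Z I).comp Algebra.TensorProduct.includeRight
  have hψ : ∀ x, scalarExtension E ψ x = Ideal.Quotient.mk I x := by
    intro x
    induction x using TensorProduct.induction_on with
    | zero => rw [map_zero, map_zero]
    | add x y hx hy => rw [map_add, map_add, hx, hy]
    | tmul c b =>
      rw [scalarExtension_tmul]
      change c • Ideal.Quotient.mkₐ E I ((1 : E) ⊗ₜ b) = Ideal.Quotient.mkₐ E I (c ⊗ₜ b)
      rw [← map_smul, TensorProduct.smul_tmul', smul_eq_mul, mul_one]
  have hspan : span E (Set.range ψ) = ⊤ := by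
    rw [eq_top_iff]
    rintro x -
    obtain ⟨x, rfl⟩ := Ideal.Quotient.mk_surjective x
    rw [← hψ]
    induction x using TensorProduct.induction_on with
    | zero => rw [map_zero]; exact zero_mem _
    | add x y hx hy => rw [map_add]; exact add_mem hx hy
    | tmul c b =>
      rw [scalarExtension_tmul]
      exact Submodule.smul_mem _ _ (subset_span ⟨b, rfl⟩)
  have hinj := (scalarExtension_bijective (E := E) ψ hspan).1
  rw [eq_bot_iff]
  intro x hx
  apply hinj
  rw [hψ, map_zero]
  exact Ideal.Quotient.eq_zero_iff_mem.2 hx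

theorem Representation.isIrreducible_of_forall_mem_span {H E V : Type*} [Group H] [Field E]
    [AddCommGroup V] [Module E V] [Nontrivial V] (ρ : Representation E H V)
    (h : ∀ v ≠ 0, ∀ w, w ∈ span E (Set.range fun g => ρ g v)) : ρ.IsIrreducible where
  exists_pair_ne := ⟨⊥, ⊤, fun hbt => by
    obtain ⟨v, hv⟩ := exists_ne (0 : V)
    have h1 : v ∈ (⊥ : Subrepresentation ρ).toSubmodule := by
      rw [hbt]
      trivial
    exact hv h1⟩
  eq_bot_or_eq_top W := by
    by_cases hW : ∀ v ∈ W.toSubmodule, v = 0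
    · left
      exact Subrepresentation.toSubmodule_injective ((Submodule.eq_bot_iff _).2 hW)
    · right
      push Not at hW
      obtain ⟨v, hv, hv0⟩ := hW
      apply Subrepresentation.toSubmodule_injective
      change W.toSubmodule = ⊤
      rw [eq_top_iff]
      rintro w -
      refine Submodule.span_le.2 ?_ (h v hv0 w)
      rintro _ ⟨g, rfl⟩
      exact W.apply_mem_toSubmodule g hv

/-- If a full matrix algebra and a group together generate all endomorphisms of a space and commute
with each other, then the space is the sum of `n` copies of an irreducible representation. -/
theorem exists_irreducible_of_matrix_commute {H E Y : Type*} [Group H] [Field E] [AddCommGroup Y]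
    [Module E Y] [FiniteDimensional E Y] [Nontrivial Y] {n : ℕ} [NeZero n]
    (μ : Matrix (Fin n) (Fin n) E →ₐ[E] End E Y) (κ : Representation E H Y)
    (hc : ∀ X h, μ X * κ h = κ h * μ X)
    (hspan : ∀ T : End E Y, T ∈ span E {T | ∃ X h, T = μ X * κ h}) :
    ∃ (N : Submodule E Y) (τ : Representation E H N), τ.IsIrreducible ∧
      ∀ h, LinearMap.trace E Y (κ h) = n * τ.character h := by
  let o : Fin n := 0
  let q := μ (Matrix.single o o 1)
  have hq : q * q = q := by
    rw [← map_mul, Matrix.single_mul_single_same, mul_one]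
  have hqv : ∀ v ∈ LinearMap.range q, q v = v := by
    rintro _ ⟨v, rfl⟩
    exact LinearMap.congr_fun hq v
  have hmem : ∀ h, ∀ v ∈ LinearMap.range q, κ h v ∈ LinearMap.range q := by
    rintro h _ ⟨v, rfl⟩
    exact ⟨κ h v, LinearMap.congr_fun (hc _ h) v⟩
  let τ : Representation E H (LinearMap.range q) :=
    { toFun := fun h => (κ h).restrict (hmem h)
      map_one' := by
        ext v
        simp
      map_mul' := fun g h => by
        ext v
        simp }
  have hnt : Nontrivial (LinearMap.range q) := by
    by_contra hcon
    rw [not_nontrivial_iff_subsingleton] at hcon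
    have h0 : q = 0 := by
      ext v
      exact congrArg Subtype.val (Subsingleton.elim (⟨q v, v, rfl⟩ : LinearMap.range q) 0)
    have h1 : (1 : End E Y) = 0 := by
      have h2 : (1 : Matrix (Fin n) (Fin n) E) = ∑ a, Matrix.single a o 1 * Matrix.single o o 1 *
          Matrix.single o a 1 := by
        simp only [Matrix.single_mul_single_same, mul_one]
        exact (Matrix.sum_single_one (m := Fin n) (α := E)).symm
      rw [← map_one μ, h2, map_sum]
      refine Finset.sum_eq_zero fun a _ => ?_
      rw [map_mul, map_mul]
      change μ _ * q * _ = 0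
      rw [h0, mul_zero, zero_mul]
    exact one_ne_zero h1
  refine ⟨LinearMap.range q, τ, τ.isIrreducible_of_forall_mem_span fun v hv w => ?_, fun h => ?_⟩
  · have hv' : (v : Y) ≠ 0 := fun h => hv (Subtype.ext h)
    obtain ⟨f, hf⟩ : ∃ f : Module.Dual E Y, f v ≠ 0 := by
      by_contra! hcon
      exact hv' ((Module.forall_dual_apply_eq_zero_iff E (v : Y)).1 hcon)
    have key : ∀ T : End E Y, q (T v) ∈
        (span E (Set.range fun g => τ g v)).map (LinearMap.range q).subtype := by
      intro T
      have hT := hspan T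
      induction hT using Submodule.span_induction with
      | zero => rw [LinearMap.zero_apply, map_zero]; exact zero_mem _
      | add x y _ _ hx hy => rw [LinearMap.add_apply, map_add]; exact add_mem hx hy
      | smul c x _ hx => rw [LinearMap.smul_apply, map_smul]; exact Submodule.smul_mem _ c hx
      | mem T hT =>
        obtain ⟨X, h, rfl⟩ := hT
        refine ⟨X o o • τ h v, Submodule.smul_mem _ _ (subset_span ⟨h, rfl⟩), ?_⟩
        have h1 : q * μ X * q = X o o • q := by
          rw [← map_mul, ← map_mul, Matrix.single_mul_mul_single, one_mul, mul_one, ← map_smul,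
            Matrix.smul_single, smul_eq_mul, mul_one]
        change X o o • κ h v = q (μ X (κ h v))
        have h2 := LinearMap.congr_fun h1 (κ h v)
        have h3 := hqv _ (hmem h v v.2)
        rw [Module.End.mul_apply, Module.End.mul_apply, LinearMap.smul_apply, h3] at h2
        exact h2.symm
    obtain ⟨w', hw', hw⟩ := key ((f v)⁻¹ • f.smulRight (w : Y))
    have h1 : q (((f v)⁻¹ • f.smulRight (w : Y)) v) = w := by
      rw [LinearMap.smul_apply, LinearMap.smulRight_apply, inv_smul_smul₀ hf, hqv _ w.2]
    have h2 : w' = w := Subtype.ext (hw.trans h1)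
    rwa [← h2]
  · have htr : ∀ a, LinearMap.trace E Y (μ (Matrix.single a a 1) * κ h) = τ.character h := by
      intro a
      have h1 : (Matrix.single a a 1 : Matrix (Fin n) (Fin n) E) =
          Matrix.single a o 1 * Matrix.single o a 1 := by
        rw [Matrix.single_mul_single_same, mul_one]
      rw [h1, map_mul μ, mul_assoc, LinearMap.trace_mul_comm, mul_assoc, ← hc, ← mul_assoc,
        ← map_mul, Matrix.single_mul_single_same, mul_one]
      exact (LinearMap.trace_restrict_eq_of_forall_mem (LinearMap.range q) (q * κ h)
        (fun x => ⟨κ h x, rfl⟩)).symm.trans (by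
          change _ = LinearMap.trace E _ ((κ h).restrict (hmem h))
          congr 1
          ext v
          exact hqv _ (hmem h v v.2))
    have h2 : κ h = ∑ a, μ (Matrix.single a a 1) * κ h := by
      rw [← sum_mul, ← map_sum, Matrix.sum_single_one, map_one, one_mul]
    rw [h2, map_sum]
    simp only [htr]
    rw [Finset.sum_const, Finset.card_univ, Fintype.card_fin, nsmul_eq_mul]

/-- If a central simple algebra of dimension `n ^ 2` and a group together generate all
endomorphisms of a space and commute with each other, then the space is the sum of `n` copies of
an irreducible representation. -/
theorem exists_irreducible_of_centralSimple_commute {Z B H E Y : Type*} [Field Z] [Ring B]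
    [Algebra Z B] [IsSimpleRing B] [Algebra.IsCentral Z B] [FiniteDimensional Z B] [Group H]
    [Field E] [IsAlgClosed E] [AddCommGroup Y] [Module E Y] [FiniteDimensional E Y] [Nontrivial Y]
    {n : ℕ} (hB : finrank Z B = n ^ 2) (ζ : Z →+* E) (α : B →+* End E Y)
    (hα : ∀ z, α (algebraMap Z B z) = ζ z • 1) (κ : Representation E H Y)
    (hc : ∀ b h, α b * κ h = κ h * α b)
    (hspan : ∀ T : End E Y, T ∈ span E {T | ∃ b h, T = α b * κ h}) :
    ∃ (N : Submodule E Y) (τ : Representation E H N), τ.IsIrreducible ∧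
      ∀ h, LinearMap.trace E Y (κ h) = n * τ.character h := by
  let := ζ.toAlgebra
  let : Algebra Z (End E Y) := Algebra.compHom (End E Y) ζ
  have : IsScalarTower Z E (End E Y) := ⟨fun z c T => mul_smul (ζ z) c T⟩
  let α' : B →ₐ[Z] End E Y :=
    { α with
      commutes' := fun z => (hα z).trans (Algebra.algebraMap_eq_smul_one (ζ z)).symm }
  have := isSimpleRing_tensorProduct Z B E
  obtain ⟨k, hk, ⟨e⟩⟩ := IsSimpleRing.exists_algEquiv_matrix_of_isAlgClosed E (E ⊗[Z] B)
  have hkn : k = n := by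
    have h1 := e.toLinearEquiv.finrank_eq
    rw [finrank_baseChange, hB, Module.finrank_matrix, Fintype.card_fin, finrank_self, mul_one,
      ← sq] at h1
    exact (Nat.pow_left_injective two_ne_zero h1).symm
  subst hkn
  have hbc : ∀ (x : E ⊗[Z] B) h, scalarExtension E α' x * κ h = κ h * scalarExtension E α' x := by
    intro x h
    induction x using TensorProduct.induction_on with
    | zero => rw [map_zero, zero_mul, mul_zero]
    | add x y hx hy => rw [map_add, add_mul, mul_add, hx, hy]
    | tmul c b =>
      rw [scalarExtension_tmul, smul_mul_assoc, mul_smul_comm]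
      congr 1
      exact hc b h
  refine exists_irreducible_of_matrix_commute ((scalarExtension E α').comp e.symm.toAlgHom) κ
    (fun X h => hbc _ h) fun T => Submodule.span_mono ?_ (hspan T)
  rintro _ ⟨b, h, rfl⟩
  refine ⟨e (1 ⊗ₜ b), h, ?_⟩
  change _ = scalarExtension E α' (e.symm (e (1 ⊗ₜ b))) * κ h
  rw [e.symm_apply_apply, scalarExtension_tmul, one_smul]
  rfl

/-- If `n` is invertible, matrices of size `n` are spanned by the identity and the commutators. -/
theorem span_one_commutators_matrix {E : Type*} [Field E] {n : ℕ} (hn : (n : E) ≠ 0)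
    (W : Submodule E (Matrix (Fin n) (Fin n) E)) (h1 : 1 ∈ W)
    (hW : ∀ X Y : Matrix (Fin n) (Fin n) E, X * Y - Y * X ∈ W) : W = ⊤ := by
  have hoff : ∀ a b : Fin n, a ≠ b → Matrix.single a b (1 : E) ∈ W := by
    intro a b hab
    have h2 := hW (Matrix.single a a 1) (Matrix.single a b 1)
    rwa [Matrix.single_mul_single_same, Matrix.single_mul_single_of_ne _ _ _ _ hab.symm, sub_zero,
      mul_one] at h2
  have hdiag : ∀ a b : Fin n, Matrix.single a a (1 : E) - Matrix.single b b 1 ∈ W := by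
    intro a b
    have h2 := hW (Matrix.single a b 1) (Matrix.single b a 1)
    rwa [Matrix.single_mul_single_same, Matrix.single_mul_single_same, mul_one] at h2
  have hall : ∀ a b : Fin n, Matrix.single a b (1 : E) ∈ W := by
    intro a b
    rcases eq_or_ne a b with rfl | hab
    · have h2 : (n : E) • Matrix.single a a (1 : E) ∈ W := by
        have h3 : (n : E) • Matrix.single a a (1 : E) =
            ∑ b : Fin n, (Matrix.single a a (1 : E) - Matrix.single b b 1) + 1 := by
          rw [Finset.sum_sub_distrib, Matrix.sum_single_one, sub_add_cancel, Finset.sum_const,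
            Finset.card_univ, Fintype.card_fin, Nat.cast_smul_eq_nsmul]
        rw [h3]
        exact add_mem (sum_mem fun b _ => hdiag a b) h1
      have h3 := W.smul_mem (n : E)⁻¹ h2
      rwa [inv_smul_smul₀ hn] at h3
    · exact hoff a b hab
  rw [eq_top_iff]
  rintro X -
  rw [Matrix.matrix_eq_sum_single X]
  refine sum_mem fun a _ => sum_mem fun b _ => ?_
  have h2 := W.smul_mem (X a b) (hall a b)
  rwa [Matrix.smul_single, smul_eq_mul, mul_one] at h2

/-- In a central simple algebra whose degree is invertible, every element is the sum of a scalar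
and a combination of commutators. -/
theorem span_one_commutators_eq_top {Z B E : Type*} [Field Z] [Ring B] [Algebra Z B]
    [IsSimpleRing B] [Algebra.IsCentral Z B] [FiniteDimensional Z B] [Field E] [Algebra Z E]
    {n : ℕ} [NeZero n] (hn : (n : E) ≠ 0) (ψ : B →ₐ[Z] Matrix (Fin n) (Fin n) E)
    (hψ : span E (Set.range ψ) = ⊤) (W : Submodule Z B) (h1 : 1 ∈ W)
    (hW : ∀ x y : B, x * y - y * x ∈ W) : W = ⊤ := by
  have htop : span E (ψ '' W) = ⊤ := by
    apply span_one_commutators_matrix hn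
    · exact subset_span ⟨1, h1, map_one ψ⟩
    · intro X Y
      have hX : X ∈ span E (Set.range ψ) := hψ ▸ Submodule.mem_top
      have hY : Y ∈ span E (Set.range ψ) := hψ ▸ Submodule.mem_top
      refine map_mem_of_mem_span (LinearMap.mulRight E Y - LinearMap.mulLeft E Y) ?_ hX
      rintro _ ⟨x, rfl⟩
      refine map_mem_of_mem_span (LinearMap.mulLeft E (ψ x) - LinearMap.mulRight E (ψ x)) ?_ hY
      rintro _ ⟨y, rfl⟩
      refine subset_span ⟨_, hW x y, ?_⟩
      rw [map_sub, map_mul, map_mul]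
      rfl
  let b := finBasis Z W
  have h2 : span E (Set.range fun k => ψ (b k)) = ⊤ := by
    rw [eq_top_iff, ← htop, span_le]
    rintro _ ⟨w, hw, rfl⟩
    have h3 := congrArg Subtype.val (b.sum_repr ⟨w, hw⟩)
    change _ = w at h3
    rw [← h3, AddSubmonoidClass.coe_finsetSum, map_sum]
    refine sum_mem fun k _ => ?_
    rw [Submodule.coe_smul, map_smul, ← algebraMap_smul E]
    exact Submodule.smul_mem _ _ (subset_span ⟨k, rfl⟩)
  have h3 := finrank_range_le_card (R := E) fun k => ψ (b k)
  rw [Set.finrank, h2, finrank_top, Fintype.card_fin, ← finrank_eq_of_span_eq_top ψ hψ] at h3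
  exact Submodule.eq_top_of_finrank_eq (le_antisymm (Submodule.finrank_le W) h3)

end TensorFactor

/-! ### Generation of the corner -/

section CoefficientAutomorphisms

variable {N E : Type*} [Group N] [Field E]

theorem mapRingHom_smul (γ : E →+* E) (t : E) (x : E[N]) :
    mapRingHom N γ (t • x) = γ t • mapRingHom N γ x := by
  ext g
  rw [coeff_mapRingHom, coeff_smul_apply,
    coeff_smul_apply, coeff_mapRingHom, smul_eq_mul, smul_eq_mul,
    map_mul]

theorem mapRingHom_mem_span (γ : E →+* E) {T : Set E[N]}
    (hT : ∀ t ∈ T, mapRingHom N γ t ∈ T) {x : E[N]}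
    (hx : x ∈ span E T) : mapRingHom N γ x ∈ span E T := by
  induction hx using Submodule.span_induction with
  | zero => rw [map_zero]; exact zero_mem _
  | add x y _ _ hx hy => rw [map_add]; exact add_mem hx hy
  | smul c x _ hx => rw [mapRingHom_smul]; exact Submodule.smul_mem _ _ hx
  | mem x hx => exact subset_span (hT x hx)

theorem mapDomain_mem_span_of {N' : Type*} [Group N'] (ι : N →* N') (y : E[N]) :
    mapDomain ι y ∈
      span E (Set.range fun l => of E N' (ι l)) := by
  induction y using induction_linear with
  | zero => rw [mapDomain_zero]; exact zero_mem _
  | add x y hx hy => rw [mapDomain_add]; exact add_mem hx hy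
  | single l t =>
    have h : mapDomain ι (single l t) =
        t • of E N' (ι l) := by simp
    rw [h]
    exact Submodule.smul_mem _ _ (subset_span ⟨l, rfl⟩)

theorem mapRingHom_symm_apply (γ : E ≃+* E) (x : E[N]) :
    mapRingHom N (γ : E →+* E) (mapRingHom N (γ.symm : E →+* E) x) =
      x := by
  ext g
  rw [coeff_mapRingHom, coeff_mapRingHom]
  exact γ.apply_symm_apply _

end CoefficientAutomorphisms

namespace CharacterCorner

variable {K L E F : Type*} [Group K] [Group L] [Field E] [Field F] [Algebra F E]
    {ι : L →* K} {M : IntermediateField F E} {V : Type*} [AddCommGroup V] [Module E V]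
    {n : ℕ} (C : CharacterCorner ι M V n) [Fintype (M ≃ₐ[F] M)]

theorem f_mul_i (hf : ∀ γ : M ≃ₐ[F] M, γ ≠ 1 → C.c.f * galConj γ C.c.f = 0) :
    C.c.f * C.i = C.j := by
  rw [i, mul_sum, Finset.sum_eq_single 1, galConj_one_apply C.j_mem, f_mul_j]
  · intro γ _ hγ
    rw [galConj_j, ← mul_assoc, hf γ hγ, zero_mul]
  · simp

theorem galConj_f_mul_i (hf : ∀ γ : M ≃ₐ[F] M, γ ≠ 1 → C.c.f * galConj γ C.c.f = 0)
    (γ : M ≃ₐ[F] M) : galConj γ C.c.f * C.i = galConj γ C.j := by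
  rw [← C.f_mul_i hf, galConj_mul γ C.f_mem C.i_mem, galConj_i]

theorem galSum_f_mul_i (hf : ∀ γ : M ≃ₐ[F] M, γ ≠ 1 → C.c.f * galConj γ C.c.f = 0) :
    galSum (M := M) C.c.f * C.i = C.i := by
  rw [galSum, sum_mul]
  simp only [C.galConj_f_mul_i hf]
  rfl

theorem galSum_e_mul_i : galSum (M := M) C.c.e * C.i = C.i := by
  rw [galSum, sum_mul]
  simp only [← C.mul_galConj_e, C.i_mul_galConj_e]
  rfl

theorem mul_galSum_e (x : E[K]) :
    x * galSum (M := M) C.c.e = galSum (M := M) C.c.e * x := by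
  rw [galSum, sum_mul, mul_sum]
  exact sum_congr rfl fun γ _ => C.mul_galConj_e γ x

theorem galSum_e_mul_galSum_e :
    galSum (M := M) C.c.e * galSum (M := M) C.c.e = galSum (M := M) C.c.e := by
  conv_lhs => rw [galSum, sum_mul]
  refine sum_congr rfl fun γ _ => ?_
  rw [mul_sum, Finset.sum_eq_single γ, ← galConj_mul γ C.e_mem C.e_mem, C.c.e_mul_e]
  · exact fun δ _ hδ => C.galConj_e_mul_galConj_e hδ.symm
  · simp

variable [IsAlgClosed E]

omit [IsAlgClosed E] in
theorem unit_mul_mem_span (hf : ∀ γ : M ≃ₐ[F] M, γ ≠ 1 → C.c.f * galConj γ C.c.f = 0)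
    [Finite K] [IsGalois F M] (a b : Fin C.d) {y : E[K]}
    (hy : ∀ a b, C.c.unit a b * y = y * C.c.unit a b) (hye : y * C.c.e = y) (hyf : y * C.c.f = y) :
    C.c.unit a b * y ∈ span E
      {x | ∃ l s, C.InS s ∧ x = of E K (ι l) * s} := by
  have h1 : ∀ X ∈ span E (C.c.rep '' {x | C.InS x}),
      ∃ s ∈ span E {x | C.InS x}, C.c.rep s = X := by
    intro X hX
    rw [Submodule.span_image] at hX
    exact hX
  obtain ⟨s, hs, hsy⟩ := h1 (C.c.rep y) (by rw [C.span_rep_eq_top]; trivial)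
  have hcomm : ∀ l, of E K (ι l) * s = s * of E K (ι l) :=
    fun l => (mul_comm_of_mem_span (fun x hx => (hx.comm l).symm) hs).symm
  have hi : s * C.i = s := by
    exact LinearMap.eqOn_span (f := LinearMap.mulRight E C.i) (g := LinearMap.id)
      (fun x hx => hx.mul_i) hs
  have h2 : s * C.j = y * C.j := C.eq_of_rep_eq hcomm (C.of_commute hy hyf) hsy
  have h3 : y * C.j = y := by rw [j, ← mul_assoc, hyf, hye]
  have hfi : C.i * C.c.f = C.j := by
    have h4 : C.c.f * C.i = C.i * C.c.f := by
      rw [C.c.f_mul_comm (C.unit_commute fun l => ?_)]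
      rw [i, mul_sum, sum_mul]
      refine sum_congr rfl fun γ _ => ?_
      have h := congrArg (galConj γ) (C.of_mul_j l)
      rwa [galConj_mul γ (of_mem_coeffSubring _) C.j_mem,
        galConj_mul γ C.j_mem (of_mem_coeffSubring _), galConj_of] at h
    rw [← h4, C.f_mul_i hf]
  have h5 : C.c.unit a b * y = C.c.unit a b * s := by
    have hu := C.unit_commute hcomm
    calc C.c.unit a b * y = C.c.unit a b * (s * C.i * C.c.f) := by
          rw [mul_assoc, hfi, h2, h3]
      _ = C.c.unit a b * (C.c.f * s) := by rw [hi, C.c.f_mul_comm hu]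
      _ = C.c.unit a b * s := by rw [← mul_assoc, C.c.unit_mul_f]
  obtain ⟨u, hu⟩ := C.unit_mem a b
  rw [h5, hu]
  have h6 := mapDomain_mem_span_of ι u
  refine mul_mem_of_mem_span_left ?_ h6
  rintro _ ⟨l, rfl⟩
  refine mul_mem_of_mem_span ?_ hs
  exact fun x hx => subset_span ⟨l, x, hx, rfl⟩

omit [IsAlgClosed E] in
theorem j_mul_mul_j_mem_span (hf : ∀ γ : M ≃ₐ[F] M, γ ≠ 1 → C.c.f * galConj γ C.c.f = 0)
    [Finite K] [IsGalois F M] (x : E[K]) :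
    C.j * x * C.j ∈ span E
      {x | ∃ l s, C.InS s ∧ x = of E K (ι l) * s} := by
  have h1 : C.j * x * C.j = C.c.f * (C.c.e * x * C.c.e) * C.c.f := by
    have h2 : C.j * x * C.j = C.c.f * C.c.e * x * (C.c.e * C.c.f) := by
      rw [C.e_mul_f]
      rfl
    rw [h2]
    simp only [mul_assoc]
  rw [h1, ← C.c.sum_unit_mul_average]
  refine sum_mem fun a _ => sum_mem fun b _ => C.unit_mul_mem_span hf a b
    (C.c.unit_mul_average a b _) ?_ (C.c.average_mul_f _ _ _)
  rw [C.c.average_mul_e, mul_assoc, C.c.e_mul_e]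

/-- The double centralizer property: the corner `i E K i` is generated by `L` and `S`. -/
theorem i_mul_mul_i_mem_span (hf : ∀ γ : M ≃ₐ[F] M, γ ≠ 1 → C.c.f * galConj γ C.c.f = 0)
    [Finite K] [IsGalois F M] (x : E[K]) :
    C.i * x * C.i ∈ span E
      {x | ∃ l s, C.InS s ∧ x = of E K (ι l) * s} := by
  have h1 : C.i * x * C.i = ∑ γ : M ≃ₐ[F] M, galConj γ C.j * x * galConj γ C.j := by
    conv_lhs => rw [i, sum_mul, sum_mul]
    refine sum_congr rfl fun γ _ => ?_
    rw [mul_sum, Finset.sum_eq_single γ _ (by simp)]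
    intro δ _ hδ
    have h2 : galConj γ C.j * x * galConj δ C.j =
        galConj γ C.j * galConj δ C.c.e * x * galConj δ C.c.f := by
      rw [C.galConj_j δ, C.mul_galConj_e, ← mul_assoc, mul_assoc _ x, C.mul_galConj_e, ← mul_assoc]
    rw [h2, C.galConj_j_mul_galConj_e hδ.symm, zero_mul, zero_mul]
  rw [h1]
  refine sum_mem fun γ _ => ?_
  obtain ⟨γ', hγ'⟩ := exists_ringEquiv_extending γ
  have h2 : galConj γ C.j * x * galConj γ C.j = mapRingHom K (γ' : E →+* E)
      (C.j * mapRingHom K (γ'.symm : E →+* E) x * C.j) := by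
    rw [map_mul, map_mul, mapRingHom_symm_apply,
      galConj_eq_mapRingHom (γ' := (γ' : E →+* E)) hγ' C.j_mem]
  rw [h2]
  refine mapRingHom_mem_span _ ?_ (C.j_mul_mul_j_mem_span hf _)
  rintro _ ⟨l, s, hs, rfl⟩
  refine ⟨l, s, hs, ?_⟩
  rw [map_mul, ← galConj_eq_mapRingHom (γ' := (γ' : E →+* E)) hγ' hs.coeff_mem, hs.galConj]
  congr 1
  simp

/-- The centre of `i F K i` is contained in the image of the group algebra of `L`. -/
theorem zeta_mem_span (hf : ∀ γ : M ≃ₐ[F] M, γ ≠ 1 → C.c.f * galConj γ C.c.f = 0) (l : M) :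
    C.zeta l ∈ span E (Set.range fun k => of E K (ι k) * C.i) := by
  rw [zeta, galSum]
  refine sum_mem fun γ _ => ?_
  rw [galConj_smul _ _ C.j_mem, ← C.galConj_f_mul_i hf]
  refine Submodule.smul_mem _ _ ?_
  obtain ⟨γ', hγ'⟩ := exists_ringEquiv_extending γ
  have h1 : galConj γ C.c.f ∈ span E (Set.range fun k => of E K (ι k)) := by
    rw [galConj_eq_mapRingHom (γ' := (γ' : E →+* E)) hγ' C.f_mem]
    refine mapRingHom_mem_span _ ?_ ?_
    · rintro _ ⟨k, rfl⟩
      exact ⟨k, by simp⟩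
    · refine sum_mem fun a _ => ?_
      obtain ⟨u, hu⟩ := C.unit_mem a a
      rw [hu]
      exact mapDomain_mem_span_of ι u
  refine mul_mem_of_mem_span_left ?_ h1
  rintro _ ⟨k, rfl⟩
  exact subset_span ⟨k, rfl⟩

omit [Fintype (M ≃ₐ[F] M)] [IsAlgClosed E] in
/-- Multiplication by `e_θ` is injective on `E L e_φ`, because `E L e_φ` is a matrix algebra and
`e_φ e_θ` is not zero. -/
theorem mapDomain_mul_f_eq_zero [NeZero n] {y : E[L]}
    (hy : mapDomain ι y * C.j = 0) : mapDomain ι y * C.c.f = 0 := by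
  obtain ⟨t, ht⟩ := (Submodule.mem_span_range_iff_exists_fun E).1 (C.mul_f_mem y)
  have h1 : (∑ p : Fin C.d × Fin C.d, t p • C.c.unit p.1 p.2) * C.c.e = 0 := by
    rw [ht, mul_assoc]
    exact hy
  have h2 : ∀ p, t p = 0 := by
    intro p
    have h3 : C.c.unit C.c.o p.1 * ((∑ p : Fin C.d × Fin C.d, t p • C.c.unit p.1 p.2) *
        C.c.unit p.2 C.c.o) = t p • C.c.unit C.c.o C.c.o := by
      rw [sum_mul, mul_sum, Finset.sum_eq_single p]
      · rw [smul_mul_assoc, mul_smul_comm, C.c.unit_mul, if_pos rfl, C.c.unit_mul, if_pos rfl]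
      · intro q _ hq
        rw [smul_mul_assoc, mul_smul_comm, C.c.unit_mul]
        split_ifs with h4
        · rw [C.c.unit_mul, if_neg fun h5 => hq (Prod.ext h5.symm h4), smul_zero]
        · rw [mul_zero, smul_zero]
      · simp
    have h4 : (t p • C.c.unit C.c.o C.c.o) * C.c.e = 0 := by
      rw [← h3, mul_assoc, mul_assoc, C.c.mul_e, ← mul_assoc _ C.c.e, h1, zero_mul, mul_zero]
    have h5 := congrArg C.c.rep h4
    rw [C.c.rep_mul_e, map_smul, C.c.rep_unit, map_zero] at h5
    exact (smul_eq_zero.1 h5).resolve_right one_ne_zero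
  rw [← ht]
  exact Finset.sum_eq_zero fun p _ => by rw [h2, zero_smul]

theorem mapDomain_mul_galSum_f_eq_zero [NeZero n] {y : E[L]}
    (hy : mapDomain ι y * C.i = 0) :
    mapDomain ι y * galSum (M := M) C.c.f = 0 := by
  rw [galSum, mul_sum]
  refine Finset.sum_eq_zero fun γ _ => ?_
  obtain ⟨γ', hγ'⟩ := exists_ringEquiv_extending γ
  have hmap : ∀ (δ : E →+* E) (y : E[L]), mapRingHom K δ
      (mapDomain ι y) = mapDomain ι (mapRingHom L δ y) :=
    fun δ y => RingHom.congr_fun (mapRingHom_comp_mapDomainRingHom δ ι) y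
  have h1 : mapDomain ι (mapRingHom L (γ'.symm : E →+* E) y) * C.j =
      0 := by
    have h2 : mapDomain ι y * galConj γ C.j = 0 := by
      rw [← C.i_mul_galConj_j, ← mul_assoc, hy, zero_mul]
    rw [galConj_eq_mapRingHom (γ' := (γ' : E →+* E)) hγ' C.j_mem] at h2
    have h3 := congrArg (mapRingHom K (γ'.symm : E →+* E)) h2
    rw [map_mul, map_zero, hmap] at h3
    have h4 := mapRingHom_symm_apply (N := K) γ'.symm C.j
    rw [RingEquiv.symm_symm] at h4
    rwa [h4] at h3
  have h5 := congrArg (mapRingHom K (γ' : E →+* E)) (C.mapDomain_mul_f_eq_zero h1)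
  rw [map_mul, map_zero, hmap, mapRingHom_symm_apply] at h5
  rwa [galConj_eq_mapRingHom (γ' := (γ' : E →+* E)) hγ' C.f_mem]

omit [IsAlgClosed E] in
/-- The two-sided ideal generated by `i` contains `e`, because `E K e` is simple and `i e` is not
zero. -/
theorem e_mem_span_mul_i_mul [NeZero n] [FiniteDimensional E V] :
    C.c.e ∈ span E {x | ∃ a b, x = a * C.i * b} := by
  have hj : C.c.toEnd C.j ≠ 0 := by
    intro h
    have h1 := C.c.mul_e_eq_zero _ h
    rw [j_mul_e] at h1
    have h2 := C.rep_j
    rw [h1, map_zero] at h2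
    exact zero_ne_one h2
  have hnt : Nontrivial V := by
    by_contra hcon
    rw [not_nontrivial_iff_subsingleton] at hcon
    exact hj (Subsingleton.elim _ _)
  have : NeZero (Module.finrank E V) := ⟨Module.finrank_pos.ne'⟩
  have : IsSimpleRing (Module.End E V) :=
    IsSimpleRing.of_ringEquiv (algEquivMatrix (Module.finBasis E V)).symm.toRingEquiv inferInstance
  let T := {x : E[K] | ∃ a b, x = a * C.i * b}
  have hleft : ∀ a, ∀ x ∈ span E T, a * x ∈ span E T := by
    intro a x hx
    refine mul_mem_of_mem_span ?_ hx
    rintro _ ⟨b, c, rfl⟩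
    exact subset_span ⟨a * b, c, by simp only [mul_assoc]⟩
  have hright : ∀ a, ∀ x ∈ span E T, x * a ∈ span E T := by
    intro a x hx
    refine mul_mem_of_mem_span_left ?_ hx
    rintro _ ⟨b, c, rfl⟩
    exact subset_span ⟨b, c * a, by simp only [mul_assoc]⟩
  let I : TwoSidedIdeal (Module.End E V) := TwoSidedIdeal.mk'
    {A | ∃ x ∈ span E T, C.c.toEnd x = A} ⟨0, zero_mem _, map_zero _⟩
    (by
      rintro _ _ ⟨x, hx, rfl⟩ ⟨y, hy, rfl⟩
      exact ⟨x + y, add_mem hx hy, map_add _ _ _⟩)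
    (by
      rintro _ ⟨x, hx, rfl⟩
      exact ⟨-x, neg_mem hx, map_neg _ _⟩)
    (by
      rintro A _ ⟨x, hx, rfl⟩
      obtain ⟨a, rfl⟩ := C.c.surjective A
      exact ⟨a * x, hleft a x hx, map_mul _ _ _⟩)
    (by
      rintro _ A ⟨x, hx, rfl⟩
      obtain ⟨a, rfl⟩ := C.c.surjective A
      exact ⟨x * a, hright a x hx, map_mul _ _ _⟩)
  have hmem : ∀ A, A ∈ I ↔ ∃ x ∈ span E T, C.c.toEnd x = A :=
    TwoSidedIdeal.mem_mk' _ _ _ _ _ _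
  have h1 : C.c.toEnd C.j ∈ I := (hmem _).2
    ⟨C.j, subset_span ⟨C.j, 1, by rw [j_mul_i, mul_one]⟩, rfl⟩
  obtain ⟨x, hx, hx1⟩ := (hmem 1).1 (IsSimpleRing.one_mem_of_ne_zero_mem I hj h1)
  have h2 := C.c.mul_e_eq_zero (x - 1) (by rw [map_sub, hx1, map_one, sub_self])
  rw [sub_mul, one_mul, sub_eq_zero] at h2
  rw [← h2]
  exact hright _ x hx

theorem galSum_e_mem_span_mul_i_mul [NeZero n] [FiniteDimensional E V] :
    galSum (M := M) C.c.e ∈ span E {x | ∃ a b, x = a * C.i * b} := by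
  refine sum_mem fun γ _ => ?_
  obtain ⟨γ', hγ'⟩ := exists_ringEquiv_extending γ
  rw [galConj_eq_mapRingHom (γ' := (γ' : E →+* E)) hγ' C.e_mem]
  refine mapRingHom_mem_span _ ?_ C.e_mem_span_mul_i_mul
  rintro _ ⟨a, b, rfl⟩
  refine ⟨mapRingHom K (γ' : E →+* E) a, mapRingHom K (γ' : E →+* E) b,
    ?_⟩
  rw [map_mul, map_mul, ← galConj_eq_mapRingHom (γ' := (γ' : E →+* E)) hγ' C.i_mem, galConj_i]

end CharacterCorner

section GlobalCorner

variable {G : Type*} [Group G] {K H : Subgroup G} {E : Type*} [Field E]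

/-- The relations between the idempotents `i`, `e_(θ,F)`, `e_(φ,F)` and the rings `S` and `Z` on
which the correspondence rests. -/
structure IsCornerGenerated (F : Type*) [Field F] [Algebra F E] (θ : K → E)
    (φ : ↥(H ⊓ K) → E) : Prop where
  prod_eq : ∀ g : G, ∃ h ∈ H, ∃ k ∈ K, g = h * k
  of_mul_idem : ∀ h : H, of E G (h : G) * idemI F θ φ =
    idemI F θ φ * of E G (h : G)
  corner : ∀ x : E[K], idemI F θ φ * inclK K x * idemI F θ φ ∈ span E
    {a | ∃ l ∈ H ⊓ K, ∃ s ∈ ringS F θ φ, a = of E G l * s}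
  center : ∀ z ∈ ringZ F θ φ, z ∈ span E
    (Set.range fun l : ↥(H ⊓ K) => of E G (l : G) * idemI F θ φ)
  phi_mul : mapDomain (H ⊓ K).subtype (charIdemOver F φ) * idemI F θ φ =
    idemI F θ φ
  mul_phi_eq_zero : ∀ y : E[↥(H ⊓ K)],
    mapDomain (H ⊓ K).subtype y * idemI F θ φ = 0 → y * charIdemOver F φ = 0
  theta_mul : inclK K (charIdemOver F θ) * idemI F θ φ = idemI F θ φ
  theta_comm : ∀ x : E[G],
    x * inclK K (charIdemOver F θ) = inclK K (charIdemOver F θ) * x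
  theta_idem : inclK K (charIdemOver F θ) * inclK K (charIdemOver F θ) =
    inclK K (charIdemOver F θ)
  theta_mem : inclK K (charIdemOver F θ) ∈ span E
    {x | ∃ a b, x = a * idemI F θ φ * b}

theorem charIdemOver_eq {N F : Type*} [Group N] [Field F] [Algebra F E] {χ : N → E}
    {M : IntermediateField F E} (hM : charField F χ = M) [Fintype (M ≃ₐ[F] M)] :
    charIdemOver F χ = CharacterCorner.galSum (M := M) (charIdem χ) := by
  subst hM
  rw [charIdemOver, finsum_eq_sum_of_fintype]
  rfl

theorem mapDomain_subtype_eq_inclK (y : E[↥(H ⊓ K)]) :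
    mapDomain (H ⊓ K).subtype y =
      inclK K (mapDomain (interIncl H K) y) :=
  RingHom.congr_fun (mapDomainRingHom_comp (R := E) K.subtype
    (interIncl H K)) y

theorem inclK_mem_span {T : Set E[K]} {T' : Set E[G]}
    (hT : ∀ t ∈ T, inclK K t ∈ T') {x : E[K]} (hx : x ∈ span E T) :
    inclK K x ∈ span E T' := by
  induction hx using Submodule.span_induction with
  | zero => rw [map_zero]; exact zero_mem _
  | add x y _ _ hx hy => rw [map_add]; exact add_mem hx hy
  | smul c x _ hx => rw [inclK_smul]; exact Submodule.smul_mem _ _ hx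
  | mem x hx => exact subset_span (hT x hx)

theorem CharacterCorner.twist_galSum_e [K.Normal] {F : Type*} [Field F] [Algebra F E]
    {M : IntermediateField F E} [Fintype (M ≃ₐ[F] M)] {V : Type*} [AddCommGroup V] [Module E V]
    {n : ℕ} {C : CharacterCorner (interIncl H K) M V n} {h : H}
    {γ : M ≃ₐ[F] M} (hγ : C.IsSemiInvariant h γ) :
    twist K (h : G) (galSum (M := M) C.c.e) = galSum (M := M) C.c.e := by
  rw [twist_galSum _ C.e_mem, ← galSum_galConj γ (twist_mem _ C.e_mem), hγ.e]

theorem of_mul_eq_of_conjBy_eq {g : G} {x : E[G]} (h : conjBy g x = x) :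
    of E G g * x = x * of E G g := by
  conv_lhs => rw [← h]
  rw [conjBy, ← mul_assoc, ← mul_assoc, ← map_mul, mul_inv_cancel, map_one, one_mul]

theorem mul_inclK_comm {y : E[K]} (hG : ∀ g : G, ∃ h ∈ H, ∃ k ∈ K, g = h * k)
    (hH : ∀ h : H, of E G (h : G) * inclK K y =
      inclK K y * of E G (h : G))
    (hK : ∀ x, x * y = y * x) (x : E[G]) : x * inclK K y = inclK K y * x := by
  induction x using induction_linear with
  | zero => rw [zero_mul, mul_zero]
  | add x y hx hy => rw [add_mul, mul_add, hx, hy]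
  | single g t =>
    obtain ⟨h, hh, k, hk, rfl⟩ := hG g
    have h1 : single (h * k) t =
        t • (of E G h * inclK K (of E K ⟨k, hk⟩)) := by
      rw [inclK_of, ← map_mul]
      simp
    have h2 := hH ⟨h, hh⟩
    rw [h1, smul_mul_assoc, mul_smul_comm, mul_assoc, ← map_mul, hK, map_mul, ← mul_assoc, h2,
      mul_assoc]

theorem SemiInvariantConfig.isCornerGenerated [Finite G] [IsAlgClosed E] [K.Normal] {F : Type*}
    [Field F] [Algebra F E] {V U : Type*} [AddCommGroup V] [Module E V] [AddCommGroup U]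
    [Module E U] {ρ : Representation E K V} {τ : Representation E ↥(H ⊓ K) U}
    (cfg : SemiInvariantConfig F K H ρ τ) :
    IsCornerGenerated F ρ.character τ.character := by
  have := cfg.simple_theta
  have := cfg.simple_phi
  have := cfg.proj_theta
  have := cfg.proj_phi
  have : NeZero (charMult ρ τ) := ⟨cfg.mult_pos.ne'⟩
  have := τ.finiteDimensional_of_isIrreducible
  have := ρ.finiteDimensional_of_isIrreducible
  have := τ.finiteDimensional_charField F
  have : IsGalois F (charField F τ.character) := by
    have := τ.isAbelianGalois_charField F
    infer_instance
  have := Fintype.ofFinite (charField F τ.character ≃ₐ[F] charField F τ.character)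
  obtain ⟨C, he, hf, -⟩ := cfg.exists_characterCorner
  have hφ := τ.charIdem_mem_coeffSubring (F := F) rfl
  have hI := CharacterCorner.idemI_eq he hf hφ
  have hγ : ∀ h : H, ∃ γ, C.IsSemiInvariant h γ := fun h => by
    obtain ⟨γ, h1, h2⟩ := cfg.exists_galConj_twist_eq h
    exact ⟨γ, by rw [he, h1], by rw [hf, h2]⟩
  have hff : ∀ γ : charField F τ.character ≃ₐ[F] charField F τ.character, γ ≠ 1 →
      C.c.f * galConj γ C.c.f = 0 := by
    intro γ hγ
    have h1 : galConj γ (mapDomain (interIncl H K) (charIdem τ.character)) =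
      mapDomain (interIncl H K) (galConj γ (charIdem τ.character)) := galConj_mapDomain γ _ hφ
    have h2 := map_mul (mapDomainRingHom E (interIncl H K)) (charIdem τ.character)
      (galConj γ (charIdem τ.character))
    rw [hf, h1]
    refine h2.symm.trans ?_
    rw [τ.mul_galConj_charIdem_comm rfl γ, τ.galConj_charIdem_mul_charIdem rfl hγ, map_zero]
  have hθ : charIdemOver F ρ.character =
      CharacterCorner.galSum (M := charField F τ.character) C.c.e := by
    rw [he, charIdemOver_eq cfg.field_eq.symm]
  have hφ' : mapDomain (interIncl H K) (charIdemOver F τ.character) =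
      CharacterCorner.galSum (M := charField F τ.character) C.c.f := by
    rw [hf, charIdemOver_eq rfl, CharacterCorner.galSum, CharacterCorner.galSum]
    refine (map_sum (mapDomainRingHom E (interIncl H K)) _ _).trans (sum_congr rfl fun γ _ => ?_)
    exact (galConj_mapDomain γ (interIncl H K) hφ).symm
  refine ⟨cfg.prod_eq, fun h => ?_, fun x => ?_, fun z hz => ?_, ?_, fun y hy => ?_, ?_, ?_, ?_, ?_⟩
  · obtain ⟨γ, hγ⟩ := hγ h
    apply of_mul_eq_of_conjBy_eq
    rw [hI, conjBy_inclK, hγ.twist_i]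
  · rw [hI, ← map_mul, ← map_mul]
    refine inclK_mem_span ?_ (C.i_mul_mul_i_mem_span hff x)
    rintro _ ⟨l, s, hs, rfl⟩
    refine ⟨l, l.2, inclK K s, (mem_ringS_iff hI).2 ⟨s, hs, rfl⟩, ?_⟩
    rw [map_mul, inclK_of]
    rfl
  · obtain ⟨l, rfl⟩ := (mem_ringZ_iff hI).1 hz
    refine inclK_mem_span ?_ (C.zeta_mem_span hff l)
    rintro _ ⟨k, rfl⟩
    refine ⟨k, ?_⟩
    rw [map_mul, inclK_of, hI]
    rfl
  · rw [mapDomain_subtype_eq_inclK, hφ', hI, ← map_mul, C.galSum_f_mul_i hff]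
  · rw [mapDomain_subtype_eq_inclK, hI, ← map_mul] at hy
    have h1 := C.mapDomain_mul_galSum_f_eq_zero (inclK_injective K (hy.trans (map_zero _).symm))
    rw [← hφ'] at h1
    have h2 := (map_mul (mapDomainRingHom E (interIncl H K)) y
      (charIdemOver F τ.character)).trans h1
    exact mapDomain_injective (Subgroup.inclusion_injective _)
      (h2.trans (map_zero (mapDomainRingHom E _)).symm)
  · rw [hθ, hI, ← map_mul, C.galSum_e_mul_i]
  · rw [hθ]
    refine mul_inclK_comm cfg.prod_eq (fun h => ?_) C.mul_galSum_e
    obtain ⟨γ, hγ⟩ := hγ h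
    apply of_mul_eq_of_conjBy_eq
    rw [conjBy_inclK, CharacterCorner.twist_galSum_e hγ]
  · rw [hθ, ← map_mul, C.galSum_e_mul_galSum_e]
  · rw [hθ, hI]
    refine inclK_mem_span ?_
      C.galSum_e_mem_span_mul_i_mul
    rintro _ ⟨a, b, rfl⟩
    exact ⟨inclK K a, inclK K b, by
      rw [map_mul, map_mul]⟩

end GlobalCorner

/-! ### The representation attached to a magic crossed representation -/

section LinearExtension

variable {N E B : Type*} [Group N] [Field E] [AddCommGroup B] [Module E B]

/-- The linear extension of a map from a group to the group algebra. -/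
noncomputable def linExt (f : N → B) : E[N] →ₗ[E] B :=
  Finsupp.linearCombination E f ∘ₗ (MonoidAlgebra.coeffLinearEquiv E).toLinearMap

omit [Group N] in
theorem linExt_single (f : N → B) (g : N) (c : E) :
    linExt f (single g c) = c • f g :=
  Finsupp.linearCombination_single E c g

theorem linExt_of (f : N → B) (g : N) : linExt f (of E N g) = f g := by
  rw [of_apply, linExt_single, one_smul]

theorem linearMap_eq_of_forall_of {f f' : E[N] →ₗ[E] B}
    (h : ∀ g, f (of E N g) = f' (of E N g)) (x : E[N]) :
    f x = f' x := by
  induction x using induction_linear with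
  | zero => rw [map_zero, map_zero]
  | add x y hx hy => rw [map_add, map_add, hx, hy]
  | single g c =>
    have h1 : single g c = c • of E N g := by simp
    rw [h1, map_smul, map_smul, h]

omit [Group N] in
theorem charEval_eq_linExt (χ : N → E) (x : E[N]) : charEval χ x = linExt χ x := rfl

theorem linExt_add (f f' : N → B) (x : E[N]) :
    linExt (fun g => f g + f' g) x = linExt f x + linExt f' x :=
  linearMap_eq_of_forall_of (f := linExt _) (f' := linExt f + linExt f')
    (fun g => by rw [LinearMap.add_apply, linExt_of, linExt_of, linExt_of]) x

theorem linExt_smul (c : E) (f : N → B) (x : E[N]) :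
    linExt (fun g => c • f g) x = c • linExt f x :=
  linearMap_eq_of_forall_of (f := linExt _) (f' := c • linExt f)
    (fun g => by rw [LinearMap.smul_apply, linExt_of, linExt_of]) x

end LinearExtension

namespace MagicCrossedRep

variable {G : Type*} [Group G] {K H : Subgroup G} {E F : Type*} [Field E] [Field F] [Algebra F E]
  {θ : K → E} {φ : ↥(H ⊓ K) → E} {S₀ : NonUnitalSubring E[G]}
  (σ : MagicCrossedRep F θ φ S₀)

/-- The representation `h ↦ h σ(Lh)⁻¹` of `H` in the algebra `i E G i`. -/
noncomputable def kappa (h : H) : E[G] :=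
  of E G (h : G) * (σ.inv h : E[G])

theorem idemI_mul_of_mem {s : E[G]} (hs : s ∈ ringS F θ φ) : idemI F θ φ * s = s :=
  hs.1.2.1

theorem mul_idemI_of_mem {s : E[G]} (hs : s ∈ ringS F θ φ) : s * idemI F θ φ = s :=
  hs.1.2.2

theorem of_mul_conjBy (g : G) (s : E[G]) :
    of E G g * conjBy g s = s * of E G g := by
  rw [conjBy, ← mul_assoc, ← mul_assoc, ← map_mul, mul_inv_cancel, map_one, one_mul]

theorem kappa_mul_toFun (h : H) : σ.kappa h * (σ.toFun h : E[G]) =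
    of E G (h : G) * idemI F θ φ := by
  rw [kappa, mul_assoc, σ.inv_mul]

theorem kappa_mul_idemI (h : H) : σ.kappa h * idemI F θ φ = σ.kappa h := by
  rw [kappa, mul_assoc, mul_idemI_of_mem (σ.inv h).2]

/-- The magic property says that `κ(h)` commutes with `S₀`. -/
theorem mul_kappa {s : E[G]} (hle : S₀ ≤ ringS F θ φ) (hs : s ∈ S₀) (h : H) :
    s * σ.kappa h = σ.kappa h * s := by
  have h1 : conjBy (h : G) s = (σ.inv h : E[G]) * s * σ.toFun h := by
    have h2 := σ.magic h ⟨s, hle hs⟩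
    rw [σ.eps_form h ⟨s, hle hs⟩ hs] at h2
    exact h2
  rw [kappa, ← mul_assoc, ← of_mul_conjBy, h1, mul_assoc, mul_assoc, σ.mul_inv,
    mul_assoc, mul_idemI_of_mem (hle hs), mul_assoc]

theorem idemI_mul_kappa (hC : IsCornerGenerated F θ φ) (h : H) :
    idemI F θ φ * σ.kappa h = σ.kappa h := by
  rw [kappa, ← mul_assoc, ← hC.of_mul_idem, mul_assoc, idemI_mul_of_mem (σ.inv h).2]

theorem kappa_mul (hC : IsCornerGenerated F θ φ) (x y : H) :
    σ.kappa (x * y) = σ.kappa x * σ.kappa y := by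
  have h1 : (σ.toFun ((x * y : H) : H ⧸ (H ⊓ K).subgroupOf H) : E[G]) =
      σ.toFun y * conjBy (y : G) (σ.toFun x : E[G]) := by
    have h2 := σ.magic y (σ.toFun x)
    have h3 : ((σ.inv y * σ.eps y (σ.toFun x) * σ.toFun y : ringS F θ φ) : E[G]) =
      σ.inv y * (σ.eps y (σ.toFun x) * σ.toFun y : ringS F θ φ) := mul_assoc _ _ _
    rw [h2, h3, σ.crossed_mul, ← mul_assoc, σ.mul_inv, idemI_mul_of_mem (σ.toFun _).2]
  have h2 : σ.kappa x * σ.kappa y * (σ.toFun ((x * y : H) : H ⧸ (H ⊓ K).subgroupOf H) :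
      E[G]) = of E G ((x * y : H) : G) * idemI F θ φ := by
    rw [h1, mul_assoc, ← mul_assoc (σ.kappa y), kappa_mul_toFun, mul_assoc (of E G _)]
    have h3 : idemI F θ φ * conjBy (y : G) (σ.toFun x : E[G]) =
        conjBy (y : G) (σ.toFun x : E[G]) := by
      rw [σ.magic y (σ.toFun x)]
      exact idemI_mul_of_mem (SetLike.coe_mem _)
    rw [h3, of_mul_conjBy, ← mul_assoc, kappa_mul_toFun, mul_assoc, ← hC.of_mul_idem, ← mul_assoc,
      ← map_mul]
    rfl
  calc σ.kappa (x * y)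
      = of E G ((x * y : H) : G) * idemI F θ φ * (σ.inv ((x * y : H) :
          H ⧸ (H ⊓ K).subgroupOf H) : E[G]) := by
        rw [mul_assoc, idemI_mul_of_mem (σ.inv _).2]
        rfl
    _ = σ.kappa x * σ.kappa y := by
        rw [← h2, mul_assoc _ (σ.toFun _ : E[G]), σ.mul_inv, mul_assoc,
          kappa_mul_idemI]

theorem inv_one (hC : IsCornerGenerated F θ φ) :
    (σ.inv ((1 : H) : H ⧸ (H ⊓ K).subgroupOf H) : E[G]) = idemI F θ φ := by
  have h1 := σ.kappa_mul hC 1 1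
  rw [mul_one] at h1
  have h2 : σ.kappa 1 = σ.inv ((1 : H) : H ⧸ (H ⊓ K).subgroupOf H) := by
    rw [kappa, OneMemClass.coe_one, map_one, one_mul]
  rw [h2] at h1
  have h3 := congrArg (fun x => x * (σ.toFun ((1 : H) : H ⧸ (H ⊓ K).subgroupOf H) :
    E[G])) h1
  rw [mul_assoc, σ.inv_mul, mul_idemI_of_mem (σ.inv _).2] at h3
  exact h3.symm

/-- The crossed representation is trivial on `L`. -/
theorem kappa_of_mem (hC : IsCornerGenerated F θ φ) (h : H) (hh : (h : G) ∈ K) :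
    σ.kappa h = of E G (h : G) * idemI F θ φ := by
  have h1 : (h : H ⧸ (H ⊓ K).subgroupOf H) = ((1 : H) : H ⧸ (H ⊓ K).subgroupOf H) := by
    refine QuotientGroup.eq.2 (Subgroup.mem_subgroupOf.2 ?_)
    rw [mul_one]
    exact inv_mem ⟨h.2, hh⟩
  rw [kappa, h1, σ.inv_one hC]

theorem kappa_one (hC : IsCornerGenerated F θ φ) : σ.kappa 1 = idemI F θ φ := by
  rw [σ.kappa_of_mem hC 1 (one_mem K), OneMemClass.coe_one, map_one, one_mul]

/-- The linear span of the products `s κ(h)` with `s ∈ S₀` and `h ∈ H`; it is `i E G i`. -/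
noncomputable def kappaSpan : Submodule E E[G] :=
  span E {x | ∃ s ∈ S₀, ∃ h : H, x = s * σ.kappa h}

theorem mul_mem_kappaSpan (hC : IsCornerGenerated F θ φ) (hle : S₀ ≤ ringS F θ φ)
    {x y : E[G]} (hx : x ∈ σ.kappaSpan) (hy : y ∈ σ.kappaSpan) :
    x * y ∈ σ.kappaSpan := by
  have h1 : x * y ∈ σ.kappaSpan * σ.kappaSpan := Submodule.mul_mem_mul hx hy
  rw [kappaSpan, Submodule.span_mul_span] at h1
  refine Submodule.span_mono ?_ h1
  rintro _ ⟨_, ⟨s, hs, h, rfl⟩, _, ⟨s', hs', h', rfl⟩, rfl⟩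
  refine ⟨s * s', mul_mem hs hs', h * h', ?_⟩
  dsimp only
  rw [σ.kappa_mul hC, mul_assoc, ← mul_assoc _ s', ← σ.mul_kappa hle hs']
  simp only [mul_assoc]

theorem mem_kappaSpan (hC : IsCornerGenerated F θ φ) (hle : S₀ ≤ ringS F θ φ)
    {s : E[G]} (hs : s ∈ S₀) : s ∈ σ.kappaSpan :=
  subset_span ⟨s, hs, 1, by rw [σ.kappa_one hC, mul_idemI_of_mem (hle hs)]⟩

theorem kappa_mem_kappaSpan (hC : IsCornerGenerated F θ φ) (hi : idemI F θ φ ∈ S₀) (h : H) :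
    σ.kappa h ∈ σ.kappaSpan :=
  subset_span ⟨_, hi, h, (σ.idemI_mul_kappa hC h).symm⟩

theorem mem_kappaSpan_of_mem_ringS (hC : IsCornerGenerated F θ φ) (hS₀ : IsForm F θ φ S₀)
    (hi : idemI F θ φ ∈ S₀) {s : E[G]} (hs : s ∈ ringS F θ φ) : s ∈ σ.kappaSpan := by
  have h1 : s ∈ AddSubgroup.closure {x | ∃ s ∈ S₀, ∃ z ∈ ringZ F θ φ, x = s * z} :=
    (Set.ext_iff.1 hS₀.span_eq s).2 hs
  induction h1 using AddSubgroup.closure_induction with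
  | zero => exact zero_mem _
  | add x y hx hy h h' =>
    exact add_mem (h ((Set.ext_iff.1 hS₀.span_eq x).1 hx)) (h' ((Set.ext_iff.1 hS₀.span_eq y).1 hy))
  | neg x hx h => exact neg_mem (h ((Set.ext_iff.1 hS₀.span_eq x).1 hx))
  | mem x hx =>
    obtain ⟨s₀, hs₀, z, hz, rfl⟩ := hx
    refine σ.mul_mem_kappaSpan hC hS₀.le (σ.mem_kappaSpan hC hS₀.le hs₀) ?_
    refine Submodule.span_le.2 ?_ (hC.center z hz)
    rintro _ ⟨l, rfl⟩
    have h2 := σ.kappa_of_mem hC ⟨l, l.2.1⟩ l.2.2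
    dsimp only
    rw [← h2]
    exact σ.kappa_mem_kappaSpan hC hi _

theorem of_mul_idemI_mem_kappaSpan (hC : IsCornerGenerated F θ φ) (hS₀ : IsForm F θ φ S₀)
    (hi : idemI F θ φ ∈ S₀) (h : H) :
    of E G (h : G) * idemI F θ φ ∈ σ.kappaSpan := by
  rw [← kappa_mul_toFun]
  exact σ.mul_mem_kappaSpan hC hS₀.le (σ.kappa_mem_kappaSpan hC hi h)
    (σ.mem_kappaSpan_of_mem_ringS hC hS₀ hi (σ.toFun h).2)

/-- The algebra `i E G i` is spanned by `S₀` and the elements `h σ(Lh)⁻¹`. -/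
theorem idemI_mul_mul_idemI_mem (hC : IsCornerGenerated F θ φ) (hS₀ : IsForm F θ φ S₀)
    (hi : idemI F θ φ ∈ S₀) (x : E[G]) :
    idemI F θ φ * x * idemI F θ φ ∈ σ.kappaSpan := by
  have hii : idemI F θ φ * idemI F θ φ = idemI F θ φ := idemI_mul_of_mem (hS₀.le hi)
  induction x using induction_linear with
  | zero => rw [mul_zero, zero_mul]; exact zero_mem _
  | add x y hx hy => rw [mul_add, add_mul]; exact add_mem hx hy
  | single g t =>
    obtain ⟨h, hh, k, hk, rfl⟩ := hC.prod_eq g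
    have h1 : single (h * k) t =
        t • (of E G h * inclK K (of E K ⟨k, hk⟩)) := by
      rw [inclK_of, ← map_mul]
      simp
    rw [h1, mul_smul_comm, smul_mul_assoc]
    refine Submodule.smul_mem _ _ ?_
    have h2 := hC.of_mul_idem ⟨h, hh⟩
    have h3 : idemI F θ φ * (of E G h * inclK K (of E K ⟨k, hk⟩)) *
        idemI F θ φ = of E G h * idemI F θ φ *
          (idemI F θ φ * inclK K (of E K ⟨k, hk⟩) * idemI F θ φ) := by
      rw [← mul_assoc, ← h2]
      simp only [mul_assoc]
      rw [← mul_assoc (idemI F θ φ) (idemI F θ φ), hii]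
    rw [h3]
    refine σ.mul_mem_kappaSpan hC hS₀.le (σ.of_mul_idemI_mem_kappaSpan hC hS₀ hi ⟨h, hh⟩) ?_
    refine Submodule.span_le.2 ?_ (hC.corner _)
    rintro _ ⟨l, hl, s, hs, rfl⟩
    rw [← idemI_mul_of_mem hs, ← mul_assoc]
    exact σ.mul_mem_kappaSpan hC hS₀.le (σ.of_mul_idemI_mem_kappaSpan hC hS₀ hi ⟨l, hl.1⟩)
      (σ.mem_kappaSpan_of_mem_ringS hC hS₀ hi hs)

end MagicCrossedRep

section CosetPart

variable {G : Type*} [Group G] {K H : Subgroup G} {E : Type*} [Field E]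

open Classical in
/-- The component of an element of `E G` supported on the coset `t K`. -/
noncomputable def cosetPart (K : Subgroup G) (t : G) : E[G] →ₗ[E] E[G] :=
  linExt fun g => if t⁻¹ * g ∈ K then of E G g else 0

open Classical in
/-- For `x ∈ E H`, the element `y ∈ E L` such that `t y` is the component of `x` supported on the
coset `t L`. -/
noncomputable def cosetCoord (K : Subgroup G) (t : H) :
    E[H] →ₗ[E] E[↥(H ⊓ K)] :=
  linExt fun h => if hm : (((t⁻¹ * h : H) : G) ∈ K) then
    of E ↥(H ⊓ K) ⟨(t⁻¹ * h : H), Subgroup.mem_inf.2 ⟨(t⁻¹ * h).2, hm⟩⟩ else 0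

theorem cosetPart_of_mul (t g : G) (b : E[K]) [Decidable (t⁻¹ * g ∈ K)] :
    cosetPart K t (of E G g * inclK K b) =
      if t⁻¹ * g ∈ K then of E G g * inclK K b else 0 := by
  induction b using induction_linear with
  | zero => rw [map_zero, mul_zero, map_zero, ite_self]
  | add x y hx hy =>
    rw [map_add, mul_add, map_add, hx, hy]
    split_ifs
    · rfl
    · rw [add_zero]
  | single k c =>
    have h1 : single k c = c • of E K k := by simp
    have h2 : t⁻¹ * (g * k) ∈ K ↔ t⁻¹ * g ∈ K := by
      rw [← mul_assoc, Subgroup.mul_mem_cancel_right _ k.2]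
    rw [h1, inclK_smul, inclK_of, mul_smul_comm, map_smul, ← map_mul, cosetPart, linExt_of]
    by_cases h : t⁻¹ * g ∈ K
    · rw [if_pos h, if_pos (h2.2 h)]
    · rw [if_neg h, if_neg (fun h' => h (h2.1 h')), smul_zero]

theorem coeff_one_cosetCoord (t : H) (x : E[H]) :
    (cosetCoord K t x).coeff 1 = x.coeff t := by
  induction x using induction_linear with
  | zero => rw [map_zero]; rfl
  | add x y hx hy => rw [map_add, MonoidAlgebra.coeff_add, MonoidAlgebra.coeff_add,
      Finsupp.add_apply, Finsupp.add_apply, hx, hy]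
  | single h c =>
    classical
    rw [cosetCoord, linExt_single, MonoidAlgebra.coeff_single, Finsupp.single_apply]
    by_cases hht : h = t
    · subst hht
      have h1 : ((h⁻¹ * h : H) : G) ∈ K := by
        rw [inv_mul_cancel]
        exact one_mem K
      rw [dif_pos h1, if_pos rfl]
      have h2 : (⟨(h⁻¹ * h : H), Subgroup.mem_inf.2 ⟨(h⁻¹ * h).2, h1⟩⟩ : ↥(H ⊓ K)) = 1 := by
        apply Subtype.ext
        simp
      rw [h2]
      simp
    · rw [if_neg hht]
      split_ifs with hm
      · rw [MonoidAlgebra.coeff_smul, Finsupp.smul_apply, of_apply,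
          MonoidAlgebra.coeff_single, Finsupp.single_apply, if_neg, smul_zero]
        intro h1
        apply hht
        have h2 : ((t⁻¹ * h : H) : G) = 1 := congrArg Subtype.val h1
        have h3 : t⁻¹ * h = 1 := Subtype.ext h2
        rw [← mul_one t, ← h3, mul_inv_cancel_left]
      · rw [smul_zero]; rfl

theorem eq_zero_of_cosetCoord_eq_zero {x : E[H]}
    (h : ∀ t : H, cosetCoord K t x = 0) : x = 0 := by
  ext t
  rw [← coeff_one_cosetCoord (K := K), h]
  rfl

theorem cosetCoord_mul (t : H) (x : E[H]) (y : E[↥(H ⊓ K)]) :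
    cosetCoord K t (x * mapDomain (Subgroup.inclusion (inf_le_left : H ⊓ K ≤ H)) y) =
      cosetCoord K t x * y := by
  induction y using induction_linear with
  | zero => rw [mapDomain_zero, mul_zero, mul_zero, map_zero]
  | add y y' hy hy' => rw [mapDomain_add, mul_add, mul_add, map_add, hy, hy']
  | single l c =>
    rw [mapDomain_single]
    induction x using induction_linear with
    | zero => rw [zero_mul, map_zero, zero_mul]
    | add x x' hx hx' => rw [add_mul, map_add, map_add, add_mul, hx, hx']
    | single h d =>
      rw [single_mul_single, cosetCoord, linExt_single, linExt_single]
      have h2 : ((t⁻¹ * (h * Subgroup.inclusion (inf_le_left : H ⊓ K ≤ H) l) : H) : G) ∈ K ↔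
          ((t⁻¹ * h : H) : G) ∈ K := by
        rw [← mul_assoc, Subgroup.coe_mul,
          Subgroup.mul_mem_cancel_right _ (show ((Subgroup.inclusion _ l : H) : G) ∈ K from l.2.2)]
      by_cases hm : ((t⁻¹ * h : H) : G) ∈ K
      · rw [dif_pos hm, dif_pos (h2.2 hm), of_apply, of_apply,
          smul_single, smul_single, single_mul_single,
          smul_eq_mul, smul_eq_mul, mul_one, mul_one]
        congr 1
        apply Subtype.ext
        simp [mul_assoc]
      · rw [dif_neg hm, dif_neg (fun h' => hm (h2.1 h')), smul_zero, smul_zero, zero_mul]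

end CosetPart

namespace MagicCrossedRep

variable {G : Type*} [Group G] {K H : Subgroup G} {E F : Type*} [Field E] [Field F] [Algebra F E]
  {θ : K → E} {φ : ↥(H ⊓ K) → E} {S₀ : NonUnitalSubring E[G]}
  (σ : MagicCrossedRep F θ φ S₀)

theorem kappa_of_mul (hC : IsCornerGenerated F θ φ) (t : H) (y : E[↥(H ⊓ K)]) :
    linExt σ.kappa (of E H t *
      mapDomain (Subgroup.inclusion (inf_le_left : H ⊓ K ≤ H)) y) =
      σ.kappa t * (mapDomain (H ⊓ K).subtype y * idemI F θ φ) := by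
  induction y using induction_linear with
  | zero => simp only [mapDomain_zero, mul_zero, zero_mul, map_zero]
  | add y y' hy hy' => simp only [mapDomain_add, mul_add, add_mul, map_add, hy, hy']
  | single l c =>
    rw [mapDomain_single, mapDomain_single, of_apply,
      single_mul_single, one_mul, linExt_single, σ.kappa_mul hC,
      σ.kappa_of_mem hC _ (show ((Subgroup.inclusion _ l : H) : G) ∈ K from l.2.2)]
    have h1 : single ((H ⊓ K).subtype l) c = c • of E G (l : G) := by
      simp
    rw [h1, smul_mul_assoc, mul_smul_comm]
    rfl

theorem linExt_kappa_idemPhi (hC : IsCornerGenerated F θ φ) :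
    linExt σ.kappa (mapDomain (Subgroup.inclusion (inf_le_left : H ⊓ K ≤ H))
      (charIdemOver F φ)) = idemI F θ φ := by
  have h1 := σ.kappa_of_mul hC 1 (charIdemOver F φ)
  rwa [map_one, one_mul, σ.kappa_one hC, hC.phi_mul, ← σ.kappa_one hC, ← σ.kappa_mul hC, mul_one,
    σ.kappa_one hC]
    at h1

theorem cosetPart_linExt_kappa (t : H) (x : E[H]) :
    cosetPart K (t : G) (linExt σ.kappa x) = of E G (t : G) *
      mapDomain (H ⊓ K).subtype (cosetCoord K t x) * (σ.inv t : E[G]) := by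
  classical
  induction x using induction_linear with
  | zero => simp only [mapDomain_zero, mul_zero, zero_mul, map_zero]
  | add y y' hy hy' => simp only [mapDomain_add, mul_add, add_mul, map_add, hy, hy']
  | single h c =>
    have hsub : (σ.inv h : E[G]) ∈ subAlg F K E := (σ.inv h).2.1.1
    obtain ⟨b, hb⟩ : ∃ b, inclK K b = (σ.inv h : E[G]) := by
      obtain ⟨b, -, hb⟩ := mem_subAlg.1 hsub
      exact ⟨b, hb⟩
    rw [linExt_single, map_smul, kappa, ← hb, cosetPart_of_mul, hb, cosetCoord, linExt_single]
    by_cases hm : ((t : G)⁻¹ * h ∈ K)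
    · have hm' : ((t⁻¹ * h : H) : G) ∈ K := hm
      have h1 : (t : H ⧸ (H ⊓ K).subgroupOf H) = (h : H ⧸ (H ⊓ K).subgroupOf H) :=
        QuotientGroup.eq.2 (Subgroup.mem_subgroupOf.2 ⟨(t⁻¹ * h).2, hm'⟩)
      rw [if_pos hm, dif_pos hm', h1, mapDomain_smul, mul_smul_comm, smul_mul_assoc,
        of_apply, of_apply, of_apply,
        mapDomain_single, single_mul_single, one_mul]
      congr 3
      simp
    · have hm' : ¬((t⁻¹ * h : H) : G) ∈ K := hm
      rw [if_neg hm, dif_neg hm', smul_zero, smul_zero, mapDomain_zero, mul_zero,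
        zero_mul]

/-- The representation `κ` of `E H` is faithful on the ideal generated by `e_(φ,F)`: the elements
`κ(h)` for `h` in different cosets of `L` are supported on different cosets of `K`. -/
theorem mul_idemPhi_eq_zero (hC : IsCornerGenerated F θ φ) {x : E[H]}
    (hx : linExt σ.kappa x = 0) :
    x * mapDomain (Subgroup.inclusion (inf_le_left : H ⊓ K ≤ H))
      (charIdemOver F φ) = 0 := by
  refine eq_zero_of_cosetCoord_eq_zero (K := K) fun t => ?_
  rw [cosetCoord_mul]
  apply hC.mul_phi_eq_zero
  have h1 := σ.cosetPart_linExt_kappa t x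
  rw [hx, map_zero] at h1
  have h2 := congrArg (fun y => of E G ((t : G)⁻¹) * y * σ.toFun t) h1
  simp only [mul_zero, zero_mul] at h2
  rw [mul_assoc (of E G (t : G)), ← mul_assoc (of E G (t : G)⁻¹),
    ← map_mul, inv_mul_cancel, map_one, one_mul, mul_assoc, σ.inv_mul] at h2
  exact h2.symm

end MagicCrossedRep

/-! ### Restriction of irreducible modules, and reduced traces -/

section CornerMap

open Module

variable {A E M : Type*} [Ring A] [Field E] [Algebra E A] [AddCommGroup M] [Module E M]
  (D : A →ₐ[E] End E M) (i : A)

/-- For an idempotent `i`, the compression of the action of `a` to the image of `i`. -/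
noncomputable def cornerMap : A →ₗ[E] End E (LinearMap.range (D i)) where
  toFun a := (D i).rangeRestrict ∘ₗ D a ∘ₗ (LinearMap.range (D i)).subtype
  map_add' a b := by rw [map_add, LinearMap.add_comp, LinearMap.comp_add]
  map_smul' c a := by rw [map_smul, LinearMap.smul_comp, LinearMap.comp_smul]; rfl

theorem coe_cornerMap_apply (a : A) (y : LinearMap.range (D i)) :
    (cornerMap D i a y : M) = D (i * a) y := by
  rw [map_mul]
  rfl

variable {i} (hi : i * i = i)

include hi in
theorem map_apply_of_mem_range {y : M} (hy : y ∈ LinearMap.range (D i)) : D i y = y := by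
  obtain ⟨x, rfl⟩ := hy
  rw [← Module.End.mul_apply, ← map_mul, hi]

include hi in
theorem cornerMap_idem : cornerMap D i i = 1 := by
  ext y
  rw [coe_cornerMap_apply, hi]
  exact map_apply_of_mem_range D hi y.2

theorem cornerMap_mul (a : A) {b : A} (hb : i * b = b) :
    cornerMap D i (a * b) = cornerMap D i a * cornerMap D i b := by
  ext y
  rw [coe_cornerMap_apply, Module.End.mul_apply, coe_cornerMap_apply, coe_cornerMap_apply,
    ← Module.End.mul_apply, ← map_mul, hb, mul_assoc]

theorem trace_cornerMap [FiniteDimensional E M] {a : A} (ha : a * i = a) :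
    LinearMap.trace E _ (cornerMap D i a) = LinearMap.trace E M (D a) := by
  have h1 : cornerMap D i a = (D i).rangeRestrict ∘ₗ (D a ∘ₗ (LinearMap.range (D i)).subtype) := rfl
  rw [h1, LinearMap.trace_comp_comm', LinearMap.comp_assoc]
  change LinearMap.trace E M (D a * D i) = _
  rw [← map_mul, ha]

include hi in
theorem exists_cornerMap_eq (hD : Function.Surjective D) (T : End E (LinearMap.range (D i))) :
    ∃ a, cornerMap D i (i * a * i) = T := by
  obtain ⟨a, ha⟩ := hD ((LinearMap.range (D i)).subtype ∘ₗ T ∘ₗ (D i).rangeRestrict)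
  refine ⟨a, ?_⟩
  ext y
  rw [coe_cornerMap_apply, ← mul_assoc, ← mul_assoc, hi, map_mul, map_mul, ha,
    Module.End.mul_apply, map_apply_of_mem_range D hi y.2, Module.End.mul_apply]
  have h1 : (D i).rangeRestrict y = y := Subtype.ext (map_apply_of_mem_range D hi y.2)
  rw [LinearMap.comp_apply, LinearMap.comp_apply, h1]
  exact map_apply_of_mem_range D hi (T y).2

theorem exists_ringHom_of_forall_smul_one {Z B : Type*} [Ring Z] [Ring B] [Nontrivial B]
    [Algebra E B] (f : Z →+* B) (h : ∀ z, ∃ c : E, f z = c • 1) :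
    ∃ ζ : Z →+* E, ∀ z, f z = ζ z • 1 := by
  choose ζ hζ using h
  have hinj : Function.Injective fun c : E => c • (1 : B) := smul_left_injective E one_ne_zero
  exact ⟨{ toFun := ζ
           map_one' := hinj (by dsimp only; rw [← hζ, map_one, one_smul])
           map_zero' := hinj (by dsimp only; rw [← hζ, map_zero, zero_smul])
           map_add' := fun x y => hinj (by dsimp only; rw [← hζ, map_add, hζ, hζ, add_smul])
           map_mul' := fun x y => hinj (by
            dsimp only; rw [← hζ, map_mul, hζ, hζ, smul_mul_smul_comm, one_mul]) }, hζ⟩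

/-- Let `i A i` be spanned by the products of a central simple algebra `j B` of dimension `n ^ 2` and
a group `κ(H)` commuting with it. If `A` acts on `M` by all endomorphisms, then the image of `i` in
`M` restricts to `n` copies of one irreducible representation of `H`. -/
theorem exists_irreducible_of_corner {A E M : Type*} [Ring A] [Field E] [Algebra E A]
    [AddCommGroup M] [Module E M] {Z B H : Type*} [Field Z] [Ring B] [Algebra Z B] [IsSimpleRing B]
    [Algebra.IsCentral Z B] [FiniteDimensional Z B] [Group H] [IsAlgClosed E]
    [FiniteDimensional E M] {n : ℕ} (hB : finrank Z B = n ^ 2) (D : A →ₐ[E] End E M)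
    (hD : Function.Surjective D) {i : A} (hi : i * i = i) (hDi : D i ≠ 0) (j : B →ₙ+* A)
    (hj : j 1 = i) (κ : H → A) (hκ1 : κ 1 = i) (hκm : ∀ x y, κ (x * y) = κ x * κ y)
    (hiκ : ∀ h, i * κ h = κ h) (hκi : ∀ h, κ h * i = κ h) (hc : ∀ b h, j b * κ h = κ h * j b)
    (hspan : ∀ a, i * a * i ∈ span E {x | ∃ b h, x = j b * κ h}) :
    ∃ (N : Submodule E (LinearMap.range (D i))) (τ : Representation E H N), τ.IsIrreducible ∧
      ∀ h, LinearMap.trace E M (D (κ h)) = n * τ.character h := by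
  have : Nontrivial (LinearMap.range (D i)) := by
    rw [Submodule.nontrivial_iff_ne_bot]
    exact fun h => hDi (LinearMap.range_eq_bot.1 h)
  let r := cornerMap D i
  let k : Representation E H (LinearMap.range (D i)) :=
    { toFun := fun h => r (κ h)
      map_one' := by
        rw [hκ1]
        exact cornerMap_idem _ hi
      map_mul' := fun x y => by
        rw [hκm]
        exact cornerMap_mul _ _ (hiκ y) }
  have hij : ∀ b, i * j b = j b := fun b => by rw [← hj, ← map_mul, one_mul]
  let α : B →+* End E (LinearMap.range (D i)) :=
    { toFun := fun b => r (j b)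
      map_one' := by
        rw [hj]
        exact cornerMap_idem _ hi
      map_mul' := fun x y => by
        rw [map_mul]
        exact cornerMap_mul _ _ (hij y)
      map_zero' := by rw [map_zero, map_zero]
      map_add' := fun x y => by rw [map_add, map_add] }
  have hc' : ∀ b h, α b * k h = k h * α b := fun b h => by
    change r _ * r _ = r _ * r _
    rw [← cornerMap_mul _ _ (hij b), ← hc, cornerMap_mul _ _ (hiκ h)]
  have hspan' : ∀ T, T ∈ span E {T | ∃ b h, T = α b * k h} := by
    intro T
    obtain ⟨a, rfl⟩ := exists_cornerMap_eq _ hi hD T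
    have h1 := hspan a
    refine map_mem_of_mem_span (cornerMap D i) ?_ h1
    rintro _ ⟨b, h, rfl⟩
    exact subset_span ⟨b, h, cornerMap_mul _ _ (hiκ h)⟩
  have hscalar : ∀ z, ∃ c : E, (α.comp (algebraMap Z B)) z = c • 1 := by
    intro z
    refine Representation.exists_eq_smul_one_of_forall_commute _ fun T => ?_
    refine mul_comm_of_mem_span ?_ (hspan' T)
    rintro _ ⟨b, h, rfl⟩
    rw [RingHom.comp_apply, mul_assoc, ← hc', ← mul_assoc, ← mul_assoc, ← map_mul, ← map_mul,
      Algebra.commutes]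
  obtain ⟨ζ, hζ⟩ := exists_ringHom_of_forall_smul_one _ hscalar
  obtain ⟨N, τ, hτ, h1⟩ := exists_irreducible_of_centralSimple_commute hB ζ α hζ k hc' hspan'
  exact ⟨N, τ, hτ, fun h => (trace_cornerMap D (hκi h)).symm.trans (h1 h)⟩

end CornerMap

section FormSplitting

open Module

variable {Z₀ Z S E : Type*} [Field Z₀] [Field Z] [Algebra Z₀ Z] [Ring S] [Algebra Z S]
  [Algebra Z₀ S] [IsScalarTower Z₀ Z S] [Field E] [Algebra Z E] [Algebra Z₀ E]
  [IsScalarTower Z₀ Z E] {n : ℕ} (ψ : S →ₐ[Z] Matrix (Fin n) (Fin n) E)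
  (hψ : span E (Set.range ψ) = ⊤) (B : Subalgebra Z₀ S)
  (hB : span Z (B : Set S) = ⊤)

/-- The restriction of a splitting to a form. -/
noncomputable def formVal : B →ₐ[Z₀] Matrix (Fin n) (Fin n) E :=
  (ψ.restrictScalars Z₀).comp B.val

include hψ hB in
theorem span_formVal : span E (Set.range (formVal ψ B)) = ⊤ := by
  rw [eq_top_iff, ← hψ]
  refine Submodule.span_le.2 ?_
  rintro _ ⟨s, rfl⟩
  have hs : s ∈ span Z (B : Set S) := hB ▸ Submodule.mem_top
  refine map_mem_of_mem_span ψ.toLinearMap (N := (span E _).restrictScalars Z) ?_ hs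
  exact fun x hx => subset_span ⟨⟨x, hx⟩, rfl⟩

include hψ hB in
theorem finrank_of_span_formVal [IsSimpleRing B] [Algebra.IsCentral Z₀ B] [FiniteDimensional Z₀ B]
    [NeZero n] : finrank Z₀ B = n ^ 2 :=
  finrank_eq_sq_of_span_eq_top (formVal ψ B) (span_formVal ψ hψ B hB)

end FormSplitting

universe u

namespace CornerModel

open Module

variable {G : Type*} [Group G] {K H : Subgroup G} [K.Normal] {E : Type u} {F : Type*}
  [Field E] [Field F]
  [Algebra F E] {θ : K → E} {φ : ↥(H ⊓ K) → E} {n : ℕ} (m : CornerModel F θ φ n)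
  {S₀ : NonUnitalSubring E[G]} (hS₀ : IsForm F θ φ S₀)

theorem isSimpleRing_formSubalgebra [Finite m.galGroup] : IsSimpleRing (m.formSubalgebra hS₀) :=
  isSimpleRing_form (m.formSubalgebra hS₀)
    (fun b hb hb' => m.exists_algebraMap_eq_of_commute hS₀ b hb hb') (m.span_formSubalgebra hS₀)

theorem isCentral_formSubalgebra : Algebra.IsCentral
    (subfield m.galGroup (charField F φ)) (m.formSubalgebra hS₀) where
  out b hb := by
    rw [Subalgebra.mem_center_iff] at hb
    obtain ⟨c, hc⟩ := m.exists_algebraMap_eq_of_commute hS₀ b b.2 fun b' hb' =>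
      congrArg Subtype.val (hb ⟨b', hb'⟩)
    exact Algebra.mem_bot.2 ⟨c, Subtype.ext hc⟩

theorem finite_formSubalgebra [Finite m.galGroup] : FiniteDimensional
    (subfield m.galGroup (charField F φ)) (m.formSubalgebra hS₀) := by
  have : Fintype m.galGroup := Fintype.ofFinite _
  have : FiniteDimensional (subfield m.galGroup (charField F φ)) m.S :=
    Module.Finite.trans (charField F φ) m.S
  infer_instance

/-- The splitting of `S₀` given by the inclusion of `S` in a matrix ring. -/
noncomputable def formSplitting : m.formSubalgebra hS₀
    →ₐ[subfield m.galGroup (charField F φ)] Matrix (Fin n) (Fin n) E :=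
  formVal m.S.val (m.formSubalgebra hS₀)

theorem span_formSplitting : span E (Set.range (m.formSplitting hS₀)) = ⊤ :=
  span_formVal m.S.val m.span_eq_top (m.formSubalgebra hS₀) (m.span_formSubalgebra hS₀)

theorem finrank_formSubalgebra [Finite m.galGroup] [NeZero n] :
    finrank (subfield m.galGroup (charField F φ)) (m.formSubalgebra hS₀) = n ^ 2 := by
  have := m.isSimpleRing_formSubalgebra hS₀
  have := m.isCentral_formSubalgebra hS₀
  have := m.finite_formSubalgebra hS₀
  exact finrank_of_span_formVal m.S.val m.span_eq_top (m.formSubalgebra hS₀)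
    (m.span_formSubalgebra hS₀)

include m hS₀ in
/-- The form `S₀`, as a central simple algebra of dimension `n ^ 2` with a splitting over `E`. -/
theorem exists_centralSimple_ringEquiv [Finite m.galGroup] [NeZero n] :
    ∃ (Z B : Type u) (_ : Field Z) (_ : Ring B) (_ : Algebra Z B) (_ : IsSimpleRing B)
      (_ : Algebra.IsCentral Z B) (_ : FiniteDimensional Z B) (j : B ≃+* S₀)
      (ψ : B →+* Matrix (Fin n) (Fin n) E), finrank Z B = n ^ 2 ∧
      (j 1 : E[G]) = idemI F θ φ ∧ span E (Set.range ψ) = ⊤ := by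
  have hr : ∀ s : S₀, (m.equiv.symm (m.equiv ⟨s, hS₀.le s.2⟩) : E[G]) = s :=
    fun s => by rw [m.equiv.symm_apply_apply]
  let j : m.formSubalgebra hS₀ ≃+* S₀ :=
    { toFun := fun b => ⟨m.equiv.symm b, b.2⟩
      invFun := fun s => ⟨m.equiv ⟨s, hS₀.le s.2⟩,
        (m.equiv_mem_formSubalgebra hS₀ (s := ⟨s, hS₀.le s.2⟩)).2 s.2⟩
      left_inv := fun b => Subtype.ext (m.equiv.apply_symm_apply b)
      right_inv := fun s => Subtype.ext (hr s)
      map_mul' := fun x y => Subtype.ext (m.equiv_symm_mul x y)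
      map_add' := fun x y => Subtype.ext (m.equiv_symm_add x y) }
  exact ⟨subfield m.galGroup (charField F φ), m.formSubalgebra hS₀, inferInstance,
    inferInstance, inferInstance, m.isSimpleRing_formSubalgebra hS₀, m.isCentral_formSubalgebra hS₀,
    m.finite_formSubalgebra hS₀, j, m.formSplitting hS₀, m.finrank_formSubalgebra hS₀,
    m.equiv_symm_one, m.span_formSplitting hS₀⟩

include m hS₀ in
theorem idemI_mem_form : idemI F θ φ ∈ S₀ := by
  have h1 := (m.formSubalgebra hS₀).one_mem
  rwa [mem_formSubalgebra, m.equiv_symm_one] at h1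

include m hS₀ in
/-- The restriction of an irreducible representation of `G` along `κ` is `n` times an irreducible
representation of `H`. -/
theorem exists_isIrreducible_character_eq [Finite G] [Finite m.galGroup] [NeZero n] [IsAlgClosed E]
    (hC : IsCornerGenerated F θ φ) (σ : MagicCrossedRep F θ φ S₀) {M : Type*} [AddCommGroup M]
    [Module E M] (D : Representation E G M) [D.IsIrreducible]
    (hD : D.asAlgebraHom (idemI F θ φ) ≠ 0) :
    ∃ (N : Submodule E (LinearMap.range (D.asAlgebraHom (idemI F θ φ))))
      (τ : Representation E H N), τ.IsIrreducible ∧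
      ∀ h, LinearMap.trace E M (D.asAlgebraHom (σ.kappa h)) = n * τ.character h := by
  have := D.finiteDimensional_of_isIrreducible
  have hi := m.idemI_mem_form hS₀
  have hii : idemI F θ φ * idemI F θ φ = idemI F θ φ :=
    MagicCrossedRep.idemI_mul_of_mem (hS₀.le hi)
  obtain ⟨Z, B, _, _, _, _, _, _, j, -, hB, hj1, -⟩ := m.exists_centralSimple_ringEquiv hS₀
  let j' : B →ₙ+* E[G] :=
    { toFun := fun b => j b
      map_mul' := fun x y => congrArg Subtype.val (RingEquiv.map_mul j x y)
      map_zero' := congrArg Subtype.val (RingEquiv.map_zero j)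
      map_add' := fun x y => congrArg Subtype.val (RingEquiv.map_add j x y) }
  refine exists_irreducible_of_corner hB D.asAlgebraHom
    D.asAlgebraHom_surjective hii hD j' hj1 σ.kappa (σ.kappa_one hC) (σ.kappa_mul hC)
    (σ.idemI_mul_kappa hC) σ.kappa_mul_idemI (fun b h => σ.mul_kappa hS₀.le (j b).2 h) fun a => ?_
  refine Submodule.span_mono ?_ (σ.idemI_mul_mul_idemI_mem hC hS₀ hi a)
  rintro x ⟨s, hs, h, rfl⟩
  refine ⟨j.symm ⟨s, hs⟩, h, ?_⟩
  change _ = (j (j.symm ⟨s, hs⟩) : E[G]) * σ.kappa h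
  rw [j.apply_symm_apply]

end CornerModel

section ReducedTrace

open Module

theorem apply_eq_zero_of_mem_closure_commutators {B X : Type*} [Ring B] [AddCommGroup X]
    (f : B →+ X)
    (hf : ∀ x y, f (x * y) = f (y * x)) {c : B}
    (hc : c ∈ AddSubgroup.closure {b : B | ∃ x y, b = x * y - y * x}) : f c = 0 := by
  induction hc using AddSubgroup.closure_induction with
  | zero => rw [map_zero]
  | add x y _ _ hx hy => rw [map_add, hx, hy, add_zero]
  | neg x _ hx => rw [map_neg, hx, neg_zero]
  | mem x hx =>
    obtain ⟨x, y, rfl⟩ := hx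
    rw [map_sub, hf, sub_self]

/-- A central simple algebra of degree prime to the characteristic is the sum of its centre and
the additive group generated by the commutators. -/
theorem exists_eq_algebraMap_add_commutators {Z B E : Type*} [Field Z] [Ring B] [Algebra Z B]
    [IsSimpleRing B] [Algebra.IsCentral Z B] [FiniteDimensional Z B] [Field E]
    {n : ℕ} [NeZero n] (hn : (n : E) ≠ 0) (ψ : B →+* Matrix (Fin n) (Fin n) E)
    (hψ : span E (Set.range ψ) = ⊤) (s : B) :
    ∃ z : Z, ∃ c ∈ AddSubgroup.closure {b : B | ∃ x y, b = x * y - y * x},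
      s = algebraMap Z B z + c := by
  obtain ⟨ζ, hζ⟩ := exists_ringHom_of_span_range_eq_top (Z := Z) ψ hψ
  let := ζ.toAlgebra
  let ψ₂ : B →ₐ[Z] Matrix (Fin n) (Fin n) E :=
    { ψ with commutes' := fun z => (hζ z).trans (by
        rw [Algebra.algebraMap_eq_smul_one, ← algebraMap_smul E z]; rfl) }
  let C : Submodule Z B :=
    { AddSubgroup.closure {b : B | ∃ x y, b = x * y - y * x} with
      smul_mem' := fun t c hc => by
        change c ∈ AddSubgroup.closure _ at hc
        change t • c ∈ AddSubgroup.closure _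
        induction hc using AddSubgroup.closure_induction with
        | zero => rw [smul_zero]; exact zero_mem _
        | add x y _ _ hx hy => rw [smul_add]; exact add_mem hx hy
        | neg x _ hx => rw [smul_neg]; exact neg_mem hx
        | mem x hx =>
          obtain ⟨x, y, rfl⟩ := hx
          exact AddSubgroup.subset_closure ⟨t • x, y, by
            rw [smul_sub, ← smul_mul_assoc, ← mul_smul_comm]⟩ }
  have htop : span Z {(1 : B)} ⊔ C = ⊤ := by
    refine span_one_commutators_eq_top hn ψ₂ hψ _ ?_ fun x y => ?_
    · exact Submodule.mem_sup_left (Submodule.mem_span_singleton_self 1)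
    · exact Submodule.mem_sup_right (AddSubgroup.subset_closure ⟨x, y, rfl⟩)
  have hs' : s ∈ span Z {(1 : B)} ⊔ C := htop ▸ Submodule.mem_top
  obtain ⟨z', hz', c, hc, rfl⟩ := Submodule.mem_sup.1 hs'
  obtain ⟨z, rfl⟩ := Submodule.mem_span_singleton.1 hz'
  exact ⟨z, c, hc, by rw [Algebra.algebraMap_eq_smul_one]⟩

/-- In a central simple algebra of dimension `n ^ 2`, an element `s` of reduced trace `1` differs
from `n⁻¹` by a sum of commutators, so that `n f(s) = f(1)` for every trace function `f`. -/
theorem nsmul_apply_eq_of_trace_eq_one {Z B E X : Type*} [Field Z] [Ring B] [Algebra Z B]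
    [IsSimpleRing B] [Algebra.IsCentral Z B] [FiniteDimensional Z B] [Field E] [AddCommGroup X]
    {n k : ℕ} (hk : 0 < k) (hB : finrank Z B = n ^ 2) (hn : (n : E) ≠ 0)
    (ψ : B →ₙ+* Matrix (Fin k) (Fin k) E) (hψ : span E (Set.range ψ) = ⊤) {s : B}
    (hs : ψ 1 = (ψ s).trace • 1) (f : B →+ X) (hf : ∀ x y, f (x * y) = f (y * x)) :
    n • f s = f 1 := by
  have : NeZero k := ⟨hk.ne'⟩
  have hψ1 := map_one_of_span_range_eq_top ψ hψ
  let ψ₁ : B →+* Matrix (Fin k) (Fin k) E := { ψ with map_one' := hψ1 }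
  obtain ⟨ζ, hζ⟩ := exists_ringHom_of_span_range_eq_top (Z := Z) ψ₁ hψ
  have hkn : k = n := by
    let := ζ.toAlgebra
    let ψ₂ : B →ₐ[Z] Matrix (Fin k) (Fin k) E :=
      { ψ₁ with commutes' := fun z => (hζ z).trans (by
          rw [Algebra.algebraMap_eq_smul_one, ← algebraMap_smul E z]; rfl) }
    have h1 := finrank_eq_sq_of_span_eq_top ψ₂ hψ
    rw [hB] at h1
    exact (Nat.pow_left_injective two_ne_zero h1).symm
  subst hkn
  obtain ⟨z, c, hc, rfl⟩ := exists_eq_algebraMap_add_commutators (Z := Z) hn ψ₁ hψ s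
  have htr : (ψ₁ c).trace = 0 := apply_eq_zero_of_mem_closure_commutators
    ((Matrix.traceAddMonoidHom (Fin k) E).comp ψ₁.toAddMonoidHom) (fun x y => by
      change (ψ₁ (x * y)).trace = (ψ₁ (y * x)).trace
      rw [map_mul, map_mul, Matrix.trace_mul_comm]) hc
  have hs₂ : (1 : Matrix (Fin k) (Fin k) E) = (ψ₁ (algebraMap Z B z + c)).trace • 1 :=
    hψ1.symm.trans hs
  rw [map_add, Matrix.trace_add, htr, add_zero, hζ,
    Matrix.trace_smul, Matrix.trace_one, Fintype.card_fin] at hs₂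
  have h1 : (1 : E) = ζ z * k := by
    have := congrFun (congrFun hs₂ ⟨0, hk⟩) ⟨0, hk⟩
    simpa using this
  have h2 : (k : Z) * z = 1 := by
    apply ζ.injective
    rw [map_mul, map_natCast, mul_comm, ← h1, map_one]
  rw [map_add, apply_eq_zero_of_mem_closure_commutators f hf hc, add_zero, ← map_nsmul,
    ← Nat.cast_smul_eq_nsmul Z, Algebra.smul_def, ← map_mul, h2, map_one]

end ReducedTrace

namespace CornerModel

open Module

variable {G : Type*} [Group G] {K H : Subgroup G} [K.Normal] {E F : Type*} [Field E] [Field F]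
  [Algebra F E] {θ : K → E} {φ : ↥(H ⊓ K) → E} {n : ℕ} (m : CornerModel F θ φ n)
  {S₀ : NonUnitalSubring E[G]} (hS₀ : IsForm F θ φ S₀)

include m hS₀ in
/-- For `s₀ ∈ S₀` of reduced trace `1`, and `x` commuting with `S₀`, trace functions satisfy
`n f(s₀ x) = f(x)`. -/
theorem nsmul_apply_mul_eq [Finite m.galGroup] [NeZero n] (hn : (n : E) ≠ 0)
    {s₀ : E[G]} (hs₀ : IsReducedTrace E S₀ s₀ (idemI F θ φ)) {X : Type*}
    [AddCommGroup X] (f : E[G] →+ X) (hf : ∀ x y, f (x * y) = f (y * x))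
    {x : E[G]} (hx : ∀ s ∈ S₀, s * x = x * s) (hix : idemI F θ φ * x = x) :
    n • f (s₀ * x) = f x := by
  obtain ⟨hs, hi, -, k, ψ, ⟨hk, hψ⟩, htr⟩ := hs₀
  obtain ⟨Z, B, _, _, _, _, _, _, j, -, hB, hj1, -⟩ := m.exists_centralSimple_ringEquiv hS₀
  have hj1 : j 1 = ⟨idemI F θ φ, hi⟩ := Subtype.ext hj1
  let ψ' : B →ₙ+* Matrix (Fin k) (Fin k) E := ψ.comp (j : B →ₙ+* S₀)
  have hψ' : span E (Set.range ψ') = ⊤ := by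
    rw [← hψ]
    exact congrArg _ (j.surjective.range_comp ψ)
  let g : B →+ X :=
    { toFun := fun b => f (j b * x)
      map_zero' := by rw [RingEquiv.map_zero, ZeroMemClass.coe_zero, zero_mul, map_zero]
      map_add' := fun a b => by rw [RingEquiv.map_add, AddMemClass.coe_add, add_mul, map_add] }
  have h1 := nsmul_apply_eq_of_trace_eq_one hk hB hn ψ' hψ' (s := j.symm ⟨s₀, hs⟩) (by
      change ψ (j 1) = (ψ (j (j.symm ⟨s₀, hs⟩))).trace • 1
      rw [hj1, j.apply_symm_apply, htr]) g (fun a b => by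
      change f (j (a * b) * x) = f (j (b * a) * x)
      rw [RingEquiv.map_mul, RingEquiv.map_mul, MulMemClass.coe_mul, MulMemClass.coe_mul,
        mul_assoc, hf, mul_assoc, ← hx _ (j a).2, ← mul_assoc])
  have h2 : g (j.symm ⟨s₀, hs⟩) = f (s₀ * x) := by
    change f (j _ * x) = _
    rw [j.apply_symm_apply]
  have h3 : g 1 = f x := by
    change f (j 1 * x) = _
    rw [hj1, hix]
  rwa [h2, h3] at h1

include m hS₀ in
/-- The element `n⁻¹` of `S₀` has reduced trace `1`. -/
theorem exists_isReducedTrace [Finite m.galGroup] [NeZero n] (hn : (n : E) ≠ 0) :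
    ∃ s₀, IsReducedTrace E S₀ s₀ (idemI F θ φ) := by
  have hi := m.idemI_mem_form hS₀
  obtain ⟨Z, B, _, _, _, _, _, _, j, ψ, hB, hj1, hψ⟩ := m.exists_centralSimple_ringEquiv hS₀
  have hj1 : j 1 = ⟨idemI F θ φ, hi⟩ := Subtype.ext hj1
  have hn0 : 0 < n := Nat.pos_of_ne_zero (NeZero.ne n)
  let ψ' : S₀ →ₙ+* Matrix (Fin n) (Fin n) E := (ψ : B →ₙ+* _).comp (j.symm : S₀ →ₙ+* B)
  have hψ' : span E (Set.range ψ') = ⊤ := by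
    rw [← hψ]
    exact congrArg _ (j.symm.surjective.range_comp ψ)
  obtain ⟨ζ, hζ⟩ := exists_ringHom_of_span_range_eq_top (Z := Z) ψ hψ
  refine ⟨j (algebraMap Z B (n : Z)⁻¹), (j _).2, hi,
    ⟨hi, NonUnitalSubring.mem_centralizer_iff.2 fun s hs => ?_⟩, n, ψ', ⟨hn0, hψ'⟩, ?_⟩
  · rw [MagicCrossedRep.idemI_mul_of_mem (hS₀.le hs), MagicCrossedRep.mul_idemI_of_mem (hS₀.le hs)]
  · have h1 : ψ' ⟨idemI F θ φ, hi⟩ = 1 := by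
      rw [← hj1]
      change ψ (j.symm (j 1)) = 1
      rw [j.symm_apply_apply, map_one]
    have h2 : ψ' (j (algebraMap Z B (n : Z)⁻¹)) = (n : E)⁻¹ • 1 := by
      change ψ (j.symm (j _)) = _
      rw [j.symm_apply_apply, hζ, map_inv₀, map_natCast]
    change ψ' ⟨idemI F θ φ, hi⟩ = (ψ' (j (algebraMap Z B (n : Z)⁻¹))).trace • 1
    rw [h1, h2, Matrix.trace_smul, Matrix.trace_one, Fintype.card_fin, smul_eq_mul,
      inv_mul_cancel₀ hn, one_smul]

include m hS₀ in
/-- A trace function on `E G` that vanishes on `κ(H)` vanishes on `i E G i`. -/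
theorem apply_eq_zero_of_kappa [Finite m.galGroup] [NeZero n] (hn : (n : E) ≠ 0)
    (hC : IsCornerGenerated F θ φ) (σ : MagicCrossedRep F θ φ S₀) (f : E[G] →ₗ[E] E)
    (hf : ∀ x y, f (x * y) = f (y * x)) (hκ : ∀ h, f (σ.kappa h) = 0) (x : E[G]) :
    f (idemI F θ φ * x * idemI F θ φ) = 0 := by
  have hi := m.idemI_mem_form hS₀
  obtain ⟨Z, B, _, _, _, _, _, _, j, ψ, -, hj1, hψ⟩ := m.exists_centralSimple_ringEquiv hS₀
  have hZ : ∀ (z : Z) (h : H), f (j (algebraMap Z B z) * σ.kappa h) = 0 := by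
    intro z h
    have h1 : (j (algebraMap Z B z) : E[G]) ∈ centerOf S₀ := by
      refine ⟨(j _).2, NonUnitalSubring.mem_centralizer_iff.2 fun s hs => ?_⟩
      have h2 : (⟨s, hs⟩ : S₀) * j (algebraMap Z B z) = j (algebraMap Z B z) * ⟨s, hs⟩ := by
        obtain ⟨b, hb⟩ := j.surjective ⟨s, hs⟩
        rw [← hb, ← RingEquiv.map_mul, ← RingEquiv.map_mul, Algebra.commutes]
      exact congrArg Subtype.val h2
    have h2 := hC.center _ ((Set.ext_iff.1 hS₀.center_eq _).1 h1).1
    refine map_eq_zero_of_mem_span (f ∘ₗ LinearMap.mulRight E (σ.kappa h)) ?_ h2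
    rintro _ ⟨l, rfl⟩
    have h3 := σ.kappa_of_mem hC ⟨l, l.2.1⟩ l.2.2
    rw [LinearMap.comp_apply, LinearMap.mulRight_apply]
    dsimp only at h3 ⊢
    rw [← h3, ← σ.kappa_mul hC, hκ]
  have hB : ∀ (b : B) (h : H), f (j b * σ.kappa h) = 0 := by
    intro b h
    obtain ⟨z, c, hc, rfl⟩ := exists_eq_algebraMap_add_commutators (Z := Z) hn ψ hψ b
    let g : B →+ E :=
      { toFun := fun b => f (j b * σ.kappa h)
        map_zero' := by rw [RingEquiv.map_zero, ZeroMemClass.coe_zero, zero_mul, map_zero]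
        map_add' := fun a b => by rw [RingEquiv.map_add, AddMemClass.coe_add, add_mul, map_add] }
    have h1 : g c = 0 := apply_eq_zero_of_mem_closure_commutators g (fun a b => by
      change f (j (a * b) * σ.kappa h) = f (j (b * a) * σ.kappa h)
      rw [RingEquiv.map_mul, RingEquiv.map_mul, MulMemClass.coe_mul, MulMemClass.coe_mul,
        mul_assoc, hf, mul_assoc, ← σ.mul_kappa hS₀.le (j a).2, ← mul_assoc]) hc
    have h2 : g (algebraMap Z B z) = 0 := hZ z h
    have h3 : g (algebraMap Z B z + c) = 0 := by rw [map_add, h1, h2, add_zero]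
    exact h3
  have h1 := σ.idemI_mul_mul_idemI_mem hC hS₀ hi x
  refine map_eq_zero_of_mem_span f ?_ h1
  rintro _ ⟨s, hs, h, rfl⟩
  have h2 := hB (j.symm ⟨s, hs⟩) h
  rwa [j.apply_symm_apply] at h2

end CornerModel

/-! ### Complex characters -/

section ComplexCharacters

open Module

/-- The representation of `N` on a module over the group algebra. -/
noncomputable def Representation.ofGroupAlgebraModule (E N M : Type*) [Group N] [Field E]
    [AddCommGroup M] [Module E M] [Module E[N] M]
    [IsScalarTower E E[N] M] : Representation E N M :=
  (Algebra.lsmul E E M : E[N] →ₐ[E] End E M).toMonoidHom.comp (of E N)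

theorem Representation.asAlgebraHom_ofGroupAlgebraModule {E N M : Type*} [Group N] [Field E]
    [AddCommGroup M] [Module E M] [Module E[N] M]
    [IsScalarTower E E[N] M] (x : E[N]) (v : M) :
    (Representation.ofGroupAlgebraModule E N M).asAlgebraHom x v = x • v :=
  LinearMap.congr_fun (linearMap_eq_of_forall_of
    (f := (Representation.ofGroupAlgebraModule E N M).asAlgebraHom.toLinearMap)
    (f' := (Algebra.lsmul E E M : E[N] →ₐ[E] End E M).toLinearMap)
    (fun g => Representation.asAlgebraHom_of _ g) x) v

theorem Representation.isIrreducible_ofGroupAlgebraModule {E N M : Type*} [Group N] [Field E]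
    [AddCommGroup M] [Module E M] [Module E[N] M]
    [IsScalarTower E E[N] M] [IsSimpleModule E[N] M] :
    (Representation.ofGroupAlgebraModule E N M).IsIrreducible := by
  have := IsSimpleModule.nontrivial E[N] M
  refine Representation.isIrreducible_of_forall_mem_span _ fun v hv w => ?_
  obtain ⟨x, rfl⟩ := IsSimpleModule.toSpanSingleton_surjective E[N] hv w
  rw [LinearMap.toSpanSingleton_apply]
  induction x using induction_linear with
  | zero => rw [zero_smul]; exact zero_mem _
  | add x y hx hy => rw [add_smul]; exact add_mem hx hy
  | single g c =>
    have h1 : single g c = c • of E N g := by simp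
    rw [h1, smul_assoc]
    exact Submodule.smul_mem _ _ (subset_span ⟨g, rfl⟩)

/-- A semisimple group algebra acts faithfully on the sum of its irreducible representations. -/
theorem Representation.exists_irreducible_asAlgebraHom_ne_zero {N E : Type*} [Group N] [Field E]
    [IsSemisimpleRing E[N]] {y : E[N]} (hy : y ≠ 0) :
    ∃ (m : Submodule E[N] E[N]) (ρ : Representation E N m),
      ρ.IsIrreducible ∧ ρ.asAlgebraHom y ≠ 0 := by
  by_contra! hcon
  have h1 : ∀ x ∈ sSup {m : Submodule E[N] E[N] |
      IsSimpleModule E[N] m}, y * x = 0 := by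
    intro x hx
    rw [sSup_eq_iSup'] at hx
    induction hx using Submodule.iSup_induction' with
    | mem m x hx =>
      have : IsSimpleModule E[N]
        (m : Submodule E[N] E[N]) := m.2
      have h2 := hcon m (Representation.ofGroupAlgebraModule E N m)
        Representation.isIrreducible_ofGroupAlgebraModule
      have h3 := Representation.asAlgebraHom_ofGroupAlgebraModule y
        (⟨x, hx⟩ : (m : Submodule E[N] E[N]))
      rw [h2, LinearMap.zero_apply] at h3
      exact (congrArg Subtype.val h3).symm
    | zero => rw [mul_zero]
    | add x x' _ _ hx hx' => rw [mul_add, hx, hx', add_zero]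
  rw [IsSemisimpleModule.sSup_simples_eq_top] at h1
  exact hy ((mul_one y).symm.trans (h1 1 Submodule.mem_top))

/-- Every irreducible representation is equivalent to one on a space of coordinate vectors. -/
theorem Representation.isIrrChar_character {N V : Type*} [Group N] [Finite N] [AddCommGroup V]
    [Module ℂ V] (ρ : Representation ℂ N V) [hρ : ρ.IsIrreducible] : IsIrrChar ρ.character := by
  have := ρ.finiteDimensional_of_isIrreducible
  let e : V ≃ₗ[ℂ] (Fin (finrank ℂ V) → ℂ) := (finBasis ℂ V).equivFun
  let ρ' : Representation ℂ N (Fin (finrank ℂ V) → ℂ) :=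
    { toFun := fun g => e.conj (ρ g)
      map_one' := by rw [map_one]; exact e.conj_id
      map_mul' := fun g h => by rw [map_mul]; exact e.conj_comp _ _ }
  let f : ρ'.IntertwiningMap ρ :=
    { toLinearMap := e.symm.toLinearMap
      isIntertwining' := fun g => by
        refine LinearMap.ext fun v => ?_
        change e.symm (e (ρ g (e.symm v))) = _
        rw [e.symm_apply_apply]
        rfl }
  refine ⟨_, ρ', ?_, ?_⟩
  · rw [Representation.irreducible_iff_isSimpleModule_asModule] at hρ ⊢
    exact IsSimpleModule.congr (LinearEquiv.ofBijective
      (Representation.IntertwiningMap.equivLinearMapAsModule ρ' ρ f) e.symm.bijective)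
  · ext g
    exact LinearMap.trace_conj' (ρ g) e

open scoped ComplexOrder in
/-- The value of a complex character at `g⁻¹` is the complex conjugate of its value at `g`: the
average of `A(g)ᴴ A(g)` over a matrix representation `A` is an invariant positive definite form. -/
theorem Representation.character_inv {N : Type*} [Group N] [Finite N] {d : ℕ}
    (ρ : Representation ℂ N (Fin d → ℂ)) (g : N) :
    ρ.character g⁻¹ = starRingEnd ℂ (ρ.character g) := by
  have := Fintype.ofFinite N
  classical
  let A : N → Matrix (Fin d) (Fin d) ℂ := fun g => LinearMap.toMatrix' (ρ g)
  have hA : ∀ g h, A (g * h) = A g * A h := fun g h => by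
    change LinearMap.toMatrix' (ρ (g * h)) = _
    rw [map_mul]
    exact LinearMap.toMatrix'_mul _ _
  have hA1 : A 1 = 1 := by
    change LinearMap.toMatrix' (ρ 1) = _
    rw [map_one]
    exact LinearMap.toMatrix'_one
  have htr : ∀ g, ρ.character g = (A g).trace := fun g => by
    change LinearMap.trace ℂ _ (ρ g) = _
    rw [LinearMap.trace_eq_matrix_trace ℂ (Pi.basisFun ℂ (Fin d)),
      LinearMap.toMatrix_eq_toMatrix']
  let P : Matrix (Fin d) (Fin d) ℂ := ∑ h : N, (A h).conjTranspose * A h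
  have hP : P.PosDef := by
    change (∑ h : N, (A h).conjTranspose * A h).PosDef
    rw [← Finset.add_sum_erase _ _ (Finset.mem_univ (1 : N)), hA1, Matrix.conjTranspose_one,
      one_mul]
    exact Matrix.PosDef.one.add_posSemidef (Matrix.posSemidef_sum _ fun h _ =>
      Matrix.posSemidef_conjTranspose_mul_self _)
  have hinv : (A g).conjTranspose * P * A g = P := by
    change _ * (∑ h : N, (A h).conjTranspose * A h) * _ = ∑ h : N, (A h).conjTranspose * A h
    rw [mul_sum, sum_mul]
    refine Fintype.sum_equiv (Equiv.mulRight g) _ _ fun h => ?_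
    rw [Equiv.coe_mulRight, hA, Matrix.conjTranspose_mul]
    simp only [mul_assoc]
  have hgg : A g * A g⁻¹ = 1 := by rw [← hA, mul_inv_cancel, hA1]
  obtain ⟨u, hu⟩ := hP.isUnit
  have h1 : (A g).conjTranspose = P * A g⁻¹ * (↑u⁻¹ : Matrix (Fin d) (Fin d) ℂ) := by
    calc (A g).conjTranspose = (A g).conjTranspose * P * (A g * A g⁻¹) *
          (↑u⁻¹ : Matrix (Fin d) (Fin d) ℂ) := by
            rw [hgg, mul_one, mul_assoc, ← hu, Units.mul_inv, mul_one]
      _ = _ := by rw [← mul_assoc, hinv]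
  have h2 : (A g).conjTranspose.trace = (A g⁻¹).trace := by
    rw [h1, Matrix.trace_mul_comm, ← mul_assoc, ← hu, Units.inv_mul, one_mul]
  rw [htr, htr, ← h2, Matrix.trace_conjTranspose]
  rfl

theorem charInner_of_isIrrChar {N : Type*} [Group N] [Finite N] {χ ψ : N → ℂ} (hχ : IsIrrChar χ)
    (hψ : IsIrrChar ψ) [Decidable (χ = ψ)] : charInner χ ψ = if χ = ψ then 1 else 0 := by
  have := Fintype.ofFinite N
  obtain ⟨d, ρ, hρ, rfl⟩ := hχ
  obtain ⟨d', ρ', hρ', rfl⟩ := hψ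
  have : Invertible (Nat.card N : ℂ) := invertibleOfNonzero (Nat.cast_ne_zero.2 Nat.card_pos.ne')
  have key : ∀ {d d' : ℕ} (ρ : Representation ℂ N (Fin d → ℂ))
      (ρ' : Representation ℂ N (Fin d' → ℂ)), charInner ρ.character ρ'.character =
      (Nat.card N : ℂ)⁻¹ * ∑ g : N, ρ.character g * ρ'.character g⁻¹ := by
    intro d d' ρ ρ'
    rw [charInner, finsum_eq_sum_of_fintype]
    simp only [Representation.character_inv]
  split_ifs with h
  · rw [← h, key, Representation.char_orthonormal, if_pos ⟨Representation.Equiv.refl ρ⟩]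
  · rw [key, Representation.char_orthonormal, if_neg]
    rintro ⟨f⟩
    exact h (Representation.char_iso f).symm

theorem charEval_mul_comm_of_isIrrChar {N : Type*} [Group N] {χ : N → ℂ} (hχ : IsIrrChar χ)
    (x y : ℂ[N]) : charEval χ (x * y) = charEval χ (y * x) := by
  obtain ⟨d, ρ, hρ, rfl⟩ := hχ
  rw [ρ.charEval_character, ρ.charEval_character, map_mul ρ.asAlgebraHom,
    map_mul ρ.asAlgebraHom, LinearMap.trace_mul_comm]

/-- An irreducible character is determined by the central primitive idempotent on which it does
not vanish. -/
theorem eq_of_charEval_charIdem_ne_zero {N : Type*} [Group N] [Finite N] {χ ψ : N → ℂ}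
    (hχ : IsIrrChar χ) (hψ : IsIrrChar ψ) (h : charEval χ (charIdem ψ) ≠ 0) : χ = ψ := by
  classical
  have := Fintype.ofFinite N
  by_contra hne
  have h1 := charInner_of_isIrrChar hχ hψ
  rw [if_neg hne] at h1
  obtain ⟨d, ρ, hρ, rfl⟩ := hψ
  have : NeZero (Nat.card N : ℂ) := ⟨Nat.cast_ne_zero.2 Nat.card_pos.ne'⟩
  have : Module.Projective ℂ[N] ρ.asModule :=
    Module.projective_of_isSemisimpleRing _ _
  obtain ⟨c, -, -, hc⟩ := ρ.exists_coeff_charIdem ℂ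
  apply h
  rw [charInner, finsum_eq_sum_of_fintype] at h1
  have h2 : ∑ g : N, χ g * starRingEnd ℂ (ρ.character g) = 0 :=
    (mul_eq_zero.1 h1).resolve_left (inv_ne_zero (NeZero.ne _))
  have h3 : charEval χ (charIdem ρ.character) = ∑ g, (charIdem ρ.character).coeff g * χ g :=
    Finsupp.sum_fintype _ _ fun g => zero_mul _
  rw [h3, ← mul_zero c, ← h2, mul_sum]
  refine sum_congr rfl fun g _ => ?_
  rw [hc, Representation.character_inv]
  ring

theorem charEval_ne_zero_of_idem {N V : Type*} [Group N] [Finite N] [AddCommGroup V] [Module ℂ V]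
    (ρ : Representation ℂ N V) [ρ.IsIrreducible] {e : ℂ[N]} (he : e * e = e) :
    charEval ρ.character e ≠ 0 ↔ ρ.asAlgebraHom e ≠ 0 := by
  have := ρ.finiteDimensional_of_isIrreducible
  rw [ρ.charEval_character, not_iff_not]
  exact LinearMap.IsIdempotentElem.trace_eq_zero_iff (by
    change _ * _ = _
    rw [← map_mul, he])

end ComplexCharacters

/-! ### The correspondence of characters -/

namespace MagicCrossedRep

open Module

variable {G : Type*} [Group G] {K H : Subgroup G} {F : Type*} [Field F] [Algebra F ℂ]
  {θ : K → ℂ} {φ : ↥(H ⊓ K) → ℂ} {S₀ : NonUnitalSubring ℂ[G]}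
  (σ : MagicCrossedRep F θ φ S₀)

/-- The correspondence `χ ↦ n⁻¹ (χ ∘ κ)`; on class functions it agrees with
`χ ↦ (h ↦ χ(s₀ h σ(Lh)⁻¹))` for `s₀ ∈ S₀` of reduced trace `1`. -/
noncomputable def corrMap (n : ℕ) : (G → ℂ) →ₗ[ℂ] (H → ℂ) where
  toFun χ h := (n : ℂ)⁻¹ * charEval χ (σ.kappa h)
  map_add' χ ψ := by
    ext h
    rw [Pi.add_apply, ← mul_add]
    exact congrArg _ (linExt_add χ ψ _)
  map_smul' c χ := by
    ext h
    rw [Pi.smul_apply, RingHom.id_apply, smul_eq_mul, mul_left_comm]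
    exact congrArg _ (linExt_smul c χ _)

theorem corrMap_apply (n : ℕ) (χ : G → ℂ) (h : H) :
    σ.corrMap n χ h = (n : ℂ)⁻¹ * charEval χ (σ.kappa h) := rfl

theorem charEval_corrMap (n : ℕ) (χ : G → ℂ) (x : ℂ[H]) :
    charEval (σ.corrMap n χ) x = (n : ℂ)⁻¹ * charEval χ (linExt σ.kappa x) := by
  refine linearMap_eq_of_forall_of (f := linExt (σ.corrMap n χ))
    (f' := (n : ℂ)⁻¹ • (linExt χ ∘ₗ linExt σ.kappa)) (fun h => ?_) x
  rw [LinearMap.smul_apply, LinearMap.comp_apply, linExt_of, linExt_of]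
  rfl

theorem linExt_kappa_mul (hC : IsCornerGenerated F θ φ) (x y : ℂ[H]) :
    linExt σ.kappa (x * y) = linExt σ.kappa x * linExt σ.kappa y := by
  induction x using induction_linear with
  | zero => rw [zero_mul, map_zero, zero_mul]
  | add x x' hx hx' => rw [add_mul, map_add, map_add, add_mul, hx, hx']
  | single g c =>
    induction y using induction_linear with
    | zero => rw [mul_zero, map_zero, mul_zero]
    | add y y' hy hy' => rw [mul_add, map_add, map_add, mul_add, hy, hy']
    | single h d =>
      rw [single_mul_single, linExt_single, linExt_single, linExt_single,
        σ.kappa_mul hC, smul_mul_smul_comm]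

end MagicCrossedRep

section TraceFunctions

variable {N : Type*} [Group N]

theorem charEval_eq_of_mem_span {T : Set (N → ℂ)} {x y : ℂ[N]}
    (h : ∀ χ ∈ T, charEval χ x = charEval χ y) {χ : N → ℂ} (hχ : χ ∈ span ℂ T) :
    charEval χ x = charEval χ y := by
  induction hχ using Submodule.span_induction with
  | mem χ hχ => exact h χ hχ
  | zero => simp [charEval]
  | add χ ψ _ _ h1 h2 =>
    exact (linExt_add χ ψ _).trans ((congrArg₂ _ h1 h2).trans (linExt_add χ ψ _).symm)
  | smul c χ _ h1 =>
    exact (linExt_smul c χ _).trans ((congrArg _ h1).trans (linExt_smul c χ _).symm)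

theorem charEval_mul_comm_of_mem_irrSpan {e : ℂ[N]} {χ : N → ℂ} (hχ : χ ∈ irrSpan e)
    (x y : ℂ[N]) : charEval χ (x * y) = charEval χ (y * x) :=
  charEval_eq_of_mem_span (fun _ hχ => charEval_mul_comm_of_isIrrChar hχ.1 x y) hχ

theorem charEval_mul_of_mem_irrSpan [Finite N] {e : ℂ[N]}
    (hc : ∀ x, x * e = e * x) (he : e * e = e) {χ : N → ℂ} (hχ : χ ∈ irrSpan e)
    (x : ℂ[N]) : charEval χ (x * e) = charEval χ x := by
  refine charEval_eq_of_mem_span ?_ hχ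
  rintro _ ⟨⟨d, ρ, hρ, rfl⟩, h⟩
  rw [charEval_ne_zero_of_idem ρ he] at h
  rw [ρ.charEval_character, ρ.charEval_character, map_mul ρ.asAlgebraHom,
    ρ.asAlgebraHom_eq_one_of_central hc he h, mul_one]

end TraceFunctions

namespace IsCornerGenerated

variable {G : Type*} [Group G] {K H : Subgroup G} {F E : Type*} [Field F] [Field E] [Algebra F E]
  {θ : K → E} {φ : ↥(H ⊓ K) → E}

/-- Since `e_(θ,F)` lies in the ideal generated by `i`, a representation over `e_(θ,F)` does not
kill `i`. -/
theorem map_idemI_ne_zero (hC : IsCornerGenerated F θ φ) {B : Type*} [Ring B] [Algebra E B]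
    (D : E[G] →ₐ[E] B) (hD : D (inclK K (charIdemOver F θ)) ≠ 0) :
    D (idemI F θ φ) ≠ 0 := by
  intro h0
  apply hD
  refine map_eq_zero_of_mem_span D.toLinearMap ?_ hC.theta_mem
  rintro _ ⟨a, b, rfl⟩
  rw [AlgHom.toLinearMap_apply, map_mul, map_mul, h0, mul_zero, zero_mul]

end IsCornerGenerated

namespace CornerModel

open Module

variable {G : Type*} [Group G] [Finite G] {K H : Subgroup G} [K.Normal] {F : Type*} [Field F]
  [Algebra F ℂ] {θ : K → ℂ} {φ : ↥(H ⊓ K) → ℂ} {n : ℕ} (m : CornerModel F θ φ n)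
  {S₀ : NonUnitalSubring ℂ[G]} (hS₀ : IsForm F θ φ S₀) [Finite m.galGroup]
  [NeZero n] (hC : IsCornerGenerated F θ φ) (σ : MagicCrossedRep F θ φ S₀)

include m hS₀ hC

theorem corrMap_mem_irrOver {χ : G → ℂ} (hχ : χ ∈ irrOver (idemTheta F θ)) :
    σ.corrMap n χ ∈ irrOver (idemPhi F φ) := by
  have hn : (n : ℂ) ≠ 0 := Nat.cast_ne_zero.2 (NeZero.ne n)
  have hii : idemI F θ φ * idemI F θ φ = idemI F θ φ :=
    MagicCrossedRep.idemI_mul_of_mem (hS₀.le (m.idemI_mem_form hS₀))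
  obtain ⟨⟨d, D, hD, rfl⟩, h⟩ := hχ
  have h1 := hC.map_idemI_ne_zero D.asAlgebraHom ((charEval_ne_zero_of_idem D hC.theta_idem).1 h)
  obtain ⟨N, τ, hτ, h2⟩ := m.exists_isIrreducible_character_eq hS₀ hC σ D h1
  have h3 : σ.corrMap n D.character = Representation.character (V := N) τ := by
    ext h
    rw [σ.corrMap_apply, D.charEval_character, h2, inv_mul_cancel_left₀ hn]
  constructor
  · rw [h3]
    exact Representation.isIrrChar_character (V := N) τ
  · rw [σ.charEval_corrMap]
    refine mul_ne_zero (inv_ne_zero hn) ?_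
    have h4 := σ.linExt_kappa_idemPhi hC
    rw [idemPhi, h4]
    exact (charEval_ne_zero_of_idem D hii).2 h1

theorem corrMap_mem_irrSpan {χ : G → ℂ} (hχ : χ ∈ irrSpan (idemTheta F θ)) :
    σ.corrMap n χ ∈ irrSpan (idemPhi F φ) := by
  have h1 : (irrSpan (idemTheta F θ) : Submodule ℂ (G → ℂ)) ≤
      (irrSpan (idemPhi F φ)).comap (σ.corrMap n) := Submodule.span_le.2 fun χ hχ =>
    subset_span (m.corrMap_mem_irrOver hS₀ hC σ hχ)
  exact h1 hχ

/-- A trace function over `e_(θ,F)` that vanishes on `κ(H)` vanishes on the ideal generated by `i`,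
hence everywhere. -/
theorem eq_zero_of_corrMap_eq_zero {χ : G → ℂ} (hχ : χ ∈ irrSpan (idemTheta F θ))
    (h : σ.corrMap n χ = 0) : χ = 0 := by
  have hn : (n : ℂ) ≠ 0 := Nat.cast_ne_zero.2 (NeZero.ne n)
  have hii : idemI F θ φ * idemI F θ φ = idemI F θ φ :=
    MagicCrossedRep.idemI_mul_of_mem (hS₀.le (m.idemI_mem_form hS₀))
  have hκ : ∀ h, linExt χ (σ.kappa h) = 0 := fun x =>
    (mul_eq_zero.1 (congrFun h x)).resolve_left (inv_ne_zero hn)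
  have hcomm : ∀ x y, linExt χ (x * y) = linExt χ (y * x) :=
    charEval_mul_comm_of_mem_irrSpan hχ
  have h1 := m.apply_eq_zero_of_kappa hS₀ hn hC σ (linExt χ) hcomm hκ
  have h2 : ∀ a b, linExt χ (a * idemI F θ φ * b) = 0 := fun a b => by
    have h3 : idemI F θ φ * (b * a) * idemI F θ φ = idemI F θ φ * (b * a * idemI F θ φ) :=
      mul_assoc _ _ _
    rw [← h1 (b * a), h3, hcomm (idemI F θ φ), mul_assoc (b * a), hii, mul_assoc b, hcomm b]
  have h3 : ∀ x, linExt χ (x * inclK K (charIdemOver F θ)) = 0 := by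
    intro x
    refine map_eq_zero_of_mem_span (linExt χ ∘ₗ LinearMap.mulLeft ℂ x) ?_ hC.theta_mem
    rintro _ ⟨a, b, rfl⟩
    rw [LinearMap.comp_apply, LinearMap.mulLeft_apply, ← mul_assoc, ← mul_assoc, h2]
  ext g
  have h4 := charEval_mul_of_mem_irrSpan hC.theta_comm hC.theta_idem hχ (of ℂ G g)
  rw [charEval_eq_linExt, h3, charEval_eq_linExt, linExt_of] at h4
  exact h4.symm

/-- The image under `κ` of the idempotent of `ψ` is not zero, so some irreducible representation of
`G` does not kill it; the character of `G` that it affords corresponds to `ψ`. -/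
theorem exists_corrMap_eq {ψ : H → ℂ} (hψ : ψ ∈ irrOver (idemPhi F φ)) :
    ∃ χ ∈ irrOver (idemTheta F θ), σ.corrMap n χ = ψ := by
  have hn : (n : ℂ) ≠ 0 := Nat.cast_ne_zero.2 (NeZero.ne n)
  have : NeZero (Nat.card H : ℂ) := ⟨Nat.cast_ne_zero.2 Nat.card_pos.ne'⟩
  have : NeZero (Nat.card G : ℂ) := ⟨Nat.cast_ne_zero.2 Nat.card_pos.ne'⟩
  obtain ⟨⟨d, τ, hτ, rfl⟩, h⟩ := hψ
  have : Module.Projective ℂ[H] τ.asModule := Module.projective_of_isSemisimpleRing _ _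
  have hee := τ.isCentralPrimitiveIdempotent_charIdem.2.1
  have h1 : linExt σ.kappa (charIdem τ.character) ≠ 0 := by
    intro h0
    have h2 := congrArg τ.asAlgebraHom (σ.mul_idemPhi_eq_zero hC h0)
    rw [map_mul, τ.asAlgebraHom_charIdem, one_mul, map_zero] at h2
    apply h
    rw [τ.charEval_character]
    exact (congrArg _ h2).trans (map_zero _)
  have hyy : linExt σ.kappa (charIdem τ.character) * linExt σ.kappa (charIdem τ.character) =
      linExt σ.kappa (charIdem τ.character) := by
    rw [← σ.linExt_kappa_mul hC, hee]
  have hiy : idemI F θ φ * linExt σ.kappa (charIdem τ.character) =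
      linExt σ.kappa (charIdem τ.character) := by
    have h2 := σ.linExt_kappa_mul hC (of ℂ H 1) (charIdem τ.character)
    rw [map_one, one_mul, ← map_one (of ℂ H), linExt_of, σ.kappa_one hC] at h2
    exact h2.symm
  obtain ⟨V, D, hD, hDy⟩ := Representation.exists_irreducible_asAlgebraHom_ne_zero h1
  have hmem : D.character ∈ irrOver (idemTheta F θ) := by
    refine ⟨D.isIrrChar_character, (charEval_ne_zero_of_idem D hC.theta_idem).2 fun h0 => hDy ?_⟩
    rw [← hiy, ← hC.theta_mul, map_mul, map_mul, h0, zero_mul, zero_mul]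
  refine ⟨_, hmem, ?_⟩
  refine eq_of_charEval_charIdem_ne_zero (m.corrMap_mem_irrOver hS₀ hC σ hmem).1 ⟨d, τ, hτ, rfl⟩ ?_
  rw [σ.charEval_corrMap]
  exact mul_ne_zero (inv_ne_zero hn) ((charEval_ne_zero_of_idem D hyy).2 hDy)

end CornerModel

section InnerProduct

variable {N : Type*} [Group N] [Finite N]

theorem charInner_add_left (χ χ' ψ : N → ℂ) :
    charInner (χ + χ') ψ = charInner χ ψ + charInner χ' ψ := by
  have := Fintype.ofFinite N
  simp only [charInner, finsum_eq_sum_of_fintype, Pi.add_apply, add_mul, Finset.sum_add_distrib,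
    mul_add]

theorem charInner_smul_left (c : ℂ) (χ ψ : N → ℂ) :
    charInner (c • χ) ψ = c * charInner χ ψ := by
  have := Fintype.ofFinite N
  simp only [charInner, finsum_eq_sum_of_fintype, Pi.smul_apply, smul_eq_mul, mul_assoc,
    ← mul_sum]
  rw [mul_left_comm]

theorem charInner_add_right (χ ψ ψ' : N → ℂ) :
    charInner χ (ψ + ψ') = charInner χ ψ + charInner χ ψ' := by
  have := Fintype.ofFinite N
  simp only [charInner, finsum_eq_sum_of_fintype, Pi.add_apply, map_add, Finset.sum_add_distrib,
    mul_add]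

theorem charInner_smul_right (c : ℂ) (χ ψ : N → ℂ) :
    charInner χ (c • ψ) = starRingEnd ℂ c * charInner χ ψ := by
  have := Fintype.ofFinite N
  simp only [charInner, finsum_eq_sum_of_fintype, Pi.smul_apply, smul_eq_mul, map_mul,
    mul_left_comm _ (starRingEnd ℂ c), ← mul_sum]

/-- A linear map that sends distinct irreducible characters to distinct irreducible characters is
an isometry. -/
theorem charInner_map_of_irrOver {N' : Type*} [Group N'] [Finite N'] {e : ℂ[N]}
    (f : (N → ℂ) →ₗ[ℂ] (N' → ℂ)) (hirr : ∀ χ ∈ irrOver e, IsIrrChar (f χ))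
    (hinj : ∀ χ ∈ irrOver e, ∀ ψ ∈ irrOver e, f χ = f ψ → χ = ψ) {χ ψ : N → ℂ}
    (hχ : χ ∈ irrSpan e) (hψ : ψ ∈ irrSpan e) : charInner (f χ) (f ψ) = charInner χ ψ := by
  classical
  induction hχ using Submodule.span_induction with
  | mem χ hχ =>
    induction hψ using Submodule.span_induction with
    | mem ψ hψ =>
      rw [charInner_of_isIrrChar hχ.1 hψ.1, charInner_of_isIrrChar (hirr χ hχ) (hirr ψ hψ)]
      exact if_congr ⟨hinj χ hχ ψ hψ, fun h => by rw [h]⟩ rfl rfl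
    | zero => rw [map_zero, charInner, charInner]; simp
    | add ψ ψ' _ _ h h' => rw [map_add, charInner_add_right, charInner_add_right, h, h']
    | smul c ψ _ h => rw [map_smul, charInner_smul_right, charInner_smul_right, h]
  | zero => rw [map_zero, charInner, charInner]; simp
  | add χ χ' _ _ h h' => rw [map_add, charInner_add_left, charInner_add_left, h, h']
  | smul c χ _ h => rw [map_smul, charInner_smul_left, charInner_smul_left, h]

end InnerProduct

namespace CornerModel

open Module

variable {G : Type*} [Group G] [Finite G] {K H : Subgroup G} [K.Normal] {F : Type*} [Field F]
  [Algebra F ℂ] {θ : K → ℂ} {φ : ↥(H ⊓ K) → ℂ} {n : ℕ} (m : CornerModel F θ φ n)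
  {S₀ : NonUnitalSubring ℂ[G]} (hS₀ : IsForm F θ φ S₀) [Finite m.galGroup]
  [NeZero n] (hC : IsCornerGenerated F θ φ) (σ : MagicCrossedRep F θ φ S₀)

include m hS₀ hC

theorem corrMap_injOn {χ ψ : G → ℂ} (hχ : χ ∈ irrSpan (idemTheta F θ))
    (hψ : ψ ∈ irrSpan (idemTheta F θ)) (h : σ.corrMap n χ = σ.corrMap n ψ) : χ = ψ := by
  rw [← sub_eq_zero] at h ⊢
  rw [← map_sub] at h
  exact m.eq_zero_of_corrMap_eq_zero hS₀ hC σ (sub_mem hχ hψ) h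

/-- The correspondence induced by a magic crossed representation. -/
theorem exists_linearEquiv_corrMap :
    ∃ ι : irrSpan (idemTheta F θ) ≃ₗ[ℂ] irrSpan (idemPhi F φ),
      ∀ χ, (ι χ : H → ℂ) = σ.corrMap n (χ : G → ℂ) := by
  let f : irrSpan (idemTheta F θ) →ₗ[ℂ] irrSpan (idemPhi F φ) :=
    (σ.corrMap n).restrict fun χ hχ => m.corrMap_mem_irrSpan hS₀ hC σ hχ
  refine ⟨LinearEquiv.ofBijective f ⟨fun χ ψ h => ?_, fun ψ => ?_⟩, fun χ => rfl⟩
  · exact Subtype.ext (m.corrMap_injOn hS₀ hC σ χ.2 ψ.2 (congrArg Subtype.val h))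
  · have h1 : irrSpan (idemPhi F φ) ≤ (irrSpan (idemTheta F θ)).map (σ.corrMap n) := by
      refine Submodule.span_le.2 fun ψ hψ => ?_
      obtain ⟨χ, hχ, rfl⟩ := m.exists_corrMap_eq hS₀ hC σ hψ
      exact ⟨χ, subset_span hχ, rfl⟩
    obtain ⟨χ, hχ, h2⟩ := h1 ψ.2
    exact ⟨⟨χ, hχ⟩, Subtype.ext h2⟩

theorem corrMap_mem_irrOver_iff {χ : G → ℂ} (hχ : χ ∈ irrSpan (idemTheta F θ)) :
    σ.corrMap n χ ∈ irrOver (idemPhi F φ) ↔ χ ∈ irrOver (idemTheta F θ) := by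
  refine ⟨fun h => ?_, m.corrMap_mem_irrOver hS₀ hC σ⟩
  obtain ⟨χ', hχ', h1⟩ := m.exists_corrMap_eq hS₀ hC σ h
  rwa [← m.corrMap_injOn hS₀ hC σ (subset_span hχ') hχ h1]

theorem charInner_corrMap {χ ψ : G → ℂ} (hχ : χ ∈ irrSpan (idemTheta F θ))
    (hψ : ψ ∈ irrSpan (idemTheta F θ)) :
    charInner (σ.corrMap n χ) (σ.corrMap n ψ) = charInner χ ψ :=
  charInner_map_of_irrOver (σ.corrMap n) (fun _ h => (m.corrMap_mem_irrOver hS₀ hC σ h).1)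
    (fun _ h _ h' => m.corrMap_injOn hS₀ hC σ (subset_span h) (subset_span h'))
    hχ hψ

omit [Finite G] in
theorem corr_eq_corrMap {s₀ : ℂ[G]}
    (hs₀ : IsReducedTrace ℂ S₀ s₀ (idemI F θ φ)) {χ : G → ℂ} (hχ : χ ∈ irrSpan (idemTheta F θ)) :
    σ.corr s₀ χ = σ.corrMap n χ := by
  have hn : (n : ℂ) ≠ 0 := Nat.cast_ne_zero.2 (NeZero.ne n)
  ext h
  have h1 := m.nsmul_apply_mul_eq hS₀ hn hs₀ (linExt χ : ℂ[G] →ₗ[ℂ] ℂ).toAddMonoidHom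
    (charEval_mul_comm_of_mem_irrSpan hχ) (fun s hs => σ.mul_kappa hS₀.le hs h)
    (σ.idemI_mul_kappa hC h)
  rw [nsmul_eq_mul] at h1
  rw [σ.corrMap_apply, MagicCrossedRep.corr, mul_assoc, eq_inv_mul_iff_mul_eq₀ hn]
  exact h1

omit hC in
/-- The correspondence is canonical: for two magic crossed representations, the representations
`κ` and `κ'` of `H` are conjugate by a unit of `S`. -/
theorem corrMap_eq_corrMap (hC : IsCornerGenerated F θ φ)
    (hn : n.Coprime (Nat.card (H ⧸ (H ⊓ K).subgroupOf H)))
    {S₀' : NonUnitalSubring ℂ[G]} (hS₀' : IsForm F θ φ S₀')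
    {σ : MagicCrossedRep F θ φ S₀} {σ' : MagicCrossedRep F θ φ S₀'} (hσ : σ.NormIsCoboundary)
    (hσ' : σ'.NormIsCoboundary) {χ : G → ℂ} (hχ : χ ∈ irrSpan (idemTheta F θ)) :
    σ'.corrMap n χ = σ.corrMap n χ := by
  obtain ⟨v, w, hvw, hwv, hv⟩ := m.exists_unit_conj hn hS₀ hS₀' hσ hσ'
  ext h
  rw [σ'.corrMap_apply, σ.corrMap_apply]
  congr 1
  have h1 : (v : ℂ[G]) * σ'.kappa h = σ.kappa h * v := by
    rw [MagicCrossedRep.kappa, ← mul_assoc, ← MagicCrossedRep.of_mul_conjBy, σ.magic, ← hv h,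
      MagicCrossedRep.kappa]
    change _ * ((σ.inv h : ℂ[G]) * σ.eps h v * σ.toFun h) * _ = _
    simp only [mul_assoc]
  have h2 : σ'.kappa h = w * (σ.kappa h * v) := by
    rw [← h1, ← mul_assoc, hwv, σ'.idemI_mul_kappa hC]
  rw [h2, charEval_mul_comm_of_mem_irrSpan hχ, mul_assoc, hvw, σ.kappa_mul_idemI]

end CornerModel

theorem propositionp {G : Type*} [Group G] [Finite G] (K H : Subgroup G) [K.Normal] :
    -- existence, over an arbitrary field `F` contained in an algebraically closed field `E`
    (∀ (F : Type*) [Field F] (E : Type*) [Field E] [IsAlgClosed E] [Algebra F E]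
      (V : Type*) [AddCommGroup V] [Module E V] (U : Type*) [AddCommGroup U] [Module E U]
      (ρ : Representation E K V) (τ : Representation E ↥(H ⊓ K) U),
      SemiInvariantConfig F K H ρ τ →
      Nat.Coprime (charMult ρ τ) (Nat.card (H ⧸ (H ⊓ K).subgroupOf H)) →
      (∃ S₀, IsForm F ρ.character τ.character S₀) ∧
      ∀ S₀, IsForm F ρ.character τ.character S₀ →
        ∃ σ : MagicCrossedRep F ρ.character τ.character S₀, σ.NormIsCoboundary) ∧
    -- the canonical correspondence, over a field `F` contained in `ℂ`
    (∀ (F : Type*) [Field F] [Algebra F ℂ]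
      (V : Type*) [AddCommGroup V] [Module ℂ V] (U : Type*) [AddCommGroup U] [Module ℂ U]
      (ρ : Representation ℂ K V) (τ : Representation ℂ ↥(H ⊓ K) U),
      SemiInvariantConfig F K H ρ τ →
      Nat.Coprime (charMult ρ τ) (Nat.card (H ⧸ (H ⊓ K).subgroupOf H)) →
      ∃ ι : irrSpan (idemTheta F ρ.character) ≃ₗ[ℂ] irrSpan (idemPhi F τ.character),
        (∀ χ₁ χ₂, charInner (ι χ₁ : H → ℂ) (ι χ₂ : H → ℂ) =
          charInner (χ₁ : G → ℂ) (χ₂ : G → ℂ)) ∧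
        (∀ χ, (ι χ : H → ℂ) ∈ irrOver (idemPhi F τ.character) ↔
          (χ : G → ℂ) ∈ irrOver (idemTheta F ρ.character)) ∧
        (∃ S₀, IsForm F ρ.character τ.character S₀ ∧
          ∃ σ : MagicCrossedRep F ρ.character τ.character S₀, σ.NormIsCoboundary) ∧
        ∀ S₀, IsForm F ρ.character τ.character S₀ →
          ∀ σ : MagicCrossedRep F ρ.character τ.character S₀, σ.NormIsCoboundary →
            σ.Induces ι) := by
  refine ⟨fun F _ E _ _ _ V _ _ U _ _ ρ τ cfg hn => cfg.exists_magicCrossedRep hn,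
    fun F _ _ V _ _ U _ _ ρ τ cfg hn => ?_⟩
  have hex := cfg.exists_magicCrossedRep hn
  obtain ⟨S₀, hS₀⟩ := hex.1
  obtain ⟨σ, hσ⟩ := hex.2 S₀ hS₀
  obtain ⟨m⟩ := cfg.exists_cornerModel
  have : NeZero (charMult ρ τ) := ⟨cfg.mult_pos.ne'⟩
  have : Finite m.galGroup := Set.finite_range m.gal
  have hC := cfg.isCornerGenerated
  obtain ⟨ι, hι⟩ := m.exists_linearEquiv_corrMap hS₀ hC σ
  refine ⟨ι, fun χ₁ χ₂ => ?_, fun χ => ?_, ⟨S₀, hS₀, σ, hσ⟩, fun S₀' hS₀' σ' hσ' => ⟨?_, ?_⟩⟩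
  · rw [hι, hι]
    exact m.charInner_corrMap hS₀ hC σ χ₁.2 χ₂.2
  · rw [hι]
    exact m.corrMap_mem_irrOver_iff hS₀ hC σ χ.2
  · exact m.exists_isReducedTrace hS₀' (Nat.cast_ne_zero.2 (NeZero.ne _))
  · intro s₀ hs₀ χ
    rw [hι, m.corr_eq_corrMap hS₀' hC σ' hs₀ χ.2]
    exact (m.corrMap_eq_corrMap hS₀ hC hn hS₀' hσ hσ' χ.2).symm
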